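/- **Setting.** Let $G$ be a connected finite-dimensional Lie group with Lie algebra $\mathfrak g$ (basis $e_a$, $[e_b,e_c]=f^a_{bc}e_a$), and let $M$ be a smooth finite-dimensional manifold without boundary. Let $S^+\mathfrak g=\bigoplus_{k\ge1}S^k\mathfrak g$, where $S^k\mathfrak g$ is placed in degree $1-2k$, and let $\mathcal L(S^+\mathfrak g)$ be the free graded Lie algebra on it, with generators $\mathcal I(u)$, $u\in S^+\mathfrak g$. The differential graded Lie algebra $D\mathfrak g=\mathfrak g\ltimes\mathcal L(S^+\mathfrak g)$ has generators $l(x)$ ($x\in\mathfrak g$, degree $0$) and $\mathcal I(u)$, relations $[l(x),l(y)]=l([x,y])$, $[l(x),\mathcal I(u)]=\mathcal I(\mathrm{ad}_xu)$, and differential $dl(x)=0$, $di(x)=\tfrac12[i(x),i(x)]+l(x)$ with $i(x)=\sum_{k\ge1}\mathcal I(x^k)$. Let $W\mathfrak g=S\mathfrak g^*\otimes\Lambda\mathfrak g^*$ be the Weil algebra, with generators $t^a$ (degree $2$), $\theta^a$ (degree $1$) and differential $d\theta^a=t^a-\tfrac12f^a_{bc}\theta^b\theta^c$, $dt^a=-f^a_{bc}\theta^bt^c$.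 Enveloping algebras $\mathcal U$ are Hopf algebras whose generators are primitive. Tensor products are graded, and $W\mathfrak g\otimes\mathcal U$ is completed by degree. There is a $\mathfrak g$-invariant group-like element of degree zero $\Phi\in W\mathfrak g\otimes\mathcal U(\mathcal L(S^+\mathfrak g))$ with $$\Phi^{-1}d\Phi=-i(t)+l(\theta)\in W\mathfrak g\otimes D\mathfrak g,\qquad t=t^a\otimes e_a,\quad\theta=\theta^a\otimes e_a.$$ Let $\Phi$ be any such element. Let $G(M)=C^\infty(M,G)$. Let $H(M)$ be the group of group-like elements of degree zero of $\Omega(M)\otimes\mathcal U(\mathcal L(S^+\mathfrak g))$, on which $G(M)$ acts by the adjoint action. Let $\overline{\mathcal{SG}}(M,D\mathfrak g,G)=H(M)\rtimes G(M)$, with product $(h_1,g_1)(h_2,g_2)=(h_1\,\mathrm{Ad}_{g_1}h_2,\;g_1g_2)$, and let $$DG(M)=\mathcal{SG}(M,D\mathfrak g,G)=\{(h,g)\in\overline{\mathcal{SG}}(M,D\mathfrak g,G)\;:\;h^{-1}dh+dg\,g^{-1}=0\},$$ where $d$ is the total differential, $dg\,g^{-1}$ is viewed as an element of $\Omega^1(M)\otimes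 l(\mathfrak g)$, and the equation is read in $\Omega(M)\otimes\mathcal U(D\mathfrak g)$. The group $G(M)$ acts from the right on the set $\mathcal G(M)=\Omega^1(M)\otimes\mathfrak g$ of $\mathfrak g$-connections by gauge transformations $A^g=\mathrm{Ad}_{g^{-1}}A+g^{-1}dg$. Let $\widehat{\mathcal G}(M)$ be the action groupoid, with morphisms $m_{g,A}:A\to A^g$; the composite of $m_{g,A}$ followed by $m_{h,A^g}$ is $m_{gh,A}$, and the identity of $A$ is $m_{1,A}$. For $A\in\mathcal G(M)$ let $F_A=dA+\tfrac12[A,A]$, and let $\Phi(A,F_A)$ be the image of $\Phi$ under the Weil homomorphism $W\mathfrak g\to\Omega(M)$, $\theta\mapsto A$, $t\mapsto F_A$. **Theorem.** $\overline{\mathcal{SG}}(M,D\mathfrak g,G)$ is a group and $DG(M)$ is a subgroup of it. For every $A\in\mathcal G(M)$ the element $\Phi(A,F_A)$ lies in $H(M)$. For $g\in G(M)$ and $A\in\mathcal G(M)$ put $$\mu(m_{g,A})=\Phi(A,F_A)\;g\;\Phi(A^g,F_{A^g})^{-1}\in\overline{\mathcal{SG}}(M,D\mathfrak g,G).$$ 1.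 $\mu$ is a morphism of groupoids from $\widehat{\mathcal G}(M)$ to the group $\overline{\mathcal{SG}}(M,D\mathfrak g,G)$: $\mu(m_{1,A})=1$ and $\mu(m_{gh,A})=\mu(m_{g,A})\,\mu(m_{h,A^g})$ for all $A\in\mathcal G(M)$ and $g,h\in G(M)$. 2. $\mu$ takes values in $DG(M)$. 3. The composition of $\mu$ with the projection $DG(M)\to G(M)$, $(h,g)\mapsto g$, is the forgetful map $m_{g,A}\mapsto g$. 4. Consequently the projection $DG(M)\to G(M)$ is surjective, and the map of sets $g\mapsto\mu(m_{g,0})$ is a section of it. -/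

import Mathlib

open scoped TensorProduct Manifold ContDiff

/-- A superalgebra over `ℝ`, given by its parity automorphism (`+1` on even, `-1` on odd
elements). -/
class SuperAlgebra (A : Type*) [Ring A] [Algebra ℝ A] where
  parity : A →ₐ[ℝ] A
  parity_parity : ∀ a, parity (parity a) = a

namespace SuperAlgebra
variable (A : Type*) [Ring A] [Algebra ℝ A] [SuperAlgebra A]

/-- The even part (`i = 0`) and the odd part (`i = 1`). -/
def part (i : ZMod 2) : Submodule ℝ A where
  carrier := {a | parity a = if i = 0 then a else -a}
  add_mem' {a b} ha hb := by
    change parity (a + b) = _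
    rw [map_add, show parity a = _ from ha, show parity b = _ from hb]
    split_ifs <;> abel
  zero_mem' := by change parity 0 = _; simp
  smul_mem' r a ha := by
    change parity (r • a) = _
    rw [map_smul, show parity a = _ from ha]
    split_ifs <;> simp

variable {A}

theorem mem_part {i : ZMod 2} {a : A} : a ∈ part A i ↔ parity a = if i = 0 then a else -a :=
  Iff.rfl

theorem mem_part_zero {a : A} : a ∈ part A 0 ↔ parity a = a := by simp [mem_part]

theorem mem_part_one {a : A} : a ∈ part A 1 ↔ parity a = -a := by simp [mem_part]

theorem even_mem (a : A) : (2⁻¹ : ℝ) • (a + parity a) ∈ part A 0 := by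
  rw [mem_part_zero]; simp [parity_parity, add_comm]

theorem odd_mem (a : A) : (2⁻¹ : ℝ) • (a - parity a) ∈ part A 1 := by
  rw [mem_part_one]; simp only [map_smul, map_sub, parity_parity, ← smul_neg, neg_sub]

noncomputable instance : GradedAlgebra (part A) where
  one_mem := by rw [mem_part_zero]; simp
  mul_mem i j a b ha hb := by
    rw [mem_part] at *
    rw [map_mul, ha, hb]
    have h2 : ∀ i j : ZMod 2, i ≠ 0 → j ≠ 0 → i + j = 0 := by decide
    by_cases hi : i = 0 <;> by_cases hj : j = 0 <;> simp [hi, hj, h2]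
  decompose' a := DirectSum.of (fun i => part A i) 0 ⟨_, even_mem a⟩ +
    DirectSum.of (fun i => part A i) 1 ⟨_, odd_mem a⟩
  left_inv a := by
    simp only [map_add, DirectSum.coeAddMonoidHom_of]
    rw [← smul_add, add_add_sub_cancel, ← two_smul ℝ a, smul_smul]; norm_num
  right_inv x := by
    induction x using DirectSum.induction_on with
    | zero =>
      simp only [map_zero, add_zero, sub_zero, smul_zero]
      rw [show (⟨0, _⟩ : part A 0) = 0 from rfl, show (⟨0, _⟩ : part A 1) = 0 from rfl]
      simp
    | of i a =>
      obtain ⟨a, ha⟩ := a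
      simp only [DirectSum.coeAddMonoidHom_of]
      rcases (by decide : ∀ i : ZMod 2, i = 0 ∨ i = 1) i with rfl | rfl
      · rw [mem_part_zero] at ha
        have h0 : (⟨_, even_mem a⟩ : part A 0) = ⟨a, mem_part_zero.2 ha⟩ := by
          ext; simp only [ha]; rw [← two_smul ℝ a, smul_smul]; norm_num
        have h1 : (⟨_, odd_mem a⟩ : part A 1) = 0 := by
          ext; simp [ha]
        rw [h0, h1, map_zero, add_zero]
      · rw [mem_part_one] at ha
        have h0 : (⟨_, even_mem a⟩ : part A 0) = 0 := by
          ext; simp [ha]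
        have h1 : (⟨_, odd_mem a⟩ : part A 1) = ⟨a, mem_part_one.2 ha⟩ := by
          ext; simp only [ha]; rw [sub_neg_eq_add, ← two_smul ℝ a, smul_smul]; norm_num
        rw [h0, h1, map_zero, zero_add]
    | add x y hx hy =>
      conv_rhs => rw [← hx, ← hy]
      rw [add_add_add_comm]
      refine congrArg₂ (· + ·) ?_ ?_
      · refine Eq.trans (congrArg _ (Subtype.ext ?_)) (map_add (DirectSum.of (fun i => part A i) 0) _ _)
        simp only [map_add, Submodule.coe_add]; rw [← smul_add]; congr 1; abel
      · refine Eq.trans (congrArg _ (Subtype.ext ?_)) (map_add (DirectSum.of (fun i => part A i) 1) _ _)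
        simp only [map_add, Submodule.coe_add]; rw [← smul_add]; congr 1; abel

end SuperAlgebra

open SuperAlgebra

/-- The tensor product of superalgebras, `(a ⊗ b) (a' ⊗ b') = (-1) ^ (|b| |a'|) aa' ⊗ bb'`. -/
abbrev SuperTensor (A B : Type*) [Ring A] [Algebra ℝ A] [SuperAlgebra A]
    [Ring B] [Algebra ℝ B] [SuperAlgebra B] : Type _ :=
  GradedTensorProduct ℝ (part A) (part B)

infixl:70 " ⊗ₛ " => SuperTensor

section
variable {A B A' B' : Type*} [Ring A] [Algebra ℝ A] [SuperAlgebra A]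
  [Ring B] [Algebra ℝ B] [SuperAlgebra B]
  [Ring A'] [Algebra ℝ A'] [SuperAlgebra A'] [Ring B'] [Algebra ℝ B'] [SuperAlgebra B']

/-- The linear map `f ⊗ g` on the spaces underlying super tensor products. -/
noncomputable def superMapLin (f : A →ₗ[ℝ] A') (g : B →ₗ[ℝ] B') : (A ⊗ₛ B) →ₗ[ℝ] (A' ⊗ₛ B') :=
  (GradedTensorProduct.of ℝ (part A') (part B')).toLinearMap ∘ₗ TensorProduct.map f g ∘ₗ
    (GradedTensorProduct.of ℝ (part A) (part B)).symm.toLinearMap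

/-- The algebra homomorphism `f ⊗ g` between super tensor products, for parity preserving algebra
homomorphisms `f` and `g`. -/
noncomputable def superMap (f : A →ₐ[ℝ] A') (g : B →ₐ[ℝ] B')
    (hf : ∀ a, f (parity a) = parity (f a)) (hg : ∀ b, g (parity b) = parity (g b)) :
    (A ⊗ₛ B) →ₐ[ℝ] (A' ⊗ₛ B') :=
  GradedTensorProduct.lift (part A) (part B)
    ((GradedTensorProduct.includeLeft (part A') (part B')).comp f)
    ((GradedTensorProduct.includeRight (part A') (part B')).comp g) (by
      intro i j a b
      have hfa : f a ∈ part A' i := by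
        rw [mem_part, ← hf, mem_part.1 a.2]; split_ifs <;> simp
      have hgb : g b ∈ part B' j := by
        rw [mem_part, ← hg, mem_part.1 b.2]; split_ifs <;> simp
      simp only [AlgHom.comp_apply, GradedTensorProduct.includeLeft_apply,
        GradedTensorProduct.includeRight_apply]
      rw [GradedTensorProduct.tmul_one_mul_one_tmul]
      have := GradedTensorProduct.tmul_coe_mul_coe_tmul (R := ℝ) (part A') (part B')
        (1 : A') ⟨_, hgb⟩ ⟨_, hfa⟩ (1 : B')
      simp only [one_mul, mul_one] at this
      rw [this, smul_smul, Int.units_mul_self, one_smul])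

theorem superMap_tmul (f : A →ₐ[ℝ] A') (g : B →ₐ[ℝ] B') (hf hg) (a : A) (b : B) :
    superMap f g hf hg (a ᵍ⊗ₜ[ℝ] b : A ⊗ₛ B) = (f a ᵍ⊗ₜ[ℝ] g b : A' ⊗ₛ B') := by
  simp [superMap, GradedTensorProduct.tmul_one_mul_one_tmul]

/-- `A ⊗ₛ B` is again a superalgebra, with the total parity. -/
noncomputable instance : SuperAlgebra (A ⊗ₛ B) where
  parity := superMap parity parity (fun _ => rfl) (fun _ => rfl)
  parity_parity x := by
    have : (superMap (A := A) (B := B) parity parity (fun _ => rfl) (fun _ => rfl)).comp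
        (superMap parity parity (fun _ => rfl) (fun _ => rfl)) = AlgHom.id ℝ (A ⊗ₛ B) := by
      ext a
      · simp [superMap_tmul, parity_parity]
      · simp [superMap_tmul, parity_parity]
    exact DFunLike.congr_fun this x

theorem superMap_eq_id (f : A →ₐ[ℝ] A) (g : B →ₐ[ℝ] B) (hf hg)
    (h1 : f = AlgHom.id ℝ A) (h2 : g = AlgHom.id ℝ B) :
    superMap f g hf hg = AlgHom.id ℝ (A ⊗ₛ B) := by
  subst h1 h2
  ext a
  · simpa using superMap_tmul (AlgHom.id ℝ A) (AlgHom.id ℝ B) _ _ a 1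
  · simpa using superMap_tmul (AlgHom.id ℝ A) (AlgHom.id ℝ B) _ _ 1 a

theorem superMap_eq_comp {A'' B'' : Type*} [Ring A''] [Algebra ℝ A''] [SuperAlgebra A'']
    [Ring B''] [Algebra ℝ B''] [SuperAlgebra B'']
    (f' : A' →ₐ[ℝ] A'') (g' : B' →ₐ[ℝ] B'') (hf' hg')
    (f : A →ₐ[ℝ] A') (g : B →ₐ[ℝ] B') (hf hg)
    (f'' : A →ₐ[ℝ] A'') (g'' : B →ₐ[ℝ] B'') (hf'' hg'')
    (h1 : f'' = f'.comp f) (h2 : g'' = g'.comp g) :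
    superMap f'' g'' hf'' hg'' = (superMap f' g' hf' hg').comp (superMap f g hf hg) := by
  subst h1 h2
  ext a
  · simp [superMap_tmul]
  · simp [superMap_tmul]
end

/-! ### The symmetric algebra and `U(D𝔤)` -/
section Algebra
variable (𝔤 : Type*) [LieRing 𝔤] [LieAlgebra ℝ 𝔤] [Module.Finite ℝ 𝔤]

/-- Index set of the chosen basis `e_a` of `𝔤`. -/
abbrev Idx : Type := Fin (Module.finrank ℝ 𝔤)

/-- The chosen basis `e_a` of `𝔤`. -/
noncomputable def lieBasis : Module.Basis (Idx 𝔤) ℝ 𝔤 := Module.finBasis ℝ 𝔤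

/-- The structure constants: `[e_b, e_c] = ∑ a, f a b c • e_a`. -/
noncomputable def structConst (a b c : Idx 𝔤) : ℝ :=
  (lieBasis 𝔤).repr ⁅lieBasis 𝔤 b, lieBasis 𝔤 c⁆ a

/-- The symmetric algebra `S𝔤`: polynomials in the basis vectors, the variable `X a` being
`e_a`. -/
abbrev Sym𝔤 : Type := MvPolynomial (Idx 𝔤) ℝ

variable {𝔤}

/-- The inclusion `𝔤 → S𝔤`. -/
noncomputable def symι : 𝔤 →ₗ[ℝ] Sym𝔤 𝔤 := (lieBasis 𝔤).constr ℝ MvPolynomial.X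

/-- The algebra endomorphism `S(φ)` of `S𝔤` induced by a linear endomorphism `φ` of `𝔤`. -/
noncomputable def symMap (φ : Module.End ℝ 𝔤) : Sym𝔤 𝔤 →ₐ[ℝ] Sym𝔤 𝔤 :=
  MvPolynomial.aeval fun a => symι (φ (lieBasis 𝔤 a))

/-- The derivation of `S𝔤` which extends `ad x`. -/
noncomputable def symAd (x : 𝔤) : Derivation ℝ (Sym𝔤 𝔤) (Sym𝔤 𝔤) :=
  MvPolynomial.mkDerivation ℝ fun a => symι ⁅x, lieBasis 𝔤 a⁆

variable (𝔤) in
/-- `S⁺𝔤 = ⨁_{k ≥ 1} S^k 𝔤`, the polynomials without constant term. -/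
noncomputable def SymPlus : Submodule ℝ (Sym𝔤 𝔤) := LinearMap.ker (MvPolynomial.lcoeff ℝ 0)

/-- The projection `S𝔤 → S⁺𝔤` which drops the constant term. -/
noncomputable def toSymPlus : Sym𝔤 𝔤 →ₗ[ℝ] SymPlus 𝔤 :=
  LinearMap.codRestrict (SymPlus 𝔤)
    (LinearMap.id - (Algebra.linearMap ℝ (Sym𝔤 𝔤)) ∘ₗ MvPolynomial.lcoeff ℝ 0) (by
      intro u
      simp [SymPlus, MvPolynomial.algebraMap_eq])

theorem coe_toSymPlus (u : Sym𝔤 𝔤) :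
    (toSymPlus u : Sym𝔤 𝔤) = u - MvPolynomial.C (MvPolynomial.coeff 0 u) := rfl

variable (𝔤) in
/-- The enveloping algebra `U(L(S⁺𝔤))` of the free graded Lie algebra `L(S⁺𝔤)`, i.e. the tensor
algebra of `S⁺𝔤`. -/
abbrev UL : Type := TensorAlgebra ℝ (SymPlus 𝔤)

/-- The generators `I(u)` of `U(L(S⁺𝔤))`, extended by `I(1) = 0` to all `u` in `S𝔤`. -/
noncomputable def genI : Sym𝔤 𝔤 →ₗ[ℝ] UL 𝔤 := TensorAlgebra.ι ℝ ∘ₗ toSymPlus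

/-- All generators `I(u)` are odd, `I(u)` having degree `1 - 2k` for `u` in `S^k 𝔤`. -/
noncomputable instance : SuperAlgebra (UL 𝔤) where
  parity := TensorAlgebra.lift ℝ (-TensorAlgebra.ι ℝ)
  parity_parity x := by
    have : (TensorAlgebra.lift ℝ (-TensorAlgebra.ι ℝ (M := SymPlus 𝔤))).comp
        (TensorAlgebra.lift ℝ (-TensorAlgebra.ι ℝ)) = AlgHom.id ℝ (UL 𝔤) := by
      ext u; simp
    exact DFunLike.congr_fun this x

/-- The products `I(u₁) ⋯ I(u_r)` with `u_j` in `S^{k_j} 𝔤`, `k_j ≥ 1`, of degree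
`-n = ∑ (1 - 2 k_j)`. -/
inductive IsWord : ℕ → UL 𝔤 → Prop
  | one : IsWord 0 1
  | mul {k n : ℕ} {u : Sym𝔤 𝔤} {w : UL 𝔤} (hu : u.IsHomogeneous (k + 1)) (hw : IsWord n w) :
      IsWord ((2 * k + 1) + n) (genI u * w)

variable (𝔤) in
/-- The component of degree `-n` of `U(L(S⁺𝔤))`. -/
noncomputable def ULdeg (n : ℕ) : Submodule ℝ (UL 𝔤) := Submodule.span ℝ {w | IsWord n w}

theorem coeff_zero_symMap (φ : Module.End ℝ 𝔤) (u : Sym𝔤 𝔤) :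
    MvPolynomial.coeff 0 (symMap φ u) = MvPolynomial.coeff 0 u := by
  have hlin : ∀ x : 𝔤, MvPolynomial.constantCoeff (symι x) = 0 := by
    intro x
    simp [symι, Module.Basis.constr_apply_fintype]
  have : (MvPolynomial.constantCoeff.comp (symMap φ).toRingHom) =
      (MvPolynomial.constantCoeff : Sym𝔤 𝔤 →+* ℝ) := by
    apply MvPolynomial.ringHom_ext
    · intro r; simp [symMap]
    · intro a; simp [symMap, hlin]
  exact DFunLike.congr_fun this u

/-- The action on `U(L(S⁺𝔤))` of a linear endomorphism of `𝔤`, `I(u) ↦ I(S(φ) u)`. -/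
noncomputable def ulMap (φ : Module.End ℝ 𝔤) : UL 𝔤 →ₐ[ℝ] UL 𝔤 :=
  TensorAlgebra.lift ℝ (genI ∘ₗ (symMap φ).toLinearMap ∘ₗ (SymPlus 𝔤).subtype)

theorem ulMap_genI (φ : Module.End ℝ 𝔤) (u : Sym𝔤 𝔤) :
    ulMap φ (genI u) = genI (symMap φ u) := by
  have h1 : genI (𝔤 := 𝔤) (MvPolynomial.C (MvPolynomial.coeff 0 u)) = 0 := by
    have : toSymPlus (𝔤 := 𝔤) (MvPolynomial.C (MvPolynomial.coeff 0 u)) = 0 := by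
      apply Subtype.ext; rw [coe_toSymPlus]; simp
    simp [genI, this]
  have h2 : symMap φ (MvPolynomial.C (MvPolynomial.coeff 0 u)) =
      MvPolynomial.C (MvPolynomial.coeff 0 u) := by simp [symMap, MvPolynomial.algebraMap_eq]
  have : ulMap φ (genI u) = genI (symMap φ ((toSymPlus u : SymPlus 𝔤) : Sym𝔤 𝔤)) := by
    simp [ulMap, genI]
  rw [this, coe_toSymPlus, map_sub, map_sub, h2, h1, sub_zero]

theorem genI_coe (u : SymPlus 𝔤) : genI (u : Sym𝔤 𝔤) = TensorAlgebra.ι ℝ u := by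
  have : toSymPlus (u : Sym𝔤 𝔤) = u := by
    have hu : MvPolynomial.coeff 0 (u : Sym𝔤 𝔤) = 0 := by
      have := u.2; simpa [SymPlus] using this
    apply Subtype.ext; rw [coe_toSymPlus, hu]; simp
  simp [genI, this]

theorem symMap_symι (φ : Module.End ℝ 𝔤) (x : 𝔤) : symMap φ (symι x) = symι (φ x) := by
  have : (symMap φ).toLinearMap ∘ₗ symι = symι ∘ₗ φ := by
    apply (lieBasis 𝔤).ext
    intro a
    simp [symMap, symι]
  exact DFunLike.congr_fun this x

theorem ulMap_one : ulMap (1 : Module.End ℝ 𝔤) = AlgHom.id ℝ (UL 𝔤) := by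
  have h : symMap (1 : Module.End ℝ 𝔤) = AlgHom.id ℝ _ := by
    apply MvPolynomial.algHom_ext; intro a; simp [symMap, symι]
  ext u
  simp only [LinearMap.comp_apply, AlgHom.toLinearMap_apply, AlgHom.id_apply]
  rw [← genI_coe, ulMap_genI, h, AlgHom.id_apply]

theorem ulMap_mul (φ ψ : Module.End ℝ 𝔤) : ulMap (φ * ψ) = (ulMap φ).comp (ulMap ψ) := by
  have h : symMap (φ * ψ) = (symMap φ).comp (symMap ψ) := by
    apply MvPolynomial.algHom_ext; intro a
    simp only [AlgHom.comp_apply]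
    rw [show (MvPolynomial.X a : Sym𝔤 𝔤) = symι (lieBasis 𝔤 a) by simp [symι]]
    simp [symMap_symι]
  ext u
  simp only [LinearMap.comp_apply, AlgHom.toLinearMap_apply, AlgHom.comp_apply]
  rw [← genI_coe, ulMap_genI, ulMap_genI, ulMap_genI, h, AlgHom.comp_apply]

theorem ulMap_parity (φ : Module.End ℝ 𝔤) (x : UL 𝔤) :
    ulMap φ (SuperAlgebra.parity x) = SuperAlgebra.parity (ulMap φ x) := by
  have : (ulMap φ).comp (SuperAlgebra.parity : UL 𝔤 →ₐ[ℝ] UL 𝔤) =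
      SuperAlgebra.parity.comp (ulMap φ) := by
    ext u
    simp [ulMap, SuperAlgebra.parity, genI]
  exact DFunLike.congr_fun this x

variable (𝔤) in
/-- The coproduct of `U(L(S⁺𝔤))`: the generators are primitive. -/
noncomputable def ulComul : UL 𝔤 →ₐ[ℝ] (UL 𝔤 ⊗ₛ UL 𝔤) :=
  TensorAlgebra.lift ℝ
    ((GradedTensorProduct.includeLeft (part (UL 𝔤)) (part (UL 𝔤))).toLinearMap ∘ₗ TensorAlgebra.ι ℝ +
      (GradedTensorProduct.includeRight (part (UL 𝔤)) (part (UL 𝔤))).toLinearMap ∘ₗ TensorAlgebra.ι ℝ)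

theorem parity_includeLeft {A B : Type*} [Ring A] [Algebra ℝ A] [SuperAlgebra A]
    [Ring B] [Algebra ℝ B] [SuperAlgebra B] (a : A) :
    GradedTensorProduct.includeLeft (part A) (part B) (parity a) =
      parity (GradedTensorProduct.includeLeft (part A) (part B) a) := by
  simp [SuperAlgebra.parity, superMap_tmul]

theorem parity_includeRight {A B : Type*} [Ring A] [Algebra ℝ A] [SuperAlgebra A]
    [Ring B] [Algebra ℝ B] [SuperAlgebra B] (b : B) :
    GradedTensorProduct.includeRight (part A) (part B) (parity b) =
      parity (GradedTensorProduct.includeRight (part A) (part B) b) := by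
  simp [SuperAlgebra.parity, superMap_tmul]

theorem parity_ulComul (x : UL 𝔤) : ulComul 𝔤 (parity x) = parity (ulComul 𝔤 x) := by
  have : (ulComul 𝔤).comp (parity : UL 𝔤 →ₐ[ℝ] UL 𝔤) = parity.comp (ulComul 𝔤) := by
    ext u
    have h : parity (TensorAlgebra.ι ℝ u : UL 𝔤) = -TensorAlgebra.ι ℝ u := by
      simp [parity]
    simp only [LinearMap.comp_apply, AlgHom.toLinearMap_apply, AlgHom.comp_apply]
    rw [h, map_neg]
    simp only [ulComul, TensorAlgebra.lift_ι_apply, LinearMap.add_apply, LinearMap.comp_apply,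
      AlgHom.toLinearMap_apply, map_add]
    rw [← parity_includeLeft, ← parity_includeRight, h, map_neg, map_neg, neg_add]
  exact DFunLike.congr_fun this x

variable (𝔤) in
/-- The relations of `U(D𝔤)` in the generators `l(x)` and `I(u)`:
`[l(x), l(y)] = l([x, y])` and `[l(x), I(u)] = I(ad_x u)`. -/
inductive UDRel : TensorAlgebra ℝ (𝔤 × SymPlus 𝔤) → TensorAlgebra ℝ (𝔤 × SymPlus 𝔤) → Prop
  | lie (x y : 𝔤) : UDRel
      (TensorAlgebra.ι ℝ (x, 0) * TensorAlgebra.ι ℝ (y, 0) -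
        TensorAlgebra.ι ℝ (y, 0) * TensorAlgebra.ι ℝ (x, 0))
      (TensorAlgebra.ι ℝ (⁅x, y⁆, 0))
  | act (x : 𝔤) (u : SymPlus 𝔤) : UDRel
      (TensorAlgebra.ι ℝ (x, 0) * TensorAlgebra.ι ℝ (0, u) -
        TensorAlgebra.ι ℝ (0, u) * TensorAlgebra.ι ℝ (x, 0))
      (TensorAlgebra.ι ℝ (0, toSymPlus (symAd x (u : Sym𝔤 𝔤))))

variable (𝔤) in
/-- The enveloping algebra `U(D𝔤)` of the graded Lie algebra `D𝔤 = 𝔤 ⋉ L(S⁺𝔤)`. -/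
abbrev UD : Type _ := RingQuot (UDRel 𝔤)

/-- The generators `l(x)` of `U(D𝔤)`. -/
noncomputable def udL : 𝔤 →ₗ[ℝ] UD 𝔤 :=
  (RingQuot.mkAlgHom ℝ (UDRel 𝔤)).toLinearMap ∘ₗ TensorAlgebra.ι ℝ ∘ₗ LinearMap.inl ℝ 𝔤 (SymPlus 𝔤)

/-- The generators `I(u)` of `U(D𝔤)`, extended by `I(1) = 0` to all `u` in `S𝔤`. -/
noncomputable def udI : Sym𝔤 𝔤 →ₗ[ℝ] UD 𝔤 :=
  (RingQuot.mkAlgHom ℝ (UDRel 𝔤)).toLinearMap ∘ₗ TensorAlgebra.ι ℝ ∘ₗ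
    LinearMap.inr ℝ 𝔤 (SymPlus 𝔤) ∘ₗ toSymPlus

theorem commutator_neg {R : Type*} [Ring R] {a b c : R} (h : a * b - b * a = c) :
    a * -b - -b * a = -c := by
  rw [← h]; noncomm_ring

/-- The generators `l(x)` are even and the generators `I(u)` are odd. -/
noncomputable def udParity : UD 𝔤 →ₐ[ℝ] UD 𝔤 :=
  RingQuot.liftAlgHom ℝ ⟨TensorAlgebra.lift ℝ
    ((RingQuot.mkAlgHom ℝ (UDRel 𝔤)).toLinearMap ∘ₗ TensorAlgebra.ι ℝ ∘ₗ
      LinearMap.prodMap LinearMap.id (-LinearMap.id)), by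
    intro a b h
    cases h with
    | lie x y =>
      have := RingQuot.mkAlgHom_rel ℝ (UDRel.lie x y)
      rw [map_sub, map_mul, map_mul] at this
      simpa using this
    | act x u =>
      have := RingQuot.mkAlgHom_rel ℝ (UDRel.act x u)
      rw [map_sub, map_mul, map_mul] at this
      have h0 : ∀ v : SymPlus 𝔤, ((0 : 𝔤), -v) = -((0 : 𝔤), v) := by intro v; simp
      simp only [map_sub, map_mul, TensorAlgebra.lift_ι_apply, LinearMap.comp_apply,
        LinearMap.prodMap_apply, LinearMap.id_apply, map_zero, AlgHom.toLinearMap_apply,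
        LinearMap.neg_apply, h0, map_neg]
      exact commutator_neg this⟩

theorem udParity_ι (x : 𝔤) (u : SymPlus 𝔤) :
    udParity (RingQuot.mkAlgHom ℝ (UDRel 𝔤) (TensorAlgebra.ι ℝ (x, u))) =
      RingQuot.mkAlgHom ℝ (UDRel 𝔤) (TensorAlgebra.ι ℝ (x, -u)) := by
  rw [udParity, RingQuot.liftAlgHom_mkAlgHom_apply, TensorAlgebra.lift_ι_apply]
  rfl

noncomputable instance : SuperAlgebra (UD 𝔤) where
  parity := udParity
  parity_parity x := by
    have : (udParity (𝔤 := 𝔤)).comp udParity = AlgHom.id ℝ (UD 𝔤) := by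
      apply RingQuot.ringQuot_ext'
      apply TensorAlgebra.hom_ext
      apply LinearMap.ext
      rintro ⟨x, u⟩
      simp only [LinearMap.comp_apply, AlgHom.toLinearMap_apply, AlgHom.comp_apply, udParity_ι,
        neg_neg, AlgHom.id_apply]
    exact DFunLike.congr_fun this x

variable (𝔤) in
/-- The inclusion `U(L(S⁺𝔤)) → U(D𝔤)`. -/
noncomputable def ulToUD : UL 𝔤 →ₐ[ℝ] UD 𝔤 :=
  TensorAlgebra.lift ℝ (udI ∘ₗ (SymPlus 𝔤).subtype)

theorem parity_ulToUD (x : UL 𝔤) : ulToUD 𝔤 (parity x) = parity (ulToUD 𝔤 x) := by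
  have : (ulToUD 𝔤).comp (parity : UL 𝔤 →ₐ[ℝ] UL 𝔤) = parity.comp (ulToUD 𝔤) := by
    apply TensorAlgebra.hom_ext
    apply LinearMap.ext
    intro u
    have h1 : parity (TensorAlgebra.ι ℝ u : UL 𝔤) = -TensorAlgebra.ι ℝ u := by simp [parity]
    have h2 : parity (udI (u : Sym𝔤 𝔤)) = -udI (u : Sym𝔤 𝔤) := by
      change udParity (RingQuot.mkAlgHom ℝ (UDRel 𝔤) (TensorAlgebra.ι ℝ (0, toSymPlus _))) = _
      rw [udParity_ι, show ((0 : 𝔤), -toSymPlus (u : Sym𝔤 𝔤)) = -((0 : 𝔤), toSymPlus (u : Sym𝔤 𝔤))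
        by simp, map_neg, map_neg]
      rfl
    simp only [LinearMap.comp_apply, AlgHom.toLinearMap_apply, AlgHom.comp_apply, h1, map_neg]
    rw [ulToUD, TensorAlgebra.lift_ι_apply, LinearMap.comp_apply, Submodule.subtype_apply, h2]
  exact DFunLike.congr_fun this x

/-- The differential of `D𝔤` on the generators `I(u)`. It is characterised by
`d I(x) = l(x)` and, for `k ≥ 2`,
`d I(x ^ k) = 1/2 * ∑_{0 < s < k} [I(x ^ s), I(x ^ (k - s))] = ∑_{0 < s < k} I(x ^ s) I(x ^ (k - s))`
for `x` in `𝔤`. Polarisation, which is carried out here on the monomials `e^α`, gives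
`d I(e^α) = ∑_{β + γ = α} (∏ a, (α_a choose β_a)) / (|α| choose |β|) * I(e^β) I(e^γ)` for
`|α| ≥ 2` (recall that `I(1) = 0`). -/
noncomputable def dGen : Sym𝔤 𝔤 →ₗ[ℝ] UD 𝔤 :=
  (MvPolynomial.basisMonomials (Idx 𝔤) ℝ).constr ℝ fun α =>
    (∑ a, if α = Finsupp.single a 1 then udL (lieBasis 𝔤 a) else 0) +
    ∑ p ∈ Finset.HasAntidiagonal.antidiagonal α,
      ((∏ a, ((α a).choose (p.1 a) : ℝ)) / (α.degree.choose p.1.degree : ℝ)) •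
        (udI (MvPolynomial.monomial p.1 1) * udI (MvPolynomial.monomial p.2 1))

/-- Auxiliary homomorphism `w ↦ (σ(w), d w; 0, w)` with `σ` the parity automorphism. -/
noncomputable def dULAux : UL 𝔤 →ₐ[ℝ] Matrix (Fin 2) (Fin 2) (UD 𝔤) :=
  TensorAlgebra.lift ℝ
    { toFun := fun u => !![-udI (u : Sym𝔤 𝔤), dGen (u : Sym𝔤 𝔤); 0, udI (u : Sym𝔤 𝔤)]
      map_add' := by intro u v; ext i j; fin_cases i <;> fin_cases j <;> simp [add_comm]
      map_smul' := by intro r u; ext i j; fin_cases i <;> fin_cases j <;> simp }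

variable (𝔤) in
/-- The differential of `U(D𝔤)` on the subalgebra `U(L(S⁺𝔤))`: the odd derivation
`d (v w) = d v * w + (-1) ^ |v| v * d w` which extends `dGen`. -/
noncomputable def dUL : UL 𝔤 →ₗ[ℝ] UD 𝔤 :=
  { toFun := fun w => dULAux w 0 1
    map_add' := by intro u v; simp
    map_smul' := by intro r u; simp }

/-- On generators `dUL` is `dGen`. -/
theorem dUL_gen (u : SymPlus 𝔤) : dUL 𝔤 (TensorAlgebra.ι ℝ u) = dGen (u : Sym𝔤 𝔤) := by
  simp [dUL, dULAux]

theorem dULAux_shape (w : UL 𝔤) : dULAux w 0 0 = ulToUD 𝔤 (parity w) ∧ dULAux w 1 0 = 0 ∧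
    dULAux w 1 1 = ulToUD 𝔤 w := by
  induction w using TensorAlgebra.induction with
  | algebraMap r => simp [Algebra.algebraMap_eq_smul_one]
  | ι u => simp [dULAux, ulToUD, parity]
  | mul v w hv hw => simp [Matrix.mul_apply, hv, hw]
  | add v w hv hw => simp [hv, hw]

theorem dUL_mul (v w : UL 𝔤) :
    dUL 𝔤 (v * w) = dUL 𝔤 v * ulToUD 𝔤 w + ulToUD 𝔤 (parity v) * dUL 𝔤 w := by
  change dULAux (v * w) 0 1 = dULAux v 0 1 * _ + _ * dULAux w 0 1
  rw [map_mul, Matrix.mul_apply, Fin.sum_univ_two, (dULAux_shape v).1, (dULAux_shape w).2.2,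
    add_comm]
end Algebra

/-! ### The Weil algebra -/
section Weil
variable (𝔤 : Type*) [LieRing 𝔤] [LieAlgebra ℝ 𝔤] [Module.Finite ℝ 𝔤]

/-- The symmetric algebra `S𝔤*`, the variable `X a` being the coordinate function `t^a`. -/
abbrev SymDual : Type := MvPolynomial (Idx 𝔤) ℝ

/-- The Weil algebra `W𝔤 = S𝔤* ⊗ Λ𝔤*`. -/
abbrev Weil : Type _ := SymDual 𝔤 ⊗[ℝ] ExteriorAlgebra ℝ (Module.Dual ℝ 𝔤)

variable {V : Type*} [AddCommGroup V] [Module ℝ V]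

/-- Exterior algebras are superalgebras with odd generators. -/
noncomputable instance : SuperAlgebra (ExteriorAlgebra ℝ V) where
  parity := CliffordAlgebra.involute
  parity_parity := CliffordAlgebra.involute_involute

/-- In the Weil algebra `S𝔤*` is even and the generators of `Λ𝔤*` are odd. -/
noncomputable instance : SuperAlgebra (Weil 𝔤) where
  parity := Algebra.TensorProduct.map (AlgHom.id ℝ (SymDual 𝔤)) parity
  parity_parity x := by
    induction x using TensorProduct.induction_on with
    | zero => simp
    | tmul p w => simp [parity_parity]
    | add x y hx hy => rw [map_add, map_add, hx, hy]

variable {𝔤}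

/-- The generators `θ^a` of `Λ𝔤*`. -/
noncomputable def extθ (a : Idx 𝔤) : ExteriorAlgebra ℝ (Module.Dual ℝ 𝔤) :=
  ExteriorAlgebra.ι ℝ ((lieBasis 𝔤).coord a)

/-- The contraction `∂/∂θ^a` with `e_a` on `Λ𝔤*`. -/
noncomputable def extContract (a : Idx 𝔤) :
    ExteriorAlgebra ℝ (Module.Dual ℝ 𝔤) →ₗ[ℝ] ExteriorAlgebra ℝ (Module.Dual ℝ 𝔤) :=
  CliffordAlgebra.contractLeft (Module.Dual.eval ℝ 𝔤 (lieBasis 𝔤 a))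

variable (𝔤) in
/-- The Weil differential: the odd derivation of `W𝔤` with
`d θ^a = t^a - 1/2 f^a_{bc} θ^b θ^c` and `d t^a = - f^a_{bc} θ^b t^c`. -/
noncomputable def weilD : Weil 𝔤 →ₗ[ℝ] Weil 𝔤 :=
  ∑ a, (TensorProduct.map (LinearMap.mulLeft ℝ (MvPolynomial.X a)) (extContract a)
    - (2⁻¹ : ℝ) • ∑ b, ∑ c, structConst 𝔤 a b c •
        TensorProduct.map LinearMap.id (LinearMap.mulLeft ℝ (extθ b * extθ c) ∘ₗ extContract a)
    - ∑ b, ∑ c, structConst 𝔤 a b c •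
        TensorProduct.map
          (LinearMap.mulLeft ℝ (MvPolynomial.X c) ∘ₗ (MvPolynomial.pderiv a).toLinearMap)
          (LinearMap.mulLeft ℝ (extθ b)))

/-- The action of `x` in `𝔤` on `W𝔤`: the derivation which extends the coadjoint action
`t^a ↦ - [x, e_c]^a t^c`, `θ^a ↦ - [x, e_c]^a θ^c`. -/
noncomputable def weilL (x : 𝔤) : Weil 𝔤 →ₗ[ℝ] Weil 𝔤 :=
  -∑ a, ∑ c, (lieBasis 𝔤).repr ⁅x, lieBasis 𝔤 c⁆ a •
    (TensorProduct.map
        (LinearMap.mulLeft ℝ (MvPolynomial.X c) ∘ₗ (MvPolynomial.pderiv a).toLinearMap)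
        LinearMap.id
      + TensorProduct.map LinearMap.id (LinearMap.mulLeft ℝ (extθ c) ∘ₗ extContract a))

variable (𝔤) in
/-- The component of degree `n` of `W𝔤`, where `t^a` has degree `2` and `θ^a` has degree `1`. -/
noncomputable def weilDeg (n : ℕ) : Submodule ℝ (Weil 𝔤) :=
  Submodule.span ℝ {z | ∃ (i j : ℕ) (p : SymDual 𝔤) (w : ExteriorAlgebra ℝ (Module.Dual ℝ 𝔤)),
    2 * i + j = n ∧ p.IsHomogeneous i ∧ w ∈ ⋀[ℝ]^j (Module.Dual ℝ 𝔤) ∧ z = p ⊗ₜ[ℝ] w}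

end Weil

/-! ### Group-like elements and the element `Φ` -/
section GroupLike
variable {𝔤 : Type*} [LieRing 𝔤] [LieAlgebra ℝ 𝔤] [Module.Finite ℝ 𝔤]
  {B : Type*} [Ring B] [Algebra ℝ B] [SuperAlgebra B]

variable (𝔤 B) in
/-- The coproduct of the Hopf algebra `B ⊗ U(L(S⁺𝔤))` over `B`. Here
`(B ⊗ U) ⊗_B (B ⊗ U)` is identified with `B ⊗ (U ⊗ U)`. -/
noncomputable def comulB : (B ⊗ₛ UL 𝔤) →ₐ[ℝ] (B ⊗ₛ (UL 𝔤 ⊗ₛ UL 𝔤)) :=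
  superMap (AlgHom.id ℝ B) (ulComul 𝔤) (fun _ => rfl) parity_ulComul

variable (𝔤 B) in
/-- The map `h ↦ h ⊗_B 1`. -/
noncomputable def inFst : (B ⊗ₛ UL 𝔤) →ₐ[ℝ] (B ⊗ₛ (UL 𝔤 ⊗ₛ UL 𝔤)) :=
  superMap (AlgHom.id ℝ B) (GradedTensorProduct.includeLeft (part (UL 𝔤)) (part (UL 𝔤)))
    (fun _ => rfl) parity_includeLeft

variable (𝔤 B) in
/-- The map `h ↦ 1 ⊗_B h`. -/
noncomputable def inSnd : (B ⊗ₛ UL 𝔤) →ₐ[ℝ] (B ⊗ₛ (UL 𝔤 ⊗ₛ UL 𝔤)) :=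
  superMap (AlgHom.id ℝ B) (GradedTensorProduct.includeRight (part (UL 𝔤)) (part (UL 𝔤)))
    (fun _ => rfl) parity_includeRight

variable (𝔤 B) in
/-- The inclusion `B ⊗ U(L(S⁺𝔤)) → B ⊗ U(D𝔤)`. -/
noncomputable def toBUD : (B ⊗ₛ UL 𝔤) →ₐ[ℝ] (B ⊗ₛ UD 𝔤) :=
  superMap (AlgHom.id ℝ B) (ulToUD 𝔤) (fun _ => rfl) parity_ulToUD

variable (B) in
/-- The action on `B ⊗ U(L(S⁺𝔤))` of a linear endomorphism of `𝔤`. -/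
noncomputable def bMap (φ : Module.End ℝ 𝔤) : (B ⊗ₛ UL 𝔤) →ₐ[ℝ] (B ⊗ₛ UL 𝔤) :=
  superMap (AlgHom.id ℝ B) (ulMap φ) (fun _ => rfl) (ulMap_parity φ)

theorem bMap_one : bMap B (1 : Module.End ℝ 𝔤) = AlgHom.id ℝ (B ⊗ₛ UL 𝔤) :=
  superMap_eq_id _ _ _ _ rfl ulMap_one

theorem bMap_mul (φ ψ : Module.End ℝ 𝔤) : bMap B (φ * ψ) = (bMap B φ).comp (bMap B ψ) :=
  superMap_eq_comp _ _ _ _ _ _ _ _ _ _ _ _ rfl (ulMap_mul φ ψ)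

/-- The span of the `b ⊗ u` with `b` in the given subspace `S` of `B` and `u` of degree `-n`. -/
noncomputable def bidegree (S : Submodule ℝ B) (n : ℕ) : Submodule ℝ (B ⊗ₛ UL 𝔤) :=
  Submodule.span ℝ {z | ∃ b ∈ S, ∃ u ∈ ULdeg 𝔤 n, z = (b ᵍ⊗ₜ[ℝ] u : B ⊗ₛ UL 𝔤)}

variable (𝔤) in
/-- The element `-i(t) + l(θ)` of total degree one of `W𝔤 ⊗ D𝔤`, where
`i(t) = ∑_{k ≥ 1} t^{a₁} ⋯ t^{a_k} ⊗ I(e_{a₁} ⋯ e_{a_k})` and `l(θ) = θ^a ⊗ l(e_a)`.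
The coefficient of index `n` of the power series is the component in `W𝔤 ⊗ U(D𝔤)^{-n}`; thus
`l(θ)` has index `0` and the `k`-th summand of `i(t)` has index `2k - 1`. -/
noncomputable def connElt : PowerSeries (Weil 𝔤 ⊗ₛ UD 𝔤) :=
  PowerSeries.mk fun n =>
    if n = 0 then
      ∑ a, (((1 : SymDual 𝔤) ⊗ₜ[ℝ] extθ a : Weil 𝔤) ᵍ⊗ₜ[ℝ] udL (lieBasis 𝔤 a) : Weil 𝔤 ⊗ₛ UD 𝔤)
    else if Odd n then
      -∑ a : Fin ((n + 1) / 2) → Idx 𝔤,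
        (((∏ i, (MvPolynomial.X (a i) : SymDual 𝔤)) ⊗ₜ[ℝ] 1 : Weil 𝔤) ᵍ⊗ₜ[ℝ]
          udI (∏ i, (MvPolynomial.X (a i) : Sym𝔤 𝔤)) : Weil 𝔤 ⊗ₛ UD 𝔤)
    else 0

/-- The differential `d_W ⊗ 1 + 1 ⊗ d_{D𝔤}` on elements of total degree zero of the degree
completion of `W𝔤 ⊗ U(L(S⁺𝔤))`. The coefficient of index `n` of `Φ` is the component in
`(W𝔤)^n ⊗ U^{-n}`, the coefficient of index `n` of the differential is the component in
`(W𝔤)^{n+1} ⊗ U^{-n}`. -/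
noncomputable def totalD (Φ : PowerSeries (Weil 𝔤 ⊗ₛ UL 𝔤)) : PowerSeries (Weil 𝔤 ⊗ₛ UD 𝔤) :=
  PowerSeries.mk fun n =>
    superMapLin (weilD 𝔤) (ulToUD 𝔤).toLinearMap (PowerSeries.coeff n Φ) +
    superMapLin (parity : Weil 𝔤 →ₐ[ℝ] Weil 𝔤).toLinearMap (dUL 𝔤) (PowerSeries.coeff (n + 1) Φ)

/-- `Φ` is a `𝔤`-invariant group-like element of degree zero of the degree completion of
`W𝔤 ⊗ U(L(S⁺𝔤))`, and `Φ⁻¹ dΦ = -i(t) + l(θ)`. The element `Φ` is written as the power series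
whose coefficient of index `n` is its component in `(W𝔤)^n ⊗ U(L(S⁺𝔤))^{-n}`. -/
structure IsKalkman (Φ : PowerSeries (Weil 𝔤 ⊗ₛ UL 𝔤)) : Prop where
  degree_zero : ∀ n, PowerSeries.coeff n Φ ∈ bidegree (weilDeg 𝔤 n) n
  counit : PowerSeries.coeff 0 Φ = 1
  comul : PowerSeries.map (comulB 𝔤 (Weil 𝔤)).toRingHom Φ =
    PowerSeries.map (inFst 𝔤 (Weil 𝔤)).toRingHom Φ * PowerSeries.map (inSnd 𝔤 (Weil 𝔤)).toRingHom Φ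
  invariant : ∀ (x : 𝔤) (n : ℕ),
    superMapLin (weilL x) (ulToUD 𝔤).toLinearMap (PowerSeries.coeff n Φ) +
      ((1 ᵍ⊗ₜ[ℝ] udL x : Weil 𝔤 ⊗ₛ UD 𝔤) * toBUD 𝔤 (Weil 𝔤) (PowerSeries.coeff n Φ) -
        toBUD 𝔤 (Weil 𝔤) (PowerSeries.coeff n Φ) * (1 ᵍ⊗ₜ[ℝ] udL x : Weil 𝔤 ⊗ₛ UD 𝔤)) = 0
  dlog : totalD Φ = PowerSeries.map (toBUD 𝔤 (Weil 𝔤)).toRingHom Φ * connElt 𝔤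

end GroupLike

/-- Let a group `Γ` act on an algebra `R` through `θ x` for each `x` in `X`. The induced action
on families of units, `(g h)(x) = θ x g (h x)`. -/
noncomputable def pointwiseAut {Γ X R : Type*} [Group Γ] [Ring R] [Algebra ℝ R]
    (θ : X → Γ → (R →ₐ[ℝ] R)) (h1 : ∀ x, θ x 1 = AlgHom.id ℝ R)
    (h2 : ∀ x g g', θ x (g * g') = (θ x g).comp (θ x g')) : Γ →* MulAut (X → Rˣ) where
  toFun g :=
    { toFun := fun h x => Units.map (θ x g).toMonoidHom (h x)
      invFun := fun h x => Units.map (θ x g⁻¹).toMonoidHom (h x)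
      left_inv := fun h => funext fun x => Units.ext (by
        change ((θ x g⁻¹).comp (θ x g)) (h x : R) = h x
        rw [← h2, inv_mul_cancel, h1]; rfl)
      right_inv := fun h => funext fun x => Units.ext (by
        change ((θ x g).comp (θ x g⁻¹)) (h x : R) = h x
        rw [← h2, mul_inv_cancel, h1]; rfl)
      map_mul' := fun h h' => funext fun x => map_mul _ _ _ }
  map_one' := MulEquiv.ext fun h => funext fun x => Units.ext (by
    change θ x 1 (h x : R) = h x
    rw [h1]; rfl)
  map_mul' g g' := MulEquiv.ext fun h => funext fun x => Units.ext (by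
    change θ x (g * g') (h x : R) = θ x g (θ x g' (h x : R))
    rw [h2]; rfl)

/-! ### Differential forms with values in a vector space -/
section Forms
variable {E : Type*} [NormedAddCommGroup E] [NormedSpace ℝ E] [FiniteDimensional ℝ E]
  {M : Type*} [TopologicalSpace M] [ChartedSpace E M]
  {V : Type*} [AddCommGroup V] [Module ℝ V]

variable (E) in
/-- The exterior algebra `Λ T_x^* M` of the cotangent space; in Mathlib `T_x M` is the model space
`E`, identified through the preferred chart at `x`. A differential form on `M` with values in `V`
is a smooth section `M → ExtCot E ⊗ V`. -/
abbrev ExtCot : Type _ := ExteriorAlgebra ℝ (Module.Dual ℝ E)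

/-- A one-form at a point with values in `V`, as an element of `Λ¹ ⊗ V`. -/
noncomputable def oneFormElt (B : E →ₗ[ℝ] V) : ExtCot E ⊗[ℝ] V :=
  ∑ i, ExteriorAlgebra.ι ℝ ((Module.finBasis ℝ E).coord i) ⊗ₜ[ℝ] B (Module.finBasis ℝ E i)

/-- The derivative at `y` of the inverse of the preferred chart at `x₀`, as a linear map into the
tangent space of `M` at the image of `y`. -/
noncomputable def chartInvDeriv (x₀ : M) (y : E) : E →ₗ[ℝ] E :=
  (mfderiv 𝓘(ℝ, E) 𝓘(ℝ, E) (extChartAt 𝓘(ℝ, E) x₀).symm y).toLinearMap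

/-- The pullback of a form by the inverse of the preferred chart at `x₀`. -/
noncomputable def chartForm (η : M → ExtCot E ⊗[ℝ] V) (x₀ : M) (y : E) : ExtCot E ⊗[ℝ] V :=
  (ExteriorAlgebra.map (chartInvDeriv x₀ y).dualMap).toLinearMap.rTensor V
    (η ((extChartAt 𝓘(ℝ, E) x₀).symm y))

/-- A section is smooth if all its components are smooth in the charts. -/
def IsSmoothForm (η : M → ExtCot E ⊗[ℝ] V) : Prop :=
  ∀ (x₀ : M) (c : Module.Dual ℝ (ExtCot E ⊗[ℝ] V)),
    ContDiffOn ℝ ∞ (fun y => c (chartForm η x₀ y)) (extChartAt 𝓘(ℝ, E) x₀).target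

/-- The derivative at `y` in direction `v` of a function with values in a vector space `U`, taken
componentwise with respect to a basis of `U`. (It is only used for functions which locally take
values in a finite dimensional subspace.) -/
noncomputable def dirDeriv {U : Type*} [AddCommGroup U] [Module ℝ U] (f : E → U) (y v : E) : U :=
  ∑ᶠ i, fderiv ℝ (fun z => (Module.Basis.ofVectorSpace ℝ U).repr (f z) i) y v •
    Module.Basis.ofVectorSpace ℝ U i

/-- The exterior derivative: in the preferred chart at `x` it is `∑ᵢ dxⁱ ∧ ∂ᵢ`. -/
noncomputable def extD (η : M → ExtCot E ⊗[ℝ] V) (x : M) : ExtCot E ⊗[ℝ] V :=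
  ∑ i, (LinearMap.mulLeft ℝ (ExteriorAlgebra.ι ℝ ((Module.finBasis ℝ E).coord i))).rTensor V
    (dirDeriv (chartForm η x) (extChartAt 𝓘(ℝ, E) x x) (Module.finBasis ℝ E i))

end Forms

/-! ### Lie groups -/
section Groups
variable {E : Type*} [NormedAddCommGroup E] [NormedSpace ℝ E] [FiniteDimensional ℝ E]
  {M : Type*} [TopologicalSpace M] [ChartedSpace E M]
  {F : Type*} [NormedAddCommGroup F] [NormedSpace ℝ F] [FiniteDimensional ℝ F] [CompleteSpace F]
  {G : Type*} [TopologicalSpace G] [ChartedSpace F G] [Group G] [LieGroup 𝓘(ℝ, F) ∞ G]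

instance lieGroup_minSmoothness : LieGroup 𝓘(ℝ, F) (minSmoothness ℝ 3) G :=
  LieGroup.of_le (n := ∞) (by
    rw [minSmoothness_of_isRCLikeNormedField]
    exact WithTop.coe_le_coe.2 le_top)

variable (F G) in
/-- The Lie algebra `𝔤` of `G`, with the bracket of left invariant vector fields. -/
abbrev LieAlg : Type _ := GroupLieAlgebra 𝓘(ℝ, F) G

instance finite_lieAlg : Module.Finite ℝ (LieAlg F G) := inferInstanceAs (Module.Finite ℝ F)

/-- The derivative at `1` of a map `G → G`. -/
noncomputable def derivOne (c : G → G) : F →L[ℝ] F := mfderiv 𝓘(ℝ, F) 𝓘(ℝ, F) c 1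

theorem derivOne_comp (c c' : G → G) (h1 : c' 1 = 1)
    (hc : MDifferentiableAt 𝓘(ℝ, F) 𝓘(ℝ, F) c 1)
    (hc' : MDifferentiableAt 𝓘(ℝ, F) 𝓘(ℝ, F) c' 1) :
    derivOne (F := F) (c ∘ c') = (derivOne c).comp (derivOne c') := by
  have hc1 : MDifferentiableAt 𝓘(ℝ, F) 𝓘(ℝ, F) c (c' 1) := by rw [h1]; exact hc
  have := mfderiv_comp (I' := 𝓘(ℝ, F)) (1 : G) hc1 hc'
  unfold derivOne
  rw [this]
  have key : ∀ z : G, z = 1 → (mfderiv 𝓘(ℝ, F) 𝓘(ℝ, F) c z : F →L[ℝ] F) =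
      mfderiv 𝓘(ℝ, F) 𝓘(ℝ, F) c 1 := by rintro z rfl; rfl
  exact congrArg (fun L : F →L[ℝ] F => L.comp
    (mfderiv 𝓘(ℝ, F) 𝓘(ℝ, F) c' 1 : F →L[ℝ] F)) (key _ h1)

theorem derivOne_id : derivOne (F := F) (id : G → G) = ContinuousLinearMap.id ℝ F :=
  mfderiv_id (I := 𝓘(ℝ, F)) (M := G)

/-- The adjoint action: `Ad_g` is the derivative at `1` of `y ↦ g y g⁻¹`. -/
noncomputable def AdLin (g : G) : Module.End ℝ (LieAlg F G) :=
  (derivOne (F := F) fun y : G => g * y * g⁻¹).toLinearMap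

theorem mdiff_conj (g x : G) :
    MDifferentiableAt 𝓘(ℝ, F) 𝓘(ℝ, F) (fun y : G => g * y * g⁻¹) x :=
  ((contMDiff_mul_right (I := 𝓘(ℝ, F)) (n := ∞) (a := g⁻¹)).comp
    (contMDiff_mul_left (I := 𝓘(ℝ, F)) (n := ∞) (a := g))).mdifferentiable (by simp) x

theorem AdLin_one : AdLin (F := F) (1 : G) = 1 := by
  have : (fun y : G => 1 * y * 1⁻¹) = id := by ext; simp
  rw [AdLin, this, derivOne_id]; rfl

theorem AdLin_mul (g h : G) : AdLin (F := F) (g * h) = AdLin g * AdLin h := by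
  have : (fun y : G => g * h * y * (g * h)⁻¹) = (fun y => g * y * g⁻¹) ∘ fun y => h * y * h⁻¹ := by
    ext; simp [mul_assoc]
  rw [AdLin, this, derivOne_comp _ _ (by simp) (mdiff_conj g _) (mdiff_conj h _)]
  rfl

variable (E F G) in
/-- The fibre `Λ T_x^* M ⊗ U(L(S⁺𝔤))` of the algebra `Ω(M) ⊗ U(L(S⁺𝔤))`. -/
abbrev Fib : Type _ := ExtCot E ⊗ₛ UL (LieAlg F G)

/-- The adjoint action of `G` on the fibre. -/
noncomputable def fibAd (g : G) : Fib E F G →ₐ[ℝ] Fib E F G := bMap (ExtCot E) (AdLin g)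

variable (E M F G) in
/-- The group `G(M)` of smooth maps from `M` to `G`. -/
abbrev MapGroup : Type _ := C^∞⟮𝓘(ℝ, E), M; 𝓘(ℝ, F), G⟯

variable (E M F G) in
/-- The group of all (not necessarily smooth) maps `h` which assign to `x` in `M` an invertible
element of the fibre at `x`. -/
abbrev UnitSections : Type _ := M → (Fib E F G)ˣ

/-- The adjoint action of `G(M)`: `(Ad_g h)(x) = Ad_{g(x)} (h(x))`. -/
noncomputable def sectionAd : MapGroup E M F G →* MulAut (UnitSections E M F G) :=
  pointwiseAut (fun x g => fibAd (g x))
    (fun x => by rw [ContMDiffMap.coe_one, Pi.one_apply, fibAd, AdLin_one, bMap_one])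
    (fun x g g' => by
      rw [ContMDiffMap.coe_mul, Pi.mul_apply, fibAd, AdLin_mul, bMap_mul]; rfl)

variable (E M F G) in
/-- The semidirect product of all pairs `(h, g)`, with product
`(h₁, g₁) (h₂, g₂) = (h₁ Ad_{g₁} h₂, g₁ g₂)`. -/
abbrev Ambient : Type _ := UnitSections E M F G ⋊[sectionAd] MapGroup E M F G

variable (E F G) in
/-- The subspace of total degree zero of the fibre, `⨁ₙ Λⁿ T_x^* M ⊗ U(L(S⁺𝔤))^{-n}`. -/
noncomputable def fibDegZero : Submodule ℝ (Fib E F G) :=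
  ⨆ n : ℕ, bidegree (⋀[ℝ]^n (Module.Dual ℝ E)) n

/-- A section with values in the fibres, regarded as a differential form. -/
noncomputable def sectionForm (h : UnitSections E M F G) :
    M → ExtCot E ⊗[ℝ] UL (LieAlg F G) :=
  fun x => (GradedTensorProduct.of ℝ (part (ExtCot E)) (part (UL (LieAlg F G)))).symm
    (h x : Fib E F G)

/-- The group `H(M)`: the smooth group-like elements of degree zero of
`Ω(M) ⊗ U(L(S⁺𝔤))`. -/
structure IsH (h : UnitSections E M F G) : Prop where
  smooth : IsSmoothForm (sectionForm h)
  degree_zero : ∀ x, (h x : Fib E F G) ∈ fibDegZero E F G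
  groupLike : ∀ x, comulB (LieAlg F G) (ExtCot E) (h x) =
    inFst (LieAlg F G) (ExtCot E) (h x) * inSnd (LieAlg F G) (ExtCot E) (h x)

variable (E M F G) in
/-- The semidirect product `H(M) ⋊ G(M)`, as a subset of the group of all pairs `(h, g)`. -/
def SGbar : Set (Ambient E M F G) := {p | IsH p.left}

/-- The differential `d_M ⊗ 1 + 1 ⊗ d_{D𝔤}` on `Ω(M) ⊗ U(L(S⁺𝔤))`, with values in
`Ω(M) ⊗ U(D𝔤)`. -/
noncomputable def sectionD (h : UnitSections E M F G) (x : M) :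
    ExtCot E ⊗ₛ UD (LieAlg F G) :=
  superMapLin LinearMap.id (ulToUD (LieAlg F G)).toLinearMap
      (GradedTensorProduct.of ℝ (part (ExtCot E)) (part (UL (LieAlg F G)))
        (extD (sectionForm h) x)) +
    superMapLin (parity : ExtCot E →ₐ[ℝ] ExtCot E).toLinearMap (dUL (LieAlg F G)) (h x)

/-- The form `g⁻¹ dg` at `x`: the derivative at `x` of `y ↦ g(x)⁻¹ g(y)`. -/
noncomputable def leftMC (g : MapGroup E M F G) (x : M) : E →ₗ[ℝ] LieAlg F G :=
  (mfderiv 𝓘(ℝ, E) 𝓘(ℝ, F) (fun y : M => (g x)⁻¹ * g y) x : E →L[ℝ] F).toLinearMap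

/-- The form `dg g⁻¹` at `x`: the derivative at `x` of `y ↦ g(y) g(x)⁻¹`. -/
noncomputable def rightMC (g : MapGroup E M F G) (x : M) : E →ₗ[ℝ] LieAlg F G :=
  (mfderiv 𝓘(ℝ, E) 𝓘(ℝ, F) (fun y : M => g y * (g x)⁻¹) x : E →L[ℝ] F).toLinearMap

variable (E M F G) in
/-- `DG(M)`: the pairs `(h, g)` in `H(M) ⋊ G(M)` which are closed, i.e. satisfy
`h⁻¹ dh + dg g⁻¹ = 0` in `Ω(M) ⊗ U(D𝔤)`. -/
def DGset : Set (Ambient E M F G) :=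
  {p | p ∈ SGbar E M F G ∧ ∀ x : M,
    toBUD (LieAlg F G) (ExtCot E) ((p.left x)⁻¹ : (Fib E F G)ˣ) * sectionD p.left x +
      GradedTensorProduct.of ℝ (part (ExtCot E)) (part (UD (LieAlg F G)))
        (oneFormElt (udL ∘ₗ rightMC p.right x)) = 0}

/-! ### Connections, the evaluation of `Φ` and the map `μ` -/

variable (E M F G) in
/-- `𝔤`-valued one-forms on `M`, without the smoothness condition. -/
abbrev OneForms : Type _ := M → (E →ₗ[ℝ] LieAlg F G)

/-- `A` is smooth, i.e. `A` is a `𝔤`-connection: an element of `Ω¹(M) ⊗ 𝔤`. -/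
def IsConnection (A : OneForms E M F G) : Prop := IsSmoothForm fun x => oneFormElt (A x)

/-- The gauge transform `A^g = Ad_{g⁻¹} A + g⁻¹ dg`. -/
noncomputable def gaugeTransform (A : OneForms E M F G) (g : MapGroup E M F G) : OneForms E M F G :=
  fun x => AdLin (g x)⁻¹ ∘ₗ A x + leftMC g x

/-- The component `A^a` of `A` at `x`, as an element of the exterior algebra. -/
noncomputable def connComp (A : OneForms E M F G) (x : M) (a : Idx (LieAlg F G)) : ExtCot E :=
  ExteriorAlgebra.ι ℝ ((lieBasis (LieAlg F G)).coord a ∘ₗ A x)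

/-- The component `F^a = dA^a + 1/2 f^a_{bc} A^b A^c` of the curvature `F_A = dA + 1/2 [A, A]`
at `x`. -/
noncomputable def curvComp (A : OneForms E M F G) (x : M) (a : Idx (LieAlg F G)) : ExtCot E :=
  TensorProduct.rid ℝ (ExtCot E) (((lieBasis (LieAlg F G)).coord a).lTensor (ExtCot E)
      (extD (fun y => oneFormElt (A y)) x)) +
    (2⁻¹ : ℝ) • ∑ b, ∑ c, structConst (LieAlg F G) a b c • (connComp A x b * connComp A x c)

/-- The Weil homomorphism `W𝔤 → Ω(M)`, `θ^a ↦ A^a`, `t^a ↦ F^a`, at the point `x`. (The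
elements `F^a` are even, so that they commute and the order of the factors does not matter.) -/
noncomputable def evWeil (A : OneForms E M F G) (x : M) : Weil (LieAlg F G) →ₗ[ℝ] ExtCot E :=
  LinearMap.mul' ℝ (ExtCot E) ∘ₗ TensorProduct.map
    ((MvPolynomial.basisMonomials (Idx (LieAlg F G)) ℝ).constr ℝ fun α =>
      (List.ofFn fun a => curvComp A x a ^ α a).prod)
    (ExteriorAlgebra.map (A x).dualMap).toLinearMap

/-- The value at `x` of `Φ(A, F_A)`. The components of `Φ` of index `n > dim M` are mapped
to zero. -/
noncomputable def evPhi (Φ : PowerSeries (Weil (LieAlg F G) ⊗ₛ UL (LieAlg F G)))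
    (A : OneForms E M F G) (x : M) : Fib E F G :=
  ∑ n ∈ Finset.range (Module.finrank ℝ E + 1),
    superMapLin (evWeil A x) LinearMap.id (PowerSeries.coeff n Φ)

open Classical in
/-- `Φ(A, F_A)` as a section of units. It is defined to be `1` where `Φ(A, F_A)` is not
invertible, which does not happen for the elements `Φ` of interest. -/
noncomputable def phiSection (Φ : PowerSeries (Weil (LieAlg F G) ⊗ₛ UL (LieAlg F G)))
    (A : OneForms E M F G) : UnitSections E M F G :=
  fun x => if h : IsUnit (evPhi Φ A x) then h.unit else 1

/-- `μ(m_{g,A}) = Φ(A, F_A) g Φ(A^g, F_{A^g})⁻¹`. -/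
noncomputable def mu (Φ : PowerSeries (Weil (LieAlg F G) ⊗ₛ UL (LieAlg F G)))
    (g : MapGroup E M F G) (A : OneForms E M F G) : Ambient E M F G :=
  SemidirectProduct.inl (phiSection Φ A) * SemidirectProduct.inr g *
    (SemidirectProduct.inl (phiSection Φ (gaugeTransform A g)))⁻¹

end Groups

/-!
The Lie algebra is called `L` below, except in prose, where `W𝔤`, `D𝔤` and `S⁺𝔤` are the algebras
built from it.

*The element `Φ`.* Let `h` be the odd derivation of `W𝔤` with `t^a ↦ θ^a`, `θ^a ↦ 0`. The even
derivation `N = [d, h]` counts the generators `θ^a`, `dθ^a`, so it is invertible in positive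
degrees. Applying `h` to the required equation `dΦ = Φ α`, `α = -i(t) + l(θ)`, suggests looking
for `Φ` with `h Φ = 0`; then `N Φ = Φ b` with `b = h α`, which determines `Φ` recursively from
`Φ₀ = 1` (`kalkΦ`). Solutions of `N Z = Z b` without constant term vanish
(`eq_zero_of_numOp_eq_mul`). This uniqueness turns the relations `dα + α² = 0`, invariance and primitivity of `b` into the three properties of `Φ`: the
differential equation, invariance and the group-like property (`exists_isKalkman`). The structure
equation of `i(t)` is checked on powers `x^k`, which span `S𝔤`.

*Differentiation.* Sections of forms with values in `U(D𝔤)` are handled in charts, where they are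
finite sums of smooth functions times constant vectors (`smoothFin`), so that `HasD`, a derivative
tested on linear functionals, obeys all product rules. A section of degree zero is a nonzero scalar
plus a nilpotent when it is a unit, and so its inverse is again smooth and of degree zero. For the
Lie group, the bracket is the antisymmetrised second derivative of the product in the chart at `1`.
This gives the derivative of `Ad_g` and the Maurer-Cartan equation.

*The groups.* Put `δ(h, g) = dh + h (dg g⁻¹)` (`closedDefect`). Since
`δ(pq) = δ(p) Ad_g h' + h Ad_g δ(q)` for `p = (h, g)`, `q = (h', g')`, the zeros of `δ` form a
subgroup (`closedDefect_mul`, `DGGroup`).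

*The map `μ`.* The Weil homomorphism of a connection commutes with the differentials: both sides
satisfy the product rule, and they agree on the generators, by the Bianchi identity for `t^a`
(`evalCommutes`). Hence `dΦ(A, F_A) = Φ(A, F_A) α(A)`, where `α(A) = -i(F_A) + l(A)`
(`sectionD_phiSection`). The gauge transformation formula for `A` and `F_A` says
`Ad_g α(A^g) = α(A) + dg g⁻¹` (`bMapUD_connValue`). So `δ` takes the same form on the two sides of
`Φ(A, F_A) g = μ · Φ(A^g, F_{A^g})`, and the product rule for `δ` leaves `δ(μ) = 0`
(`mu_mem_DGGroup`). The groupoid law and the projection to `G(M)` are read off from the definition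
of `μ`.
-/
set_option linter.unusedSectionVars false

/-! ### Calculus in super tensor products -/
section SuperCalculus
variable {A B A' B' C : Type*} [Ring A] [Algebra ℝ A] [SuperAlgebra A]
  [Ring B] [Algebra ℝ B] [SuperAlgebra B]
  [Ring A'] [Algebra ℝ A'] [SuperAlgebra A'] [Ring B'] [Algebra ℝ B'] [SuperAlgebra B']
  [Ring C] [Algebra ℝ C] [SuperAlgebra C]

theorem SuperAlgebra.even_odd_induction {P : A → Prop} (a : A)
    (even : ∀ a, parity a = a → P a) (odd : ∀ a, parity a = -a → P a)
    (add : ∀ a b, P a → P b → P (a + b)) : P a := by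
  have h : a = (2⁻¹ : ℝ) • (a + parity a) + (2⁻¹ : ℝ) • (a - parity a) := by
    rw [← smul_add, add_add_sub_cancel, ← two_smul ℝ a, smul_smul]; norm_num
  rw [h]
  exact add _ _ (even _ (mem_part_zero.1 (even_mem a))) (odd _ (mem_part_one.1 (odd_mem a)))

theorem SuperTensor.induction {P : A ⊗ₛ B → Prop} (z : A ⊗ₛ B) (zero : P 0)
    (tmul : ∀ (a : A) (b : B), P (a ᵍ⊗ₜ[ℝ] b : A ⊗ₛ B))
    (add : ∀ x y, P x → P y → P (x + y)) : P z :=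
  TensorProduct.induction_on (motive := P) z zero tmul add

theorem SuperTensor.tmul_add (a : A) (b b' : B) :
    (a ᵍ⊗ₜ[ℝ] (b + b') : A ⊗ₛ B) = a ᵍ⊗ₜ[ℝ] b + a ᵍ⊗ₜ[ℝ] b' := by
  simp [GradedTensorProduct.tmul, TensorProduct.tmul_add]

theorem SuperTensor.add_tmul (a a' : A) (b : B) :
    ((a + a') ᵍ⊗ₜ[ℝ] b : A ⊗ₛ B) = a ᵍ⊗ₜ[ℝ] b + a' ᵍ⊗ₜ[ℝ] b := by
  simp [GradedTensorProduct.tmul, TensorProduct.add_tmul]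

theorem SuperTensor.tmul_neg (a : A) (b : B) :
    (a ᵍ⊗ₜ[ℝ] (-b) : A ⊗ₛ B) = -(a ᵍ⊗ₜ[ℝ] b) := by
  simp [GradedTensorProduct.tmul, TensorProduct.tmul_neg]

theorem SuperTensor.neg_tmul (a : A) (b : B) :
    ((-a) ᵍ⊗ₜ[ℝ] b : A ⊗ₛ B) = -(a ᵍ⊗ₜ[ℝ] b) := by
  simp [GradedTensorProduct.tmul, TensorProduct.neg_tmul]

theorem SuperTensor.tmul_smul (r : ℝ) (a : A) (b : B) :
    (a ᵍ⊗ₜ[ℝ] (r • b) : A ⊗ₛ B) = r • (a ᵍ⊗ₜ[ℝ] b) := by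
  simp [GradedTensorProduct.tmul, TensorProduct.tmul_smul]

theorem SuperTensor.smul_tmul (r : ℝ) (a : A) (b : B) :
    ((r • a) ᵍ⊗ₜ[ℝ] b : A ⊗ₛ B) = r • (a ᵍ⊗ₜ[ℝ] b) := by
  rw [GradedTensorProduct.tmul, ← TensorProduct.smul_tmul', map_smul]

theorem SuperTensor.hom_induction {P : A ⊗ₛ B → Prop} (z : A ⊗ₛ B) (zero : P 0)
    (even : ∀ (a : A) (b : B), parity a = a → P (a ᵍ⊗ₜ[ℝ] b : A ⊗ₛ B))
    (odd : ∀ (a : A) (b : B), parity a = -a → P (a ᵍ⊗ₜ[ℝ] b : A ⊗ₛ B))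
    (add : ∀ x y, P x → P y → P (x + y)) : P z := by
  refine SuperTensor.induction z zero (fun a b => ?_) add
  refine SuperAlgebra.even_odd_induction (P := fun a => P (a ᵍ⊗ₜ[ℝ] b : A ⊗ₛ B)) a
    (fun a => even a b) (fun a => odd a b) fun a a' h h' => ?_
  rw [SuperTensor.add_tmul]
  exact add _ _ h h'

theorem SuperTensor.tmul_mul_even {a' : A} (h : parity a' = a') (a : A) (b b' : B) :
    (a ᵍ⊗ₜ[ℝ] b * a' ᵍ⊗ₜ[ℝ] b' : A ⊗ₛ B) = (a * a') ᵍ⊗ₜ[ℝ] (b * b') := by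
  induction b using SuperAlgebra.even_odd_induction with
  | even b hb =>
    simpa using GradedTensorProduct.tmul_coe_mul_coe_tmul (R := ℝ) (part A) (part B) a
      ⟨b, mem_part_zero.2 hb⟩ ⟨a', mem_part_zero.2 h⟩ b'
  | odd b hb =>
    simpa using GradedTensorProduct.tmul_coe_mul_coe_tmul (R := ℝ) (part A) (part B) a
      ⟨b, mem_part_one.2 hb⟩ ⟨a', mem_part_zero.2 h⟩ b'
  | add b c hb hc =>
    rw [SuperTensor.tmul_add, add_mul, hb, hc, ← SuperTensor.tmul_add, add_mul]

theorem SuperTensor.tmul_mul_odd {a' : A} (h : parity a' = -a') (a : A) (b b' : B) :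
    (a ᵍ⊗ₜ[ℝ] b * a' ᵍ⊗ₜ[ℝ] b' : A ⊗ₛ B) = (a * a') ᵍ⊗ₜ[ℝ] (parity b * b') := by
  induction b using SuperAlgebra.even_odd_induction with
  | even b hb =>
    rw [hb]
    simpa using GradedTensorProduct.tmul_coe_mul_coe_tmul (R := ℝ) (part A) (part B) a
      ⟨b, mem_part_zero.2 hb⟩ ⟨a', mem_part_one.2 h⟩ b'
  | odd b hb =>
    rw [hb, neg_mul, SuperTensor.tmul_neg]
    simpa using GradedTensorProduct.tmul_coe_mul_coe_tmul (R := ℝ) (part A) (part B) a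
      ⟨b, mem_part_one.2 hb⟩ ⟨a', mem_part_one.2 h⟩ b'
  | add b c hb hc =>
    rw [SuperTensor.tmul_add, add_mul, hb, hc, ← SuperTensor.tmul_add, map_add, add_mul]

theorem SuperTensor.tmul_even_mul {b : B} (h : parity b = b) (a a' : A) (b' : B) :
    (a ᵍ⊗ₜ[ℝ] b * a' ᵍ⊗ₜ[ℝ] b' : A ⊗ₛ B) = (a * a') ᵍ⊗ₜ[ℝ] (b * b') := by
  induction a' using SuperAlgebra.even_odd_induction with
  | even a' h' => exact SuperTensor.tmul_mul_even h' _ _ _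
  | odd a' h' => rw [SuperTensor.tmul_mul_odd h', h]
  | add x y hx hy =>
    rw [SuperTensor.add_tmul, mul_add, hx, hy, ← SuperTensor.add_tmul, mul_add]

theorem SuperTensor.tmul_one_mul (a a' : A) (b' : B) :
    (a ᵍ⊗ₜ[ℝ] (1 : B) * a' ᵍ⊗ₜ[ℝ] b' : A ⊗ₛ B) = (a * a') ᵍ⊗ₜ[ℝ] b' := by
  rw [SuperTensor.tmul_even_mul (map_one _), one_mul]

theorem SuperTensor.tmul_mul_one (a : A) (b b' : B) :
    (a ᵍ⊗ₜ[ℝ] b * (1 : A) ᵍ⊗ₜ[ℝ] b' : A ⊗ₛ B) = a ᵍ⊗ₜ[ℝ] (b * b') := by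
  rw [SuperTensor.tmul_mul_even (map_one _), mul_one]

theorem SuperTensor.one_def : (1 : A ⊗ₛ B) = (1 : A) ᵍ⊗ₜ[ℝ] (1 : B) := rfl

theorem SuperTensor.parity_tmul (a : A) (b : B) :
    parity (a ᵍ⊗ₜ[ℝ] b : A ⊗ₛ B) = (parity a ᵍ⊗ₜ[ℝ] parity b : A ⊗ₛ B) :=
  superMap_tmul parity parity (fun _ => rfl) (fun _ => rfl) a b

theorem superMapLin_tmul (f : A →ₗ[ℝ] A') (g : B →ₗ[ℝ] B') (a : A) (b : B) :
    superMapLin f g (a ᵍ⊗ₜ[ℝ] b : A ⊗ₛ B) = (f a ᵍ⊗ₜ[ℝ] g b : A' ⊗ₛ B') := rfl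

theorem superMap_eq_superMapLin (f : A →ₐ[ℝ] A') (g : B →ₐ[ℝ] B')
    (hf : ∀ a, f (parity a) = parity (f a)) (hg : ∀ b, g (parity b) = parity (g b)) (z : A ⊗ₛ B) :
    superMap f g hf hg z = superMapLin f.toLinearMap g.toLinearMap z := by
  induction z using SuperTensor.induction with
  | zero => simp
  | tmul a b => rw [superMap_tmul, superMapLin_tmul]; rfl
  | add x y hx hy => rw [map_add, map_add, hx, hy]

/-- Two linear maps on a super tensor product agree if they agree on pure tensors. -/
theorem SuperTensor.linearMap_ext {V : Type*} [AddCommGroup V] [Module ℝ V]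
    {f g : (A ⊗ₛ B) →ₗ[ℝ] V}
    (h : ∀ (a : A) (b : B), f (a ᵍ⊗ₜ[ℝ] b : A ⊗ₛ B) = g (a ᵍ⊗ₜ[ℝ] b : A ⊗ₛ B)) : f = g := by
  refine LinearMap.ext fun z => ?_
  induction z using SuperTensor.induction with
  | zero => simp
  | tmul a b => exact h a b
  | add x y hx hy => rw [map_add, map_add, hx, hy]

theorem superMapLin_comp_apply {A'' B'' : Type*} [Ring A''] [Algebra ℝ A''] [SuperAlgebra A'']
    [Ring B''] [Algebra ℝ B''] [SuperAlgebra B'']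
    (f' : A' →ₗ[ℝ] A'') (g' : B' →ₗ[ℝ] B'') (f : A →ₗ[ℝ] A') (g : B →ₗ[ℝ] B') (z : A ⊗ₛ B) :
    superMapLin f' g' (superMapLin f g z) = superMapLin (f' ∘ₗ f) (g' ∘ₗ g) z := by
  induction z using SuperTensor.induction with
  | zero => simp
  | tmul a b => rfl
  | add x y hx hy => simp only [map_add, hx, hy]

theorem superMapLin_id (z : A ⊗ₛ B) :
    superMapLin (LinearMap.id : A →ₗ[ℝ] A) (LinearMap.id : B →ₗ[ℝ] B) z = z := by
  induction z using SuperTensor.induction with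
  | zero => simp
  | tmul a b => rfl
  | add x y hx hy => simp only [map_add, hx, hy]

theorem superMapLin_add_left (f f' : A →ₗ[ℝ] A') (g : B →ₗ[ℝ] B') :
    superMapLin (f + f') g = superMapLin f g + superMapLin f' g :=
  SuperTensor.linearMap_ext fun a b => by
    rw [LinearMap.add_apply]
    simp only [superMapLin_tmul, LinearMap.add_apply, SuperTensor.add_tmul]

theorem superMapLin_neg_left (f : A →ₗ[ℝ] A') (g : B →ₗ[ℝ] B') :
    superMapLin (-f) g = -superMapLin f g :=
  SuperTensor.linearMap_ext fun a b => by
    rw [LinearMap.neg_apply]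
    simp only [superMapLin_tmul, LinearMap.neg_apply, SuperTensor.neg_tmul]

/-- A derivation `D` over two algebra homomorphisms: `D (a b) = D a * J b + K a * D b`. With
`K = J` this is an even derivation, with `K = J ∘ parity` an odd one. -/
def IsDerOver {R R' : Type*} [Ring R] [Algebra ℝ R] [Ring R'] [Algebra ℝ R']
    (J K : R →ₐ[ℝ] R') (D : R →ₗ[ℝ] R') : Prop :=
  ∀ a b, D (a * b) = D a * J b + K a * D b

/-- Even derivations of an algebra. -/
abbrev IsEvenDer (D : A →ₗ[ℝ] A) : Prop := IsDerOver (AlgHom.id ℝ A) (AlgHom.id ℝ A) D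

/-- Odd derivations of a superalgebra. -/
abbrev IsOddDer (D : A →ₗ[ℝ] A) : Prop := IsDerOver (AlgHom.id ℝ A) parity D

section
variable {R R' : Type*} [Ring R] [Algebra ℝ R] [Ring R'] [Algebra ℝ R']
  {J K : R →ₐ[ℝ] R'} {D D' : R →ₗ[ℝ] R'}

theorem IsDerOver.map_one (h : IsDerOver J K D) : D 1 = 0 := by
  have := h 1 1
  simpa using this

theorem IsDerOver.add (h : IsDerOver J K D) (h' : IsDerOver J K D') : IsDerOver J K (D + D') := by
  intro a b
  simp only [LinearMap.add_apply, h a b, h' a b]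
  noncomm_ring

theorem IsDerOver.neg (h : IsDerOver J K D) : IsDerOver J K (-D) := by
  intro a b
  simp only [LinearMap.neg_apply, h a b]
  noncomm_ring

theorem IsDerOver.smul (h : IsDerOver J K D) (r : ℝ) : IsDerOver J K (r • D) := by
  intro a b
  simp only [LinearMap.smul_apply, h a b, smul_add, smul_mul_assoc, mul_smul_comm]

theorem IsDerOver.sum {ι : Type*} (s : Finset ι) {D : ι → R →ₗ[ℝ] R'}
    (h : ∀ i ∈ s, IsDerOver J K (D i)) : IsDerOver J K (∑ i ∈ s, D i) := by
  intro a b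
  simp only [LinearMap.sum_apply, Finset.sum_mul, Finset.mul_sum, ← Finset.sum_add_distrib]
  exact Finset.sum_congr rfl fun i hi => h i hi a b
end

theorem IsOddDer.anticomm {D D' : A →ₗ[ℝ] A} (h : IsOddDer D) (h' : IsOddDer D')
    (hp : ∀ a, D (parity a) = -parity (D a)) (hp' : ∀ a, D' (parity a) = -parity (D' a)) :
    IsEvenDer (D ∘ₗ D' + D' ∘ₗ D) := by
  intro a b
  simp only [LinearMap.add_apply, LinearMap.comp_apply, h a b, h' a b, map_add,
    h (D' a) _, h (parity a) _, h' (D a) _, h' (parity a) _, AlgHom.id_apply, hp, hp',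
    parity_parity]
  noncomm_ring

theorem IsOddDer.commutator {D D' : A →ₗ[ℝ] A} (h : IsOddDer D) (h' : IsEvenDer D')
    (hp' : ∀ a, D' (parity a) = parity (D' a)) :
    IsOddDer (D ∘ₗ D' - D' ∘ₗ D) := by
  intro a b
  simp only [LinearMap.sub_apply, LinearMap.comp_apply, h a b, h' a b, map_add,
    h (D' a) _, h a _, h' (D a) _, h' (parity a) _, AlgHom.id_apply, hp', map_sub]
  noncomm_ring

theorem IsEvenDer.commutator {D D' : A →ₗ[ℝ] A} (h : IsEvenDer D) (h' : IsEvenDer D') :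
    IsEvenDer (D ∘ₗ D' - D' ∘ₗ D) := by
  intro a b
  simp only [LinearMap.sub_apply, LinearMap.comp_apply, h a b, h' a b, map_add,
    h (D' a) _, h a _, h' (D a) _, h' a _, AlgHom.id_apply]
  noncomm_ring

theorem IsOddDer.sq {D : A →ₗ[ℝ] A} (h : IsOddDer D)
    (hp : ∀ a, D (parity a) = -parity (D a)) : IsEvenDer (D ∘ₗ D) := by
  intro a b
  simp only [LinearMap.comp_apply, h a b, map_add,
    h (D a) _, h (parity a) _, AlgHom.id_apply, hp, parity_parity]
  noncomm_ring

/-- The derivation `D ⊗ J` for an even derivation `D`. -/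
theorem IsEvenDer.superMapLin {D : A →ₗ[ℝ] A} (h : IsEvenDer D)
    (hp : ∀ a, D (parity a) = parity (D a)) (J : B →ₐ[ℝ] B')
    (hi : ∀ a, AlgHom.id ℝ A (parity a) = parity (AlgHom.id ℝ A a))
    (hJ : ∀ b, J (parity b) = parity (J b)) :
    IsDerOver (superMap (AlgHom.id ℝ A) J hi hJ)
      (superMap (AlgHom.id ℝ A) J hi hJ) (superMapLin D J.toLinearMap) := by
  intro x y
  induction x using SuperTensor.induction with
  | zero => simp
  | add x x' hx hx' => simp only [add_mul, map_add, hx, hx']; abel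
  | tmul a b =>
    induction y using SuperTensor.hom_induction with
    | zero => simp
    | add x x' hx hx' => simp only [mul_add, map_add, hx, hx']; abel
    | even a' b' h' =>
      have h1 : parity (D a') = D a' := by rw [← hp, h']
      rw [SuperTensor.tmul_mul_even h']
      simp only [superMapLin_tmul, superMap_tmul, AlgHom.id_apply, AlgHom.toLinearMap_apply, map_mul]
      rw [SuperTensor.tmul_mul_even h', SuperTensor.tmul_mul_even h1, ← SuperTensor.add_tmul, h a a']
      rfl
    | odd a' b' h' =>
      have h1 : parity (D a') = -D a' := by rw [← hp, h', map_neg]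
      rw [SuperTensor.tmul_mul_odd h']
      simp only [superMapLin_tmul, superMap_tmul, AlgHom.id_apply, AlgHom.toLinearMap_apply, map_mul]
      rw [SuperTensor.tmul_mul_odd h', SuperTensor.tmul_mul_odd h1, hJ, ← SuperTensor.add_tmul,
        h a a']
      rfl

/-- The derivation `D ⊗ J` for an odd derivation `D`. -/
theorem IsOddDer.superMapLin {D : A →ₗ[ℝ] A} (h : IsOddDer D)
    (hp : ∀ a, D (parity a) = -parity (D a)) (J : B →ₐ[ℝ] B')
    (hi : ∀ a, AlgHom.id ℝ A (parity a) = parity (AlgHom.id ℝ A a))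
    (hJ : ∀ b, J (parity b) = parity (J b)) :
    IsDerOver (superMap (AlgHom.id ℝ A) J hi hJ)
      ((superMap (AlgHom.id ℝ A) J hi hJ).comp parity)
      (superMapLin D J.toLinearMap) := by
  intro x y
  induction x using SuperTensor.induction with
  | zero => simp
  | add x x' hx hx' => simp only [add_mul, map_add, hx, hx']; abel
  | tmul a b =>
    induction y using SuperTensor.hom_induction with
    | zero => simp
    | add x x' hx hx' => simp only [mul_add, map_add, hx, hx']; abel
    | even a' b' h' =>
      have h1 : parity (D a') = -D a' := by rw [← neg_eq_iff_eq_neg.2 (hp a'), h']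
      rw [SuperTensor.tmul_mul_even h']
      simp only [superMapLin_tmul, superMap_tmul, AlgHom.id_apply, AlgHom.toLinearMap_apply, map_mul,
        AlgHom.comp_apply, SuperTensor.parity_tmul]
      rw [SuperTensor.tmul_mul_even h', SuperTensor.tmul_mul_odd h1, hJ, parity_parity,
        ← SuperTensor.add_tmul, h a a']
      rfl
    | odd a' b' h' =>
      have h1 : parity (D a') = D a' := by rw [← neg_eq_iff_eq_neg.2 (hp a'), h', map_neg, neg_neg]
      rw [SuperTensor.tmul_mul_odd h']
      simp only [superMapLin_tmul, superMap_tmul, AlgHom.id_apply, AlgHom.toLinearMap_apply, map_mul,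
        AlgHom.comp_apply, SuperTensor.parity_tmul]
      rw [SuperTensor.tmul_mul_odd h', SuperTensor.tmul_mul_even h1, hJ,
        ← SuperTensor.add_tmul, h a a']
      rfl

/-- The odd derivation `1 ⊗ δ` (with the Koszul sign) for an odd derivation `δ` over `J`. -/
theorem IsDerOver.superMapLin_parity {J : B →ₐ[ℝ] B'} {δ : B →ₗ[ℝ] B'}
    (h : IsDerOver J (J.comp parity) δ) (hp : ∀ b, δ (parity b) = -parity (δ b))
    (hi : ∀ a, AlgHom.id ℝ A (parity a) = parity (AlgHom.id ℝ A a))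
    (hJ : ∀ b, J (parity b) = parity (J b)) :
    IsDerOver (superMap (AlgHom.id ℝ A) J hi hJ)
      ((superMap (AlgHom.id ℝ A) J hi hJ).comp parity)
      (superMapLin (parity : A →ₐ[ℝ] A).toLinearMap δ) := by
  intro x y
  have hp' : ∀ b, parity (δ b) = -δ (parity b) := fun b => by rw [hp, neg_neg]
  induction x using SuperTensor.induction with
  | zero => simp
  | add x x' hx hx' => simp only [add_mul, map_add, hx, hx']; abel
  | tmul a b =>
    induction y using SuperTensor.hom_induction with
    | zero => simp
    | add x x' hx hx' => simp only [mul_add, map_add, hx, hx']; abel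
    | even a' b' h' =>
      rw [SuperTensor.tmul_mul_even h']
      simp only [superMapLin_tmul, superMap_tmul, AlgHom.id_apply, AlgHom.toLinearMap_apply,
        AlgHom.comp_apply, SuperTensor.parity_tmul, map_mul, h']
      rw [SuperTensor.tmul_mul_even h', SuperTensor.tmul_mul_even h', h b b',
        ← SuperTensor.tmul_add]
      rfl
    | odd a' b' h' =>
      rw [SuperTensor.tmul_mul_odd h']
      simp only [superMapLin_tmul, superMap_tmul, AlgHom.id_apply, AlgHom.toLinearMap_apply,
        AlgHom.comp_apply, SuperTensor.parity_tmul, map_mul, h']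
      have h'' : parity (-a') = -(-a') := by rw [map_neg, h']
      rw [SuperTensor.tmul_mul_odd h', SuperTensor.tmul_mul_odd h'', h _ b', hp',
        ← hJ, neg_mul, SuperTensor.tmul_neg, ← SuperTensor.neg_tmul, ← mul_neg,
        ← SuperTensor.tmul_add, AlgHom.comp_apply]

/-- Even elements commute with elements of the form `a ⊗ 1`, if `a` supercommutes with `A`. -/
theorem SuperTensor.tmul_one_comm {a : A} (ha : parity a = -a)
    (hc : ∀ a', a * a' = parity a' * a) (z : A ⊗ₛ B) :
    (a ᵍ⊗ₜ[ℝ] (1 : B) : A ⊗ₛ B) * z = parity z * (a ᵍ⊗ₜ[ℝ] (1 : B) : A ⊗ₛ B) := by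
  induction z using SuperTensor.induction with
  | zero => simp
  | add x y hx hy => rw [mul_add, hx, hy, map_add, add_mul]
  | tmul a' b =>
    rw [SuperTensor.tmul_one_mul, SuperTensor.parity_tmul, SuperTensor.tmul_mul_odd ha,
      parity_parity, mul_one, hc]

theorem parity_superMap (f : A →ₐ[ℝ] A') (g : B →ₐ[ℝ] B')
    (hf : ∀ a, f (parity a) = parity (f a)) (hg : ∀ b, g (parity b) = parity (g b)) (z : A ⊗ₛ B) :
    superMap f g hf hg (parity z) = parity (superMap f g hf hg z) := by
  induction z using SuperTensor.induction with
  | zero => simp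
  | add x y hx hy => simp only [map_add, hx, hy]
  | tmul a b => simp only [superMap_tmul, SuperTensor.parity_tmul, hf, hg]

end SuperCalculus

/-! ### Linear maps on power series -/
section PowerSeriesCalculus
variable {R R' R'' : Type*} [Ring R] [Algebra ℝ R] [Ring R'] [Algebra ℝ R']
  [Ring R''] [Algebra ℝ R'']

/-- A linear map applied to the coefficients of a power series. -/
noncomputable def PowerSeries.mapLin (T : R →ₗ[ℝ] R') (f : PowerSeries R) : PowerSeries R' :=
  PowerSeries.mk fun n => T (PowerSeries.coeff n f)

@[simp] theorem PowerSeries.coeff_mapLin (T : R →ₗ[ℝ] R') (f : PowerSeries R) (n : ℕ) :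
    PowerSeries.coeff n (PowerSeries.mapLin T f) = T (PowerSeries.coeff n f) := by
  simp [PowerSeries.mapLin]

theorem PowerSeries.mapLin_add (T : R →ₗ[ℝ] R') (f g : PowerSeries R) :
    PowerSeries.mapLin T (f + g) = PowerSeries.mapLin T f + PowerSeries.mapLin T g := by
  ext n; simp

theorem PowerSeries.mapLin_sub (T : R →ₗ[ℝ] R') (f g : PowerSeries R) :
    PowerSeries.mapLin T (f - g) = PowerSeries.mapLin T f - PowerSeries.mapLin T g := by
  ext n; simp

theorem PowerSeries.mapLin_neg (T : R →ₗ[ℝ] R') (f : PowerSeries R) :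
    PowerSeries.mapLin T (-f) = -PowerSeries.mapLin T f := by
  ext n; simp

theorem PowerSeries.mapLin_X_mul (T : R →ₗ[ℝ] R') (f : PowerSeries R) :
    PowerSeries.mapLin T (PowerSeries.X * f) = PowerSeries.X * PowerSeries.mapLin T f := by
  ext n
  cases n <;> simp [PowerSeries.coeff_succ_X_mul]

theorem PowerSeries.mapLin_mapLin (T' : R' →ₗ[ℝ] R'') (T : R →ₗ[ℝ] R') (f : PowerSeries R) :
    PowerSeries.mapLin T' (PowerSeries.mapLin T f) = PowerSeries.mapLin (T' ∘ₗ T) f := by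
  ext n; simp

theorem PowerSeries.map_eq_mapLin (J : R →ₐ[ℝ] R') (f : PowerSeries R) :
    PowerSeries.map J.toRingHom f = PowerSeries.mapLin J.toLinearMap f := by
  ext n; simp

theorem IsDerOver.mapLin_mul {J K : R →ₐ[ℝ] R'} {D : R →ₗ[ℝ] R'} (h : IsDerOver J K D)
    (f g : PowerSeries R) :
    PowerSeries.mapLin D (f * g) = PowerSeries.mapLin D f * PowerSeries.map J.toRingHom g +
      PowerSeries.map K.toRingHom f * PowerSeries.mapLin D g := by
  ext n
  simp only [PowerSeries.coeff_mapLin, PowerSeries.coeff_mul, map_add, map_sum,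
    PowerSeries.coeff_map, ← Finset.sum_add_distrib]
  exact Finset.sum_congr rfl fun p _ => h _ _

end PowerSeriesCalculus
open SuperTensor ExteriorAlgebra
open LinearMap (comp_apply id_apply mulLeft mulLeft_apply mulRight mulRight_apply llcomp
  compl₁₂_apply flip_apply compr₂_apply)
open Finset (sum_congr sum_add_distrib sum_comm sum_neg_distrib mul_sum smul_sum sum_eq_zero
  sum_mul sum_const_zero sum_eq_single sum_sub_distrib range univ mem_finsuppAntidiag
  HasAntidiagonal mem_sigma mem_product mem_range)
open PowerSeries (coeff mapLin coeff_mapLin coeff_map coeff_mul mapLin_mapLin coeff_succ_X_mul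
  coeff_mk coeff_C mapLin_add mapLin_sub mapLin_X_mul coeff_zero_X_mul commute_X)
open Module (finBasis Dual End finrank)
open Submodule (smul_mem span_induction subset_span)
open MvPolynomial (monomial basisMonomials aeval smul_eq_C_mul isHomogeneous_X mkDerivation_X)
open Algebra.TensorProduct (tmul_mul_tmul)

noncomputable section
variable {L : Type*} [LieRing L] [LieAlgebra ℝ L] [Module.Finite ℝ L]
  {E : Type*} [NormedAddCommGroup E] [NormedSpace ℝ E] [FiniteDimensional ℝ E]
  {M : Type*} [TopologicalSpace M] [ChartedSpace E M] [IsManifold 𝓘(ℝ, E) ∞ M]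
  {F : Type*} [NormedAddCommGroup F] [NormedSpace ℝ F] [FiniteDimensional ℝ F] [CompleteSpace F]
  {G : Type*} [TopologicalSpace G] [ChartedSpace F G] [Group G] [LieGroup 𝓘(ℝ, F) ∞ G]

/-! ### Exterior algebras as superalgebras -/
section Exterior
variable {V : Type*} [AddCommGroup V] [Module ℝ V]

theorem ExteriorAlgebra.parity_ι (v : V) :
    parity (ι ℝ v) = -ι ℝ v :=
  CliffordAlgebra.involute_ι v

theorem ExteriorAlgebra.left_induction {P : ExteriorAlgebra ℝ V → Prop}
    (algebraMap : ∀ r : ℝ, P (algebraMap ℝ _ r))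
    (add : ∀ x y, P x → P y → P (x + y))
    (ι_mul : ∀ x v, P x → P (ι ℝ v * x)) (x) : P x :=
  CliffordAlgebra.left_induction _ algebraMap add ι_mul x

theorem ExteriorAlgebra.ι_superComm (v : V) (w : ExteriorAlgebra ℝ V) :
    ι ℝ v * w = parity w * ι ℝ v := by
  induction w using ExteriorAlgebra.left_induction with
  | algebraMap r => rw [AlgHom.commutes, Algebra.commutes]
  | add x y hx hy => rw [mul_add, hx, hy, map_add, add_mul]
  | ι_mul x m hx =>
    rw [map_mul, parity_ι, mul_assoc, ← hx, ← mul_assoc, neg_mul,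
      ← mul_assoc, ← neg_mul, eq_neg_of_add_eq_zero_left (ExteriorAlgebra.ι_add_mul_swap v m)]

theorem ExteriorAlgebra.even_central {w : ExteriorAlgebra ℝ V} (hw : parity w = w)
    (z : ExteriorAlgebra ℝ V) : w * z = z * w := by
  induction z using ExteriorAlgebra.left_induction with
  | algebraMap r => rw [Algebra.commutes]
  | add x y hx hy => rw [mul_add, hx, hy, add_mul]
  | ι_mul x m hx =>
    have := ι_superComm m w
    rw [hw] at this
    rw [← mul_assoc, ← this, mul_assoc, hx, mul_assoc]

theorem CliffordAlgebra.contractLeft_isOddDer (d : Dual ℝ V) :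
    IsOddDer (A := ExteriorAlgebra ℝ V) (CliffordAlgebra.contractLeft d) := by
  intro x y
  induction x using ExteriorAlgebra.left_induction with
  | algebraMap r =>
    rw [CliffordAlgebra.contractLeft_algebraMap_mul, CliffordAlgebra.contractLeft_algebraMap,
      AlgHom.commutes, zero_mul, zero_add]
  | add a b ha hb =>
    rw [add_mul, map_add, map_add, map_add, add_mul, add_mul, ha, hb]; abel
  | ι_mul x m hx =>
    rw [mul_assoc]
    refine (CliffordAlgebra.contractLeft_ι_mul _ _ _).trans ?_
    rw [hx, show CliffordAlgebra.contractLeft d (ExteriorAlgebra.ι ℝ m * x) = _ from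
      CliffordAlgebra.contractLeft_ι_mul d m x, map_mul, parity_ι]
    simp only [AlgHom.id_apply, sub_mul, smul_mul_assoc, mul_add, neg_mul, mul_assoc]
    rw [show CliffordAlgebra.ι (0 : QuadraticForm ℝ V) m = ExteriorAlgebra.ι ℝ m from rfl]
    abel

theorem CliffordAlgebra.contractLeft_parity (d : Dual ℝ V) (x : ExteriorAlgebra ℝ V) :
    CliffordAlgebra.contractLeft d (parity x) = -parity (CliffordAlgebra.contractLeft d x) := by
  induction x using ExteriorAlgebra.left_induction with
  | algebraMap r =>
    rw [AlgHom.commutes, CliffordAlgebra.contractLeft_algebraMap, map_zero, neg_zero]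
  | add a b ha hb => simp only [map_add, ha, hb]; abel
  | ι_mul x m hx =>
    rw [map_mul, parity_ι, neg_mul, map_neg,
      show CliffordAlgebra.contractLeft d (ExteriorAlgebra.ι ℝ m * parity x) = _ from
        CliffordAlgebra.contractLeft_ι_mul d m _,
      show CliffordAlgebra.contractLeft d (ExteriorAlgebra.ι ℝ m * x) = _ from
        CliffordAlgebra.contractLeft_ι_mul d m x, hx, map_sub, map_mul, map_smul,
      show CliffordAlgebra.ι (0 : QuadraticForm ℝ V) m = ExteriorAlgebra.ι ℝ m from rfl,
      parity_ι]
    noncomm_ring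

/-- Elements of `Λⁿ` have parity `n`. -/
theorem ExteriorAlgebra.parity_of_mem {n : ℕ} {w : ExteriorAlgebra ℝ V}
    (hw : w ∈ ⋀[ℝ]^n V) : parity w = (-1 : ℝ) ^ n • w := by
  refine Submodule.pow_induction_on_left' (LinearMap.range (ι ℝ (M := V)))
    (C := fun n w _ => parity w = (-1 : ℝ) ^ n • w) ?_ ?_ ?_ hw
  · intro r; simp
  · intro x y i _ _ hx hy; rw [map_add, hx, hy, smul_add]
  · rintro _ ⟨v, rfl⟩ i x _ hx
    rw [map_mul, hx, parity_ι, pow_succ]; simp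
end Exterior

/-! ### Derivations of the Weil algebra -/
section WeilDer

section
variable (r : ℝ) (v w : Weil L)
/- The negation of a tensor product and of the ring structure on it agree only up to unfolding, so
that rewriting needs the rules for signs in the following form. -/
theorem Weil.neg_mul : -v * w = -(v * w) := _root_.neg_mul v w
theorem Weil.mul_neg : v * -w = -(v * w) := _root_.mul_neg v w
theorem Weil.neg_smul : -r • w = -(r • w) := _root_.neg_smul r w
end

/-- The generators `t^a` of the Weil algebra. -/
def weilt (a : Idx L) : Weil L := (MvPolynomial.X a : SymDual L) ⊗ₜ[ℝ] 1

/-- The generators `θ^a` of the Weil algebra. -/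
def weilθ (a : Idx L) : Weil L := (1 : SymDual L) ⊗ₜ[ℝ] extθ a

theorem Weil.induction {P : Weil L → Prop} (w : Weil L) (one : P 1)
    (add : ∀ x y, P x → P y → P (x + y)) (smul : ∀ (r : ℝ) x, P x → P (r • x))
    (mul_t : ∀ a x, P x → P (weilt a * x)) (mul_θ : ∀ a x, P x → P (weilθ a * x)) : P w := by
  have zero : P 0 := by simpa using smul 0 1 one
  have h1 : ∀ w : ExteriorAlgebra ℝ (Dual ℝ L), P ((1 : SymDual L) ⊗ₜ[ℝ] w) := by
    intro w
    induction w using ExteriorAlgebra.left_induction with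
    | algebraMap r =>
      rw [Algebra.algebraMap_eq_smul_one, TensorProduct.tmul_smul]
      exact smul r _ one
    | add x y hx hy => rw [TensorProduct.tmul_add]; exact add _ _ hx hy
    | ι_mul x v hx =>
      have hv : (1 : SymDual L) ⊗ₜ[ℝ] (ι ℝ v * x) =
          ∑ a, v (lieBasis L a) • (weilθ a * (1 : SymDual L) ⊗ₜ[ℝ] x) := by
        conv_lhs => rw [← (lieBasis L).sum_dual_apply_smul_coord v]
        simp only [weilθ, tmul_mul_tmul, one_mul, map_sum, map_smul,
          sum_mul, TensorProduct.tmul_sum, smul_mul_assoc, TensorProduct.tmul_smul, extθ]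
      rw [hv]
      exact Finset.sum_induction _ P add zero fun a _ => smul _ _ (mul_θ _ _ hx)
  induction w using TensorProduct.induction_on with
  | zero => exact zero
  | add x y hx hy => exact add _ _ hx hy
  | tmul p w =>
    induction p using MvPolynomial.induction_on with
    | C r =>
      rw [← MvPolynomial.algebraMap_eq, Algebra.algebraMap_eq_smul_one, ← TensorProduct.smul_tmul']
      exact smul r _ (h1 w)
    | add p q hp hq => rw [TensorProduct.add_tmul]; exact add _ _ hp hq
    | mul_X p a hp =>
      have := mul_t a _ hp
      rwa [weilt, tmul_mul_tmul, one_mul, mul_comm] at this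

theorem Weil.parity_tmul (p : SymDual L) (w : ExteriorAlgebra ℝ (Dual ℝ L)) :
    parity (p ⊗ₜ[ℝ] w : Weil L) = p ⊗ₜ[ℝ] parity w := rfl

theorem parity_weilt (a : Idx L) : parity (weilt a) = weilt a := by
  rw [weilt, Weil.parity_tmul, map_one]

theorem parity_weilθ (a : Idx L) : parity (weilθ a) = -weilθ a := by
  rw [weilθ, Weil.parity_tmul, extθ, parity_ι, TensorProduct.tmul_neg]

theorem weilt_comm (a : Idx L) (w : Weil L) : weilt a * w = w * weilt a := by
  induction w using TensorProduct.induction_on with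
  | zero => simp
  | add x y hx hy => rw [mul_add, hx, hy, add_mul]
  | tmul p w => simp [weilt, mul_comm]

theorem weilθ_comm (a : Idx L) (w : Weil L) : weilθ a * w = parity w * weilθ a := by
  induction w using TensorProduct.induction_on with
  | zero => simp
  | add x y hx hy => rw [mul_add, hx, hy, map_add, add_mul]
  | tmul p w => simp [weilθ, Weil.parity_tmul, extθ, ι_superComm]

theorem Weil.even_central {z : Weil L} (hz : parity z = z) (w : Weil L) : z * w = w * z := by
  induction w using Weil.induction with
  | one => simp
  | add x y hx hy => rw [mul_add, hx, hy, add_mul]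
  | smul r x hx => rw [mul_smul_comm, hx, smul_mul_assoc]
  | mul_t a x hx => rw [← mul_assoc, ← weilt_comm, mul_assoc, hx, mul_assoc]
  | mul_θ a x hx =>
    have := weilθ_comm a z
    rw [hz] at this
    rw [← mul_assoc, ← this, mul_assoc, hx, mul_assoc]

/-- The contraction with `e_a` on the Weil algebra. -/
def weilContract (a : Idx L) : Weil L →ₗ[ℝ] Weil L :=
  TensorProduct.map LinearMap.id (extContract a)

/-- The partial derivative `∂/∂t^a` on the Weil algebra. -/
def weilPderiv (a : Idx L) : Weil L →ₗ[ℝ] Weil L :=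
  TensorProduct.map (MvPolynomial.pderiv a).toLinearMap LinearMap.id

theorem weilContract_isOddDer (a : Idx L) : IsOddDer (weilContract a) := by
  intro x y
  induction x using TensorProduct.induction_on with
  | zero => simp
  | add x x' hx hx' => simp only [add_mul, map_add, hx, hx']; abel
  | tmul p w =>
    induction y using TensorProduct.induction_on with
    | zero => simp
    | add x x' hx hx' => simp only [mul_add, map_add, hx, hx']; abel
    | tmul q v =>
      simp only [weilContract, tmul_mul_tmul, TensorProduct.map_tmul,
        id_apply, AlgHom.id_apply, Weil.parity_tmul, ← TensorProduct.tmul_add]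
      rw [extContract, CliffordAlgebra.contractLeft_isOddDer]
      rfl

theorem weilPderiv_isEvenDer (a : Idx L) : IsEvenDer (weilPderiv a) := by
  intro x y
  induction x using TensorProduct.induction_on with
  | zero => simp
  | add x x' hx hx' => simp only [add_mul, map_add, hx, hx']; abel
  | tmul p w =>
    induction y using TensorProduct.induction_on with
    | zero => simp
    | add x x' hx hx' => simp only [mul_add, map_add, hx, hx']; abel
    | tmul q v =>
      simp only [weilPderiv, tmul_mul_tmul, TensorProduct.map_tmul,
        id_apply, AlgHom.id_apply, ← TensorProduct.add_tmul, Derivation.coeFn_coe,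
        Derivation.leibniz, smul_eq_mul]
      rw [add_comm, mul_comm q]

theorem weilContract_parity (a : Idx L) (w : Weil L) :
    weilContract a (parity w) = -parity (weilContract a w) := by
  induction w using TensorProduct.induction_on with
  | zero => simp
  | add x y hx hy => simp only [map_add, hx, hy]; abel
  | tmul p w =>
    simp only [weilContract, Weil.parity_tmul, TensorProduct.map_tmul, extContract,
      CliffordAlgebra.contractLeft_parity, TensorProduct.tmul_neg]

theorem weilPderiv_parity (a : Idx L) (w : Weil L) :
    weilPderiv a (parity w) = parity (weilPderiv a w) := by
  induction w using TensorProduct.induction_on with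
  | zero => simp
  | add x y hx hy => simp only [map_add, hx, hy]
  | tmul p w => simp only [weilPderiv, Weil.parity_tmul, TensorProduct.map_tmul]; rfl

theorem weilContract_weilθ (a b : Idx L) :
    weilContract a (weilθ b) = if a = b then 1 else 0 := by
  have : extContract a (extθ b) = if a = b then 1 else 0 := by
    rw [extContract, extθ]
    refine (CliffordAlgebra.contractLeft_ι _ _ _).trans ?_
    simp only [Dual.eval_apply, Module.Basis.coord_apply, Module.Basis.repr_self,
      Finsupp.single_apply]
    split_ifs <;> simp
  rw [weilContract, weilθ, TensorProduct.map_tmul, this]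
  split_ifs <;> simp [Algebra.TensorProduct.one_def]

theorem weilContract_weilt (a b : Idx L) : weilContract a (weilt b) = 0 := by
  have : extContract a (1 : ExteriorAlgebra ℝ (Dual ℝ L)) = 0 :=
    CliffordAlgebra.contractLeft_one _ _
  simp [weilContract, weilt, this]

theorem weilPderiv_weilt (a b : Idx L) :
    weilPderiv a (weilt b) = if a = b then 1 else 0 := by
  simp only [weilPderiv, weilt, TensorProduct.map_tmul, Derivation.coeFn_coe,
    MvPolynomial.pderiv_X, id_apply, Pi.single_apply]
  by_cases h : a = b
  · simp [h, Algebra.TensorProduct.one_def]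
  · simp [h, Ne.symm h]

theorem weilPderiv_weilθ (a b : Idx L) : weilPderiv a (weilθ b) = 0 := by
  simp [weilPderiv, weilθ]

theorem IsOddDer.mulLeft_even {D : Weil L →ₗ[ℝ] Weil L} (h : IsOddDer D) {z : Weil L}
    (hz : parity z = z) : IsOddDer (mulLeft ℝ z ∘ₗ D) := by
  intro a b
  simp only [comp_apply, mulLeft_apply, h a b, mul_add, AlgHom.id_apply]
  rw [← mul_assoc, ← mul_assoc, ← mul_assoc, ← Weil.even_central hz]

theorem IsEvenDer.mulLeft_even {D : Weil L →ₗ[ℝ] Weil L} (h : IsEvenDer D) {z : Weil L}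
    (hz : parity z = z) : IsEvenDer (mulLeft ℝ z ∘ₗ D) := by
  intro a b
  simp only [comp_apply, mulLeft_apply, h a b, mul_add, AlgHom.id_apply]
  rw [← mul_assoc, ← mul_assoc, ← mul_assoc, ← Weil.even_central hz]

theorem IsEvenDer.mulLeft_weilθ {D : Weil L →ₗ[ℝ] Weil L} (h : IsEvenDer D) (c : Idx L) :
    IsOddDer (mulLeft ℝ (weilθ c) ∘ₗ D) := by
  intro a b
  simp only [comp_apply, mulLeft_apply, h a b, mul_add, AlgHom.id_apply]
  rw [← mul_assoc, ← mul_assoc, ← mul_assoc, weilθ_comm c a]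

theorem IsOddDer.mulLeft_weilθ {D : Weil L →ₗ[ℝ] Weil L} (h : IsOddDer D) (c : Idx L) :
    IsEvenDer (mulLeft ℝ (weilθ c) ∘ₗ D) := by
  intro a b
  simp only [comp_apply, mulLeft_apply, h a b, mul_add, AlgHom.id_apply]
  rw [← mul_assoc, ← mul_assoc, ← mul_assoc, weilθ_comm c (parity a), parity_parity]

theorem weilD_eq : weilD L = ∑ a, (mulLeft ℝ (weilt a) ∘ₗ weilContract a
    - (2⁻¹ : ℝ) • ∑ b, ∑ c, structConst L a b c •
        (mulLeft ℝ (weilθ b * weilθ c) ∘ₗ weilContract a)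
    - ∑ b, ∑ c, structConst L a b c •
        (mulLeft ℝ (weilθ b) ∘ₗ (mulLeft ℝ (weilt c) ∘ₗ weilPderiv a))) := by
  refine TensorProduct.ext' fun p w => ?_
  simp only [weilD, weilt, weilθ, weilContract, weilPderiv, LinearMap.sum_apply,
    LinearMap.sub_apply, LinearMap.smul_apply, comp_apply, TensorProduct.map_tmul,
    mulLeft_apply, tmul_mul_tmul, one_mul, id_apply]

theorem weilL_eq (x : L) : weilL x = -∑ a, ∑ c, (lieBasis L).repr ⁅x, lieBasis L c⁆ a •
    (mulLeft ℝ (weilt c) ∘ₗ weilPderiv a +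
      mulLeft ℝ (weilθ c) ∘ₗ weilContract a) := by
  refine TensorProduct.ext' fun p w => ?_
  simp only [weilL, weilt, weilθ, weilContract, weilPderiv, LinearMap.sum_apply,
    LinearMap.neg_apply, LinearMap.add_apply, LinearMap.smul_apply, comp_apply,
    TensorProduct.map_tmul, mulLeft_apply, tmul_mul_tmul, one_mul,
    id_apply]

variable (L) in
/-- The odd derivation `t^a ↦ θ^a`, `θ^a ↦ 0` of the Weil algebra, a contracting homotopy. -/
def weilH : Weil L →ₗ[ℝ] Weil L :=
  ∑ a, mulLeft ℝ (weilθ a) ∘ₗ weilPderiv a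

theorem parity_weilθ_mul (b c : Idx L) : parity (weilθ b * weilθ c) = weilθ b * weilθ c := by
  rw [map_mul, parity_weilθ, parity_weilθ, Weil.neg_mul, Weil.mul_neg, neg_neg]

theorem IsDerOver.sub {R R' : Type*} [Ring R] [Algebra ℝ R] [Ring R'] [Algebra ℝ R']
    {J K : R →ₐ[ℝ] R'} {D D' : R →ₗ[ℝ] R'} (h : IsDerOver J K D) (h' : IsDerOver J K D') :
    IsDerOver J K (D - D') := by
  rw [sub_eq_add_neg]; exact h.add h'.neg

theorem weilD_isOddDer : IsOddDer (weilD L) := by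
  rw [weilD_eq]
  refine IsDerOver.sum _ fun a _ => ((IsDerOver.sub ?_ ?_).sub ?_)
  · exact (weilContract_isOddDer a).mulLeft_even (parity_weilt a)
  · exact (IsDerOver.sum _ fun b _ => IsDerOver.sum _ fun c _ => IsDerOver.smul
      ((weilContract_isOddDer a).mulLeft_even (parity_weilθ_mul b c)) _).smul _
  · exact IsDerOver.sum _ fun b _ => IsDerOver.sum _ fun c _ => IsDerOver.smul
      (((weilPderiv_isEvenDer a).mulLeft_even (parity_weilt c)).mulLeft_weilθ b) _

theorem weilL_isEvenDer (x : L) : IsEvenDer (weilL x) := by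
  rw [weilL_eq]
  exact (IsDerOver.sum _ fun a _ => IsDerOver.sum _ fun c _ => IsDerOver.smul
    (((weilPderiv_isEvenDer a).mulLeft_even (parity_weilt c)).add
      ((weilContract_isOddDer a).mulLeft_weilθ c)) _).neg

theorem weilH_isOddDer : IsOddDer (weilH L) :=
  IsDerOver.sum _ fun a _ => (weilPderiv_isEvenDer a).mulLeft_weilθ a

theorem weilD_parity (w : Weil L) : weilD L (parity w) = -parity (weilD L w) := by
  simp only [weilD_eq, LinearMap.sum_apply, LinearMap.sub_apply, LinearMap.smul_apply,
    comp_apply, mulLeft_apply, weilContract_parity, weilPderiv_parity, map_sum,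
    map_sub, map_smul, map_mul, parity_weilt, parity_weilθ, ← sum_neg_distrib]
  refine sum_congr rfl fun a _ => ?_
  simp only [Weil.mul_neg, Weil.neg_mul, neg_neg, smul_neg, sum_neg_distrib]
  abel

theorem weilL_parity (x : L) (w : Weil L) : weilL x (parity w) = parity (weilL x w) := by
  simp only [weilL_eq, LinearMap.sum_apply, LinearMap.neg_apply, LinearMap.add_apply,
    LinearMap.smul_apply, comp_apply, mulLeft_apply, weilContract_parity,
    weilPderiv_parity, map_sum, map_neg, map_add, map_smul, map_mul, parity_weilt, parity_weilθ,
    Weil.mul_neg, Weil.neg_mul]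

theorem weilH_parity (w : Weil L) : weilH L (parity w) = -parity (weilH L w) := by
  simp only [weilH, LinearMap.sum_apply, comp_apply, mulLeft_apply,
    weilPderiv_parity, map_sum, map_mul, parity_weilθ, Weil.neg_mul, sum_neg_distrib, neg_neg]

/-- The quadratic elements `f^a_{bc} θ^b θ^c`. -/
def weilQ (a : Idx L) : Weil L :=
  ∑ b, ∑ c, structConst L a b c • (weilθ b * weilθ c)

theorem weilD_weilθ (a : Idx L) : weilD L (weilθ a) = weilt a - (2⁻¹ : ℝ) • weilQ a := by
  simp only [weilD_eq, LinearMap.sum_apply, LinearMap.sub_apply, LinearMap.smul_apply,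
    comp_apply, mulLeft_apply, weilContract_weilθ, weilPderiv_weilθ, mul_zero,
    smul_zero, sum_const_zero, sub_zero, mul_ite, mul_one, smul_ite, weilQ,
    sum_sub_distrib]
  rw [Finset.sum_ite_eq' univ a weilt, if_pos (Finset.mem_univ a), ← smul_sum]
  congr 2
  rw [sum_eq_single a]
  · simp
  · intro b _ hb; simp [hb]
  · simp

theorem weilD_weilt (a : Idx L) :
    weilD L (weilt a) = -∑ b, ∑ c, structConst L a b c • (weilθ b * weilt c) := by
  simp only [weilD_eq, LinearMap.sum_apply, LinearMap.sub_apply, LinearMap.smul_apply,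
    comp_apply, mulLeft_apply, weilContract_weilt, weilPderiv_weilt, mul_zero,
    smul_zero, sum_const_zero, zero_sub, mul_ite, mul_one, smul_ite,
    sum_neg_distrib, sub_zero]
  congr 1
  rw [sum_eq_single a]
  · simp
  · intro b _ hb; simp [hb]
  · simp

theorem weilL_weilθ (x : L) (a : Idx L) :
    weilL x (weilθ a) = -∑ c, (lieBasis L).repr ⁅x, lieBasis L c⁆ a • weilθ c := by
  simp only [weilL_eq, LinearMap.sum_apply, LinearMap.neg_apply, LinearMap.add_apply,
    LinearMap.smul_apply, comp_apply, mulLeft_apply, weilContract_weilθ,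
    weilPderiv_weilθ, mul_zero, zero_add, mul_ite, mul_one]
  congr 1
  rw [sum_eq_single a]
  · simp
  · intro b _ hb; simp [hb]
  · simp

theorem weilL_weilt (x : L) (a : Idx L) :
    weilL x (weilt a) = -∑ c, (lieBasis L).repr ⁅x, lieBasis L c⁆ a • weilt c := by
  simp only [weilL_eq, LinearMap.sum_apply, LinearMap.neg_apply, LinearMap.add_apply,
    LinearMap.smul_apply, comp_apply, mulLeft_apply, weilContract_weilt,
    weilPderiv_weilt, mul_zero, add_zero, mul_ite, mul_one]
  congr 1
  rw [sum_eq_single a]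
  · simp
  · intro b _ hb; simp [hb]
  · simp

theorem weilH_weilθ (a : Idx L) : weilH L (weilθ a) = 0 := by
  simp [weilH, weilPderiv_weilθ]

theorem weilH_weilt (a : Idx L) : weilH L (weilt a) = weilθ a := by
  simp [weilH, weilPderiv_weilt]

/-- Derivations of the Weil algebra are determined by their values on the generators. -/
theorem Weil.der_ext {K : Weil L →ₐ[ℝ] Weil L} {D D' : Weil L →ₗ[ℝ] Weil L}
    (h : IsDerOver (AlgHom.id ℝ _) K D) (h' : IsDerOver (AlgHom.id ℝ _) K D')
    (ht : ∀ a, D (weilt a) = D' (weilt a)) (hθ : ∀ a, D (weilθ a) = D' (weilθ a)) : D = D' := by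
  refine LinearMap.ext fun w => ?_
  induction w using Weil.induction with
  | one => rw [h.map_one, h'.map_one]
  | add x y hx hy => rw [map_add, map_add, hx, hy]
  | smul r x hx => rw [map_smul, map_smul, hx]
  | mul_t a x hx => rw [h, h', ht, hx]
  | mul_θ a x hx => rw [h, h', hθ, hx]

theorem repr_lie_right (x y : L) (a : Idx L) :
    (lieBasis L).repr ⁅x, y⁆ a =
      ∑ c, (lieBasis L).repr ⁅x, lieBasis L c⁆ a * (lieBasis L).repr y c := by
  conv_lhs => rw [← (lieBasis L).sum_repr y]
  simp only [lie_sum, lie_smul, map_sum, map_smul, Finsupp.coe_finsetSum, Finset.sum_apply,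
    Finsupp.smul_apply, smul_eq_mul, mul_comm]

theorem repr_lie_left (x y : L) (a : Idx L) :
    (lieBasis L).repr ⁅x, y⁆ a =
      ∑ c, (lieBasis L).repr ⁅lieBasis L c, y⁆ a * (lieBasis L).repr x c := by
  conv_lhs => rw [← (lieBasis L).sum_repr x]
  simp only [sum_lie, smul_lie, map_sum, map_smul, Finsupp.coe_finsetSum, Finset.sum_apply,
    Finsupp.smul_apply, smul_eq_mul, mul_comm]

theorem structConst_swap (a b c : Idx L) : structConst L a c b = -structConst L a b c := by
  rw [structConst, structConst, ← lie_skew, map_neg, Finsupp.neg_apply]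

/-- The cubic identity `f^a_{bc} f^c_{de} θ^b θ^d θ^e = 0`, a consequence of the Jacobi identity
and of the invariance of `θ^b θ^d θ^e` under cyclic permutations. -/
theorem sum_structConst_weilθ_weilQ (a : Idx L) :
    ∑ b, ∑ c, structConst L a b c • (weilθ b * weilQ c) = 0 := by
  let g (b d e : Idx L) : ℝ := (lieBasis L).repr ⁅lieBasis L b, ⁅lieBasis L d, lieBasis L e⁆⁆ a
  let T (b d e : Idx L) : Weil L := weilθ b * (weilθ d * weilθ e)
  have hT : ∀ b d e, T b d e = T d e b := by
    intro b d e
    simp only [T]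
    rw [weilθ_comm b, parity_weilθ_mul, mul_assoc]
  have hS : ∑ b, ∑ c, structConst L a b c • (weilθ b * weilQ c) =
      ∑ b, ∑ d, ∑ e, g b d e • T b d e := by
    refine sum_congr rfl fun b _ => ?_
    simp only [weilQ, mul_sum, smul_sum, mul_smul_comm, smul_smul]
    rw [sum_comm]
    refine sum_congr rfl fun d _ => ?_
    rw [sum_comm]
    refine sum_congr rfl fun e _ => ?_
    simp only [g, T]
    rw [repr_lie_right, Finset.sum_smul]
    rfl
  have h1 : ∑ b, ∑ d, ∑ e, g b d e • T b d e = ∑ b, ∑ d, ∑ e, g d e b • T b d e := by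
    calc _ = ∑ e, ∑ b, ∑ d, g b d e • T b d e := Finset.sum_comm_cycle
      _ = _ := by
          refine sum_congr rfl fun b _ => ?_
          refine sum_congr rfl fun d _ => ?_
          refine sum_congr rfl fun e _ => ?_
          rw [hT d e b, hT e b d]
  have h2 : ∑ b, ∑ d, ∑ e, g b d e • T b d e = ∑ b, ∑ d, ∑ e, g e b d • T b d e := by
    calc _ = ∑ d, ∑ e, ∑ b, g b d e • T b d e :=
          sum_comm.trans (sum_congr rfl fun d _ => sum_comm)
      _ = _ := by
          refine sum_congr rfl fun b _ => ?_
          refine sum_congr rfl fun d _ => ?_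
          refine sum_congr rfl fun e _ => ?_
          rw [hT e b d]
  have h3 : ∑ b, ∑ d, ∑ e, (g b d e + g d e b + g e b d) • T b d e = 0 := by
    refine sum_eq_zero fun b _ => sum_eq_zero fun d _ =>
      sum_eq_zero fun e _ => ?_
    have := lie_jacobi (lieBasis L b) (lieBasis L d) (lieBasis L e)
    have h0 : g b d e + g d e b + g e b d = 0 := by
      simp only [g]
      rw [← Finsupp.add_apply, ← map_add, ← Finsupp.add_apply, ← map_add, this]; simp
    rw [h0, zero_smul]
  simp only [add_smul, sum_add_distrib, ← h1, ← h2] at h3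
  rw [hS]
  have h4 : (3 : ℝ) • ∑ b, ∑ d, ∑ e, g b d e • T b d e = 0 := by
    rw [show (3 : ℝ) = 1 + 1 + 1 by norm_num, add_smul, add_smul, one_smul]; exact h3
  exact (smul_eq_zero.1 h4).resolve_left (by norm_num)

theorem parity_weilQ (a : Idx L) : parity (weilQ a) = weilQ a := by
  simp only [weilQ, map_sum, map_smul, parity_weilθ_mul]

theorem weilD_weilD_weilθ (a : Idx L) : weilD L (weilD L (weilθ a)) = 0 := by
  have hQ : weilD L (weilQ a) =
      -(2 : ℝ) • ∑ b, ∑ c, structConst L a b c • (weilθ b * weilD L (weilθ c)) := by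
    have h1 : ∀ b c : Idx L, weilD L (weilθ b * weilθ c) =
        weilθ c * weilD L (weilθ b) - weilθ b * weilD L (weilθ c) := by
      intro b c
      rw [weilD_isOddDer, parity_weilθ, AlgHom.id_apply, Weil.neg_mul, ← sub_eq_add_neg,
        weilθ_comm c, weilD_weilθ b, map_sub, map_smul, parity_weilt, parity_weilQ]
    have h2 : ∑ b, ∑ c, structConst L a b c • (weilθ c * weilD L (weilθ b)) =
        -∑ b, ∑ c, structConst L a b c • (weilθ b * weilD L (weilθ c)) := by
      rw [sum_comm, ← sum_neg_distrib]
      refine sum_congr rfl fun b _ => ?_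
      rw [← sum_neg_distrib]
      refine sum_congr rfl fun c _ => ?_
      rw [structConst_swap, Weil.neg_smul]
    simp only [weilQ, map_sum, map_smul, h1, smul_sub, sum_sub_distrib, h2]
    rw [Weil.neg_smul, two_smul]
    abel
  have h3 := sum_structConst_weilθ_weilQ a
  rw [weilD_weilθ, map_sub, map_smul, hQ, weilD_weilt]
  simp only [weilD_weilθ, mul_sub, mul_smul_comm, smul_sub, sum_sub_distrib,
    smul_comm _ (2⁻¹ : ℝ), ← smul_sum, h3, smul_zero, sub_zero]
  rw [smul_smul]
  norm_num

theorem weilD_weilD (w : Weil L) : weilD L (weilD L w) = 0 := by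
  have hd : IsEvenDer (weilD L ∘ₗ weilD L) := weilD_isOddDer.sq weilD_parity
  have hθ : ∀ a, (weilD L ∘ₗ weilD L) (weilθ a) = 0 := weilD_weilD_weilθ
  have : weilD L ∘ₗ weilD L = 0 := by
    refine Weil.der_ext hd (fun a b => by simp) (fun a => ?_) (fun a => ?_)
    · have h1 : weilt a = weilD L (weilθ a) + (2⁻¹ : ℝ) • weilQ a := by
        rw [weilD_weilθ]; abel
      have h2 : (weilD L ∘ₗ weilD L) (weilQ a) = 0 := by
        simp only [weilQ, map_sum, map_smul]
        refine sum_eq_zero fun b _ => sum_eq_zero fun c _ => ?_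
        rw [hd, hθ, hθ]; simp
      rw [h1, map_add, map_smul, h2, comp_apply, weilD_weilD_weilθ, map_zero]; simp
    · rw [hθ]; rfl
  exact LinearMap.congr_fun this w

theorem weilL_weilQ (x : L) (a : Idx L) :
    weilL x (weilQ a) = -∑ c, (lieBasis L).repr ⁅x, lieBasis L c⁆ a • weilQ c := by
  have h0 : ∀ p q : Idx L, ∑ c, (lieBasis L).repr ⁅x, lieBasis L c⁆ a * structConst L c p q =
      ∑ b, structConst L a b q * (lieBasis L).repr ⁅x, lieBasis L p⁆ b +
      ∑ c, structConst L a p c * (lieBasis L).repr ⁅x, lieBasis L q⁆ c := by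
    intro p q
    have := leibniz_lie x (lieBasis L p) (lieBasis L q)
    have h := congrArg (fun y => (lieBasis L).repr y a) this
    simp only [map_add, Finsupp.add_apply] at h
    rw [repr_lie_right x, repr_lie_left ⁅x, lieBasis L p⁆,
      repr_lie_right (lieBasis L p) ⁅x, lieBasis L q⁆] at h
    exact h
  have hL : weilL x (weilQ a) = -(∑ b, ∑ c, ∑ d, (structConst L a b c *
      (lieBasis L).repr ⁅x, lieBasis L d⁆ b) • (weilθ d * weilθ c) +
      ∑ b, ∑ c, ∑ d, (structConst L a b c *
      (lieBasis L).repr ⁅x, lieBasis L d⁆ c) • (weilθ b * weilθ d)) := by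
    simp only [weilQ, map_sum, map_smul, weilL_isEvenDer x (weilθ _), AlgHom.id_apply, weilL_weilθ,
      Weil.neg_mul, Weil.mul_neg, sum_mul, mul_sum, smul_mul_assoc, mul_smul_comm, smul_add,
      smul_neg, smul_sum, smul_smul, sum_add_distrib, sum_neg_distrib, neg_add]
  have hR : ∑ c, (lieBasis L).repr ⁅x, lieBasis L c⁆ a • weilQ c =
      ∑ p, ∑ q, (∑ c, (lieBasis L).repr ⁅x, lieBasis L c⁆ a * structConst L c p q) •
        (weilθ p * weilθ q) := by
    simp only [weilQ, smul_sum, smul_smul, Finset.sum_smul]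
    rw [sum_comm]
    refine sum_congr rfl fun p _ => ?_
    rw [sum_comm]
  rw [hL, hR]
  simp only [h0, add_smul, Finset.sum_smul, sum_add_distrib]
  congr 2
  · rw [Finset.sum_comm_cycle]
    refine sum_congr rfl fun p _ => ?_
    rw [sum_comm]
  · refine sum_congr rfl fun p _ => ?_
    rw [sum_comm]

end WeilDer

/-! ### The number operator and the degree filtration of the Weil algebra -/
section WeilNumber

variable (L) in
/-- The even derivation `[d, h]` of the Weil algebra. It is the number operator for the
generators `θ^a` and `d θ^a`. -/
def weilN : Weil L →ₗ[ℝ] Weil L := weilD L ∘ₗ weilH L + weilH L ∘ₗ weilD L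

theorem weilN_apply (w : Weil L) :
    weilN L w = weilD L (weilH L w) + weilH L (weilD L w) := rfl

theorem weilN_isEvenDer : IsEvenDer (weilN L) :=
  weilD_isOddDer.anticomm weilH_isOddDer weilD_parity weilH_parity

theorem weilN_mul (v w : Weil L) : weilN L (v * w) = weilN L v * w + v * weilN L w :=
  weilN_isEvenDer v w

theorem weilN_parity (w : Weil L) : weilN L (parity w) = parity (weilN L w) := by
  simp only [weilN_apply, weilH_parity, weilD_parity, map_neg, neg_neg, map_add]

theorem weilH_weilθ_mul (b c : Idx L) : weilH L (weilθ b * weilθ c) = 0 := by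
  rw [weilH_isOddDer, weilH_weilθ, weilH_weilθ, mul_zero, zero_mul, add_zero]

theorem weilH_weilQ (a : Idx L) : weilH L (weilQ a) = 0 := by
  simp only [weilQ, map_sum, map_smul, weilH_weilθ_mul, smul_zero, sum_const_zero]

theorem weilN_weilθ (a : Idx L) : weilN L (weilθ a) = weilθ a := by
  rw [weilN_apply, weilH_weilθ, map_zero, zero_add, weilD_weilθ, map_sub, map_smul, weilH_weilQ,
    weilH_weilt, smul_zero, sub_zero]

theorem weilN_weilt (a : Idx L) : weilN L (weilt a) = weilt a + (2⁻¹ : ℝ) • weilQ a := by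
  have h : ∀ b c : Idx L, weilH L (weilθ b * weilt c) = -(weilθ b * weilθ c) := by
    intro b c
    rw [weilH_isOddDer, weilH_weilθ, weilH_weilt, zero_mul, zero_add, parity_weilθ, Weil.neg_mul]
  rw [weilN_apply, weilH_weilt, weilD_weilt, weilD_weilθ]
  simp only [map_neg, map_sum, map_smul, h, smul_neg, sum_neg_distrib, neg_neg]
  rw [← weilQ]
  have h2 : weilQ a = (2⁻¹ : ℝ) • weilQ a + (2⁻¹ : ℝ) • weilQ a := by
    rw [← add_smul]; norm_num
  calc weilt a - (2⁻¹ : ℝ) • weilQ a + weilQ a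
      = weilt a - (2⁻¹ : ℝ) • weilQ a + ((2⁻¹ : ℝ) • weilQ a + (2⁻¹ : ℝ) • weilQ a) := by
        rw [← h2]
    _ = _ := by abel

theorem weilN_weilQ (a : Idx L) : weilN L (weilQ a) = (2 : ℝ) • weilQ a := by
  simp only [weilQ, map_sum, map_smul, weilN_mul, weilN_weilθ, smul_sum]
  refine sum_congr rfl fun b _ => sum_congr rfl fun c _ => ?_
  rw [smul_comm, two_smul]

theorem weilN_weilD (w : Weil L) : weilN L (weilD L w) = weilD L (weilN L w) := by
  rw [weilN_apply, weilN_apply, weilD_weilD, map_add, weilD_weilD, map_zero, add_zero, zero_add]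

theorem weilN_weilL (x : L) (w : Weil L) : weilN L (weilL x w) = weilL x (weilN L w) := by
  have : weilN L ∘ₗ weilL x - weilL x ∘ₗ weilN L = 0 := by
    refine Weil.der_ext (weilN_isEvenDer.commutator (weilL_isEvenDer x)) (fun a b => by simp)
      (fun a => ?_) (fun a => ?_)
    · simp only [LinearMap.sub_apply, comp_apply, weilL_weilt, weilN_weilt, map_neg,
        map_sum, map_smul, map_add, weilL_weilQ, smul_add, sum_add_distrib,
        LinearMap.zero_apply, smul_neg, smul_sum]
      simp only [smul_comm (2⁻¹ : ℝ), neg_add]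
      abel
    · simp only [LinearMap.sub_apply, comp_apply, weilL_weilθ, weilN_weilθ, map_neg,
        map_sum, map_smul, LinearMap.zero_apply, sub_self]
  exact sub_eq_zero.1 (LinearMap.congr_fun this w)

theorem weilH_weilL (x : L) (w : Weil L) : weilH L (weilL x w) = weilL x (weilH L w) := by
  have : weilH L ∘ₗ weilL x - weilL x ∘ₗ weilH L = 0 := by
    refine Weil.der_ext (weilH_isOddDer.commutator (weilL_isEvenDer x) (weilL_parity x))
      (fun a b => by simp) (fun a => ?_) (fun a => ?_)
    · simp only [LinearMap.sub_apply, comp_apply, weilL_weilt, weilH_weilt, map_neg,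
        map_sum, map_smul, LinearMap.zero_apply, weilL_weilθ, sub_self]
    · simp only [LinearMap.sub_apply, comp_apply, weilL_weilθ, weilH_weilθ, map_neg,
        map_sum, map_smul, LinearMap.zero_apply, map_zero, smul_zero, sum_const_zero,
        neg_zero, sub_self]
  exact sub_eq_zero.1 (LinearMap.congr_fun this w)

theorem weilDeg_tmul {i j : ℕ} {p : SymDual L} {w : ExteriorAlgebra ℝ (Dual ℝ L)}
    (hp : p.IsHomogeneous i) (hw : w ∈ ⋀[ℝ]^j (Dual ℝ L)) :
    (p ⊗ₜ[ℝ] w : Weil L) ∈ weilDeg L (2 * i + j) :=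
  subset_span ⟨i, j, p, w, rfl, hp, hw, rfl⟩

theorem weilDeg_mul {m n : ℕ} {v w : Weil L} (hv : v ∈ weilDeg L m) (hw : w ∈ weilDeg L n) :
    v * w ∈ weilDeg L (m + n) := by
  refine Submodule.span_induction₂ (p := fun v w _ _ => v * w ∈ weilDeg L (m + n))
    ?_ ?_ ?_ ?_ ?_ ?_ ?_ hv hw
  · rintro _ _ ⟨i, j, p, u, hm, hp, hu, rfl⟩ ⟨i', j', p', u', hn, hp', hu', rfl⟩
    rw [tmul_mul_tmul]
    have h := weilDeg_tmul (hp.mul hp') (SetLike.mul_mem_graded hu hu')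
    have e : 2 * (i + i') + (j + j') = m + n := by omega
    rwa [e] at h
  · intro y _; simp
  · intro y _; simp
  · intro x y z _ _ _ h1 h2; rw [add_mul]; exact add_mem h1 h2
  · intro x y z _ _ _ h1 h2; rw [mul_add]; exact add_mem h1 h2
  · intro r x y _ _ h; rw [smul_mul_assoc]; exact smul_mem _ _ h
  · intro r x y _ _ h; rw [mul_smul_comm]; exact smul_mem _ _ h

theorem parity_of_mem_weilDeg {n : ℕ} {w : Weil L} (hw : w ∈ weilDeg L n) :
    parity w = (-1 : ℝ) ^ n • w := by
  induction hw using span_induction with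
  | mem x h =>
    obtain ⟨i, j, p, u, hm, hp, hu, rfl⟩ := h
    rw [Weil.parity_tmul, parity_of_mem hu, TensorProduct.tmul_smul, ← hm, pow_add,
      pow_mul]
    simp
  | zero => simp
  | add x y _ _ hx hy => rw [map_add, hx, hy, smul_add]
  | smul r x _ hx => rw [map_smul, hx, smul_comm]

theorem extθ_mem (a : Idx L) : extθ a ∈ ⋀[ℝ]^1 (Dual ℝ L) := by
  rw [exteriorPower, pow_one]
  exact ⟨_, rfl⟩

theorem one_mem_exteriorPower_zero {V : Type*} [AddCommGroup V] [Module ℝ V] :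
    (1 : ExteriorAlgebra ℝ V) ∈ ⋀[ℝ]^0 V := by
  rw [exteriorPower, pow_zero]
  exact Submodule.one_le.1 le_rfl

theorem weilθ_mem_weilDeg (a : Idx L) : weilθ a ∈ weilDeg L 1 := by
  have h := weilDeg_tmul (i := 0) (MvPolynomial.isHomogeneous_one (Idx L) ℝ) (extθ_mem a)
  rwa [Nat.mul_zero, Nat.zero_add] at h

theorem weilt_mem_weilDeg (a : Idx L) : weilt a ∈ weilDeg L 2 := by
  have h := weilDeg_tmul (i := 1) (j := 0) (isHomogeneous_X ℝ a)
    (one_mem_exteriorPower_zero (V := Dual ℝ L))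
  rwa [Nat.mul_one, Nat.add_zero] at h

theorem one_mem_weilDeg : (1 : Weil L) ∈ weilDeg L 0 := by
  have h := weilDeg_tmul (i := 0) (j := 0) (MvPolynomial.isHomogeneous_one (Idx L) ℝ)
    (one_mem_exteriorPower_zero (V := Dual ℝ L))
  rwa [Nat.mul_zero, Nat.add_zero] at h

theorem weilQ_mem_weilDeg (a : Idx L) : weilQ a ∈ weilDeg L 2 := by
  rw [weilQ]
  refine Submodule.sum_mem _ fun b _ => Submodule.sum_mem _ fun c _ => smul_mem _ _ ?_
  have h := weilDeg_mul (weilθ_mem_weilDeg b) (weilθ_mem_weilDeg c)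
  rwa [one_add_one_eq_two] at h

variable (L) in
/-- The sum of the eigenspaces of the number operator in degree `n` for the eigenvalues `k` with
`n ≤ 2 k`. It is the whole component of degree `n`. -/
def weilEig (n : ℕ) : Submodule ℝ (Weil L) :=
  ⨆ k : ℕ, ⨆ _ : n ≤ 2 * k, End.eigenspace (weilN L) (k : ℝ) ⊓ weilDeg L n

theorem mem_weilEig {n k : ℕ} (hk : n ≤ 2 * k) {w : Weil L} (h1 : weilN L w = (k : ℝ) • w)
    (h2 : w ∈ weilDeg L n) : w ∈ weilEig L n :=
  Submodule.mem_iSup_of_mem k (Submodule.mem_iSup_of_mem hk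
    ⟨End.mem_eigenspace_iff.2 h1, h2⟩)

theorem weilEig_induction {n : ℕ} {P : Weil L → Prop} {w : Weil L} (hw : w ∈ weilEig L n)
    (zero : P 0) (add : ∀ x y, P x → P y → P (x + y))
    (mem : ∀ k : ℕ, n ≤ 2 * k → ∀ w, weilN L w = (k : ℝ) • w → w ∈ weilDeg L n → P w) : P w := by
  refine Submodule.iSup_induction _ (motive := P) hw (fun k x hx => ?_) zero add
  refine Submodule.iSup_induction _ (motive := P) hx (fun hk x hx => ?_) zero add
  exact mem k hk x (End.mem_eigenspace_iff.1 hx.1) hx.2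

theorem mul_mem_weilEig {m n k : ℕ} (hk : m ≤ 2 * k) {z w : Weil L}
    (h1 : weilN L z = (k : ℝ) • z) (h2 : z ∈ weilDeg L m) (hw : w ∈ weilEig L n) :
    z * w ∈ weilEig L (m + n) := by
  refine weilEig_induction (P := fun w => z * w ∈ weilEig L (m + n)) hw ?_ ?_ ?_
  · simp
  · intro x y hx hy; rw [mul_add]; exact add_mem hx hy
  · intro l hl x hx1 hx2
    refine mem_weilEig (k := k + l) (by omega) ?_ (weilDeg_mul h2 hx2)
    rw [weilN_mul, h1, hx1, smul_mul_assoc, mul_smul_comm, ← add_smul, Nat.cast_add]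

theorem weilθ_mul_mem_weilEig {n : ℕ} (a : Idx L) {w : Weil L} (hw : w ∈ weilEig L n) :
    weilθ a * w ∈ weilEig L (1 + n) :=
  mul_mem_weilEig (k := 1) (by omega) (by rw [weilN_weilθ]; simp) (weilθ_mem_weilDeg a) hw

theorem weilt_mul_mem_weilEig {n : ℕ} (a : Idx L) {w : Weil L} (hw : w ∈ weilEig L n) :
    weilt a * w ∈ weilEig L (2 + n) := by
  -- `t^a` is the sum of the eigenvectors `d θ^a` and `1/2 f^a_{bc} θ^b θ^c`
  have h : weilt a = (weilt a - (2⁻¹ : ℝ) • weilQ a) + (2⁻¹ : ℝ) • weilQ a := by abel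
  rw [h, add_mul]
  refine add_mem (mul_mem_weilEig (k := 1) (by omega) ?_ ?_ hw)
    (mul_mem_weilEig (k := 2) (by omega) ?_ ?_ hw)
  · rw [← weilD_weilθ, weilN_weilD, weilN_weilθ]; simp
  · exact sub_mem (weilt_mem_weilDeg a) (smul_mem _ _ (weilQ_mem_weilDeg a))
  · rw [map_smul, weilN_weilQ, smul_comm]; simp
  · exact smul_mem _ _ (weilQ_mem_weilDeg a)

theorem weilDeg_le_weilEig (n : ℕ) : weilDeg L n ≤ weilEig L n := by
  refine Submodule.span_le.2 ?_
  rintro _ ⟨i, j, p, w, hn, hp, hw, rfl⟩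
  subst hn
  have h0 : (1 : SymDual L) ⊗ₜ[ℝ] w ∈ weilEig L j := by
    refine Submodule.pow_induction_on_left' (LinearMap.range (ι ℝ
      (M := Dual ℝ L))) (C := fun j w _ => (1 : SymDual L) ⊗ₜ[ℝ] w ∈ weilEig L j)
      ?_ ?_ ?_ hw
    · intro r
      rw [Algebra.algebraMap_eq_smul_one, TensorProduct.tmul_smul]
      rw [← Algebra.TensorProduct.one_def]
      refine smul_mem _ _ (mem_weilEig (k := 0) le_rfl ?_ one_mem_weilDeg)
      rw [weilN_isEvenDer.map_one]; simp
    · intro x y i _ _ hx hy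
      rw [TensorProduct.tmul_add]; exact add_mem hx hy
    · rintro _ ⟨v, rfl⟩ i x _ hx
      have hv : (1 : SymDual L) ⊗ₜ[ℝ] (ι ℝ v * x) =
          ∑ a, v (lieBasis L a) • (weilθ a * (1 : SymDual L) ⊗ₜ[ℝ] x) := by
        conv_lhs => rw [← (lieBasis L).sum_dual_apply_smul_coord v]
        simp only [weilθ, tmul_mul_tmul, one_mul, map_sum, map_smul,
          sum_mul, TensorProduct.tmul_sum, smul_mul_assoc, TensorProduct.tmul_smul, extθ]
      rw [hv, Nat.succ_eq_one_add]
      exact Submodule.sum_mem _ fun a _ => smul_mem _ _ (weilθ_mul_mem_weilEig a hx)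
  have hp' : p ∈ MvPolynomial.homogeneousSubmodule (Idx L) ℝ 1 ^ i := by
    rw [MvPolynomial.homogeneousSubmodule_one_pow]; exact hp
  refine Submodule.pow_induction_on_left' _
    (C := fun i p _ => p ⊗ₜ[ℝ] w ∈ weilEig L (2 * i + j)) ?_ ?_ ?_ hp'
  · intro r
    rw [Algebra.algebraMap_eq_smul_one, ← TensorProduct.smul_tmul', mul_zero, zero_add]
    exact smul_mem _ _ h0
  · intro x y i _ _ hx hy
    rw [TensorProduct.add_tmul]; exact add_mem hx hy
  · intro m hm i x _ hx
    rw [MvPolynomial.homogeneousSubmodule_one_eq_span_X] at hm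
    induction hm using span_induction with
    | mem m h =>
      obtain ⟨a, rfl⟩ := h
      have := weilt_mul_mem_weilEig a hx
      rw [weilt, tmul_mul_tmul, one_mul] at this
      rwa [Nat.succ_eq_add_one, show 2 * (i + 1) + j = 2 + (2 * i + j) by ring]
    | zero => simp
    | add m m' _ _ h h' => rw [add_mul, TensorProduct.add_tmul]; exact add_mem h h'
    | smul r m _ h =>
      rw [smul_mul_assoc, ← TensorProduct.smul_tmul']; exact smul_mem _ _ h

/-- The number operator is surjective in positive degree. -/
theorem exists_weilN_eq {n : ℕ} (hn : n ≠ 0) {w : Weil L} (hw : w ∈ weilDeg L n) :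
    ∃ v ∈ weilDeg L n, weilN L v = w := by
  refine weilEig_induction (P := fun w => ∃ v ∈ weilDeg L n, weilN L v = w)
    (weilDeg_le_weilEig n hw) ⟨0, zero_mem _, map_zero _⟩ ?_ ?_
  · rintro _ _ ⟨v, hv, rfl⟩ ⟨v', hv', rfl⟩
    exact ⟨v + v', add_mem hv hv', map_add _ _ _⟩
  · intro k hk w h1 h2
    have hk0 : (k : ℝ) ≠ 0 := by
      have : k ≠ 0 := by omega
      exact_mod_cast this
    exact ⟨(k : ℝ)⁻¹ • w, smul_mem _ _ h2, by
      rw [map_smul, h1, smul_smul, inv_mul_cancel₀ hk0, one_smul]⟩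

variable (L) in
/-- The sum of the eigenspaces of the number operator for positive eigenvalues, which is the
augmentation ideal of the Weil algebra. -/
def weilPos : Submodule ℝ (Weil L) :=
  ⨆ k : ℕ, End.eigenspace (weilN L) ((k + 1 : ℕ) : ℝ)

theorem mem_weilPos {k : ℕ} (hk : k ≠ 0) {w : Weil L} (h : weilN L w = (k : ℝ) • w) :
    w ∈ weilPos L := by
  obtain ⟨l, rfl⟩ := Nat.exists_eq_succ_of_ne_zero hk
  exact Submodule.mem_iSup_of_mem l (End.mem_eigenspace_iff.2 h)

theorem weilPos_induction {P : Weil L → Prop} {w : Weil L} (hw : w ∈ weilPos L)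
    (zero : P 0) (add : ∀ x y, P x → P y → P (x + y))
    (mem : ∀ k : ℕ, k ≠ 0 → ∀ w, weilN L w = (k : ℝ) • w → P w) : P w :=
  Submodule.iSup_induction _ (motive := P) hw
    (fun k x hx => mem (k + 1) k.succ_ne_zero x (End.mem_eigenspace_iff.1 hx)) zero add

theorem weilDeg_le_weilPos {n : ℕ} (hn : n ≠ 0) : weilDeg L n ≤ weilPos L := by
  intro w hw
  exact weilEig_induction (weilDeg_le_weilEig n hw) (zero_mem _) (fun _ _ => add_mem)
    fun k hk x hx _ => mem_weilPos (by omega) hx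

theorem weilPos_mul_weilPos {v w : Weil L} (hv : v ∈ weilPos L) (hw : w ∈ weilPos L) :
    v * w ∈ weilPos L := by
  refine weilPos_induction (P := fun v => v * w ∈ weilPos L) hv (by simp)
    (fun x y hx hy => by rw [add_mul]; exact add_mem hx hy) fun k hk v hv => ?_
  refine weilPos_induction (P := fun w => v * w ∈ weilPos L) hw (by simp)
    (fun x y hx hy => by rw [mul_add]; exact add_mem hx hy) fun l hl w hw => ?_
  refine mem_weilPos (k := k + l) (by omega) ?_
  rw [weilN_mul, hv, hw, smul_mul_assoc, mul_smul_comm, ← add_smul, Nat.cast_add]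

theorem exists_eq_smul_one_add (w : Weil L) : ∃ r : ℝ, ∃ v ∈ weilPos L, w = r • 1 + v := by
  have hmul : ∀ z ∈ weilPos L, ∀ x : Weil L, (∃ r : ℝ, ∃ v ∈ weilPos L, x = r • 1 + v) →
      ∃ r : ℝ, ∃ v ∈ weilPos L, z * x = r • 1 + v := by
    rintro z hz _ ⟨r, v, hv, rfl⟩
    refine ⟨0, r • z + z * v, add_mem (smul_mem _ _ hz) (weilPos_mul_weilPos hz hv), ?_⟩
    rw [mul_add, mul_smul_comm, mul_one, zero_smul, zero_add]
  induction w using Weil.induction with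
  | one => exact ⟨1, 0, zero_mem _, by simp⟩
  | add x y hx hy =>
    obtain ⟨r, v, hv, rfl⟩ := hx
    obtain ⟨r', v', hv', rfl⟩ := hy
    exact ⟨r + r', v + v', add_mem hv hv', by rw [add_smul]; abel⟩
  | smul s x hx =>
    obtain ⟨r, v, hv, rfl⟩ := hx
    exact ⟨s * r, s • v, smul_mem _ _ hv, by rw [smul_add, smul_smul]⟩
  | mul_t a x hx => exact hmul _ (weilDeg_le_weilPos (by norm_num) (weilt_mem_weilDeg a)) _ hx
  | mul_θ a x hx => exact hmul _ (weilDeg_le_weilPos (by norm_num) (weilθ_mem_weilDeg a)) _ hx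

theorem weilPos_mul {v : Weil L} (hv : v ∈ weilPos L) (w : Weil L) : v * w ∈ weilPos L := by
  obtain ⟨r, u, hu, rfl⟩ := exists_eq_smul_one_add w
  rw [mul_add, mul_smul_comm, mul_one]
  exact add_mem (smul_mem _ _ hv) (weilPos_mul_weilPos hv hu)

theorem mul_weilPos (v : Weil L) {w : Weil L} (hw : w ∈ weilPos L) : v * w ∈ weilPos L := by
  obtain ⟨r, u, hu, rfl⟩ := exists_eq_smul_one_add v
  rw [add_mul, smul_mul_assoc, one_mul]
  exact add_mem (smul_mem _ _ hw) (weilPos_mul_weilPos hu hw)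

theorem parity_mem_weilPos {w : Weil L} (hw : w ∈ weilPos L) : parity w ∈ weilPos L := by
  refine weilPos_induction (P := fun w => parity w ∈ weilPos L) hw (by simp)
    (fun x y hx hy => by rw [map_add]; exact add_mem hx hy) fun k hk w hw => ?_
  exact mem_weilPos hk (by rw [weilN_parity, hw, map_smul])

/-- A linear map which commutes with the number operator and annihilates constants takes values in
the augmentation ideal. -/
theorem map_mem_weilPos {D : Weil L →ₗ[ℝ] Weil L} (h1 : D 1 = 0)
    (hN : ∀ w, weilN L (D w) = D (weilN L w)) (w : Weil L) : D w ∈ weilPos L := by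
  obtain ⟨r, u, hu, rfl⟩ := exists_eq_smul_one_add w
  rw [map_add, map_smul, h1, smul_zero, zero_add]
  refine weilPos_induction (P := fun u => D u ∈ weilPos L) hu (by simp)
    (fun x y hx hy => by rw [map_add]; exact add_mem hx hy) fun k hk w hw => ?_
  exact mem_weilPos hk (by rw [hN, hw, map_smul])

end WeilNumber

/-! ### The augmentation ideal in tensor products with the Weil algebra -/
section TensLeft
variable {A B B' : Type*} [Ring A] [Algebra ℝ A] [SuperAlgebra A] [Ring B] [Algebra ℝ B]
  [SuperAlgebra B] [Ring B'] [Algebra ℝ B'] [SuperAlgebra B']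

variable (B) in
/-- The subspace `S ⊗ B` of `A ⊗ B`. -/
def tensLeft (S : Submodule ℝ A) : Submodule ℝ (A ⊗ₛ B) :=
  Submodule.span ℝ {z | ∃ s ∈ S, ∃ b : B, z = (s ᵍ⊗ₜ b : A ⊗ₛ B)}

theorem tmul_mem_tensLeft {S : Submodule ℝ A} {s : A} (hs : s ∈ S) (b : B) :
    (s ᵍ⊗ₜ b : A ⊗ₛ B) ∈ tensLeft B S := subset_span ⟨s, hs, b, rfl⟩

theorem superMapLin_mem_tensLeft {S : Submodule ℝ A} {f : A →ₗ[ℝ] A} (hf : ∀ a, f a ∈ S)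
    (g : B →ₗ[ℝ] B') (z : A ⊗ₛ B) : superMapLin f g z ∈ tensLeft B' S := by
  induction z using SuperTensor.induction with
  | zero => simp
  | add x y hx hy => rw [map_add]; exact add_mem hx hy
  | tmul a b => exact tmul_mem_tensLeft (hf a) _

theorem superMapLin_mem_tensLeft_of_mem {S : Submodule ℝ A} {f : A →ₗ[ℝ] A}
    (hf : ∀ a ∈ S, f a ∈ S) (g : B →ₗ[ℝ] B') {z : A ⊗ₛ B} (hz : z ∈ tensLeft B S) :
    superMapLin f g z ∈ tensLeft B' S := by
  induction hz using span_induction with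
  | mem x h => obtain ⟨s, hs, b, rfl⟩ := h; exact tmul_mem_tensLeft (hf s hs) _
  | zero => simp
  | add x y _ _ hx hy => rw [map_add]; exact add_mem hx hy
  | smul r x _ hx => rw [map_smul]; exact smul_mem _ _ hx

theorem tensLeft_mul {S : Submodule ℝ A} (hS : ∀ s ∈ S, ∀ a, s * a ∈ S) {z : A ⊗ₛ B}
    (hz : z ∈ tensLeft B S) (y : A ⊗ₛ B) : z * y ∈ tensLeft B S := by
  induction hz using span_induction with
  | mem x h =>
    obtain ⟨s, hs, b, rfl⟩ := h
    induction y using SuperTensor.hom_induction with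
    | zero => simp
    | add x y hx hy => rw [mul_add]; exact add_mem hx hy
    | even a c h => rw [tmul_mul_even h]; exact tmul_mem_tensLeft (hS s hs a) _
    | odd a c h => rw [tmul_mul_odd h]; exact tmul_mem_tensLeft (hS s hs a) _
  | zero => simp
  | add x y _ _ hx hy => rw [add_mul]; exact add_mem hx hy
  | smul r x _ hx => rw [smul_mul_assoc]; exact smul_mem _ _ hx

theorem mul_tensLeft {S : Submodule ℝ A} (hS : ∀ s ∈ S, ∀ a, a * s ∈ S)
    (hp : ∀ s ∈ S, parity s ∈ S) (y : A ⊗ₛ B) {z : A ⊗ₛ B}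
    (hz : z ∈ tensLeft B S) : y * z ∈ tensLeft B S := by
  induction hz using span_induction with
  | mem x h =>
    obtain ⟨s, hs, b, rfl⟩ := h
    induction y using SuperTensor.induction with
    | zero => simp
    | add x y hx hy => rw [add_mul]; exact add_mem hx hy
    | tmul a c =>
      have e : s = (2⁻¹ : ℝ) • (s + parity s) + (2⁻¹ : ℝ) • (s - parity s) := by
        rw [← smul_add, add_add_sub_cancel, ← two_smul ℝ s, smul_smul]; norm_num
      rw [e, add_tmul, mul_add,
        tmul_mul_even (mem_part_zero.1 (even_mem s)),
        tmul_mul_odd (mem_part_one.1 (odd_mem s))]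
      exact add_mem
        (tmul_mem_tensLeft (hS _ (smul_mem _ _ (add_mem hs (hp s hs))) a) _)
        (tmul_mem_tensLeft (hS _ (smul_mem _ _ (sub_mem hs (hp s hs))) a) _)
  | zero => simp
  | add x y _ _ hx hy => rw [mul_add]; exact add_mem hx hy
  | smul r x _ hx => rw [mul_smul_comm]; exact smul_mem _ _ hx

/-- The number operator on a tensor product with the Weil algebra. -/
def numOp (L : Type*) [LieRing L] [LieAlgebra ℝ L] [Module.Finite ℝ L]
    (B : Type*) [Ring B] [Algebra ℝ B] [SuperAlgebra B] : (Weil L ⊗ₛ B) →ₗ[ℝ] (Weil L ⊗ₛ B) :=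
  superMapLin (weilN L) .id

/-- The number operator is injective on the augmentation ideal. -/
theorem eq_zero_of_numOp_eq_zero {z : Weil L ⊗ₛ B} (hz : z ∈ tensLeft B (weilPos L))
    (h : numOp L B z = 0) : z = 0 := by
  have hle : tensLeft B (weilPos L) ≤
      ⨆ (r : ℝ) (_ : r ≠ 0), End.eigenspace (numOp L B) r := by
    refine Submodule.span_le.2 ?_
    rintro _ ⟨s, hs, b, rfl⟩
    refine weilPos_induction (P := fun s => (s ᵍ⊗ₜ b : Weil L ⊗ₛ B) ∈
      ⨆ (r : ℝ) (_ : r ≠ 0), End.eigenspace (numOp L B) r) hs ?_ ?_ ?_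
    · rw [show ((0 : Weil L) ᵍ⊗ₜ b : Weil L ⊗ₛ B) = 0 by simp [GradedTensorProduct.tmul]]
      exact zero_mem _
    · intro x y hx hy; rw [add_tmul]; exact add_mem hx hy
    · intro k hk w hw
      refine Submodule.mem_iSup_of_mem (k : ℝ) (Submodule.mem_iSup_of_mem
        (by exact_mod_cast hk) (End.mem_eigenspace_iff.2 ?_))
      rw [numOp, superMapLin_tmul, hw, smul_tmul]; rfl
  have h0 : z ∈ End.eigenspace (numOp L B) 0 :=
    End.mem_eigenspace_iff.2 (by rw [h, zero_smul])
  exact Submodule.disjoint_def.1 (End.eigenspaces_iSupIndep (numOp L B) 0) z h0 (hle hz)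

/-- Uniqueness of the solution of `N Z = Z β` with given constant term. -/
theorem eq_zero_of_numOp_eq_mul {Z β : PowerSeries (Weil L ⊗ₛ B)}
    (hβ : coeff 0 β = 0) (hZ0 : coeff 0 Z = 0)
    (hZ : ∀ n, n ≠ 0 → coeff n Z ∈ tensLeft B (weilPos L))
    (h : mapLin (numOp L B) Z = Z * β) : Z = 0 := by
  ext n
  induction n using Nat.strong_induction_on with
  | _ n ih =>
    by_cases hn : n = 0
    · rw [hn, hZ0, map_zero]
    · refine eq_zero_of_numOp_eq_zero (hZ n hn) ?_
      rw [← coeff_mapLin, h, coeff_mul]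
      refine sum_eq_zero fun p hp => ?_
      have hp' := HasAntidiagonal.mem_antidiagonal.1 hp
      by_cases h2 : p.2 = 0
      · rw [h2, hβ, mul_zero]
      · rw [ih p.1 (by omega), map_zero, zero_mul]

end TensLeft

/-! ### Bidegrees -/
section Bidegree
variable {B : Type*} [Ring B] [Algebra ℝ B] [SuperAlgebra B]

theorem IsWord.mul' {m n : ℕ} {v w : UL L} (hv : IsWord m v) (hw : IsWord n w) :
    IsWord (m + n) (v * w) := by
  induction hv with
  | one => simpa using hw
  | mul hu _ ih =>
    rw [mul_assoc, add_assoc]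
    exact IsWord.mul hu ih

theorem parity_genI (u : Sym𝔤 L) : parity (genI u) = -genI u := by
  simp [genI, SuperAlgebra.parity]

theorem IsWord.parity {n : ℕ} {w : UL L} (hw : IsWord n w) :
    SuperAlgebra.parity w = (-1 : ℝ) ^ n • w := by
  induction hw with
  | one => simp
  | mul hu _ ih => rw [map_mul, parity_genI, ih, pow_add, pow_add, pow_mul]; simp

theorem ULdeg_mul {m n : ℕ} {v w : UL L} (hv : v ∈ ULdeg L m) (hw : w ∈ ULdeg L n) :
    v * w ∈ ULdeg L (m + n) := by
  have : ULdeg L m * ULdeg L n ≤ ULdeg L (m + n) := by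
    rw [ULdeg, ULdeg, Submodule.span_mul_span]
    refine Submodule.span_le.2 ?_
    rintro _ ⟨v, hv, w, hw, rfl⟩
    exact subset_span (IsWord.mul' hv hw)
  exact this (Submodule.mul_mem_mul hv hw)

theorem parity_of_mem_ULdeg {n : ℕ} {w : UL L} (hw : w ∈ ULdeg L n) :
    parity w = (-1 : ℝ) ^ n • w := by
  induction hw using span_induction with
  | mem x h => exact IsWord.parity h
  | zero => simp
  | add x y _ _ hx hy => rw [map_add, hx, hy, smul_add]
  | smul r x _ hx => rw [map_smul, hx, smul_comm]

theorem tmul_mem_bidegree {S : Submodule ℝ B} {n : ℕ} {b : B} (hb : b ∈ S) {u : UL L}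
    (hu : u ∈ ULdeg L n) : (b ᵍ⊗ₜ u : B ⊗ₛ UL L) ∈ bidegree S n :=
  subset_span ⟨b, hb, u, hu, rfl⟩

theorem bidegree_mul {S T U : Submodule ℝ B} (hST : ∀ s ∈ S, ∀ t ∈ T, s * t ∈ U) {m n : ℕ}
    (hT : ∀ t ∈ T, parity t = (-1 : ℝ) ^ n • t)
    {x y : B ⊗ₛ UL L} (hx : x ∈ bidegree S m) (hy : y ∈ bidegree T n) :
    x * y ∈ bidegree U (m + n) := by
  refine Submodule.span_induction₂ (p := fun x y _ _ => x * y ∈ bidegree U (m + n))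
    ?_ ?_ ?_ ?_ ?_ ?_ ?_ hx hy
  · rintro _ _ ⟨s, hs, u, hu, rfl⟩ ⟨t, ht, v, hv, rfl⟩
    rcases Nat.even_or_odd n with h | h
    · rw [tmul_mul_even (by rw [hT t ht, h.neg_one_pow, one_smul])]
      exact tmul_mem_bidegree (hST s hs t ht) (ULdeg_mul hu hv)
    · rw [tmul_mul_odd (by rw [hT t ht, h.neg_one_pow, neg_one_smul]),
        parity_of_mem_ULdeg hu, smul_mul_assoc, tmul_smul]
      exact smul_mem _ _ (tmul_mem_bidegree (hST s hs t ht) (ULdeg_mul hu hv))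
  · intro y _; rw [zero_mul]; exact zero_mem _
  · intro y _; rw [mul_zero]; exact zero_mem _
  · intro x y z _ _ _ h1 h2; rw [add_mul]; exact add_mem h1 h2
  · intro x y z _ _ _ h1 h2; rw [mul_add]; exact add_mem h1 h2
  · intro r x y _ _ h; rw [smul_mul_assoc]; exact smul_mem _ _ h
  · intro r x y _ _ h; rw [mul_smul_comm]; exact smul_mem _ _ h

/-- Elements of `Sⁿ ⊗ U⁻ⁿ` are even if `Sⁿ` has parity `n`. -/
theorem parity_of_mem_bidegree {S : Submodule ℝ B} {n : ℕ}
    (hS : ∀ s ∈ S, parity s = (-1 : ℝ) ^ n • s) {z : B ⊗ₛ UL L} (hz : z ∈ bidegree S n) :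
    parity z = z := by
  induction hz using span_induction with
  | mem x h =>
    obtain ⟨s, hs, u, hu, rfl⟩ := h
    rw [parity_tmul, hS s hs, parity_of_mem_ULdeg hu, smul_tmul,
      tmul_smul, smul_smul, ← mul_pow]
    simp
  | zero => simp
  | add x y _ _ hx hy => rw [map_add, hx, hy]
  | smul r x _ hx => rw [map_smul, hx]

theorem one_mem_ULdeg : (1 : UL L) ∈ ULdeg L 0 := subset_span IsWord.one

theorem genI_mem_ULdeg {k : ℕ} {u : Sym𝔤 L} (hu : u.IsHomogeneous (k + 1)) :
    genI u ∈ ULdeg L (2 * k + 1) := by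
  have h := IsWord.mul hu IsWord.one
  rw [mul_one, add_zero] at h
  exact subset_span h

theorem bidegree_le_tensLeft (S : Submodule ℝ B) (n : ℕ) :
    bidegree S n ≤ tensLeft (UL L) S := by
  refine Submodule.span_mono ?_
  rintro _ ⟨s, hs, u, _, rfl⟩
  exact ⟨s, hs, u, rfl⟩

theorem tensLeft_mono {A : Type*} [Ring A] [Algebra ℝ A] [SuperAlgebra A] {S T : Submodule ℝ A}
    (h : S ≤ T) : tensLeft B S ≤ tensLeft B T := by
  refine Submodule.span_mono ?_
  rintro _ ⟨s, hs, u, rfl⟩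
  exact ⟨s, h hs, u, rfl⟩

theorem exists_numOp_eq {n : ℕ} (hn : n ≠ 0) {z : Weil L ⊗ₛ UL L}
    (hz : z ∈ bidegree (weilDeg L n) n) :
    ∃ y ∈ bidegree (weilDeg L n) n, numOp L (UL L) y = z := by
  induction hz using span_induction with
  | mem x h =>
    obtain ⟨s, hs, u, hu, rfl⟩ := h
    obtain ⟨v, hv, rfl⟩ := exists_weilN_eq hn hs
    exact ⟨v ᵍ⊗ₜ u, tmul_mem_bidegree hv hu, rfl⟩
  | zero => exact ⟨0, zero_mem _, map_zero _⟩
  | add x y _ _ hx hy =>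
    obtain ⟨v, hv, rfl⟩ := hx
    obtain ⟨w, hw, rfl⟩ := hy
    exact ⟨v + w, add_mem hv hw, map_add _ _ _⟩
  | smul r x _ hx =>
    obtain ⟨v, hv, rfl⟩ := hx
    exact ⟨r • v, smul_mem _ _ hv, map_smul _ _ _⟩

end Bidegree

/-! ### Polarisation and the differential of `D𝔤` -/
section Polarisation
variable {R : Type*} [Ring R] [Algebra ℝ R]

variable (L) in
/-- The canonical element `∑ₐ tᵃ ⊗ e_a` of `S𝔤* ⊗ S𝔤`. Its power `κ ^ k` is the universal
`k`-th power of an element of `𝔤`. -/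
def canonElt : SymDual L ⊗[ℝ] Sym𝔤 L :=
  ∑ a, (MvPolynomial.X a : SymDual L) ⊗ₜ[ℝ] (MvPolynomial.X a : Sym𝔤 L)

/-- The linear map `p ⊗ u ↦ χ(p) L(u)`. -/
def polyEval (χ : SymDual L →ₐ[ℝ] R) (Q : Sym𝔤 L →ₗ[ℝ] R) :
    SymDual L ⊗[ℝ] Sym𝔤 L →ₗ[ℝ] R :=
  LinearMap.mul' ℝ R ∘ₗ TensorProduct.map χ.toLinearMap Q

theorem polyEval_tmul (χ : SymDual L →ₐ[ℝ] R) (Q : Sym𝔤 L →ₗ[ℝ] R) (p : SymDual L)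
    (u : Sym𝔤 L) : polyEval χ Q (p ⊗ₜ u) = χ p * Q u := by
  simp [polyEval]

/-- The coefficient `|α|! / α!` of `t^α ⊗ e^α` in the powers of the canonical element. -/
def multiCoeff (α : Idx L →₀ ℕ) : ℝ :=
  (α.degree.factorial : ℝ) / ∏ a, ((α a).factorial : ℝ)

theorem multiCoeff_ne_zero (α : Idx L →₀ ℕ) : multiCoeff α ≠ 0 :=
  div_ne_zero (by positivity) (Finset.prod_ne_zero_iff.2 fun a _ => by positivity)

theorem canonElt_pow (k : ℕ) : canonElt L ^ k =
    ∑ α ∈ univ.finsuppAntidiag k, multiCoeff α •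
      ((monomial α 1 : SymDual L) ⊗ₜ[ℝ] (monomial α 1 : Sym𝔤 L)) := by
  rw [canonElt, Finset.sum_pow_eq_sum_piAntidiag]
  refine Finset.sum_bij' (fun f _ => Finsupp.equivFunOnFinite.symm f)
    (fun α _ => (α : Idx L → ℕ)) ?_ ?_ ?_ ?_ ?_
  · intro f hf
    simp only [Finset.mem_piAntidiag] at hf
    simp [mem_finsuppAntidiag, hf.1]
  · intro α hα
    simp only [mem_finsuppAntidiag] at hα
    simp [Finset.mem_piAntidiag, hα.1]
  · intro f _; rfl
  · intro α _; ext; rfl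
  · intro f hf
    simp only [Finset.mem_piAntidiag] at hf
    have hdeg : (Finsupp.equivFunOnFinite.symm f : Idx L →₀ ℕ).degree = k := by
      rw [Finsupp.degree_eq_sum]; simpa using hf.1
    have hm : ((Nat.multinomial univ f : ℕ) : ℝ) =
        multiCoeff (Finsupp.equivFunOnFinite.symm f : Idx L →₀ ℕ) := by
      rw [multiCoeff, hdeg, eq_div_iff (Finset.prod_ne_zero_iff.2 fun a _ => by positivity)]
      have := Nat.multinomial_spec univ f
      rw [hf.1] at this
      rw [mul_comm]
      exact_mod_cast this
    have hp : ∏ a, ((MvPolynomial.X a : SymDual L) ⊗ₜ[ℝ] (MvPolynomial.X a : Sym𝔤 L)) ^ f a =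
        (monomial (Finsupp.equivFunOnFinite.symm f : Idx L →₀ ℕ) 1 : SymDual L) ⊗ₜ[ℝ]
          (monomial (Finsupp.equivFunOnFinite.symm f : Idx L →₀ ℕ) 1 : Sym𝔤 L) := by
      have hmon : (monomial (Finsupp.equivFunOnFinite.symm f : Idx L →₀ ℕ) 1 :
          Sym𝔤 L) = ∏ a, MvPolynomial.X a ^ f a := by
        rw [MvPolynomial.monomial_eq, Finsupp.prod_fintype _ _ (fun _ => by simp)]; simp
      rw [hmon]
      simp only [Algebra.TensorProduct.tmul_pow]
      induction (univ : Finset (Idx L)) using Finset.induction_on with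
      | empty => simp [Algebra.TensorProduct.one_def]
      | insert a s ha ih => simp [Finset.prod_insert ha, ih, tmul_mul_tmul]
    rw [hp, ← hm, Nat.cast_smul_eq_nsmul, nsmul_eq_mul]

theorem polyEval_canonElt_pow (χ : SymDual L →ₐ[ℝ] R) (Q : Sym𝔤 L →ₗ[ℝ] R) (k : ℕ) :
    polyEval χ Q (canonElt L ^ k) = ∑ α ∈ univ.finsuppAntidiag k, multiCoeff α •
      (χ (monomial α 1) * Q (monomial α 1)) := by
  rw [canonElt_pow, map_sum]
  simp only [map_smul, polyEval_tmul]

theorem multiCoeff_mul (β γ : Idx L →₀ ℕ) :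
    multiCoeff (β + γ) * ((∏ a, (((β + γ) a).choose (β a) : ℝ)) /
      ((β + γ).degree.choose β.degree : ℝ)) = multiCoeff β * multiCoeff γ := by
  simp only [multiCoeff, Finsupp.coe_add, Pi.add_apply, map_add, Nat.cast_add_choose,
    Finset.prod_div_distrib, Finset.prod_mul_distrib]
  have h (α : Idx L →₀ ℕ) : ∏ a, ((α a).factorial : ℝ) ≠ 0 :=
    Finset.prod_ne_zero_iff.2 fun a _ => by positivity
  have h3 : ∏ a, (((β a + γ a).factorial : ℕ) : ℝ) ≠ 0 :=
    Finset.prod_ne_zero_iff.2 fun a _ => by positivity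
  have h4 := h β
  have h5 := h γ
  have h6 (n : ℕ) : (n.factorial : ℝ) ≠ 0 := by positivity
  have h7 := h6 β.degree
  have h8 := h6 γ.degree
  have h9 := h6 (β.degree + γ.degree)
  field_simp

/-- The formula `d I(x ^ k) = ∑ I(x ^ s) I(x ^ (k - s))`, with `l(x)` added if `k = 1`, for the
universal element `κ`. -/
theorem polyEval_dGen (χ : SymDual L →ₐ[ℝ] R) (J : UD L →ₐ[ℝ] R)
    (hχ : ∀ p w, Commute (χ p) (J w)) (k : ℕ) :
    polyEval χ (J.toLinearMap ∘ₗ dGen) (canonElt L ^ k) =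
      ∑ p ∈ HasAntidiagonal.antidiagonal k,
        polyEval χ (J.toLinearMap ∘ₗ udI) (canonElt L ^ p.1) *
          polyEval χ (J.toLinearMap ∘ₗ udI) (canonElt L ^ p.2) +
      if k = 1 then ∑ a, χ (MvPolynomial.X a) * J (udL (lieBasis L a)) else 0 := by
  have hd (α : Idx L →₀ ℕ) : dGen (monomial α 1 : Sym𝔤 L) =
      (∑ a, if α = Finsupp.single a 1 then udL (lieBasis L a) else 0) +
    ∑ p ∈ HasAntidiagonal.antidiagonal α,
      ((∏ a, ((α a).choose (p.1 a) : ℝ)) / (α.degree.choose p.1.degree : ℝ)) •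
        (udI (monomial p.1 1) * udI (monomial p.2 1)) := by
    rw [show (monomial α 1 : Sym𝔤 L) = basisMonomials (Idx L) ℝ α by simp,
      dGen, Module.Basis.constr_basis]
  simp only [polyEval_canonElt_pow, comp_apply, AlgHom.toLinearMap_apply, hd, map_add,
    map_sum, mul_add, smul_add, sum_add_distrib]
  rw [add_comm]
  congr 1
  · have hF (α : Idx L →₀ ℕ) : multiCoeff α • (χ (monomial α 1) *
        ∑ p ∈ HasAntidiagonal.antidiagonal α,
          J (((∏ a, ((α a).choose (p.1 a) : ℝ)) / (α.degree.choose p.1.degree : ℝ)) •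
            (udI (monomial p.1 1) * udI (monomial p.2 1)))) =
        ∑ p ∈ HasAntidiagonal.antidiagonal α,
          (multiCoeff p.1 • (χ (monomial p.1 1) * J (udI (monomial p.1 1))))
          * (multiCoeff p.2 •
            (χ (monomial p.2 1) * J (udI (monomial p.2 1)))) := by
      rw [mul_sum, smul_sum]
      refine sum_congr rfl fun p hp => ?_
      obtain rfl := HasAntidiagonal.mem_antidiagonal.1 hp
      have hm : (monomial (p.1 + p.2) 1 : SymDual L) =
          monomial p.1 1 * monomial p.2 1 := by
        simp [MvPolynomial.monomial_mul]
      rw [map_smul, mul_smul_comm, smul_smul, multiCoeff_mul, smul_mul_smul_comm, hm, map_mul,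
        map_mul]
      congr 1
      have := (hχ (monomial p.2 1) (udI (monomial p.1 1))).eq
      rw [mul_assoc, ← mul_assoc _ (J _) (J _), this]
      simp only [mul_assoc]
    rw [sum_congr rfl fun α _ => hF α]
    simp only [Finset.sum_mul_sum]
    simp only [← Finset.sum_product']
    rw [Finset.sum_sigma', Finset.sum_sigma']
    refine Finset.sum_bij' (fun x _ => ⟨⟨x.2.1.degree, x.2.2.degree⟩, x.2⟩)
      (fun y _ => ⟨y.2.1 + y.2.2, y.2⟩) ?_ ?_ ?_ ?_ ?_
    · rintro ⟨α, β, γ⟩ h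
      simp only [mem_sigma, mem_finsuppAntidiag,
        HasAntidiagonal.mem_antidiagonal] at h
      obtain ⟨⟨h, -⟩, rfl⟩ := h
      simp only [mem_sigma, mem_product, mem_finsuppAntidiag,
        HasAntidiagonal.mem_antidiagonal, Finset.subset_univ, and_true,
        Finsupp.degree_eq_sum]
      rw [← h, ← sum_add_distrib]
      simp
    · rintro ⟨⟨m, n⟩, β, γ⟩ h
      simp only [mem_sigma, mem_product, mem_finsuppAntidiag,
        HasAntidiagonal.mem_antidiagonal, Finset.subset_univ, and_true] at h ⊢
      simp [sum_add_distrib, h]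
    · rintro ⟨α, β, γ⟩ h
      simp only [mem_sigma, HasAntidiagonal.mem_antidiagonal] at h
      obtain ⟨-, rfl⟩ := h
      rfl
    · rintro ⟨⟨m, n⟩, β, γ⟩ h
      simp only [mem_sigma, mem_product, mem_finsuppAntidiag,
        HasAntidiagonal.mem_antidiagonal, Finset.subset_univ, and_true] at h
      obtain ⟨-, rfl, rfl⟩ := h
      simp [Finsupp.degree_eq_sum]
    · rintro ⟨α, β, γ⟩ h; rfl
  · have hc (a : Idx L) : multiCoeff (Finsupp.single a 1 : Idx L →₀ ℕ) = 1 := by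
      rw [multiCoeff, Finset.prod_eq_one]
      · simp
      · intro b _
        rw [Finsupp.single_apply]; split_ifs <;> simp
    simp only [mul_sum, smul_sum]
    rw [sum_comm]
    split_ifs with hk
    · refine sum_congr rfl fun a _ => ?_
      rw [sum_eq_single (Finsupp.single a 1)]
      · rw [if_pos rfl, hc, one_smul]; rfl
      · intro b _ hb
        rw [if_neg hb, map_zero, mul_zero, smul_zero]
      · intro h
        simp [mem_finsuppAntidiag, hk, Finsupp.single_apply] at h
    · refine sum_eq_zero fun a _ => sum_eq_zero fun α hα => ?_
      rw [if_neg, map_zero, mul_zero, smul_zero]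
      rintro rfl
      simp [mem_finsuppAntidiag, Finsupp.single_apply] at hα
      exact hk hα.symm

theorem symι_apply (x : L) :
    symι x = ∑ a, (lieBasis L).repr x a • (MvPolynomial.X a : Sym𝔤 L) := by
  simp [symι, Module.Basis.constr_apply_fintype]

/-- Substituting for `t` the coordinates of a vector `x` turns `κ ^ k` into `x ^ k`. -/
theorem polyEval_algebraMap (Q : Sym𝔤 L →ₗ[ℝ] R) (x : L) (k : ℕ) :
    polyEval ((Algebra.ofId ℝ R).comp (aeval fun a => (lieBasis L).repr x a)) Q
      (canonElt L ^ k) = Q (symι x ^ k) := by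
  have h (z : SymDual L ⊗[ℝ] Sym𝔤 L) :
      polyEval ((Algebra.ofId ℝ R).comp (aeval fun a => (lieBasis L).repr x a)) Q z =
      Q (Algebra.TensorProduct.lift ((Algebra.ofId ℝ (Sym𝔤 L)).comp
        (aeval fun a => (lieBasis L).repr x a)) (AlgHom.id ℝ (Sym𝔤 L))
        (fun _ _ => Commute.all _ _) z) := by
    induction z using TensorProduct.induction_on with
    | zero => simp
    | tmul p u =>
      rw [polyEval_tmul, Algebra.TensorProduct.lift_tmul]
      simp [Algebra.ofId_apply, Algebra.algebraMap_eq_smul_one, ← smul_eq_C_mul]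
    | add x y hx hy => simp only [map_add, hx, hy]
  rw [h, map_pow]
  congr 2
  rw [canonElt, map_sum, symι_apply]
  simp [Algebra.ofId_apply, smul_eq_C_mul]

/-- The differential on the generators `I(x ^ k)`. -/
theorem dGen_symι_pow (x : L) (k : ℕ) : dGen (symι x ^ k) =
    ∑ p ∈ HasAntidiagonal.antidiagonal k, udI (symι x ^ p.1) * udI (symι x ^ p.2) +
      if k = 1 then udL x else 0 := by
  have := polyEval_dGen ((Algebra.ofId ℝ (UD L)).comp
    (aeval fun a => (lieBasis L).repr x a)) (AlgHom.id ℝ (UD L))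
    (fun p w => by
      rw [AlgHom.comp_apply, Algebra.ofId_apply]; exact Algebra.commute_algebraMap_left _ _) k
  simp only [polyEval_algebraMap] at this
  refine this.trans ?_
  congr 1
  split_ifs
  · conv_rhs => rw [← (lieBasis L).sum_repr x, map_sum]
    simp only [map_smul]
    simp [Algebra.ofId_apply, Algebra.algebraMap_eq_smul_one]
  · rfl

/-- The powers `x ^ k` of vectors `x` span `S𝔤`. -/
theorem sym_linearMap_ext {V : Type*} [AddCommGroup V] [Module ℝ V] {Q Q' : Sym𝔤 L →ₗ[ℝ] V}
    (h : ∀ (x : L) (k : ℕ), Q (symι x ^ k) = Q' (symι x ^ k)) : Q = Q' := by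
  rw [← sub_eq_zero]
  refine (basisMonomials (Idx L) ℝ).ext fun β => ?_
  rw [LinearMap.zero_apply, ← Module.forall_dual_apply_eq_zero_iff ℝ]
  intro l
  have hpoly : (∑ α ∈ univ.finsuppAntidiag β.degree,
      monomial α (multiCoeff α * l ((Q - Q') (monomial α 1))) :
        MvPolynomial (Idx L) ℝ) = 0 := by
    refine MvPolynomial.funext fun c => ?_
    have h1 := polyEval_algebraMap (R := ℝ) (l ∘ₗ (Q - Q'))
      ((lieBasis L).equivFun.symm c) β.degree
    rw [polyEval_canonElt_pow, comp_apply, LinearMap.sub_apply, h, sub_self,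
      map_zero] at h1
    rw [map_sum, map_zero, ← h1]
    refine sum_congr rfl fun α _ => ?_
    have hr : (fun a => (lieBasis L).repr ((lieBasis L).equivFun.symm c) a) = c := by
      ext a
      rw [← Module.Basis.equivFun_apply, LinearEquiv.apply_symm_apply]
    simp only [AlgHom.comp_apply, hr, MvPolynomial.eval_monomial, MvPolynomial.aeval_monomial,
      comp_apply, Algebra.ofId_apply, smul_eq_mul, map_one, one_mul, Algebra.algebraMap_self,
      RingHom.id_apply]
    ring
  have h2 := congrArg (MvPolynomial.coeff β) hpoly
  rw [MvPolynomial.coeff_sum, MvPolynomial.coeff_zero, sum_eq_single β,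
    MvPolynomial.coeff_monomial, if_pos rfl] at h2
  · simpa using (mul_eq_zero.1 h2).resolve_left (multiCoeff_ne_zero β)
  · intro α _ hα
    rw [MvPolynomial.coeff_monomial, if_neg hα]
  · intro h
    simp [mem_finsuppAntidiag, Finsupp.degree_eq_sum] at h

end Polarisation

/-! ### The enveloping algebra of `D𝔤` -/
section EnvelopingAlgebra

theorem toSymPlus_one : toSymPlus (1 : Sym𝔤 L) = 0 := by
  apply Subtype.ext
  rw [coe_toSymPlus]
  simp

theorem toSymPlus_coe (u : SymPlus L) : toSymPlus (u : Sym𝔤 L) = u := by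
  have hu : MvPolynomial.coeff 0 (u : Sym𝔤 L) = 0 := by
    have := u.2; simpa [SymPlus] using this
  apply Subtype.ext; rw [coe_toSymPlus, hu]; simp

theorem sym_induction {P : Sym𝔤 L → Prop} (u : Sym𝔤 L) (one : P 1)
    (smul : ∀ (r : ℝ) u, P u → P (r • u)) (add : ∀ u v, P u → P v → P (u + v))
    (coe : ∀ u : SymPlus L, P u) : P u := by
  have : u = (toSymPlus u : Sym𝔤 L) + MvPolynomial.coeff 0 u • 1 := by
    rw [coe_toSymPlus, smul_eq_C_mul]; simp
  rw [this]
  exact add _ _ (coe _) (smul _ _ one)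

theorem udI_one : udI (1 : Sym𝔤 L) = 0 := by
  rw [udI, comp_apply, comp_apply, comp_apply, toSymPlus_one]
  simp only [map_zero]

section Neg
-- These restate ring identities for the negation that is found on `U(D𝔤)` by unification.
variable (v w : UD L)
theorem UD.neg_mul : -v * w = -(v * w) := _root_.neg_mul v w
theorem UD.mul_neg : v * -w = -(v * w) := _root_.mul_neg v w
end Neg

theorem genI_one : genI (1 : Sym𝔤 L) = 0 := by simp [genI, toSymPlus_one]

theorem ulToUD_genI (u : Sym𝔤 L) : ulToUD L (genI u) = udI u := by
  induction u using sym_induction with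
  | one => rw [udI_one, genI_one, map_zero]
  | smul r u hu => rw [map_smul, map_smul, map_smul, hu]
  | add u v hu hv => rw [map_add, map_add, map_add, hu, hv]
  | coe u => rw [genI_coe, ulToUD, TensorAlgebra.lift_ι_apply]; rfl

theorem dUL_genI (u : Sym𝔤 L) : dUL L (genI u) = dGen u := by
  induction u using sym_induction with
  | one =>
    have := dGen_symι_pow (0 : L) 0
    rw [pow_zero, if_neg (by decide), add_zero] at this
    rw [this, genI_one, map_zero, show HasAntidiagonal.antidiagonal 0 = {((0 : ℕ), 0)} from rfl,
      Finset.sum_singleton, pow_zero, udI_one, mul_zero]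
  | smul r u hu => rw [map_smul, map_smul, map_smul, hu]
  | add u v hu hv => rw [map_add, map_add, map_add, hu, hv]
  | coe u => rw [genI_coe, dUL_gen]

theorem parity_udI (u : Sym𝔤 L) : parity (udI u) = -udI u := by
  rw [← ulToUD_genI, ← parity_ulToUD, parity_genI, map_neg]

theorem parity_udL (x : L) : parity (udL x) = udL x := by
  change udParity (RingQuot.mkAlgHom ℝ (UDRel L) (TensorAlgebra.ι ℝ (x, 0))) = _
  rw [udParity_ι, neg_zero]; rfl

theorem udL_lie (x y : L) : udL x * udL y - udL y * udL x = udL ⁅x, y⁆ := by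
  have := RingQuot.mkAlgHom_rel ℝ (UDRel.lie x y)
  rw [map_sub, map_mul, map_mul] at this
  exact this

theorem udL_udI (x : L) (u : Sym𝔤 L) : udL x * udI u - udI u * udL x = udI (symAd x u) := by
  induction u using sym_induction with
  | one => rw [udI_one]; simp
  | smul r u hu =>
    rw [map_smul, Derivation.map_smul, map_smul, ← hu, mul_smul_comm, smul_mul_assoc, smul_sub]
  | add u v hu hv => rw [map_add, map_add, map_add, ← hu, ← hv]; noncomm_ring
  | coe u =>
    have := RingQuot.mkAlgHom_rel ℝ (UDRel.act x u)
    rw [map_sub, map_mul, map_mul] at this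
    rw [udI, comp_apply, comp_apply, comp_apply, toSymPlus_coe]
    exact this

theorem parity_dGen (u : Sym𝔤 L) : parity (dGen u) = dGen u := by
  have : (parity : UD L →ₐ[ℝ] UD L).toLinearMap ∘ₗ dGen = dGen := by
    refine sym_linearMap_ext fun x k => ?_
    rw [comp_apply, dGen_symι_pow, AlgHom.toLinearMap_apply, map_add, map_sum]
    congr 1
    · simp [parity_udI, UD.neg_mul, UD.mul_neg]
    · split_ifs
      · exact parity_udL x
      · simp
  exact LinearMap.congr_fun this u

theorem dUL_isDerOver : IsDerOver (ulToUD L) ((ulToUD L).comp parity) (dUL L) := dUL_mul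

theorem dUL_algebraMap (r : ℝ) : dUL L (algebraMap ℝ _ r) = 0 := by
  rw [Algebra.algebraMap_eq_smul_one, map_smul, dUL_isDerOver.map_one, smul_zero]

theorem dUL_parity (w : UL L) : dUL L (parity w) = -parity (dUL L w) := by
  induction w using TensorAlgebra.induction with
  | algebraMap r => rw [AlgHom.commutes, dUL_algebraMap]; simp
  | ι u => rw [← genI_coe, parity_genI, map_neg, dUL_genI, parity_dGen]
  | mul v w hv hw =>
    rw [map_mul, dUL_mul, dUL_mul, hv, hw, map_add, map_mul, map_mul, parity_ulToUD,
      parity_ulToUD, UD.neg_mul, UD.mul_neg]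
    abel
  | add v w hv hw => simp only [map_add, hv, hw, neg_add]

theorem symMap_symAd (φ : L →ₗ⁅ℝ⁆ L) (x : L) (u : Sym𝔤 L) :
    symMap (φ : L →ₗ[ℝ] L) (symAd x u) = symAd (φ x) (symMap (φ : L →ₗ[ℝ] L) u) := by
  have hι (x y : L) : symAd x (symι y) = symι ⁅x, y⁆ := by
    have : (symAd x : Sym𝔤 L →ₗ[ℝ] Sym𝔤 L) ∘ₗ symι = symι ∘ₗ (LieAlgebra.ad ℝ L x : L →ₗ[ℝ] L) :=
      (lieBasis L).ext fun a => by simp [symAd, symι]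
    exact LinearMap.congr_fun this y
  induction u using MvPolynomial.induction_on with
  | C r => simp [← MvPolynomial.algebraMap_eq]
  | add p q hp hq => simp only [map_add, hp, hq]
  | mul_X p a hp =>
    have ha : (MvPolynomial.X a : Sym𝔤 L) = symι (lieBasis L a) := by simp [symι]
    simp only [Derivation.leibniz, map_mul, map_add, smul_eq_mul, hp, ha, symMap_symι, hι]
    simp

/-- The endomorphism of `U(D𝔤)` induced by an endomorphism of the Lie algebra `𝔤`. -/
def udMap (φ : L →ₗ⁅ℝ⁆ L) : UD L →ₐ[ℝ] UD L :=
  RingQuot.liftAlgHom ℝ ⟨TensorAlgebra.lift ℝ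
    ((udL ∘ₗ (φ : L →ₗ[ℝ] L)).coprod
      (udI ∘ₗ (symMap (φ : L →ₗ[ℝ] L)).toLinearMap ∘ₗ (SymPlus L).subtype)), by
    intro a b h
    cases h with
    | lie x y => simp [udL_lie]
    | act x u =>
      have h0 : symMap (φ : L →ₗ[ℝ] L) (toSymPlus (symAd x (u : Sym𝔤 L)) : Sym𝔤 L) =
          symMap (φ : L →ₗ[ℝ] L) (symAd x (u : Sym𝔤 L)) -
            MvPolynomial.coeff 0 (symAd x (u : Sym𝔤 L)) • 1 := by
        rw [coe_toSymPlus, map_sub, smul_eq_C_mul, ← MvPolynomial.algebraMap_eq,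
          AlgHom.commutes, mul_one]
      simp [udL_udI, h0, symMap_symAd, udI_one]⟩

theorem udMap_udL (φ : L →ₗ⁅ℝ⁆ L) (x : L) : udMap φ (udL x) = udL (φ x) := by
  refine (RingQuot.liftAlgHom_mkAlgHom_apply _ _ _ _).trans ?_
  simp

theorem udMap_udI (φ : L →ₗ⁅ℝ⁆ L) (u : Sym𝔤 L) :
    udMap φ (udI u) = udI (symMap (φ : L →ₗ[ℝ] L) u) := by
  induction u using sym_induction with
  | one => rw [udI_one, map_zero, map_one, udI_one]
  | smul r u hu => rw [map_smul, map_smul, map_smul, map_smul, hu]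
  | add u v hu hv => rw [map_add, map_add, map_add, map_add, hu, hv]
  | coe u =>
    refine (RingQuot.liftAlgHom_mkAlgHom_apply _ _ _ _).trans ?_
    simp [toSymPlus_coe]

theorem udMap_ulToUD (φ : L →ₗ⁅ℝ⁆ L) (w : UL L) :
    udMap φ (ulToUD L w) = ulToUD L (ulMap (φ : L →ₗ[ℝ] L) w) := by
  induction w using TensorAlgebra.induction with
  | algebraMap r => simp
  | ι u => rw [← genI_coe, ulToUD_genI, udMap_udI, ulMap_genI, ulToUD_genI]
  | mul v w hv hw => simp only [map_mul, hv, hw]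
  | add v w hv hw => simp only [map_add, hv, hw]

theorem ud_algHom_ext {R : Type*} [Ring R] [Algebra ℝ R] {f g : UD L →ₐ[ℝ] R}
    (hL : ∀ x, f (udL x) = g (udL x)) (hI : ∀ u, f (udI u) = g (udI u)) : f = g := by
  apply RingQuot.ringQuot_ext'
  apply TensorAlgebra.hom_ext
  refine LinearMap.prod_ext (LinearMap.ext hL) (LinearMap.ext fun u => ?_)
  have := hI (u : Sym𝔤 L)
  rwa [udI, comp_apply, comp_apply, comp_apply, toSymPlus_coe] at this

theorem udMap_parity (φ : L →ₗ⁅ℝ⁆ L) (w : UD L) :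
    udMap φ (parity w) = parity (udMap φ w) := by
  have : (udMap φ).comp parity = parity.comp (udMap φ) := by
    refine ud_algHom_ext (fun x => ?_) fun u => ?_
    · simp [parity_udL, udMap_udL]
    · simp [parity_udI, udMap_udI]
  exact DFunLike.congr_fun this w

theorem udMap_dGen (φ : L →ₗ⁅ℝ⁆ L) (u : Sym𝔤 L) :
    udMap φ (dGen u) = dGen (symMap (φ : L →ₗ[ℝ] L) u) := by
  have : (udMap φ).toLinearMap ∘ₗ dGen = dGen ∘ₗ (symMap (φ : L →ₗ[ℝ] L)).toLinearMap := by
    refine sym_linearMap_ext fun x k => ?_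
    simp only [comp_apply, AlgHom.toLinearMap_apply, map_pow, symMap_symι]
    rw [dGen_symι_pow, dGen_symι_pow, map_add, map_sum]
    congr 1
    · simp [udMap_udI, symMap_symι]
    · split_ifs
      · exact udMap_udL φ x
      · simp
  exact LinearMap.congr_fun this u

/-- The differential is equivariant under automorphisms of `𝔤`. -/
theorem dUL_ulMap (φ : L →ₗ⁅ℝ⁆ L) (w : UL L) :
    dUL L (ulMap (φ : L →ₗ[ℝ] L) w) = udMap φ (dUL L w) := by
  induction w using TensorAlgebra.induction with
  | algebraMap r => rw [AlgHom.commutes, dUL_algebraMap, map_zero]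
  | ι u => rw [← genI_coe, ulMap_genI, dUL_genI, dUL_genI, udMap_dGen]
  | mul v w hv hw =>
    rw [map_mul, dUL_mul, dUL_mul, hv, hw, map_add, map_mul, map_mul, udMap_ulToUD, udMap_ulToUD,
      ulMap_parity]
  | add v w hv hw => simp only [map_add, hv, hw]

end EnvelopingAlgebra

/-! ### The universal element `i(t)` -/
section UniversalElement
variable {T : Type*} [Ring T] [Algebra ℝ T] [SuperAlgebra T]

/-- The map `p ⊗ u ↦ p ⊗ L(u)` to `W𝔤 ⊗ T`. -/
def polyTens (Q : Sym𝔤 L →ₗ[ℝ] T) : SymDual L ⊗[ℝ] Sym𝔤 L →ₗ[ℝ] (Weil L ⊗ₛ T) :=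
  polyEval ((GradedTensorProduct.includeLeft (part (Weil L)) (part T)).comp
    Algebra.TensorProduct.includeLeft)
    ((GradedTensorProduct.includeRight (part (Weil L)) (part T)).toLinearMap ∘ₗ Q)

theorem polyTens_tmul (Q : Sym𝔤 L →ₗ[ℝ] T) (p : SymDual L) (u : Sym𝔤 L) :
    polyTens Q (p ⊗ₜ u) = ((p ⊗ₜ[ℝ] 1 : Weil L) ᵍ⊗ₜ Q u : Weil L ⊗ₛ T) := by
  rw [polyTens, polyEval_tmul]
  exact (GradedTensorProduct.tmul_one_mul_one_tmul _ _ _ _)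

theorem parity_tmul_one (p : SymDual L) : parity (p ⊗ₜ[ℝ] 1 : Weil L) = p ⊗ₜ[ℝ] 1 := by
  rw [Weil.parity_tmul, map_one]

theorem superMapLin_polyTens {T' : Type*} [Ring T'] [Algebra ℝ T'] [SuperAlgebra T']
    {f : Weil L →ₗ[ℝ] Weil L} (hf : ∀ p : SymDual L, f (p ⊗ₜ[ℝ] 1) = p ⊗ₜ[ℝ] 1)
    (g : T →ₗ[ℝ] T') (Q : Sym𝔤 L →ₗ[ℝ] T) (z : SymDual L ⊗[ℝ] Sym𝔤 L) :
    superMapLin f g (polyTens Q z) = polyTens (g ∘ₗ Q) z := by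
  induction z using TensorProduct.induction_on with
  | zero => simp only [map_zero]
  | tmul p u => rw [polyTens_tmul, superMapLin_tmul, polyTens_tmul, hf]; rfl
  | add x y hx hy => simp only [map_add, hx, hy]

/-- The identity `d_{D𝔤} i(t) = i(t)² + l(t)`, in degree `k`. -/
theorem superMapLin_dUL_canonElt_pow (k : ℕ) :
    superMapLin (parity : Weil L →ₐ[ℝ] Weil L).toLinearMap (dUL L)
      (polyTens genI (canonElt L ^ k)) =
    ∑ p ∈ HasAntidiagonal.antidiagonal k,
        polyTens udI (canonElt L ^ p.1) * polyTens udI (canonElt L ^ p.2) +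
      if k = 1 then ∑ a, (weilt a ᵍ⊗ₜ udL (lieBasis L a) : Weil L ⊗ₛ UD L) else 0 := by
  rw [superMapLin_polyTens (fun p => parity_tmul_one p),
    show dUL L ∘ₗ genI = dGen from LinearMap.ext dUL_genI]
  have := polyEval_dGen ((GradedTensorProduct.includeLeft (part (Weil L)) (part (UD L))).comp
    Algebra.TensorProduct.includeLeft)
    (GradedTensorProduct.includeRight (part (Weil L)) (part (UD L))) (fun p w => by
      change (((p ⊗ₜ[ℝ] 1 : Weil L) ᵍ⊗ₜ 1 : Weil L ⊗ₛ UD L)) * ((1 : Weil L) ᵍ⊗ₜ w) =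
        ((1 : Weil L) ᵍ⊗ₜ w) * (((p ⊗ₜ[ℝ] 1 : Weil L) ᵍ⊗ₜ 1 : Weil L ⊗ₛ UD L))
      rw [tmul_mul_even (parity_tmul_one p), tmul_one_mul]
      simp) k
  refine this.trans ?_
  congr 1
  split_ifs
  · refine sum_congr rfl fun a _ => ?_
    exact (GradedTensorProduct.tmul_one_mul_one_tmul _ _ _ _)
  · rfl

theorem weilL_tmul_one_mul (x : L) (p q : SymDual L) :
    weilL x ((p * q) ⊗ₜ[ℝ] 1) = weilL x (p ⊗ₜ[ℝ] 1) * (q ⊗ₜ[ℝ] 1) +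
      (p ⊗ₜ[ℝ] 1) * weilL x (q ⊗ₜ[ℝ] 1) := by
  have := weilL_isEvenDer x (p ⊗ₜ[ℝ] 1) (q ⊗ₜ[ℝ] 1)
  rwa [tmul_mul_tmul, mul_one] at this

/-- The derivation of `S𝔤*` which extends the coadjoint action of `x`. -/
def symDualAd (x : L) : Derivation ℝ (SymDual L) (SymDual L) :=
  MvPolynomial.mkDerivation ℝ fun a =>
    -∑ c, (lieBasis L).repr ⁅x, lieBasis L c⁆ a • (MvPolynomial.X c : SymDual L)

theorem weilL_tmul_one (x : L) (p : SymDual L) :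
    weilL x (p ⊗ₜ[ℝ] 1) = (symDualAd x p) ⊗ₜ[ℝ] (1 : ExteriorAlgebra ℝ (Dual ℝ L)) := by
  induction p using MvPolynomial.induction_on with
  | C r =>
    have h1 : ((MvPolynomial.C r : SymDual L) ⊗ₜ[ℝ] 1 : Weil L) = r • 1 := by
      rw [Algebra.TensorProduct.one_def, TensorProduct.smul_tmul', smul_eq_C_mul,
        mul_one]
    rw [h1, map_smul, (weilL_isEvenDer x).map_one]
    simp
  | add p q hp hq => rw [TensorProduct.add_tmul, map_add, map_add, hp, hq, TensorProduct.add_tmul]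
  | mul_X p a hp =>
    have hX : weilL x ((MvPolynomial.X a : SymDual L) ⊗ₜ[ℝ] 1) =
        (symDualAd x (MvPolynomial.X a)) ⊗ₜ[ℝ] (1 : ExteriorAlgebra ℝ (Dual ℝ L)) := by
      refine (weilL_weilt x a).trans ?_
      rw [symDualAd, mkDerivation_X, TensorProduct.neg_tmul, TensorProduct.sum_tmul]
      rfl
    rw [weilL_tmul_one_mul, hp, hX, Derivation.leibniz, TensorProduct.add_tmul,
      tmul_mul_tmul, tmul_mul_tmul, mul_one, add_comm]
    simp only [smul_eq_mul, mul_comm]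

/-- The differential of an element of `S𝔤*` is `θ^b L_b`. -/
theorem weilD_tmul_one (p : SymDual L) :
    weilD L (p ⊗ₜ[ℝ] 1) = ∑ b, weilθ b * weilL (lieBasis L b) (p ⊗ₜ[ℝ] 1) := by
  induction p using MvPolynomial.induction_on with
  | C r =>
    have h1 : ((MvPolynomial.C r : SymDual L) ⊗ₜ[ℝ] 1 : Weil L) = r • 1 := by
      rw [Algebra.TensorProduct.one_def, TensorProduct.smul_tmul', smul_eq_C_mul,
        mul_one]
    simp [h1, (weilL_isEvenDer _).map_one, weilD_isOddDer.map_one]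
  | add p q hp hq =>
    simp only [TensorProduct.add_tmul, map_add, hp, hq, mul_add, sum_add_distrib]
  | mul_X p a hp =>
    have hX : weilD L ((MvPolynomial.X a : SymDual L) ⊗ₜ[ℝ] 1) =
        ∑ b, weilθ b * weilL (lieBasis L b) ((MvPolynomial.X a : SymDual L) ⊗ₜ[ℝ] 1) := by
      refine (weilD_weilt a).trans ?_
      rw [← sum_neg_distrib]
      refine sum_congr rfl fun b _ => ?_
      change _ = weilθ b * weilL (lieBasis L b) (weilt a)
      rw [weilL_weilt, Weil.mul_neg, mul_sum]
      simp only [mul_smul_comm]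
      rfl
    have hd := weilD_isOddDer (L := L) (p ⊗ₜ[ℝ] 1) ((MvPolynomial.X a : SymDual L) ⊗ₜ[ℝ] 1)
    rw [tmul_mul_tmul, mul_one, parity_tmul_one] at hd
    rw [hd]
    simp only [weilL_tmul_one_mul, mul_add, sum_add_distrib]
    rw [AlgHom.id_apply, hp, hX, sum_mul, mul_sum]
    congr 1
    · simp only [mul_assoc]
    · refine sum_congr rfl fun b _ => ?_
      rw [← mul_assoc, ← mul_assoc, Weil.even_central (parity_tmul_one p)]

/-- The action of `x` on `S𝔤* ⊗ S𝔤`. -/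
def canonAd (x : L) : SymDual L ⊗[ℝ] Sym𝔤 L →ₗ[ℝ] SymDual L ⊗[ℝ] Sym𝔤 L :=
  TensorProduct.map (symDualAd x : SymDual L →ₗ[ℝ] SymDual L) LinearMap.id +
    TensorProduct.map LinearMap.id (symAd x : Sym𝔤 L →ₗ[ℝ] Sym𝔤 L)

theorem canonAd_tmul (x : L) (p : SymDual L) (u : Sym𝔤 L) :
    canonAd x (p ⊗ₜ u) = symDualAd x p ⊗ₜ u + p ⊗ₜ symAd x u := rfl

theorem canonElt_pow_invariant (x : L) (k : ℕ) : canonAd x (canonElt L ^ k) = 0 := by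
  set D := canonAd x with hD
  have hder (y z : SymDual L ⊗[ℝ] Sym𝔤 L) : D (y * z) = D y * z + y * D z := by
    induction y using TensorProduct.induction_on with
    | zero => simp
    | add y y' hy hy' => simp only [add_mul, map_add, hy, hy']; ring
    | tmul p u =>
      induction z using TensorProduct.induction_on with
      | zero => simp
      | add y y' hy hy' => simp only [mul_add, map_add, hy, hy']; ring
      | tmul q v =>
        simp only [hD, tmul_mul_tmul, canonAd_tmul, Derivation.leibniz, smul_eq_mul,
          TensorProduct.add_tmul,
          TensorProduct.tmul_add, add_mul, mul_add, mul_comm]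
        abel
  have h1 : D (canonElt L) = 0 := by
    have hs (a : Idx L) : symAd x (MvPolynomial.X a : Sym𝔤 L) =
        ∑ c, (lieBasis L).repr ⁅x, lieBasis L a⁆ c • (MvPolynomial.X c : Sym𝔤 L) := by
      rw [symAd, mkDerivation_X, symι_apply]
    simp only [canonElt, map_sum, hD, canonAd_tmul, hs, sum_add_distrib]
    simp only [symDualAd, mkDerivation_X, TensorProduct.neg_tmul,
      TensorProduct.sum_tmul, TensorProduct.tmul_sum, TensorProduct.tmul_smul,
      TensorProduct.smul_tmul', sum_neg_distrib]
    rw [sum_comm, neg_add_cancel]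
  induction k with
  | zero =>
    have : D 1 = D 1 + D 1 := by
      conv_lhs => rw [← mul_one (1 : SymDual L ⊗[ℝ] Sym𝔤 L), hder, one_mul, mul_one]
    simpa using this
  | succ k ih => rw [pow_succ, hder, ih, h1]; simp

/-- The element `i(t)` is `𝔤`-invariant. -/
theorem superMapLin_weilL_canonElt_pow (x : L) (k : ℕ) :
    superMapLin (weilL x) .id (polyTens udI (canonElt L ^ k)) =
      polyTens udI (canonElt L ^ k) * ((1 : Weil L) ᵍ⊗ₜ udL x : Weil L ⊗ₛ UD L) -
      ((1 : Weil L) ᵍ⊗ₜ udL x : Weil L ⊗ₛ UD L) * polyTens udI (canonElt L ^ k) := by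
  have h (z : SymDual L ⊗[ℝ] Sym𝔤 L) : superMapLin (weilL x) .id (polyTens udI z) -
      (polyTens udI z * ((1 : Weil L) ᵍ⊗ₜ udL x : Weil L ⊗ₛ UD L) -
        ((1 : Weil L) ᵍ⊗ₜ udL x : Weil L ⊗ₛ UD L) * polyTens udI z) =
      polyTens udI (canonAd x z) := by
    induction z using TensorProduct.induction_on with
    | zero => simp only [map_zero, zero_mul, mul_zero, sub_zero]
    | add y z hy hz => simp only [map_add, ← hy, ← hz, add_mul, mul_add]; abel
    | tmul p u =>
      rw [canonAd_tmul, map_add, polyTens_tmul, polyTens_tmul, polyTens_tmul, superMapLin_tmul,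
        weilL_tmul_one,
        tmul_mul_one, tmul_mul_even (parity_tmul_one p)]
      simp only [id_apply, one_mul,
        ← udL_udI, sub_eq_add_neg, tmul_add, tmul_neg]
      abel
  have := h (canonElt L ^ k)
  rw [canonElt_pow_invariant, map_zero] at this
  exact sub_eq_zero.1 this

variable (L) in
/-- The element `l(θ)` of `W𝔤 ⊗ D𝔤`. -/
def lθ : Weil L ⊗ₛ UD L := ∑ a, (weilθ a ᵍ⊗ₜ udL (lieBasis L a) : Weil L ⊗ₛ UD L)

/-- The identity `d_W i(t) = -[l(θ), i(t)]`, in degree `k`. -/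
theorem superMapLin_weilD_canonElt_pow (k : ℕ) :
    superMapLin (weilD L) .id (polyTens udI (canonElt L ^ k)) =
      -(lθ L * polyTens udI (canonElt L ^ k) + polyTens udI (canonElt L ^ k) * lθ L) := by
  have h1 (z : SymDual L ⊗[ℝ] Sym𝔤 L) : superMapLin (weilD L) .id (polyTens udI z) =
      ∑ b, (weilθ b ᵍ⊗ₜ (1 : UD L) : Weil L ⊗ₛ UD L) *
        superMapLin (weilL (lieBasis L b)) LinearMap.id (polyTens udI z) := by
    induction z using TensorProduct.induction_on with
    | zero => simp only [map_zero, mul_zero, sum_const_zero]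
    | add y z hy hz => simp only [map_add, hy, hz, mul_add, sum_add_distrib]
    | tmul p u =>
      simp only [polyTens_tmul, superMapLin_tmul, weilD_tmul_one, tmul_one_mul]
      exact map_sum ((GradedTensorProduct.of ℝ (part (Weil L)) (part (UD L))).toLinearMap ∘ₗ
        (TensorProduct.mk ℝ (Weil L) (UD L)).flip (LinearMap.id (udI u))) _ _
  have h2 (b : Idx L) (z : SymDual L ⊗[ℝ] Sym𝔤 L) :
      (weilθ b ᵍ⊗ₜ (1 : UD L) : Weil L ⊗ₛ UD L) * polyTens udI z =
        -(polyTens udI z * (weilθ b ᵍ⊗ₜ (1 : UD L) : Weil L ⊗ₛ UD L)) := by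
    induction z using TensorProduct.induction_on with
    | zero => simp only [map_zero, zero_mul, mul_zero, neg_zero]
    | add y z hy hz => simp only [map_add, mul_add, hy, hz, add_mul, neg_add]
    | tmul p u =>
      rw [polyTens_tmul, tmul_one_mul, tmul_mul_odd (parity_weilθ b),
        parity_udI, mul_one, tmul_neg, neg_neg,
        Weil.even_central (parity_tmul_one p)]
  have h3 (b : Idx L) : (weilθ b ᵍ⊗ₜ udL (lieBasis L b) : Weil L ⊗ₛ UD L) =
      (weilθ b ᵍ⊗ₜ (1 : UD L)) * ((1 : Weil L) ᵍ⊗ₜ udL (lieBasis L b)) := by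
    rw [tmul_one_mul, mul_one]
  rw [h1, lθ, sum_mul, mul_sum, ← sum_add_distrib, ← sum_neg_distrib]
  refine sum_congr rfl fun b _ => ?_
  rw [superMapLin_weilL_canonElt_pow, mul_sub, h3, ← mul_assoc, h2]
  noncomm_ring

theorem canonElt_pow_eq_sum (k : ℕ) (Q : Sym𝔤 L →ₗ[ℝ] T) : polyTens Q (canonElt L ^ k) =
    ∑ a : Fin k → Idx L,
      (((∏ i, (MvPolynomial.X (a i) : SymDual L)) ⊗ₜ[ℝ] 1 : Weil L) ᵍ⊗ₜ
        Q (∏ i, (MvPolynomial.X (a i) : Sym𝔤 L)) : Weil L ⊗ₛ T) := by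
  rw [canonElt, Fintype.sum_pow, map_sum]
  refine sum_congr rfl fun a _ => ?_
  rw [← polyTens_tmul]
  congr 1
  induction (univ : Finset (Fin k)) using Finset.induction_on with
  | empty => simp [Algebra.TensorProduct.one_def]
  | insert i s ha ih => simp [Finset.prod_insert ha, ih, tmul_mul_tmul]

end UniversalElement

/-! ### Existence of the element `Φ` -/
section Operators
variable {T T' : Type*} [Ring T] [Algebra ℝ T] [SuperAlgebra T]
  [Ring T'] [Algebra ℝ T'] [SuperAlgebra T']

theorem numOp_superMapLin {f : Weil L →ₗ[ℝ] Weil L}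
    (hf : ∀ w, weilN L (f w) = f (weilN L w)) (g : T →ₗ[ℝ] T') (z : Weil L ⊗ₛ T) :
    numOp L T' (superMapLin f g z) = superMapLin f g (numOp L T z) := by
  rw [numOp, numOp, superMapLin_comp_apply, superMapLin_comp_apply,
    show weilN L ∘ₗ f = f ∘ₗ weilN L from LinearMap.ext hf, LinearMap.id_comp, LinearMap.comp_id]

theorem numOp_superMap (J : T →ₐ[ℝ] T')
    (hi : ∀ a, AlgHom.id ℝ (Weil L) (parity a) = parity (AlgHom.id ℝ (Weil L) a))
    (hJ : ∀ b, J (parity b) = parity (J b)) (z : Weil L ⊗ₛ T) :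
    numOp L T' (superMap (AlgHom.id ℝ (Weil L)) J hi hJ z) =
      superMap (AlgHom.id ℝ (Weil L)) J hi hJ (numOp L T z) := by
  refine (congrArg _ (superMap_eq_superMapLin _ _ hi hJ z)).trans ?_
  refine (numOp_superMapLin (f := (AlgHom.id ℝ (Weil L)).toLinearMap) (fun _ => rfl)
    J.toLinearMap z).trans ?_
  exact (superMap_eq_superMapLin _ _ hi hJ _).symm

theorem superMap_id_apply {A : Type*} [Ring A] [Algebra ℝ A] [SuperAlgebra A]
    (hi : ∀ a, AlgHom.id ℝ A (parity a) = parity (AlgHom.id ℝ A a))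
    (hJ : ∀ b, AlgHom.id ℝ T (parity b) = parity (AlgHom.id ℝ T b)) (z : A ⊗ₛ T) :
    superMap (AlgHom.id ℝ A) (AlgHom.id ℝ T) hi hJ z = z := by
  rw [superMap_eq_superMapLin]; exact superMapLin_id z

theorem numOp_mul (x y : Weil L ⊗ₛ T) :
    numOp L T (x * y) = numOp L T x * y + x * numOp L T y := by
  have hi (a : Weil L) : AlgHom.id ℝ (Weil L) (parity a) = parity (AlgHom.id ℝ (Weil L) a) := rfl
  have hJ (b : T) : AlgHom.id ℝ T (parity b) = parity (AlgHom.id ℝ T b) := rfl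
  have := IsEvenDer.superMapLin weilN_isEvenDer weilN_parity (AlgHom.id ℝ T) hi hJ x y
  rw [superMap_id_apply, superMap_id_apply] at this
  exact this

theorem mapLin_numOp_mul (f g : PowerSeries (Weil L ⊗ₛ T)) :
    mapLin (numOp L T) (f * g) =
      mapLin (numOp L T) f * g + f * mapLin (numOp L T) g := by
  have h : IsDerOver (AlgHom.id ℝ _) (AlgHom.id ℝ _) (numOp L T) := numOp_mul
  have := h.mapLin_mul f g
  rwa [show PowerSeries.map (AlgHom.id ℝ (Weil L ⊗ₛ T)).toRingHom = RingHom.id _ from by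
    ext; simp] at this

variable (L T) in
/-- The homotopy operator on a tensor product with the Weil algebra. -/
def hOp : (Weil L ⊗ₛ T) →ₗ[ℝ] (Weil L ⊗ₛ T) := superMapLin (weilH L) .id

theorem hOp_mul (x y : Weil L ⊗ₛ T) : hOp L T (x * y) = hOp L T x * y + parity x * hOp L T y := by
  have hi (a : Weil L) : AlgHom.id ℝ (Weil L) (parity a) = parity (AlgHom.id ℝ (Weil L) a) := rfl
  have hJ (b : T) : AlgHom.id ℝ T (parity b) = parity (AlgHom.id ℝ T b) := rfl
  have := IsOddDer.superMapLin weilH_isOddDer weilH_parity (AlgHom.id ℝ T) hi hJ x y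
  rw [AlgHom.comp_apply, superMap_id_apply, superMap_id_apply] at this
  exact this

theorem hOp_tmul (w : Weil L) (u : T) :
    hOp L T (w ᵍ⊗ₜ u : Weil L ⊗ₛ T) = (weilH L w ᵍ⊗ₜ u : Weil L ⊗ₛ T) := rfl

variable (L) in
/-- The differential of the Weil algebra, with values in `W𝔤 ⊗ U(D𝔤)`. -/
def dWeil : (Weil L ⊗ₛ UL L) →ₗ[ℝ] (Weil L ⊗ₛ UD L) :=
  superMapLin (weilD L) (ulToUD L).toLinearMap

variable (L) in
/-- The differential of `D𝔤`, with values in `W𝔤 ⊗ U(D𝔤)`. -/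
def dAlg : (Weil L ⊗ₛ UL L) →ₗ[ℝ] (Weil L ⊗ₛ UD L) :=
  superMapLin (parity : Weil L →ₐ[ℝ] Weil L).toLinearMap (dUL L)

theorem dWeil_isDerOver : IsDerOver (toBUD L (Weil L)) ((toBUD L (Weil L)).comp parity)
    (dWeil L) :=
  IsOddDer.superMapLin weilD_isOddDer weilD_parity (ulToUD L) _ _

theorem dAlg_isDerOver : IsDerOver (toBUD L (Weil L)) ((toBUD L (Weil L)).comp parity)
    (dAlg L) :=
  IsDerOver.superMapLin_parity dUL_isDerOver dUL_parity _ _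

theorem numOp_dWeil (z : Weil L ⊗ₛ UL L) :
    numOp L (UD L) (dWeil L z) = dWeil L (numOp L (UL L) z) :=
  numOp_superMapLin weilN_weilD _ _

theorem numOp_dAlg (z : Weil L ⊗ₛ UL L) :
    numOp L (UD L) (dAlg L z) = dAlg L (numOp L (UL L) z) :=
  numOp_superMapLin weilN_parity _ _

theorem numOp_toBUD (z : Weil L ⊗ₛ UL L) :
    numOp L (UD L) (toBUD L (Weil L) z) = toBUD L (Weil L) (numOp L (UL L) z) :=
  numOp_superMap _ _ _ _

theorem toBUD_eq_superMapLin {B : Type*} [Ring B] [Algebra ℝ B] [SuperAlgebra B]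
    (z : B ⊗ₛ UL L) :
    toBUD L B z = superMapLin LinearMap.id (ulToUD L).toLinearMap z :=
  superMap_eq_superMapLin _ _ _ _ z

theorem toBUD_polyTens (z : SymDual L ⊗[ℝ] Sym𝔤 L) :
    toBUD L (Weil L) (polyTens genI z) = polyTens udI z := by
  rw [toBUD_eq_superMapLin, superMapLin_polyTens (fun _ => rfl)]
  congr 2
  exact LinearMap.ext ulToUD_genI

/-- Power series with coefficients `f k` in degrees `2 k - 1`. -/
def oddSeries {R : Type*} [Ring R] (f : ℕ → R) : PowerSeries R :=
  PowerSeries.mk fun n => if Odd n then f ((n + 1) / 2) else 0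

theorem coeff_oddSeries {R : Type*} [Ring R] (f : ℕ → R) (n : ℕ) :
    coeff n (oddSeries f) = if Odd n then f ((n + 1) / 2) else 0 := by
  simp [oddSeries]

theorem mapLin_oddSeries {R R' : Type*} [Ring R] [Ring R'] [Algebra ℝ R] [Algebra ℝ R']
    (Q : R →ₗ[ℝ] R') (f : ℕ → R) :
    mapLin Q (oddSeries f) = oddSeries fun k => Q (f k) := by
  ext n
  rw [coeff_mapLin, coeff_oddSeries, coeff_oddSeries]
  split_ifs <;> simp

theorem oddSeries_add {R : Type*} [Ring R] (f g : ℕ → R) :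
    (oddSeries fun k => f k + g k) = oddSeries f + oddSeries g := by
  ext n
  rw [map_add, coeff_oddSeries, coeff_oddSeries, coeff_oddSeries]
  split_ifs <;> simp

theorem oddSeries_neg {R : Type*} [Ring R] (f : ℕ → R) :
    (oddSeries fun k => -f k) = -oddSeries f := by
  ext n
  rw [map_neg, coeff_oddSeries, coeff_oddSeries]
  split_ifs <;> simp

theorem oddSeries_C_mul {R : Type*} [Ring R] (r : R) (f : ℕ → R) :
    (oddSeries fun k => r * f k) = PowerSeries.C r * oddSeries f := by
  ext n
  rw [PowerSeries.coeff_C_mul, coeff_oddSeries, coeff_oddSeries]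
  split_ifs <;> simp

theorem oddSeries_mul_C {R : Type*} [Ring R] (r : R) (f : ℕ → R) :
    (oddSeries fun k => f k * r) = oddSeries f * PowerSeries.C r := by
  ext n
  rw [PowerSeries.coeff_mul_C, coeff_oddSeries, coeff_oddSeries]
  split_ifs <;> simp

theorem X_mul_oddSeries_sq {R : Type*} [Ring R] {f : ℕ → R} (h0 : f 0 = 0) :
    PowerSeries.X * (oddSeries f * oddSeries f) =
      oddSeries fun k => ∑ p ∈ HasAntidiagonal.antidiagonal k, f p.1 * f p.2 := by
  ext n
  rcases n with _ | n
  · rw [coeff_zero_X_mul, coeff_oddSeries, if_neg (by decide)]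
  · rw [coeff_succ_X_mul, coeff_mul, coeff_oddSeries]
    simp only [coeff_oddSeries]
    split_ifs with hn
    · have hn' : Even n := by
        rcases Nat.even_or_odd n with h | h
        · exact h
        · exact absurd h.add_one (Nat.not_even_iff_odd.2 hn)
      obtain ⟨m, rfl⟩ := hn'
      have hm : (m + m + 1 + 1) / 2 = m + 1 := by omega
      rw [hm]
      symm
      refine Finset.sum_bij_ne_zero (fun p _ _ => (2 * p.1 - 1, 2 * p.2 - 1)) ?_ ?_ ?_ ?_
      · rintro ⟨a, b⟩ h hne
        have h' := HasAntidiagonal.mem_antidiagonal.1 h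
        have ha : a ≠ 0 := by rintro rfl; exact hne (by rw [h0, zero_mul])
        have hb : b ≠ 0 := by rintro rfl; exact hne (by rw [h0, mul_zero])
        rw [HasAntidiagonal.mem_antidiagonal]
        simp only at h' ⊢
        omega
      · rintro ⟨a, b⟩ h hne ⟨c, d⟩ h2 hne2 heq
        have ha : a ≠ 0 := by rintro rfl; exact hne (by rw [h0, zero_mul])
        have hb : b ≠ 0 := by rintro rfl; exact hne (by rw [h0, mul_zero])
        have hc : c ≠ 0 := by rintro rfl; exact hne2 (by rw [h0, zero_mul])
        have hd : d ≠ 0 := by rintro rfl; exact hne2 (by rw [h0, mul_zero])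
        simp only [Prod.mk.injEq] at heq ⊢
        omega
      · rintro ⟨a, b⟩ h hne
        have h' := HasAntidiagonal.mem_antidiagonal.1 h
        have ha : Odd a := by
          by_contra hc; exact hne (by simp [hc])
        have hb : Odd b := by
          by_contra hc; exact hne (by simp [hc])
        obtain ⟨i, rfl⟩ := ha
        obtain ⟨j, rfl⟩ := hb
        have e1 : (2 * i + 1 + 1) / 2 = i + 1 := by omega
        have e2 : (2 * j + 1 + 1) / 2 = j + 1 := by omega
        refine ⟨(i + 1, j + 1), ?_, ?_, ?_⟩
        · rw [HasAntidiagonal.mem_antidiagonal]; simp only at h' ⊢; omega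
        · simpa [e1, e2] using hne
        · simp only [Prod.mk.injEq]; omega
      · rintro ⟨a, b⟩ h hne
        have ha : a ≠ 0 := by rintro rfl; exact hne (by rw [h0, zero_mul])
        have hb : b ≠ 0 := by rintro rfl; exact hne (by rw [h0, mul_zero])
        have o1 : Odd (2 * a - 1) := ⟨a - 1, by omega⟩
        have o2 : Odd (2 * b - 1) := ⟨b - 1, by omega⟩
        simp only
        rw [if_pos o1, if_pos o2, show (2 * a - 1 + 1) / 2 = a by omega,
          show (2 * b - 1 + 1) / 2 = b by omega]
    · refine sum_eq_zero fun p hp => ?_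
      have h' := HasAntidiagonal.mem_antidiagonal.1 hp
      split_ifs with h1 h2
      · exact absurd (h' ▸ (h1.add_odd h2)).add_one hn
      all_goals simp

end Operators

section Kalkman
variable {T T' : Type*} [Ring T] [Algebra ℝ T] [SuperAlgebra T]
  [Ring T'] [Algebra ℝ T'] [SuperAlgebra T']

variable (L) in
/-- The series `i(t)` in `W𝔤 ⊗ U(D𝔤)`. -/
def iSeries : PowerSeries (Weil L ⊗ₛ UD L) :=
  oddSeries fun k => polyTens udI (canonElt L ^ k)

variable (L) in
/-- The series `b = (h ⊗ 1) (-i(t) + l(θ)) = -(h ⊗ 1) i(t)` in `W𝔤 ⊗ U(L(S⁺𝔤))`. The element `Φ`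
is the solution of `N Φ = Φ b`. -/
def kalkB : PowerSeries (Weil L ⊗ₛ UL L) :=
  oddSeries fun k => -hOp L (UL L) (polyTens genI (canonElt L ^ k))

theorem connElt_eq : connElt L = PowerSeries.C (lθ L) - iSeries L := by
  ext n
  rw [connElt, coeff_mk, map_sub, iSeries, coeff_oddSeries, coeff_C]
  split_ifs with h1 h2 h2
  · exact absurd h2 (by rw [h1]; decide)
  · rw [sub_zero]; rfl
  · rw [zero_sub, canonElt_pow_eq_sum]
  · rw [sub_zero]

theorem map_toBUD_kalkB : PowerSeries.map (toBUD L (Weil L)).toRingHom (kalkB L) =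
    -mapLin (hOp L (UD L)) (iSeries L) := by
  rw [PowerSeries.map_eq_mapLin, kalkB, iSeries, mapLin_oddSeries, mapLin_oddSeries]
  ext n
  rw [map_neg, coeff_oddSeries, coeff_oddSeries]
  split_ifs
  · rw [AlgHom.toLinearMap_apply, map_neg, ← toBUD_polyTens, toBUD_eq_superMapLin,
      toBUD_eq_superMapLin, hOp, hOp, superMapLin_comp_apply, superMapLin_comp_apply]
    rfl
  · rw [neg_zero]

theorem polyTens_udI_one : polyTens udI (canonElt L ^ 0) = 0 := by
  rw [pow_zero, Algebra.TensorProduct.one_def, polyTens_tmul, udI_one]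
  simp [GradedTensorProduct.tmul]

variable (L) in
/-- The element `l(t)` of `W𝔤 ⊗ D𝔤`. -/
def lt : Weil L ⊗ₛ UD L := ∑ a, (weilt a ᵍ⊗ₜ udL (lieBasis L a) : Weil L ⊗ₛ UD L)

theorem dAlg_iSeries : mapLin (dAlg L)
    (oddSeries fun k => polyTens genI (canonElt L ^ k)) =
      PowerSeries.X * (iSeries L * iSeries L + PowerSeries.C (lt L)) := by
  rw [mapLin_oddSeries, mul_add, iSeries, X_mul_oddSeries_sq polyTens_udI_one]
  ext n
  rw [map_add, coeff_oddSeries, coeff_oddSeries, dAlg]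
  have hX : coeff n (PowerSeries.X * PowerSeries.C (lt L)) =
      if n = 1 then lt L else 0 := by
    rcases n with _ | n
    · simp
    · rw [coeff_succ_X_mul, coeff_C]; simp
  rw [hX]
  split_ifs with h1 h2 h2
  · rw [superMapLin_dUL_canonElt_pow, if_pos (by omega)]; rfl
  · rw [superMapLin_dUL_canonElt_pow, if_neg]
    obtain ⟨m, rfl⟩ := h1; omega
  · exact absurd (h2 ▸ odd_one) h1
  · simp

theorem parity_lθ : parity (lθ L) = -lθ L := by
  rw [lθ, map_sum, ← sum_neg_distrib]
  refine sum_congr rfl fun a _ => ?_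
  rw [parity_tmul, parity_weilθ, parity_udL, neg_tmul]

theorem hOp_lθ : hOp L (UD L) (lθ L) = 0 := by
  rw [lθ, map_sum]
  refine sum_eq_zero fun a _ => ?_
  rw [hOp_tmul, weilH_weilθ]
  simp [GradedTensorProduct.tmul]

theorem numOp_lθ : numOp L (UD L) (lθ L) = lθ L := by
  rw [lθ, map_sum]
  refine sum_congr rfl fun a _ => ?_
  rw [numOp, superMapLin_tmul, weilN_weilθ]; rfl

theorem hOp_lt : hOp L (UD L) (lt L) = lθ L := by
  rw [lt, lθ, map_sum]
  refine sum_congr rfl fun a _ => ?_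
  rw [hOp_tmul, weilH_weilt]

theorem parity_polyTens_udI (z : SymDual L ⊗[ℝ] Sym𝔤 L) :
    parity (polyTens udI z) = -polyTens udI z := by
  induction z using TensorProduct.induction_on with
  | zero => simp
  | add x y hx hy => rw [map_add, map_add, hx, hy, neg_add]
  | tmul p u =>
    rw [polyTens_tmul, parity_tmul, parity_udI, parity_tmul_one, tmul_neg]

theorem map_parity_iSeries : PowerSeries.map (parity : Weil L ⊗ₛ UD L →ₐ[ℝ] _).toRingHom
    (iSeries L) = -iSeries L := by
  rw [PowerSeries.map_eq_mapLin, iSeries, mapLin_oddSeries]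
  ext n
  rw [map_neg, coeff_oddSeries, coeff_oddSeries]
  split_ifs
  · exact parity_polyTens_udI _
  · rw [neg_zero]

theorem hOp_dAlg (z : Weil L ⊗ₛ UL L) :
    dAlg L (hOp L (UL L) z) = -hOp L (UD L) (dAlg L z) := by
  rw [dAlg, hOp, hOp, superMapLin_comp_apply, superMapLin_comp_apply, ← LinearMap.neg_apply,
    ← superMapLin_neg_left]
  congr 2
  refine LinearMap.ext fun w => ?_
  simp only [comp_apply, LinearMap.neg_apply, AlgHom.toLinearMap_apply, weilH_parity]
  rw [neg_neg]

theorem mapLin_C {R R' : Type*} [Ring R] [Ring R'] [Algebra ℝ R] [Algebra ℝ R']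
    (Q : R →ₗ[ℝ] R') (r : R) :
    mapLin Q (PowerSeries.C r) = PowerSeries.C (Q r) := by
  ext n
  rw [coeff_mapLin, coeff_C, coeff_C]
  split_ifs <;> simp

theorem mapLin_hOp_mul (f g : PowerSeries (Weil L ⊗ₛ T)) :
    mapLin (hOp L T) (f * g) = mapLin (hOp L T) f * g +
      PowerSeries.map (parity : Weil L ⊗ₛ T →ₐ[ℝ] _).toRingHom f *
        mapLin (hOp L T) g := by
  have h : IsDerOver (AlgHom.id ℝ _) parity (hOp L T) := hOp_mul
  have := h.mapLin_mul f g
  rwa [show PowerSeries.map (AlgHom.id ℝ (Weil L ⊗ₛ T)).toRingHom = RingHom.id _ from by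
    ext; simp] at this

/-- The total differential, multiplied by the formal variable. -/
def totD (f : PowerSeries (Weil L ⊗ₛ UL L)) : PowerSeries (Weil L ⊗ₛ UD L) :=
  PowerSeries.X * mapLin (dWeil L) f + mapLin (dAlg L) f

theorem mapLin_dWeil_hOp_iSeries :
    mapLin (dWeil L) (kalkB L) = -mapLin (numOp L (UD L)) (iSeries L)
      + mapLin (hOp L (UD L)) (-(PowerSeries.C (lθ L) * iSeries L +
        iSeries L * PowerSeries.C (lθ L))) := by
  have h1 (k : ℕ) : dWeil L (-hOp L (UL L) (polyTens genI (canonElt L ^ k))) =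
      -numOp L (UD L) (polyTens udI (canonElt L ^ k)) + hOp L (UD L)
        (-(lθ L * polyTens udI (canonElt L ^ k) + polyTens udI (canonElt L ^ k) * lθ L)) := by
    rw [← superMapLin_weilD_canonElt_pow, ← toBUD_polyTens, toBUD_eq_superMapLin, map_neg, dWeil,
      hOp, hOp, numOp]
    simp only [superMapLin_comp_apply, LinearMap.id_comp, LinearMap.comp_id]
    rw [weilN, superMapLin_add_left, LinearMap.add_apply]
    abel
  rw [iSeries, ← oddSeries_C_mul, ← oddSeries_mul_C, ← oddSeries_add, ← oddSeries_neg,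
    mapLin_oddSeries, mapLin_oddSeries, ← oddSeries_neg, ← oddSeries_add, kalkB, mapLin_oddSeries]
  exact congrArg _ (funext h1)

theorem kalkman_ring_identity {R : Type*} [Ring R] {x v w y z A B N c : R}
    (hA : A = -z + -((0 * w + -v * y) + (y * v + -w * 0))) (hB : B = x * (y * w + -w * y + v))
    (hN : N = v - z) (hc : c = v - w) :
    x * A + B = x * (N - (c * -y - -y * c)) := by
  subst hA hB hN hc
  noncomm_ring

/-- The identity `d b + [α, b] = N α` for `α = -i(t) + l(θ)`. -/
theorem totD_kalkB : totD (kalkB L) = PowerSeries.X *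
    (mapLin (numOp L (UD L)) (connElt L) -
      (connElt L * -mapLin (hOp L (UD L)) (iSeries L) -
        -mapLin (hOp L (UD L)) (iSeries L) * connElt L)) := by
  have h2 : mapLin (dAlg L) (kalkB L) = mapLin (hOp L (UD L))
      (PowerSeries.X * (iSeries L * iSeries L + PowerSeries.C (lt L))) := by
    rw [← dAlg_iSeries, kalkB, mapLin_oddSeries, mapLin_oddSeries, mapLin_oddSeries]
    congr 1
    funext k
    rw [map_neg, hOp_dAlg, neg_neg]
  have hC : PowerSeries.map (parity : Weil L ⊗ₛ UD L →ₐ[ℝ] _).toRingHom (PowerSeries.C (lθ L)) =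
      -PowerSeries.C (lθ L) := by
    rw [PowerSeries.map_C, ← map_neg]
    exact congrArg _ parity_lθ
  have e1 := mapLin_hOp_mul (iSeries L) (iSeries L)
  have e2 := mapLin_hOp_mul (iSeries L) (PowerSeries.C (lθ L))
  have e3 := mapLin_hOp_mul (PowerSeries.C (lθ L)) (iSeries L)
  rw [map_parity_iSeries] at e1 e2
  rw [hC] at e3
  rw [mapLin_C, hOp_lθ, map_zero] at e2 e3
  have e4 := mapLin_C (numOp L (UD L)) (lθ L)
  rw [numOp_lθ] at e4
  have e5 := mapLin_C (hOp L (UD L)) (lt L)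
  rw [hOp_lt] at e5
  have e6 := mapLin_add (hOp L (UD L)) (PowerSeries.C (lθ L) * iSeries L)
    (iSeries L * PowerSeries.C (lθ L))
  rw [e2, e3] at e6
  have e7 := PowerSeries.mapLin_neg (hOp L (UD L)) (PowerSeries.C (lθ L) * iSeries L +
    iSeries L * PowerSeries.C (lθ L))
  rw [e6] at e7
  have e8 := mapLin_add (hOp L (UD L)) (iSeries L * iSeries L) (PowerSeries.C (lt L))
  rw [e1, e5] at e8
  have e9 := mapLin_sub (numOp L (UD L)) (PowerSeries.C (lθ L)) (iSeries L)
  rw [e4] at e9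
  refine kalkman_ring_identity (z := mapLin (numOp L (UD L)) (iSeries L))
    (mapLin_dWeil_hOp_iSeries.trans ?_) (h2.trans ?_) ?_ connElt_eq
  · rw [← e7]
  · rw [mapLin_X_mul, e8]
  · rw [connElt_eq, e9]

end Kalkman

section KalkmanExistence

theorem weilH_mem_weilDeg {m : ℕ} {p : SymDual L} (hp : p.IsHomogeneous (m + 1)) :
    weilH L (p ⊗ₜ[ℝ] 1) ∈ weilDeg L (2 * m + 1) := by
  rw [weilH, LinearMap.sum_apply]
  refine Submodule.sum_mem _ fun a _ => ?_
  have h : (mulLeft ℝ (weilθ a) ∘ₗ weilPderiv a) (p ⊗ₜ[ℝ] 1) =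
      (MvPolynomial.pderiv a p) ⊗ₜ[ℝ] extθ a := by
    simp [weilθ, weilPderiv, tmul_mul_tmul]
  rw [h]
  exact weilDeg_tmul hp.pderiv (extθ_mem a)

theorem coeff_kalkB_mem (n : ℕ) :
    coeff n (kalkB L) ∈ bidegree (weilDeg L n) n := by
  rw [kalkB, coeff_oddSeries]
  split_ifs with h
  · obtain ⟨m, rfl⟩ := h
    rw [show (2 * m + 1 + 1) / 2 = m + 1 by omega, canonElt_pow_eq_sum, map_sum]
    refine Submodule.neg_mem _ (Submodule.sum_mem _ fun a _ => ?_)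
    have hX : (∏ i, (MvPolynomial.X (a i) : Sym𝔤 L)).IsHomogeneous (m + 1) := by
      have := MvPolynomial.IsHomogeneous.prod univ
        (fun i : Fin (m + 1) => (MvPolynomial.X (a i) : Sym𝔤 L)) (fun _ => 1)
        (fun i _ => isHomogeneous_X _ _)
      simpa using this
    rw [hOp_tmul]
    exact tmul_mem_bidegree (weilH_mem_weilDeg hX) (genI_mem_ULdeg hX)
  · exact zero_mem _

theorem coeff_zero_kalkB : coeff 0 (kalkB L) = 0 := by
  rw [kalkB, coeff_oddSeries, if_neg (by decide)]

open Classical in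
/-- A right inverse of the number operator on the elements of total degree zero. -/
def numInv (n : ℕ) (z : Weil L ⊗ₛ UL L) : Weil L ⊗ₛ UL L :=
  if h : ∃ y ∈ bidegree (weilDeg L n) n, numOp L (UL L) y = z then h.choose else 0

theorem numInv_spec {n : ℕ} (hn : n ≠ 0) {z : Weil L ⊗ₛ UL L}
    (hz : z ∈ bidegree (weilDeg L n) n) :
    numInv n z ∈ bidegree (weilDeg L n) n ∧ numOp L (UL L) (numInv n z) = z := by
  have h := exists_numOp_eq hn hz
  rw [numInv, dif_pos h]
  exact h.choose_spec

variable (L) in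
/-- The components of the solution of `N Φ = Φ b` with `Φ₀ = 1`. -/
def kalkCoeff : ℕ → Weil L ⊗ₛ UL L
  | 0 => 1
  | n + 1 => numInv (n + 1)
      (∑ i : Fin (n + 1), kalkCoeff i * coeff (n + 1 - i) (kalkB L))

theorem kalkCoeff_mem (n : ℕ) : kalkCoeff L n ∈ bidegree (weilDeg L n) n ∧
    ∀ m, n = m + 1 → numOp L (UL L) (kalkCoeff L n) =
      ∑ i : Fin (m + 1), kalkCoeff L i * coeff (m + 1 - i) (kalkB L) := by
  induction n using Nat.strong_induction_on with
  | _ n ih =>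
    rcases n with _ | n
    · refine ⟨?_, fun m hm => absurd hm (Nat.succ_ne_zero m).symm⟩
      rw [kalkCoeff, one_def]
      exact tmul_mem_bidegree one_mem_weilDeg one_mem_ULdeg
    · have hz : (∑ i : Fin (n + 1), kalkCoeff L i * coeff (n + 1 - i) (kalkB L)) ∈
          bidegree (weilDeg L (n + 1)) (n + 1) := by
        refine Submodule.sum_mem _ fun i _ => ?_
        have h := bidegree_mul (U := weilDeg L (i + (n + 1 - i)))
          (fun s hs t ht => weilDeg_mul hs ht) (fun t ht => parity_of_mem_weilDeg ht)
          (ih i i.2).1 (coeff_kalkB_mem (L := L) (n + 1 - i))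
        rwa [show (i : ℕ) + (n + 1 - i) = n + 1 by omega] at h
      have hs := numInv_spec (Nat.succ_ne_zero n) hz
      rw [kalkCoeff]
      refine ⟨hs.1, fun m hm => ?_⟩
      obtain rfl : n = m := by omega
      exact hs.2

variable (L) in
/-- The solution of `N Φ = Φ b` with `Φ₀ = 1`. -/
def kalkΦ : PowerSeries (Weil L ⊗ₛ UL L) := PowerSeries.mk (kalkCoeff L)

theorem coeff_kalkΦ (n : ℕ) : coeff n (kalkΦ L) = kalkCoeff L n := by simp [kalkΦ]

theorem coeff_kalkΦ_mem (n : ℕ) :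
    coeff n (kalkΦ L) ∈ bidegree (weilDeg L n) n := by
  rw [coeff_kalkΦ]; exact (kalkCoeff_mem n).1

theorem coeff_zero_kalkΦ : coeff 0 (kalkΦ L) = 1 := by
  rw [coeff_kalkΦ, kalkCoeff]

theorem numOp_one {T : Type*} [Ring T] [Algebra ℝ T] [SuperAlgebra T] :
    numOp L T 1 = 0 := by
  rw [one_def, numOp, superMapLin_tmul, weilN_isEvenDer.map_one]
  simp [GradedTensorProduct.tmul]

theorem mapLin_numOp_kalkΦ :
    mapLin (numOp L (UL L)) (kalkΦ L) = kalkΦ L * kalkB L := by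
  ext n
  rw [coeff_mapLin, coeff_mul]
  rcases n with _ | n
  · rw [coeff_zero_kalkΦ, numOp_one]
    symm
    refine sum_eq_zero fun p hp => ?_
    have := HasAntidiagonal.mem_antidiagonal.1 hp
    rw [show p.2 = 0 by omega, coeff_zero_kalkB, mul_zero]
  · rw [coeff_kalkΦ, (kalkCoeff_mem (n + 1)).2 n rfl,
      Finset.Nat.sum_antidiagonal_eq_sum_range_succ
        (fun i j => coeff i (kalkΦ L) * coeff j (kalkB L)),
      Finset.sum_range_succ, Nat.sub_self, coeff_zero_kalkB, mul_zero, add_zero,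
      Finset.sum_range]
    simp only [coeff_kalkΦ]

theorem map_comp_parity_of_even {R R' : Type*} [Ring R] [Algebra ℝ R] [SuperAlgebra R] [Ring R']
    [Algebra ℝ R'] (J : R →ₐ[ℝ] R') {f : PowerSeries R}
    (hf : ∀ n, parity (coeff n f) = coeff n f) :
    PowerSeries.map (J.comp parity).toRingHom f = PowerSeries.map J.toRingHom f := by
  ext n
  rw [coeff_map, coeff_map]
  exact congrArg J (hf n)

theorem totD_mul {f g : PowerSeries (Weil L ⊗ₛ UL L)}
    (hf : ∀ n, parity (coeff n f) = coeff n f) :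
    totD (f * g) = totD f * PowerSeries.map (toBUD L (Weil L)).toRingHom g +
      PowerSeries.map (toBUD L (Weil L)).toRingHom f * totD g := by
  have h1 := dWeil_isDerOver.mapLin_mul f g
  have h2 := dAlg_isDerOver.mapLin_mul f g
  rw [map_comp_parity_of_even _ hf] at h1 h2
  have aux {R : Type _} [Ring R] {x a b c d e k l m : R} (hx : ∀ r, x * r = r * x)
      (hl : l = a * b + c * d) (hm : m = e * b + c * k) :
      x * l + m = (x * a + e) * b + c * (x * d + k) := by
    rw [hl, hm, mul_add, ← mul_assoc x c, hx c]; noncomm_ring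
  exact aux (fun r => (commute_X r).eq.symm) h1 h2

theorem numOp_totD (f : PowerSeries (Weil L ⊗ₛ UL L)) :
    mapLin (numOp L (UD L)) (totD f) =
      totD (mapLin (numOp L (UL L)) f) := by
  rw [totD, totD, mapLin_add, mapLin_X_mul, mapLin_mapLin,
    mapLin_mapLin, mapLin_mapLin, mapLin_mapLin,
    show numOp L (UD L) ∘ₗ dWeil L = dWeil L ∘ₗ numOp L (UL L) from LinearMap.ext numOp_dWeil,
    show numOp L (UD L) ∘ₗ dAlg L = dAlg L ∘ₗ numOp L (UL L) from LinearMap.ext numOp_dAlg]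

theorem mapLin_numOp_map {T T' : Type*} [Ring T] [Algebra ℝ T] [SuperAlgebra T] [Ring T']
    [Algebra ℝ T'] [SuperAlgebra T'] {J : (Weil L ⊗ₛ T) →ₐ[ℝ] (Weil L ⊗ₛ T')}
    (hJ : ∀ z, numOp L T' (J z) = J (numOp L T z)) (f : PowerSeries (Weil L ⊗ₛ T)) :
    mapLin (numOp L T') (PowerSeries.map J.toRingHom f) =
      PowerSeries.map J.toRingHom (mapLin (numOp L T) f) := by
  ext n
  rw [coeff_mapLin, coeff_map, coeff_map,
    coeff_mapLin]
  exact hJ _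

theorem coeff_mul_mem_tensLeft {T : Type*} [Ring T] [Algebra ℝ T] [SuperAlgebra T]
    (f : PowerSeries (Weil L ⊗ₛ T)) {g : PowerSeries (Weil L ⊗ₛ T)}
    (hg : ∀ n, coeff n g ∈ tensLeft T (weilPos L)) (n : ℕ) :
    coeff n (f * g) ∈ tensLeft T (weilPos L) := by
  rw [coeff_mul]
  exact Submodule.sum_mem _ fun p _ => mul_tensLeft (fun s hs a => mul_weilPos a hs)
    (fun s hs => parity_mem_weilPos hs) _ (hg _)

theorem coeff_X_mul_mem {R : Type*} [Ring R] [Module ℝ R] {S : Submodule ℝ R} {f : PowerSeries R}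
    (hf : ∀ n, coeff n f ∈ S) (n : ℕ) :
    coeff n (PowerSeries.X * f) ∈ S := by
  rcases n with _ | n
  · rw [coeff_zero_X_mul]; exact zero_mem _
  · rw [coeff_succ_X_mul]; exact hf n

theorem coeff_connElt_mem (n : ℕ) :
    coeff n (connElt L) ∈ tensLeft (UD L) (weilPos L) := by
  rw [connElt, coeff_mk]
  split_ifs with h1 h2
  · exact Submodule.sum_mem _ fun a _ =>
      tmul_mem_tensLeft (weilDeg_le_weilPos one_ne_zero (weilθ_mem_weilDeg a)) _
  · refine Submodule.neg_mem _ (Submodule.sum_mem _ fun a _ => tmul_mem_tensLeft ?_ _)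
    have hX : (∏ i, (MvPolynomial.X (a i) : SymDual L)).IsHomogeneous ((n + 1) / 2) := by
      have := MvPolynomial.IsHomogeneous.prod univ
        (fun i : Fin ((n + 1) / 2) => (MvPolynomial.X (a i) : SymDual L)) (fun _ => 1)
        (fun i _ => isHomogeneous_X _ _)
      simpa using this
    obtain ⟨m, rfl⟩ := h2
    exact weilDeg_le_weilPos (n := 2 * ((2 * m + 1 + 1) / 2) + 0) (by omega)
      (weilDeg_tmul hX one_mem_exteriorPower_zero)
  · exact zero_mem _

theorem dWeil_mem (z : Weil L ⊗ₛ UL L) : dWeil L z ∈ tensLeft (UD L) (weilPos L) :=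
  superMapLin_mem_tensLeft (map_mem_weilPos weilD_isOddDer.map_one weilN_weilD) _ _

theorem coeff_kalkΦ_mem_tensLeft {n : ℕ} (hn : n ≠ 0) :
    coeff n (kalkΦ L) ∈ tensLeft (UL L) (weilPos L) :=
  tensLeft_mono (weilDeg_le_weilPos hn) (bidegree_le_tensLeft _ _ (coeff_kalkΦ_mem n))

theorem parity_coeff_kalkΦ (n : ℕ) :
    parity (coeff n (kalkΦ L)) = coeff n (kalkΦ L) :=
  parity_of_mem_bidegree (fun _ hs => parity_of_mem_weilDeg hs) (coeff_kalkΦ_mem n)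

theorem dlog_ring_identity {R : Type*} [Ring R] {y p b a x na tb : R} (hx : ∀ r, x * r = r * x)
    (htb : tb = x * (na - (a * b - b * a))) :
    (y * b + p * tb) - (p * b * (x * a) + p * (x * na)) = (y - p * (x * a)) * b := by
  have h : p * b * (x * a) = p * (x * (b * a)) := by
    rw [← mul_assoc x b, hx b]; noncomm_ring
  rw [htb, h]
  noncomm_ring

theorem coeff_zero_map_kalkB : coeff 0
    (PowerSeries.map (toBUD L (Weil L)).toRingHom (kalkB L)) = 0 := by
  rw [coeff_map, coeff_zero_kalkB, map_zero]

theorem totD_kalkΦ : totD (kalkΦ L) = PowerSeries.map (toBUD L (Weil L)).toRingHom (kalkΦ L) *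
    (PowerSeries.X * connElt L) := by
  have hdA : dAlg L (1 : Weil L ⊗ₛ UL L) = 0 := dAlg_isDerOver.map_one
  have hX : PowerSeries.map (toBUD L (Weil L)).toRingHom (kalkΦ L) * (PowerSeries.X * connElt L) =
      PowerSeries.X * (PowerSeries.map (toBUD L (Weil L)).toRingHom (kalkΦ L) * connElt L) := by
    rw [← mul_assoc, ← mul_assoc, (commute_X _).eq]
  have h0 : coeff 0 (totD (kalkΦ L)) = 0 := by
    rw [totD, map_add (coeff 0), coeff_zero_X_mul,
      coeff_mapLin, coeff_zero_kalkΦ, hdA, add_zero]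
  have e := numOp_totD (kalkΦ L)
  rw [mapLin_numOp_kalkΦ, totD_mul parity_coeff_kalkΦ] at e
  have e2 := mapLin_numOp_mul (PowerSeries.map (toBUD L (Weil L)).toRingHom (kalkΦ L))
    (PowerSeries.X * connElt L)
  rw [mapLin_numOp_map numOp_toBUD, mapLin_numOp_kalkΦ, map_mul, mapLin_X_mul] at e2
  have e3 := totD_kalkB (L := L)
  rw [← map_toBUD_kalkB] at e3
  have key := eq_zero_of_numOp_eq_mul (L := L)
    (Z := totD (kalkΦ L) - PowerSeries.map (toBUD L (Weil L)).toRingHom (kalkΦ L) *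
      (PowerSeries.X * connElt L)) coeff_zero_map_kalkB ?_ ?_ ?_
  · exact sub_eq_zero.1 key
  · rw [map_sub (coeff 0), h0, hX, coeff_zero_X_mul, sub_zero]
  · intro n hn
    rw [map_sub (coeff n), totD, map_add (coeff n),
      coeff_mapLin]
    refine sub_mem (add_mem (coeff_X_mul_mem (fun m => ?_) n) ?_)
      (coeff_mul_mem_tensLeft _ (coeff_X_mul_mem coeff_connElt_mem) n)
    · rw [coeff_mapLin]; exact dWeil_mem _
    · exact superMapLin_mem_tensLeft_of_mem (fun a ha => parity_mem_weilPos ha) _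
        (coeff_kalkΦ_mem_tensLeft hn)
  · rw [mapLin_sub, e, e2]
    exact dlog_ring_identity (fun r => (commute_X r).eq.symm) e3

theorem totalD_kalkΦ : totalD (kalkΦ L) =
    PowerSeries.map (toBUD L (Weil L)).toRingHom (kalkΦ L) * connElt L := by
  ext n
  have h := congrArg (coeff (n + 1)) (totD_kalkΦ (L := L))
  have hX : PowerSeries.map (toBUD L (Weil L)).toRingHom (kalkΦ L) * (PowerSeries.X * connElt L) =
      PowerSeries.X * (PowerSeries.map (toBUD L (Weil L)).toRingHom (kalkΦ L) * connElt L) := by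
    rw [← mul_assoc, ← mul_assoc, (commute_X _).eq]
  rw [hX, coeff_succ_X_mul, totD, map_add (coeff (n + 1)),
    coeff_succ_X_mul, coeff_mapLin, coeff_mapLin] at h
  rw [← h, totalD, coeff_mk]
  rfl

end KalkmanExistence

section GroupLikeCommute
variable {B : Type*} [Ring B] [Algebra ℝ B] [SuperAlgebra B]

theorem inFst_tmul (b : B) (u : UL L) : inFst L B (b ᵍ⊗ₜ u : B ⊗ₛ UL L) =
    (b ᵍ⊗ₜ (u ᵍ⊗ₜ (1 : UL L) : UL L ⊗ₛ UL L) : B ⊗ₛ (UL L ⊗ₛ UL L)) := by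
  exact superMap_tmul _ _ _ _ b u

theorem inSnd_tmul (b : B) (u : UL L) : inSnd L B (b ᵍ⊗ₜ u : B ⊗ₛ UL L) =
    (b ᵍ⊗ₜ ((1 : UL L) ᵍ⊗ₜ u : UL L ⊗ₛ UL L) : B ⊗ₛ (UL L ⊗ₛ UL L)) := by
  exact superMap_tmul _ _ _ _ b u

theorem comulB_tmul (b : B) (u : UL L) : comulB L B (b ᵍ⊗ₜ u : B ⊗ₛ UL L) =
    (b ᵍ⊗ₜ ulComul L u : B ⊗ₛ (UL L ⊗ₛ UL L)) := by
  exact superMap_tmul _ _ _ _ b u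

section
variable {A C D : Type*} [Ring A] [Algebra ℝ A] [SuperAlgebra A] [Ring C] [Algebra ℝ C]
  [SuperAlgebra C] [Ring D] [Algebra ℝ D] [SuperAlgebra D]

theorem SuperTensor.mul_of_parity {a' : A} {b : C} {m n : ℕ} (ha : parity a' = (-1 : ℝ) ^ n • a')
    (hb : parity b = (-1 : ℝ) ^ m • b) (a : A) (b' : C) :
    (a ᵍ⊗ₜ b : A ⊗ₛ C) * (a' ᵍ⊗ₜ b') =
      (-1 : ℝ) ^ (m * n) • ((a * a') ᵍ⊗ₜ (b * b') : A ⊗ₛ C) := by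
  rcases Nat.even_or_odd n with h | h
  · rw [h.neg_one_pow, one_smul] at ha
    rw [tmul_mul_even ha, (h.mul_left m).neg_one_pow, one_smul]
  · rw [h.neg_one_pow, neg_one_smul] at ha
    rw [tmul_mul_odd ha, hb, smul_mul_assoc, tmul_smul, mul_comm m,
      pow_mul, h.neg_one_pow]

theorem SuperTensor.fst_snd_comm {s t : A} {u : C} {v : D} {m n : ℕ}
    (hs : parity s = (-1 : ℝ) ^ m • s) (ht : parity t = (-1 : ℝ) ^ n • t)
    (hu : parity u = (-1 : ℝ) ^ m • u) (hv : parity v = (-1 : ℝ) ^ n • v)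
    (hst : t * s = (-1 : ℝ) ^ (m * n) • (s * t)) :
    (s ᵍ⊗ₜ (u ᵍ⊗ₜ (1 : D) : C ⊗ₛ D) : A ⊗ₛ (C ⊗ₛ D)) * (t ᵍ⊗ₜ ((1 : C) ᵍ⊗ₜ v : C ⊗ₛ D)) =
      (t ᵍ⊗ₜ ((1 : C) ᵍ⊗ₜ v : C ⊗ₛ D) : A ⊗ₛ (C ⊗ₛ D)) *
        (s ᵍ⊗ₜ (u ᵍ⊗ₜ (1 : D) : C ⊗ₛ D)) := by
  have e1 : ((1 : C) ᵍ⊗ₜ v : C ⊗ₛ D) * (u ᵍ⊗ₜ (1 : D)) =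
      (-1 : ℝ) ^ (n * m) • (u ᵍ⊗ₜ v : C ⊗ₛ D) := by
    rw [mul_of_parity hu hv, one_mul, mul_one]
  have e2 : (u ᵍ⊗ₜ (1 : D) : C ⊗ₛ D) * ((1 : C) ᵍ⊗ₜ v) = (u ᵍ⊗ₜ v : C ⊗ₛ D) := by
    rw [tmul_one_mul, mul_one]
  have e3 : parity (u ᵍ⊗ₜ (1 : D) : C ⊗ₛ D) = (-1 : ℝ) ^ m • (u ᵍ⊗ₜ (1 : D) : C ⊗ₛ D) := by
    rw [parity_tmul, hu, map_one, smul_tmul]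
  have e4 : parity ((1 : C) ᵍ⊗ₜ v : C ⊗ₛ D) = (-1 : ℝ) ^ n • ((1 : C) ᵍ⊗ₜ v : C ⊗ₛ D) := by
    rw [parity_tmul, hv, map_one, tmul_smul]
  have hsq : ((-1 : ℝ) ^ (m * n)) * (-1 : ℝ) ^ (m * n) = 1 := by rw [← mul_pow]; simp
  rw [mul_of_parity ht e3, mul_of_parity hs e4, e1, e2, hst,
    smul_tmul, tmul_smul, mul_comm n m, smul_smul, smul_smul, hsq, one_mul]

end

/-- The two embeddings have commuting images on elements of total degree zero. -/
theorem inFst_inSnd_comm {S T : Submodule ℝ B} {m n : ℕ}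
    (hS : ∀ s ∈ S, parity s = (-1 : ℝ) ^ m • s) (hT : ∀ t ∈ T, parity t = (-1 : ℝ) ^ n • t)
    (hc : ∀ s ∈ S, ∀ t ∈ T, t * s = (-1 : ℝ) ^ (m * n) • (s * t))
    {x y : B ⊗ₛ UL L} (hx : x ∈ bidegree S m) (hy : y ∈ bidegree T n) :
    inFst L B x * inSnd L B y = inSnd L B y * inFst L B x := by
  refine Submodule.span_induction₂
    (p := fun x y _ _ => inFst L B x * inSnd L B y = inSnd L B y * inFst L B x)
    ?_ ?_ ?_ ?_ ?_ ?_ ?_ hx hy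
  · rintro _ _ ⟨s, hs, u, hu, rfl⟩ ⟨t, ht, v, hv, rfl⟩
    rw [inFst_tmul, inSnd_tmul]
    exact fst_snd_comm (hS s hs) (hT t ht) (parity_of_mem_ULdeg hu)
      (parity_of_mem_ULdeg hv) (hc s hs t ht)
  · intro y _; rw [map_zero, zero_mul, mul_zero]
  · intro y _; rw [map_zero, zero_mul, mul_zero]
  · intro x y z _ _ _ h1 h2; rw [map_add, add_mul, mul_add, h1, h2]
  · intro x y z _ _ _ h1 h2; rw [map_add, add_mul, mul_add, h1, h2]
  · intro r x y _ _ h; rw [map_smul, smul_mul_assoc, mul_smul_comm, h]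
  · intro r x y _ _ h; rw [map_smul, smul_mul_assoc, mul_smul_comm, h]

end GroupLikeCommute

section KalkmanGroupLike

theorem Weil.superComm {v w : Weil L} {m n : ℕ} (hv : parity v = (-1 : ℝ) ^ m • v)
    (hw : parity w = (-1 : ℝ) ^ n • w) : w * v = (-1 : ℝ) ^ (m * n) • (v * w) := by
  rcases Nat.even_or_odd m with h | h
  · rw [h.neg_one_pow, one_smul] at hv
    rw [(h.mul_right n).neg_one_pow, one_smul, Weil.even_central hv]
  rcases Nat.even_or_odd n with h' | h'
  · rw [h'.neg_one_pow, one_smul] at hw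
    rw [(h'.mul_left m).neg_one_pow, one_smul, Weil.even_central hw]
  · rw [h.neg_one_pow, Weil.neg_smul, one_smul] at hv
    rw [h'.neg_one_pow, Weil.neg_smul, one_smul] at hw
    rw [(h.mul h').neg_one_pow, Weil.neg_smul, one_smul]
    -- odd elements anticommute since multiplication by the generators supercommutes
    have key : ∀ w : Weil L, w * v = v * parity w := by
      intro w
      induction w using Weil.induction with
      | one => simp
      | add a b ha hb => rw [add_mul, ha, hb, map_add, mul_add]
      | smul r a ha => rw [smul_mul_assoc, ha, map_smul, mul_smul_comm]
      | mul_t a b hb =>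
        rw [mul_assoc, hb, map_mul, parity_weilt, ← mul_assoc, weilt_comm, mul_assoc]
      | mul_θ a b hb =>
        rw [mul_assoc, hb, map_mul, parity_weilθ, ← mul_assoc, weilθ_comm, hv, Weil.neg_mul,
          Weil.neg_mul, Weil.neg_mul, Weil.mul_neg, mul_assoc]
    rw [key, hw, Weil.mul_neg]

theorem ulComul_genI (u : Sym𝔤 L) : ulComul L (genI u) =
    (genI u ᵍ⊗ₜ (1 : UL L) : UL L ⊗ₛ UL L) + ((1 : UL L) ᵍ⊗ₜ genI u : UL L ⊗ₛ UL L) := by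
  rw [genI, comp_apply, ulComul, TensorAlgebra.lift_ι_apply]
  rfl

theorem comulB_kalkB : PowerSeries.map (comulB L (Weil L)).toRingHom (kalkB L) =
    PowerSeries.map (inFst L (Weil L)).toRingHom (kalkB L) +
      PowerSeries.map (inSnd L (Weil L)).toRingHom (kalkB L) := by
  have h (z : SymDual L ⊗[ℝ] Sym𝔤 L) : comulB L (Weil L) (hOp L (UL L) (polyTens genI z)) =
      inFst L (Weil L) (hOp L (UL L) (polyTens genI z)) +
        inSnd L (Weil L) (hOp L (UL L) (polyTens genI z)) := by
    induction z using TensorProduct.induction_on with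
    | zero => simp only [map_zero, add_zero]
    | add x y hx hy => simp only [map_add, hx, hy]; abel
    | tmul p u =>
      rw [polyTens_tmul, hOp_tmul, comulB_tmul, inFst_tmul, inSnd_tmul, ulComul_genI,
        tmul_add]
  ext n
  rw [map_add (coeff n), coeff_map, coeff_map,
    coeff_map, kalkB, coeff_oddSeries]
  split_ifs
  · refine (map_neg (comulB L (Weil L)) _).trans ?_
    rw [h, neg_add]
    exact congrArg₂ (· + ·) (map_neg (inFst L (Weil L)) _).symm
      (map_neg (inSnd L (Weil L)) _).symm
  · simp

theorem coeff_mul_sub_mem {T : Type*} [Ring T] [Algebra ℝ T] [SuperAlgebra T]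
    {f g : PowerSeries (Weil L ⊗ₛ T)}
    (hf : ∀ n, n ≠ 0 → coeff n f ∈ tensLeft T (weilPos L))
    (hg : ∀ n, n ≠ 0 → coeff n g ∈ tensLeft T (weilPos L)) {n : ℕ} (hn : n ≠ 0) :
    coeff n (f * g) ∈ tensLeft T (weilPos L) := by
  rw [coeff_mul]
  refine Submodule.sum_mem _ fun p hp => ?_
  have := HasAntidiagonal.mem_antidiagonal.1 hp
  by_cases h : p.2 = 0
  · exact tensLeft_mul (fun s hs a => weilPos_mul hs a) (hf _ (by omega)) _
  · exact mul_tensLeft (fun s hs a => mul_weilPos a hs) (fun s hs => parity_mem_weilPos hs) _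
      (hg _ h)

theorem map_coeff_mem {T : Type*} [Ring T] [Algebra ℝ T] [SuperAlgebra T] {T' : Type*} [Ring T']
    [Algebra ℝ T'] [SuperAlgebra T'] {g : T →ₐ[ℝ] T'}
    (hi : ∀ a, AlgHom.id ℝ (Weil L) (parity a) = parity (AlgHom.id ℝ (Weil L) a))
    (hg : ∀ b, g (parity b) = parity (g b)) {z : Weil L ⊗ₛ T}
    (hz : z ∈ tensLeft T (weilPos L)) :
    superMap (AlgHom.id ℝ (Weil L)) g hi hg z ∈ tensLeft T' (weilPos L) := by
  have h := superMapLin_mem_tensLeft_of_mem (f := (AlgHom.id ℝ (Weil L)).toLinearMap)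
    (S := weilPos L) (fun a ha => ha) g.toLinearMap hz
  exact (superMap_eq_superMapLin _ _ hi hg z) ▸ h

theorem commute_of_coeff {R : Type*} [Ring R] {f g : PowerSeries R}
    (h : ∀ m n, coeff m f * coeff n g =
      coeff n g * coeff m f) : f * g = g * f := by
  ext n
  rw [coeff_mul, coeff_mul, ← Finset.Nat.sum_antidiagonal_swap]
  exact sum_congr rfl fun p _ => h _ _

theorem coeff_zero_sub_mul {R : Type*} [Ring R] (c f g : PowerSeries R) :
    coeff 0 (c - f * g) = coeff 0 c -
      coeff 0 f * coeff 0 g := by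
  simp

theorem coeff_map_algHom {R R' : Type*} [Ring R] [Algebra ℝ R] [Ring R'] [Algebra ℝ R']
    (J : R →ₐ[ℝ] R') (f : PowerSeries R) (n : ℕ) :
    coeff n (PowerSeries.map J.toRingHom f) = J (coeff n f) := by
  rw [coeff_map]; rfl

theorem coeff_sub_mul_mem {T : Type*} [Ring T] [Algebra ℝ T] [SuperAlgebra T]
    {c f g : PowerSeries (Weil L ⊗ₛ T)}
    (hc : ∀ n, n ≠ 0 → coeff n c ∈ tensLeft T (weilPos L))
    (hf : ∀ n, n ≠ 0 → coeff n f ∈ tensLeft T (weilPos L))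
    (hg : ∀ n, n ≠ 0 → coeff n g ∈ tensLeft T (weilPos L)) (n : ℕ) (hn : n ≠ 0) :
    coeff n (c - f * g) ∈ tensLeft T (weilPos L) := by
  rw [map_sub (coeff n)]
  exact sub_mem (hc n hn) (coeff_mul_sub_mem hf hg hn)

theorem coeff_map_superMap_mem {T T' : Type*} [Ring T] [Algebra ℝ T] [SuperAlgebra T] [Ring T']
    [Algebra ℝ T'] [SuperAlgebra T'] {g : T →ₐ[ℝ] T'}
    (hi : ∀ a, AlgHom.id ℝ (Weil L) (parity a) = parity (AlgHom.id ℝ (Weil L) a))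
    (hg : ∀ b, g (parity b) = parity (g b)) {f : PowerSeries (Weil L ⊗ₛ T)}
    (hf : ∀ n, n ≠ 0 → coeff n f ∈ tensLeft T (weilPos L)) (n : ℕ) (hn : n ≠ 0) :
    coeff n (PowerSeries.map (superMap (AlgHom.id ℝ (Weil L)) g hi hg).toRingHom f) ∈
      tensLeft T' (weilPos L) := by
  rw [coeff_map_algHom]
  exact map_coeff_mem hi hg (hf n hn)

/-- Factorisation of the solution of `N c = c (b₁ + b₂)`. -/
theorem eq_mul_of_numOp {T : Type*} [Ring T] [Algebra ℝ T] [SuperAlgebra T]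
    {c f s b₁ b₂ : PowerSeries (Weil L ⊗ₛ T)}
    (ec : mapLin (numOp L T) c = c * (b₁ + b₂))
    (ef : mapLin (numOp L T) f = f * b₁)
    (es : mapLin (numOp L T) s = s * b₂) (hb : b₁ * s = s * b₁)
    (hβ : coeff 0 (b₁ + b₂) = 0)
    (c0 : coeff 0 c = 1) (f0 : coeff 0 f = 1)
    (s0 : coeff 0 s = 1)
    (hc : ∀ n, n ≠ 0 → coeff n c ∈ tensLeft T (weilPos L))
    (hf : ∀ n, n ≠ 0 → coeff n f ∈ tensLeft T (weilPos L))
    (hs : ∀ n, n ≠ 0 → coeff n s ∈ tensLeft T (weilPos L)) : c = f * s := by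
  refine sub_eq_zero.1 (eq_zero_of_numOp_eq_mul hβ ?_ (coeff_sub_mul_mem hc hf hs) ?_)
  · rw [coeff_zero_sub_mul, c0, f0, s0, mul_one, sub_self]
  · have aux {R : Type _} [Ring R] {c f s b₁ b₂ : R} (h : b₁ * s = s * b₁) :
        c * (b₁ + b₂) - (f * b₁ * s + f * (s * b₂)) = (c - f * s) * (b₁ + b₂) := by
      rw [mul_assoc f b₁, h]; noncomm_ring
    rw [mapLin_sub, mapLin_numOp_mul, ec, ef, es]
    exact aux hb

theorem mapLin_numOp_superMap_kalkΦ {T' : Type*} [Ring T'] [Algebra ℝ T'] [SuperAlgebra T']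
    {g : UL L →ₐ[ℝ] T'}
    (hi : ∀ a, AlgHom.id ℝ (Weil L) (parity a) = parity (AlgHom.id ℝ (Weil L) a))
    (hg : ∀ b, g (parity b) = parity (g b)) :
    mapLin (numOp L T')
      (PowerSeries.map (superMap (AlgHom.id ℝ (Weil L)) g hi hg).toRingHom (kalkΦ L)) =
      PowerSeries.map (superMap (AlgHom.id ℝ (Weil L)) g hi hg).toRingHom (kalkΦ L) *
        PowerSeries.map (superMap (AlgHom.id ℝ (Weil L)) g hi hg).toRingHom (kalkB L) := by
  rw [mapLin_numOp_map (fun z => numOp_superMap g hi hg z), mapLin_numOp_kalkΦ, map_mul]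

theorem coeff_zero_map_kalkΦ {R : Type*} [Ring R] [Algebra ℝ R] (J : (Weil L ⊗ₛ UL L) →ₐ[ℝ] R) :
    coeff 0 (PowerSeries.map J.toRingHom (kalkΦ L)) = 1 := by
  rw [coeff_map_algHom, coeff_zero_kalkΦ, map_one]

theorem coeff_zero_map_kalkB_eq {R : Type*} [Ring R] [Algebra ℝ R]
    (J : (Weil L ⊗ₛ UL L) →ₐ[ℝ] R) :
    coeff 0 (PowerSeries.map J.toRingHom (kalkB L)) = 0 := by
  rw [coeff_map_algHom, coeff_zero_kalkB, map_zero]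

theorem inFst_kalkB_comm : PowerSeries.map (inFst L (Weil L)).toRingHom (kalkB L) *
      PowerSeries.map (inSnd L (Weil L)).toRingHom (kalkΦ L) =
      PowerSeries.map (inSnd L (Weil L)).toRingHom (kalkΦ L) *
      PowerSeries.map (inFst L (Weil L)).toRingHom (kalkB L) := by
  refine commute_of_coeff fun m n => ?_
  rw [coeff_map, coeff_map]
  exact inFst_inSnd_comm (fun s hs => parity_of_mem_weilDeg hs)
    (fun s hs => parity_of_mem_weilDeg hs)
    (fun s hs t ht => Weil.superComm (parity_of_mem_weilDeg hs) (parity_of_mem_weilDeg ht))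
    (coeff_kalkB_mem m) (coeff_kalkΦ_mem n)

theorem comulB_kalkΦ : PowerSeries.map (comulB L (Weil L)).toRingHom (kalkΦ L) =
    PowerSeries.map (inFst L (Weil L)).toRingHom (kalkΦ L) *
      PowerSeries.map (inSnd L (Weil L)).toRingHom (kalkΦ L) :=
  eq_mul_of_numOp ((mapLin_numOp_superMap_kalkΦ _ _).trans (congrArg _ comulB_kalkB))
    (mapLin_numOp_superMap_kalkΦ _ _) (mapLin_numOp_superMap_kalkΦ _ _) inFst_kalkB_comm
    ((congrArg (coeff 0) comulB_kalkB).symm.trans (coeff_zero_map_kalkB_eq _))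
    (coeff_zero_map_kalkΦ _) (coeff_zero_map_kalkΦ _) (coeff_zero_map_kalkΦ _)
    (coeff_map_superMap_mem _ _ fun _ => coeff_kalkΦ_mem_tensLeft)
    (coeff_map_superMap_mem _ _ fun _ => coeff_kalkΦ_mem_tensLeft)
    (coeff_map_superMap_mem _ _ fun _ => coeff_kalkΦ_mem_tensLeft)

theorem numOp_add_commutator {T : Type*} [Ring T] [Algebra ℝ T] [SuperAlgebra T]
    {l : Weil L ⊗ₛ T} (hl : numOp L T l = 0) (a y : Weil L ⊗ₛ T) :
    numOp L T (a + (l * y - y * l)) = numOp L T a + (l * numOp L T y - numOp L T y * l) := by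
  rw [map_add, map_sub, numOp_mul, numOp_mul, hl, zero_mul, mul_zero, zero_add, add_zero]

theorem hOp_commutator {T : Type*} [Ring T] [Algebra ℝ T] [SuperAlgebra T]
    {l : Weil L ⊗ₛ T} (hl : hOp L T l = 0) (hp : parity l = l) (y : Weil L ⊗ₛ T) :
    hOp L T (y * l - l * y) + (l * hOp L T y - hOp L T y * l) = 0 := by
  rw [map_sub, hOp_mul, hOp_mul, hl, hp, mul_zero, zero_mul, add_zero, zero_add]
  abel

/-- The action of `x` on `W𝔤 ⊗ U(D𝔤)`, restricted to `W𝔤 ⊗ U(L(S⁺𝔤))`. -/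
def totL (x : L) : (Weil L ⊗ₛ UL L) →ₗ[ℝ] (Weil L ⊗ₛ UD L) :=
  superMapLin (weilL x) (ulToUD L).toLinearMap +
    (mulLeft ℝ ((1 : Weil L) ᵍ⊗ₜ udL x : Weil L ⊗ₛ UD L) -
      mulRight ℝ ((1 : Weil L) ᵍ⊗ₜ udL x : Weil L ⊗ₛ UD L)) ∘ₗ
        (toBUD L (Weil L)).toLinearMap

theorem totL_apply (x : L) (z : Weil L ⊗ₛ UL L) : totL x z =
    superMapLin (weilL x) (ulToUD L).toLinearMap z +
      ((1 ᵍ⊗ₜ udL x : Weil L ⊗ₛ UD L) * toBUD L (Weil L) z -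
        toBUD L (Weil L) z * (1 ᵍ⊗ₜ udL x : Weil L ⊗ₛ UD L)) := rfl

theorem totL_isDerOver (x : L) :
    IsDerOver (toBUD L (Weil L)) (toBUD L (Weil L)) (totL x) := by
  intro a b
  have h : superMapLin (weilL x) (ulToUD L).toLinearMap (a * b) =
      superMapLin (weilL x) (ulToUD L).toLinearMap a * toBUD L (Weil L) b +
        toBUD L (Weil L) a * superMapLin (weilL x) (ulToUD L).toLinearMap b :=
    IsEvenDer.superMapLin (weilL_isEvenDer x) (weilL_parity x) (ulToUD L) _ _ a b
  rw [totL_apply, totL_apply, totL_apply, h, map_mul]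
  noncomm_ring

theorem numOp_totL (x : L) (z : Weil L ⊗ₛ UL L) :
    numOp L (UD L) (totL x z) = totL x (numOp L (UL L) z) := by
  have h1 : numOp L (UD L) ((1 : Weil L) ᵍ⊗ₜ udL x : Weil L ⊗ₛ UD L) = 0 := by
    rw [numOp, superMapLin_tmul, weilN_isEvenDer.map_one]
    simp [GradedTensorProduct.tmul]
  rw [totL_apply, totL_apply, numOp_add_commutator h1, numOp_toBUD,
    numOp_superMapLin (weilN_weilL x)]

theorem totL_kalkB (x : L) : mapLin (totL x) (kalkB L) = 0 := by
  have hl : hOp L (UD L) ((1 : Weil L) ᵍ⊗ₜ udL x : Weil L ⊗ₛ UD L) = 0 := by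
    rw [hOp_tmul, weilH_isOddDer.map_one]
    simp [GradedTensorProduct.tmul]
  have hp : parity ((1 : Weil L) ᵍ⊗ₜ udL x : Weil L ⊗ₛ UD L) = 1 ᵍ⊗ₜ udL x := by
    rw [parity_tmul, map_one, parity_udL]
  have h (k : ℕ) : totL x (hOp L (UL L) (polyTens genI (canonElt L ^ k))) = 0 := by
    have e1 : toBUD L (Weil L) (hOp L (UL L) (polyTens genI (canonElt L ^ k))) =
        hOp L (UD L) (polyTens udI (canonElt L ^ k)) := by
      rw [← toBUD_polyTens, toBUD_eq_superMapLin, toBUD_eq_superMapLin, hOp, hOp,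
        superMapLin_comp_apply, superMapLin_comp_apply]
      rfl
    have e2 : superMapLin (weilL x) (ulToUD L).toLinearMap
        (hOp L (UL L) (polyTens genI (canonElt L ^ k))) =
        hOp L (UD L) (superMapLin (weilL x) .id (polyTens udI (canonElt L ^ k))) := by
      rw [← toBUD_polyTens, toBUD_eq_superMapLin, hOp, hOp, superMapLin_comp_apply,
        superMapLin_comp_apply, superMapLin_comp_apply,
        show weilL x ∘ₗ weilH L = weilH L ∘ₗ weilL x from
          LinearMap.ext fun w => (weilH_weilL x w).symm]
      rfl
    rw [totL_apply, e1, e2, superMapLin_weilL_canonElt_pow]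
    exact hOp_commutator hl hp _
  rw [kalkB, mapLin_oddSeries]
  ext n
  rw [coeff_oddSeries, map_zero]
  split_ifs
  · rw [map_neg, h, neg_zero]
  · rfl

theorem totL_kalkΦ (x : L) : mapLin (totL x) (kalkΦ L) = 0 := by
  have e : mapLin (numOp L (UD L)) (mapLin (totL x) (kalkΦ L)) =
      mapLin (totL x) (kalkΦ L) *
        PowerSeries.map (toBUD L (Weil L)).toRingHom (kalkB L) := by
    have h := (totL_isDerOver x).mapLin_mul (kalkΦ L) (kalkB L)
    rw [totL_kalkB, mul_zero, add_zero] at h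
    rw [← h, ← mapLin_numOp_kalkΦ, mapLin_mapLin, mapLin_mapLin,
      show numOp L (UD L) ∘ₗ totL x = totL x ∘ₗ numOp L (UL L) from LinearMap.ext (numOp_totL x)]
  refine eq_zero_of_numOp_eq_mul coeff_zero_map_kalkB ?_ ?_ e
  · rw [coeff_mapLin, coeff_zero_kalkΦ, (totL_isDerOver x).map_one]
  · intro n hn
    rw [coeff_mapLin, totL_apply]
    have hm := map_coeff_mem (g := ulToUD L) (fun _ => rfl) parity_ulToUD
      (coeff_kalkΦ_mem_tensLeft (L := L) hn)
    refine add_mem (superMapLin_mem_tensLeft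
      (map_mem_weilPos (weilL_isEvenDer x).map_one (weilN_weilL x)) _ _) (sub_mem ?_ ?_)
    · exact mul_tensLeft (fun s hs a => mul_weilPos a hs) (fun s hs => parity_mem_weilPos hs) _ hm
    · exact tensLeft_mul (fun s hs a => weilPos_mul hs a) hm _

/-- The element `Φ` exists. -/
theorem exists_isKalkman : ∃ Φ : PowerSeries (Weil L ⊗ₛ UL L), IsKalkman Φ :=
  ⟨kalkΦ L, coeff_kalkΦ_mem, coeff_zero_kalkΦ, comulB_kalkΦ, fun x n => by
    have h := congrArg (coeff n) (totL_kalkΦ (L := L) x)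
    rwa [coeff_mapLin, totL_apply, map_zero] at h, totalD_kalkΦ⟩

end KalkmanGroupLike

/-! ### Smooth functions with values in finite dimensional subspaces -/
section SmoothFin
variable {E : Type*} [NormedAddCommGroup E] [NormedSpace ℝ E]
  {U V W : Type*} [AddCommGroup U] [Module ℝ U] [AddCommGroup V] [Module ℝ V]
  [AddCommGroup W] [Module ℝ W]

variable (U) in
/-- The functions `E → U` which on `s` are finite sums of products `c • u` of smooth functions `c`
and constant vectors `u`. -/
def smoothFin (s : Set E) : Submodule ℝ (E → U) :=
  Submodule.span ℝ {f | ∃ (c : E → ℝ) (u : U), ContDiffOn ℝ ∞ c s ∧ ∀ z ∈ s, f z = c z • u}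

variable {s : Set E}

theorem smul_mem_smoothFin {c : E → ℝ} (hc : ContDiffOn ℝ ∞ c s) (u : U) :
    (fun z => c z • u) ∈ smoothFin U s :=
  subset_span ⟨c, u, hc, fun _ _ => rfl⟩

theorem const_mem_smoothFin (u : U) : (fun _ => u) ∈ smoothFin U s :=
  subset_span ⟨fun _ => 1, u, contDiffOn_const, fun _ _ => (one_smul _ _).symm⟩

theorem smoothFin_congr {f g : E → U} (hf : f ∈ smoothFin U s) (h : ∀ z ∈ s, g z = f z) :
    g ∈ smoothFin U s := by
  have h0 : g - f ∈ smoothFin U s := subset_span ⟨fun _ => 0, 0, contDiffOn_const,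
    fun z hz => by simp [h z hz]⟩
  simpa using add_mem h0 hf

theorem smoothFin_linear (Q : U →ₗ[ℝ] V) {f : E → U} (hf : f ∈ smoothFin U s) :
    (fun z => Q (f z)) ∈ smoothFin V s := by
  induction hf using span_induction with
  | mem f h =>
    obtain ⟨c, u, hc, h⟩ := h
    exact subset_span ⟨c, Q u, hc, fun z hz => by simp only [h z hz, map_smul]⟩
  | zero => simp only [Pi.zero_apply, map_zero]; exact zero_mem (smoothFin V s)
  | add f g _ _ hf hg => simp only [Pi.add_apply, map_add]; exact add_mem hf hg
  | smul r f _ hf => simp only [Pi.smul_apply, map_smul]; exact smul_mem _ r hf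

theorem smoothFin_bilin (B : U →ₗ[ℝ] V →ₗ[ℝ] W) {f : E → U} {g : E → V}
    (hf : f ∈ smoothFin U s) (hg : g ∈ smoothFin V s) :
    (fun z => B (f z) (g z)) ∈ smoothFin W s := by
  induction hf using span_induction with
  | mem f h =>
    obtain ⟨c, u, hc, h⟩ := h
    induction hg using span_induction with
    | mem g h' =>
      obtain ⟨d, v, hd, h'⟩ := h'
      exact subset_span ⟨fun z => d z * c z, B u v, hd.mul hc,
        fun z hz => by simp [h z hz, h' z hz, smul_smul]⟩
    | zero => simp only [Pi.zero_apply, map_zero]; exact zero_mem (smoothFin W s)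
    | add f g _ _ hf hg => simp only [Pi.add_apply, map_add]; exact add_mem hf hg
    | smul r f _ hf => simp only [Pi.smul_apply, map_smul]; exact smul_mem _ r hf
  | zero =>
    simp only [Pi.zero_apply, map_zero, LinearMap.zero_apply]; exact zero_mem (smoothFin W s)
  | add f g _ _ hf hg =>
    simp only [Pi.add_apply, map_add, LinearMap.add_apply]; exact add_mem hf hg
  | smul r f _ hf =>
    simp only [Pi.smul_apply, map_smul, LinearMap.smul_apply]; exact smul_mem _ r hf

theorem smoothFin_mul {A : Type*} [Ring A] [Algebra ℝ A] {f g : E → A}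
    (hf : f ∈ smoothFin A s) (hg : g ∈ smoothFin A s) : (fun z => f z * g z) ∈ smoothFin A s :=
  smoothFin_bilin (LinearMap.mul ℝ A) hf hg

theorem smoothFin_pow {A : Type*} [Ring A] [Algebra ℝ A] {f : E → A}
    (hf : f ∈ smoothFin A s) (k : ℕ) : (fun z => f z ^ k) ∈ smoothFin A s := by
  induction k with
  | zero => simpa using const_mem_smoothFin (1 : A)
  | succ k ih => simpa only [pow_succ] using smoothFin_mul ih hf

theorem smoothFin_sum {ι : Type*} (t : Finset ι) {f : ι → E → U}
    (hf : ∀ i ∈ t, f i ∈ smoothFin U s) : (fun z => ∑ i ∈ t, f i z) ∈ smoothFin U s := by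
  have : (fun z => ∑ i ∈ t, f i z) = ∑ i ∈ t, f i := by ext z; simp
  rw [this]; exact Submodule.sum_mem _ hf

theorem smoothFin_add {f g : E → U} (hf : f ∈ smoothFin U s) (hg : g ∈ smoothFin U s) :
    (fun z => f z + g z) ∈ smoothFin U s := add_mem hf hg

theorem smoothFin_sub {f g : E → U} (hf : f ∈ smoothFin U s) (hg : g ∈ smoothFin U s) :
    (fun z => f z - g z) ∈ smoothFin U s := sub_mem hf hg

theorem smoothFin_const_smul (r : ℝ) {f : E → U} (hf : f ∈ smoothFin U s) :
    (fun z => r • f z) ∈ smoothFin U s := smul_mem _ r hf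

theorem contDiffOn_of_mem_smoothFin {f : E → U} (hf : f ∈ smoothFin U s)
    (l : Dual ℝ U) : ContDiffOn ℝ ∞ (fun z => l (f z)) s := by
  induction hf using span_induction with
  | mem f h =>
    obtain ⟨c, u, hc, h⟩ := h
    exact (hc.mul (contDiffOn_const (c := l u))).congr fun z hz => by
      simp only [h z hz, map_smul, smul_eq_mul]
  | zero => simpa only [Pi.zero_apply, map_zero] using contDiffOn_const
  | add f g _ _ hf hg => simpa only [Pi.add_apply, map_add] using hf.add hg
  | smul r f _ hf =>
    simpa only [Pi.smul_apply, map_smul, smul_eq_mul] using (contDiffOn_const (c := r)).mul hf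

/-- A function with values in a finite dimensional subspace lies in `smoothFin` if its components
are smooth. -/
theorem mem_smoothFin_of_contDiffOn {f : E → U} (P : Submodule ℝ U) [Module.Finite ℝ P]
    (hP : ∀ z ∈ s, f z ∈ P)
    (h : ∀ l : Dual ℝ U, ContDiffOn ℝ ∞ (fun z => l (f z)) s) : f ∈ smoothFin U s := by
  obtain ⟨p, hp⟩ := LinearMap.exists_leftInverse_of_injective P.subtype (Submodule.ker_subtype P)
  have hp' (z) (hz : z ∈ s) : f z = ∑ i, (((finBasis ℝ P).coord i) ∘ₗ p) (f z) •
      (finBasis ℝ P i : U) := by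
    have h1 : p (f z) = ⟨f z, hP z hz⟩ := DFunLike.congr_fun hp ⟨f z, hP z hz⟩
    have h2 := (finBasis ℝ P).sum_repr ⟨f z, hP z hz⟩
    have h3 := congrArg P.subtype h2
    rw [map_sum] at h3
    simp only [comp_apply, h1, Module.Basis.coord_apply]
    exact h3.symm
  exact smoothFin_congr (smoothFin_sum _ fun i _ => smul_mem_smoothFin (h _) _) hp'

theorem mem_smoothFin_of_contDiffOn' {F : Type*} [NormedAddCommGroup F] [NormedSpace ℝ F]
    [FiniteDimensional ℝ F] {f : E → F} (h : ContDiffOn ℝ ∞ f s) : f ∈ smoothFin F s := by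
  have hb (z : E) : f z = ∑ i, (finBasis ℝ F).coord i (f z) • finBasis ℝ F i := by
    simp [Module.Basis.sum_repr]
  rw [show f = fun z => ∑ i, (finBasis ℝ F).coord i (f z) • finBasis ℝ F i from
    funext hb]
  exact smoothFin_sum _ fun i _ => smul_mem_smoothFin
    ((LinearMap.toContinuousLinearMap ((finBasis ℝ F).coord i)).contDiff.comp_contDiffOn h) _

end SmoothFin

section HasD
variable {U V W : Type*} [AddCommGroup U] [Module ℝ U] [AddCommGroup V] [Module ℝ V]
  [AddCommGroup W] [Module ℝ W]

/-- `f` has derivative `f'` at `y`, in the sense that this holds after composition with every linear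
functional. -/
def HasD (f : E → U) (y : E) (f' : E →ₗ[ℝ] U) : Prop :=
  ∀ l : Dual ℝ U,
    HasFDerivAt (fun z => l (f z)) (LinearMap.toContinuousLinearMap (l ∘ₗ f')) y

variable {f g : E → U} {y : E} {f' g' : E →ₗ[ℝ] U}

theorem HasD.add (hf : HasD f y f') (hg : HasD g y g') :
    HasD (fun z => f z + g z) y (f' + g') := fun l => by
  have h := (hf l).add (hg l)
  simp only [map_add]
  exact h.congr_fderiv (by ext v; simp)

theorem HasD.const_smul (r : ℝ) (hf : HasD f y f') :
    HasD (fun z => r • f z) y (r • f') := fun l => by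
  have h := (hf l).const_mul r
  simp only [map_smul, smul_eq_mul]
  exact h.congr_fderiv (by ext v; simp)

theorem HasD.sum {ι : Type*} (t : Finset ι) {f : ι → E → U} {f' : ι → E →ₗ[ℝ] U}
    (hf : ∀ i ∈ t, HasD (f i) y (f' i)) :
    HasD (fun z => ∑ i ∈ t, f i z) y (∑ i ∈ t, f' i) := fun l => by
  have h := HasFDerivAt.fun_sum (u := t) (A := fun i z => l (f i z)) fun i hi => hf i hi l
  simp only [map_sum]
  exact h.congr_fderiv (by ext v; simp)

theorem hasD_const (u : U) : HasD (fun _ => u) y (0 : E →ₗ[ℝ] U) := fun l => by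
  have := hasFDerivAt_const (𝕜 := ℝ) (l u) y
  exact this.congr_fderiv (by ext v; simp)

theorem HasD.linear (hf : HasD f y f') (Q : U →ₗ[ℝ] V) : HasD (fun z => Q (f z)) y (Q ∘ₗ f') :=
  fun l => hf (l ∘ₗ Q)

theorem HasD.congr (hf : HasD f y f') (h : g =ᶠ[nhds y] f) : HasD g y f' := fun l =>
  (hf l).congr_of_eventuallyEq (h.mono fun z hz => by simp only [hz])

theorem HasD.unique (hf : HasD f y f') (hg : HasD f y g') : f' = g' := by
  refine LinearMap.ext fun v => ?_
  rw [← sub_eq_zero, ← Module.forall_dual_apply_eq_zero_iff ℝ]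
  intro l
  have h := DFunLike.congr_fun ((hf l).unique (hg l)) v
  rw [map_sub, sub_eq_zero]
  exact h

theorem HasD.dirDeriv_eq (hf : HasD f y f') (v : E) : dirDeriv f y v = f' v := by
  have h (i) : fderiv ℝ (fun z => (Module.Basis.ofVectorSpace ℝ U).repr (f z) i) y v =
      (Module.Basis.ofVectorSpace ℝ U).repr (f' v) i := by
    have h1 := (hf ((Module.Basis.ofVectorSpace ℝ U).coord i)).fderiv
    exact DFunLike.congr_fun h1 v
  simp only [dirDeriv, h]
  conv_rhs => rw [← (Module.Basis.ofVectorSpace ℝ U).linearCombination_repr (f' v)]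
  rw [Finsupp.linearCombination_apply, Finsupp.sum]
  refine finsum_eq_sum_of_support_subset _ fun i hi => ?_
  simp only [Function.mem_support, ne_eq, Finset.mem_coe, Finsupp.mem_support_iff] at hi ⊢
  intro h0
  exact hi (by rw [h0, zero_smul])

theorem hasD_smul {c : E → ℝ} {c' : E →L[ℝ] ℝ} (hc : HasFDerivAt c c' y) (u : U) :
    HasD (fun z => c z • u) y (c'.toLinearMap.smulRight u) := fun l => by
  have h := hc.mul_const (l u)
  simp only [map_smul, smul_eq_mul]
  exact h.congr_fderiv (by ext v; simp [mul_comm])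

theorem HasFDerivAt.hasD {F : Type*} [NormedAddCommGroup F] [NormedSpace ℝ F]
    [FiniteDimensional ℝ F] {f : E → F} {f' : E →L[ℝ] F} (h : HasFDerivAt f f' y) :
    HasD f y f'.toLinearMap := fun l =>
  ((LinearMap.toContinuousLinearMap l).hasFDerivAt.comp y h)

variable {s : Set E}

theorem exists_hasD (hs : IsOpen s) (hy : y ∈ s) (hf : f ∈ smoothFin U s) :
    ∃ f', HasD f y f' := by
  induction hf using span_induction with
  | mem f h =>
    obtain ⟨c, u, hc, h⟩ := h
    have hd := ((hc.contDiffAt (hs.mem_nhds hy)).differentiableAt (by simp)).hasFDerivAt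
    exact ⟨_, (hasD_smul hd u).congr (Filter.mem_of_superset (hs.mem_nhds hy) h)⟩
  | zero => exact ⟨0, hasD_const 0⟩
  | add f g _ _ hf hg =>
    obtain ⟨f', hf⟩ := hf
    obtain ⟨g', hg⟩ := hg
    exact ⟨_, hf.add hg⟩
  | smul r f _ hf =>
    obtain ⟨f', hf⟩ := hf
    exact ⟨_, hf.const_smul r⟩

/-- The product rule for bilinear maps. -/
theorem HasD.bilin (B : U →ₗ[ℝ] V →ₗ[ℝ] W) {g : E → V} {g' : E →ₗ[ℝ] V} (hs : IsOpen s)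
    (hy : y ∈ s) (hfs : f ∈ smoothFin U s) (hgs : g ∈ smoothFin V s) (hf : HasD f y f')
    (hg : HasD g y g') :
    HasD (fun z => B (f z) (g z)) y (B.flip (g y) ∘ₗ f' + B (f y) ∘ₗ g') := by
  induction hfs using span_induction generalizing f' with
  | mem f h =>
    obtain ⟨c, u, hc, h⟩ := h
    have hcd := ((hc.contDiffAt (hs.mem_nhds hy)).differentiableAt (by simp)).hasFDerivAt
    have hfe : f =ᶠ[nhds y] fun z => c z • u := Filter.mem_of_superset (hs.mem_nhds hy) h
    obtain rfl := hf.unique ((hasD_smul hcd u).congr hfe)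
    intro l
    have h2 := hcd.mul (hg (l ∘ₗ B u))
    refine (h2.congr_fderiv ?_).congr_of_eventuallyEq (hfe.mono fun z hz => ?_)
    · ext v
      simp [h y hy, mul_comm, add_comm]
    · simp only [hz, map_smul, LinearMap.smul_apply, smul_eq_mul]
      rfl
  | zero =>
    obtain rfl := hf.unique (hasD_const (0 : U))
    have h := hasD_const (y := y) (0 : W)
    simp only [Pi.zero_apply, map_zero, LinearMap.zero_apply]
    convert h using 1
    ext v; simp
  | add f₁ f₂ h₁ h₂ ih₁ ih₂ =>
    obtain ⟨f₁', hf₁⟩ := exists_hasD hs hy h₁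
    obtain ⟨f₂', hf₂⟩ := exists_hasD hs hy h₂
    obtain rfl := hf.unique (hf₁.add hf₂)
    have h := (ih₁ hf₁).add (ih₂ hf₂)
    simp only [Pi.add_apply, map_add, LinearMap.add_apply]
    convert h using 1
    ext v; simp; abel
  | smul r f₁ h₁ ih₁ =>
    obtain ⟨f₁', hf₁⟩ := exists_hasD hs hy h₁
    obtain rfl := hf.unique (hf₁.const_smul r)
    have h := (ih₁ hf₁).const_smul r
    simp only [Pi.smul_apply, map_smul, LinearMap.smul_apply]
    convert h using 1
    ext v; simp

theorem HasD.mul {A : Type*} [Ring A] [Algebra ℝ A] {f g : E → A} {f' g' : E →ₗ[ℝ] A}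
    (hs : IsOpen s) (hy : y ∈ s) (hfs : f ∈ smoothFin A s) (hgs : g ∈ smoothFin A s)
    (hf : HasD f y f') (hg : HasD g y g') :
    HasD (fun z => f z * g z) y (mulRight ℝ (g y) ∘ₗ f' + mulLeft ℝ (f y) ∘ₗ g') :=
  HasD.bilin (LinearMap.mul ℝ A) hs hy hfs hgs hf hg

end HasD

/-! ### Elements of degree zero over an exterior algebra -/
section DegreeZero

theorem fg_ULdeg (n : ℕ) : (ULdeg L n).FG := by
  induction n using Nat.strong_induction_on with
  | _ n ih =>
    have hfg : (Submodule.span ℝ {(1 : UL L)} ⊔ ⨆ k : Fin n,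
        (MvPolynomial.homogeneousSubmodule (Idx L) ℝ (k + 1)).map genI *
          ULdeg L (n - (2 * k + 1))).FG := by
      refine Submodule.FG.sup (Submodule.fg_span_singleton _) (Submodule.fg_iSup _ fun k => ?_)
      exact Submodule.FG.mul (Submodule.FG.map _ (MvPolynomial.homogeneousSubmodule_fg _ _ _))
        (ih _ (by omega))
    refine Submodule.FG.of_le hfg (Submodule.span_le.2 ?_)
    rintro w hw
    cases hw with
    | one => exact Submodule.mem_sup_left (Submodule.mem_span_singleton_self 1)
    | @mul k m u w hu hw =>
      refine Submodule.mem_sup_right (Submodule.mem_iSup_of_mem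
        (⟨k, by omega⟩ : Fin (2 * k + 1 + m)) (Submodule.mul_mem_mul ?_ ?_))
      · exact ⟨u, hu, rfl⟩
      · rw [show 2 * k + 1 + m - (2 * k + 1) = m by omega]
        exact subset_span hw

theorem fg_bidegree {B : Type*} [Ring B] [Algebra ℝ B] [SuperAlgebra B] {S : Submodule ℝ B}
    (hS : S.FG) (n : ℕ) : (bidegree (𝔤 := L) S n).FG := by
  refine Submodule.FG.of_le (((Submodule.FG.map₂ (TensorProduct.mk ℝ B (UL L)) hS
    (fg_ULdeg n))).map (GradedTensorProduct.of ℝ (part B) (part (UL L))).toLinearMap)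
    (Submodule.span_le.2 ?_)
  rintro _ ⟨b, hb, u, hu, rfl⟩
  exact ⟨_, Submodule.apply_mem_map₂ _ hb hu, rfl⟩

variable {V : Type*} [AddCommGroup V] [Module ℝ V]

variable (L V) in
/-- The elements of total degree zero of `ΛV ⊗ U(L(S⁺𝔤))` whose components in `ΛⁿV` vanish for
`n < k`. -/
def degFiltration (k : ℕ) : Submodule ℝ (ExteriorAlgebra ℝ V ⊗ₛ UL L) :=
  ⨆ n : ℕ, bidegree (⋀[ℝ]^(k + n) V) (k + n)

theorem bidegree_le_degFiltration {k n : ℕ} (h : k ≤ n) :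
    bidegree (⋀[ℝ]^n V) n ≤ degFiltration L V k := by
  obtain ⟨m, rfl⟩ := Nat.exists_eq_add_of_le h
  exact le_iSup (fun m => bidegree (𝔤 := L) (⋀[ℝ]^(k + m) V) (k + m)) m

theorem mul_mem_degFiltration {j k : ℕ} {x y : ExteriorAlgebra ℝ V ⊗ₛ UL L}
    (hx : x ∈ degFiltration L V j) (hy : y ∈ degFiltration L V k) :
    x * y ∈ degFiltration L V (j + k) := by
  induction hx using Submodule.iSup_induction' with
  | mem m x hx =>
    induction hy using Submodule.iSup_induction' with
    | mem n y hy =>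
      refine bidegree_le_degFiltration (n := (j + m) + (k + n)) (by omega)
        (bidegree_mul (S := ⋀[ℝ]^(j + m) V) (T := ⋀[ℝ]^(k + n) V) (fun s hs t ht => ?_)
        (fun t ht => parity_of_mem ht) hx hy)
      exact SetLike.mul_mem_graded hs ht
    | zero => rw [mul_zero]; exact zero_mem _
    | add y z _ _ hy hz => rw [mul_add]; exact add_mem hy hz
  | zero => rw [zero_mul]; exact zero_mem _
  | add y z _ _ hy hz => rw [add_mul]; exact add_mem hy hz

theorem one_mem_degFiltration : (1 : ExteriorAlgebra ℝ V ⊗ₛ UL L) ∈ degFiltration L V 0 :=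
  bidegree_le_degFiltration le_rfl
    (tmul_mem_bidegree (one_mem_exteriorPower_zero) one_mem_ULdeg)

theorem parity_of_mem_degFiltration {k : ℕ} {x : ExteriorAlgebra ℝ V ⊗ₛ UL L}
    (hx : x ∈ degFiltration L V k) : parity x = x := by
  induction hx using Submodule.iSup_induction' with
  | mem m x hx => exact parity_of_mem_bidegree (fun s hs => parity_of_mem hs) hx
  | zero => rw [map_zero]
  | add y z _ _ hy hz => rw [map_add, hy, hz]

theorem pow_mem_degFiltration {x : ExteriorAlgebra ℝ V ⊗ₛ UL L}
    (hx : x ∈ degFiltration L V 1) (k : ℕ) : x ^ k ∈ degFiltration L V k := by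
  induction k with
  | zero => rw [pow_zero]; exact one_mem_degFiltration
  | succ k ih => rw [pow_succ]; exact mul_mem_degFiltration ih hx

theorem exteriorPower_eq_bot [Module.Finite ℝ V] {n : ℕ} (h : finrank ℝ V < n) :
    ⋀[ℝ]^n V = ⊥ := by
  have h1 : finrank ℝ (⋀[ℝ]^n V) = 0 := by
    rw [exteriorPower.finrank_eq, Nat.choose_eq_zero_of_lt h]
  exact Submodule.finrank_eq_zero.1 h1

theorem bidegree_bot {B : Type*} [Ring B] [Algebra ℝ B] [SuperAlgebra B] (n : ℕ) :
    bidegree (𝔤 := L) (⊥ : Submodule ℝ B) n = ⊥ := by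
  refine eq_bot_iff.2 (Submodule.span_le.2 ?_)
  rintro _ ⟨b, hb, u, -, rfl⟩
  rw [(Submodule.mem_bot ℝ).1 hb, ← zero_smul ℝ (0 : B), smul_tmul, zero_smul]
  exact zero_mem _

theorem degFiltration_eq_bot [Module.Finite ℝ V] {k : ℕ} (h : finrank ℝ V < k) :
    degFiltration L V k = ⊥ := by
  refine eq_bot_iff.2 (iSup_le fun n => ?_)
  rw [exteriorPower_eq_bot (by omega), bidegree_bot]

theorem fg_degFiltration_zero [Module.Finite ℝ V] : (degFiltration L V 0).FG := by
  refine Submodule.FG.of_le (T := ⨆ n : Fin (finrank ℝ V + 1),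
    bidegree (𝔤 := L) (⋀[ℝ]^(n : ℕ) V) n) (Submodule.fg_iSup _ fun n => ?_)
    (iSup_le fun n => ?_)
  · exact fg_bidegree (Submodule.FG.of_finite) _
  · rw [zero_add]
    by_cases h : n < finrank ℝ V + 1
    · exact le_iSup (fun n : Fin (finrank ℝ V + 1) =>
        bidegree (𝔤 := L) (⋀[ℝ]^(n : ℕ) V) n) ⟨n, h⟩
    · rw [exteriorPower_eq_bot (by omega), bidegree_bot]
      exact bot_le

variable (L V) in
/-- The augmentation of `ΛV ⊗ U(L(S⁺𝔤))`, as a linear functional. -/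
def augm : (ExteriorAlgebra ℝ V ⊗ₛ UL L) →ₗ[ℝ] ℝ :=
  LinearMap.mul' ℝ ℝ ∘ₗ TensorProduct.map algebraMapInv.toLinearMap
    TensorAlgebra.algebraMapInv.toLinearMap ∘ₗ
      (GradedTensorProduct.of ℝ (part (ExteriorAlgebra ℝ V)) (part (UL L))).symm.toLinearMap

theorem augm_tmul (a : ExteriorAlgebra ℝ V) (u : UL L) :
    augm L V (a ᵍ⊗ₜ u : ExteriorAlgebra ℝ V ⊗ₛ UL L) =
      algebraMapInv a * TensorAlgebra.algebraMapInv u := rfl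

theorem augm_one : augm L V 1 = 1 := by
  rw [one_def, augm_tmul, map_one, map_one, one_mul]

theorem sub_augm_mem {x : ExteriorAlgebra ℝ V ⊗ₛ UL L} (hx : x ∈ degFiltration L V 0) :
    x - augm L V x • 1 ∈ degFiltration L V 1 := by
  induction hx using Submodule.iSup_induction' with
  | mem m x hx =>
    rw [zero_add] at hx
    induction hx using span_induction with
    | mem x h =>
      obtain ⟨b, hb, u, hu, rfl⟩ := h
      rw [augm_tmul]
      rcases Nat.eq_zero_or_pos m with rfl | hm
      · have hu' : u ∈ Submodule.span ℝ {(1 : UL L)} := by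
          refine Submodule.span_mono ?_ hu
          have : ∀ n w, IsWord (𝔤 := L) n w → n = 0 → w = 1 := by
            intro n w hw hn
            cases hw with
            | one => rfl
            | mul hu hw => omega
          exact fun w hw => this 0 w hw rfl
        obtain ⟨r, rfl⟩ := Submodule.mem_span_singleton.1 hu'
        rw [exteriorPower, pow_zero, Submodule.mem_one] at hb
        obtain ⟨c, rfl⟩ := hb
        have : (algebraMap ℝ (ExteriorAlgebra ℝ V) c ᵍ⊗ₜ (r • (1 : UL L)) :
            ExteriorAlgebra ℝ V ⊗ₛ UL L) = (c * r) • 1 := by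
          rw [Algebra.algebraMap_eq_smul_one, tmul_smul, smul_tmul,
            ← one_def, smul_smul, mul_comm]
        rw [this, map_smul, map_one, ExteriorAlgebra.algebraMap_leftInverse, smul_eq_mul, mul_one,
          sub_self]
        exact zero_mem _
      · have : TensorAlgebra.algebraMapInv u = (0 : ℝ) := by
          induction hu using span_induction with
          | mem w hw =>
            cases hw with
            | one => omega
            | mul hu hw =>
              rw [map_mul, genI, comp_apply, TensorAlgebra.algebraMapInv,
                TensorAlgebra.lift_ι_apply, LinearMap.zero_apply, zero_mul]
          | zero => rw [map_zero]
          | add x y _ _ hx hy => rw [map_add, hx, hy, add_zero]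
          | smul r x _ hx => rw [map_smul, hx, smul_zero]
        rw [this, mul_zero, zero_smul, sub_zero]
        exact bidegree_le_degFiltration hm (tmul_mem_bidegree hb hu)
    | zero => simp
    | add x y _ _ hx hy =>
      rw [map_add, add_smul, add_sub_add_comm]; exact add_mem hx hy
    | smul r x _ hx =>
      rw [map_smul, smul_assoc, ← smul_sub]; exact smul_mem _ r hx
  | zero => simp
  | add x y _ _ hx hy =>
    rw [map_add, add_smul, add_sub_add_comm]; exact add_mem hx hy

theorem pow_eq_zero_of_mem_degFiltration [Module.Finite ℝ V] {x : ExteriorAlgebra ℝ V ⊗ₛ UL L}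
    (hx : x ∈ degFiltration L V 1) : x ^ (finrank ℝ V + 1) = 0 := by
  have h := pow_mem_degFiltration hx (finrank ℝ V + 1)
  rw [degFiltration_eq_bot (Nat.lt_succ_self _)] at h
  exact (Submodule.mem_bot ℝ).1 h

theorem augm_ne_zero [Module.Finite ℝ V] {x : ExteriorAlgebra ℝ V ⊗ₛ UL L}
    (hx : x ∈ degFiltration L V 0) (hu : IsUnit x) : augm L V x ≠ 0 := by
  intro h0
  have h1 := sub_augm_mem hx
  rw [h0, zero_smul, sub_zero] at h1
  have h2 := (hu.pow (finrank ℝ V + 1))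
  rw [pow_eq_zero_of_mem_degFiltration h1] at h2
  have h3 : (0 : ExteriorAlgebra ℝ V ⊗ₛ UL L) = 1 := isUnit_zero_iff.1 h2
  have h4 := congrArg (augm L V) h3
  rw [map_zero, augm_one] at h4
  exact zero_ne_one h4

/-- The inverse of an element of degree zero by the geometric series. -/
theorem mul_geom_series [Module.Finite ℝ V] {x : ExteriorAlgebra ℝ V ⊗ₛ UL L}
    (hx : x ∈ degFiltration L V 0) (hc : augm L V x ≠ 0) :
    x * ((augm L V x)⁻¹ • ∑ k ∈ range (finrank ℝ V + 1),
      (1 - (augm L V x)⁻¹ • x) ^ k) = 1 := by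
  have h1 : 1 - (augm L V x)⁻¹ • x ∈ degFiltration L V 1 := by
    have h := smul_mem _ (-(augm L V x)⁻¹) (sub_augm_mem hx)
    rwa [smul_sub, smul_smul, neg_mul, inv_mul_cancel₀ hc, neg_one_smul, sub_neg_eq_add, neg_smul,
      neg_add_eq_sub] at h
  have h2 := mul_neg_geom_sum (1 - (augm L V x)⁻¹ • x) (finrank ℝ V + 1)
  rw [pow_eq_zero_of_mem_degFiltration h1, sub_zero, sub_sub_cancel, smul_mul_assoc] at h2
  rw [mul_smul_comm]
  exact h2

theorem inv_eq_geom_series [Module.Finite ℝ V] (x : (ExteriorAlgebra ℝ V ⊗ₛ UL L)ˣ)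
    (hx : (x : ExteriorAlgebra ℝ V ⊗ₛ UL L) ∈ degFiltration L V 0) :
    ((x⁻¹ : (ExteriorAlgebra ℝ V ⊗ₛ UL L)ˣ) : ExteriorAlgebra ℝ V ⊗ₛ UL L) =
      (augm L V x)⁻¹ • ∑ k ∈ range (finrank ℝ V + 1),
        (1 - (augm L V x)⁻¹ • (x : ExteriorAlgebra ℝ V ⊗ₛ UL L)) ^ k := by
  have h := mul_geom_series hx (augm_ne_zero hx x.isUnit)
  exact Units.inv_eq_of_mul_eq_one_right h

theorem geom_sum_mem_degFiltration {x : ExteriorAlgebra ℝ V ⊗ₛ UL L}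
    (hx : x ∈ degFiltration L V 0) (n : ℕ) :
    ∑ k ∈ range n, x ^ k ∈ degFiltration L V 0 := by
  have h (k : ℕ) : x ^ k ∈ degFiltration L V 0 := by
    induction k with
    | zero => rw [pow_zero]; exact one_mem_degFiltration
    | succ k ih => rw [pow_succ]; exact mul_mem_degFiltration (j := 0) (k := 0) ih hx
  exact sum_mem fun k _ => h k

theorem smul_geom_sum_mem_degFiltration {x : ExteriorAlgebra ℝ V ⊗ₛ UL L}
    (hx : x ∈ degFiltration L V 0) (n : ℕ) (c : ℝ) :
    c • ∑ k ∈ range n, (1 - c • x) ^ k ∈ degFiltration L V 0 :=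
  (degFiltration L V 0).smul_mem c (geom_sum_mem_degFiltration
    ((degFiltration L V 0).sub_mem one_mem_degFiltration ((degFiltration L V 0).smul_mem c hx)) n)

theorem inv_mem_degFiltration [Module.Finite ℝ V] (x : (ExteriorAlgebra ℝ V ⊗ₛ UL L)ˣ)
    (hx : (x : ExteriorAlgebra ℝ V ⊗ₛ UL L) ∈ degFiltration L V 0) :
    ((x⁻¹ : (ExteriorAlgebra ℝ V ⊗ₛ UL L)ˣ) : ExteriorAlgebra ℝ V ⊗ₛ UL L) ∈
      degFiltration L V 0 :=
  (inv_eq_geom_series x hx).symm ▸ smul_geom_sum_mem_degFiltration hx _ _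

/-- Maps of exterior algebras preserve the degree. -/
theorem superMapLin_mem_degFiltration {W : Type*} [AddCommGroup W] [Module ℝ W] (f : V →ₗ[ℝ] W)
    {g : UL L →ₗ[ℝ] UL L} (hg : ∀ n, ∀ u ∈ ULdeg L n, g u ∈ ULdeg L n) {k : ℕ}
    {x : ExteriorAlgebra ℝ V ⊗ₛ UL L} (hx : x ∈ degFiltration L V k) :
    superMapLin (ExteriorAlgebra.map f).toLinearMap g x ∈ degFiltration L W k := by
  induction hx using Submodule.iSup_induction' with
  | mem m x hx =>
    induction hx using span_induction with
    | mem x h =>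
      obtain ⟨b, hb, u, hu, rfl⟩ := h
      refine bidegree_le_degFiltration (n := k + m) (by omega) ?_
      refine tmul_mem_bidegree ?_ (hg _ _ hu)
      rw [exteriorPower] at hb ⊢
      have := Submodule.mem_map_of_mem (f := (ExteriorAlgebra.map f).toLinearMap) hb
      rw [Submodule.map_pow] at this
      refine pow_le_pow_left' (?_ : _ ≤ LinearMap.range (ι ℝ)) _ this
      rintro _ ⟨_, ⟨v, rfl⟩, rfl⟩
      exact ⟨f v, (map_apply_ι f v).symm⟩
    | zero => rw [map_zero]; exact zero_mem _
    | add x y _ _ hx hy => rw [map_add]; exact add_mem hx hy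
    | smul r x _ hx => rw [map_smul]; exact smul_mem _ r hx
  | zero => rw [map_zero]; exact zero_mem _
  | add x y _ _ hx hy => rw [map_add]; exact add_mem hx hy

theorem symMap_isHomogeneous (φ : End ℝ L) {k : ℕ} {u : Sym𝔤 L} (hu : u.IsHomogeneous k) :
    (symMap φ u).IsHomogeneous k := by
  have h := hu.aeval (fun a => symι (φ (lieBasis L a))) (n := 1) fun a => by
    rw [symι_apply]
    refine Submodule.sum_mem (MvPolynomial.homogeneousSubmodule (Idx L) ℝ 1) fun i _ => ?_
    exact smul_mem _ _ (isHomogeneous_X ℝ i)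
  rwa [one_mul] at h

theorem ulMap_mem_ULdeg (φ : End ℝ L) (n : ℕ) (u : UL L) (hu : u ∈ ULdeg L n) :
    ulMap φ u ∈ ULdeg L n := by
  induction hu using span_induction with
  | mem w hw =>
    induction hw with
    | one => rw [map_one]; exact one_mem_ULdeg
    | mul hu hw ih =>
      rw [map_mul, ulMap_genI]
      exact ULdeg_mul (genI_mem_ULdeg (symMap_isHomogeneous φ hu)) ih
  | zero => rw [map_zero]; exact zero_mem _
  | add x y _ _ hx hy => rw [map_add]; exact add_mem hx hy
  | smul r x _ hx => rw [map_smul]; exact smul_mem _ r hx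

end DegreeZero

/-! ### Derivatives in charts -/
section Charts
variable {E : Type*} [NormedAddCommGroup E] [NormedSpace ℝ E]
  {M : Type*} [TopologicalSpace M] [ChartedSpace E M] [IsManifold 𝓘(ℝ, E) ∞ M]

theorem contMDiffAt_chart_symm (x₀ : M) {y : E} (hy : y ∈ (extChartAt 𝓘(ℝ, E) x₀).target) :
    ContMDiffAt 𝓘(ℝ, E) 𝓘(ℝ, E) ∞ (extChartAt 𝓘(ℝ, E) x₀).symm y :=
  (contMDiffOn_extChartAt_symm x₀).contMDiffAt ((isOpen_extChartAt_target _).mem_nhds hy)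

/-- The derivative of the inverse of a chart, in terms of a transition map. -/
theorem mfderiv_chart_symm (x₀ : M) {y : E} (hy : y ∈ (extChartAt 𝓘(ℝ, E) x₀).target) {x : M}
    (hx : (extChartAt 𝓘(ℝ, E) x₀).symm y = x) :
    (mfderiv 𝓘(ℝ, E) 𝓘(ℝ, E) (extChartAt 𝓘(ℝ, E) x₀).symm y : E →L[ℝ] E) =
      fderiv ℝ (fun z => extChartAt 𝓘(ℝ, E) x ((extChartAt 𝓘(ℝ, E) x₀).symm z)) y := by
  have h1 := ((contMDiffAt_chart_symm x₀ hy).mdifferentiableAt (by simp)).mfderiv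
  simp only [writtenInExtChartAt, hx, modelWithCornersSelf_coe, Set.range_id,
    fderivWithin_univ] at h1
  exact h1

theorem mfderiv_chart_symm_self (x : M) :
    (mfderiv 𝓘(ℝ, E) 𝓘(ℝ, E) (extChartAt 𝓘(ℝ, E) x).symm (extChartAt 𝓘(ℝ, E) x x) : E →L[ℝ] E) =
      ContinuousLinearMap.id ℝ E := by
  rw [mfderiv_chart_symm x (mem_extChartAt_target x) (extChartAt_to_inv x)]
  refine HasFDerivAt.fderiv ((hasFDerivAt_id _).congr_of_eventuallyEq ?_)
  filter_upwards [extChartAt_target_mem_nhds (I := 𝓘(ℝ, E)) x] with z hz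
  exact (extChartAt 𝓘(ℝ, E) x).right_inv hz

end Charts

/-! ### The Lie group in the chart at the identity -/
section LieGroupChart
variable {X : Type*} [NormedAddCommGroup X] [NormedSpace ℝ X]

variable (F G) in
/-- The preferred chart of `G` at the identity. -/
abbrev oneChart : PartialEquiv G F := extChartAt 𝓘(ℝ, F) (1 : G)

variable (F G) in
instance isManifold_lieGroup : IsManifold 𝓘(ℝ, F) ∞ G := inferInstance

theorem one_mem_source : (1 : G) ∈ (oneChart F G).source := mem_extChartAt_source 1

theorem contDiffAt_oneChart {f : X → G} {y : X} (hf : ContMDiffAt 𝓘(ℝ, X) 𝓘(ℝ, F) ∞ f y)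
    (h : f y ∈ (oneChart F G).source) : ContDiffAt ℝ ∞ (fun z => oneChart F G (f z)) y := by
  rw [extChartAt_source] at h
  exact contMDiffAt_iff_contDiffAt.1 ((contMDiffAt_extChartAt' h).comp y hf)

theorem contMDiffAt_oneChart_symm {u : F} (hu : u ∈ (oneChart F G).target) :
    ContMDiffAt 𝓘(ℝ, F) 𝓘(ℝ, F) ∞ (oneChart F G).symm u :=
  (contMDiffOn_extChartAt_symm (1 : G)).contMDiffAt ((isOpen_extChartAt_target _).mem_nhds hu)

theorem oneChart_one_mem : oneChart F G 1 ∈ (oneChart F G).target :=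
  mem_extChartAt_target 1

theorem oneChart_symm_one : (oneChart F G).symm (oneChart F G 1) = 1 := extChartAt_to_inv 1

theorem eventually_mem_source {f : X → G} {y : X} (hf : ContinuousAt f y)
    (h : f y ∈ (oneChart F G).source) : ∀ᶠ z in nhds y, f z ∈ (oneChart F G).source :=
  hf.eventually ((isOpen_extChartAt_source (I := 𝓘(ℝ, F)) (1 : G)).mem_nhds h)

variable (F G) in
/-- The product of `G` in the chart at the identity. -/
def mulChart (p : F × F) : F :=
  oneChart F G ((oneChart F G).symm p.1 * (oneChart F G).symm p.2)

theorem mulChart_oneChart {a b : G} (ha : a ∈ (oneChart F G).source)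
    (hb : b ∈ (oneChart F G).source) :
    mulChart F G (oneChart F G a, oneChart F G b) = oneChart F G (a * b) := by
  rw [mulChart, (oneChart F G).left_inv ha, (oneChart F G).left_inv hb]

theorem contDiffAt_mulChart {u v : F} (hu : u ∈ (oneChart F G).target)
    (hv : v ∈ (oneChart F G).target)
    (h : (oneChart F G).symm u * (oneChart F G).symm v ∈ (oneChart F G).source) :
    ContDiffAt ℝ ∞ (mulChart F G) (u, v) := by
  refine contDiffAt_oneChart (f := fun p : F × F => (oneChart F G).symm p.1 * (oneChart F G).symm p.2)
    (ContMDiffAt.mul ?_ ?_) h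
  · exact ContMDiffAt.comp (u, v) (contMDiffAt_oneChart_symm hu) contDiff_fst.contDiffAt.contMDiffAt
  · exact ContMDiffAt.comp (u, v) (contMDiffAt_oneChart_symm hv) contDiff_snd.contDiffAt.contMDiffAt

variable (F G) in
/-- The identity of `G` in the chart. -/
abbrev ptOne : F := oneChart F G 1

theorem contDiffAt_mulChart_one : ContDiffAt ℝ ∞ (mulChart F G) (ptOne F G, ptOne F G) :=
  contDiffAt_mulChart oneChart_one_mem oneChart_one_mem (by
    rw [oneChart_symm_one, one_mul]; exact one_mem_source)

theorem eventually_left : ∀ᶠ c in nhds (ptOne F G), c ∈ (oneChart F G).target ∧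
    ContDiffAt ℝ ∞ (mulChart F G) (c, ptOne F G) ∧
    ContDiffAt ℝ ∞ (mulChart F G) (ptOne F G, c) := by
  filter_upwards [extChartAt_target_mem_nhds (I := 𝓘(ℝ, F)) (1 : G)] with c hc
  refine ⟨hc, contDiffAt_mulChart hc oneChart_one_mem ?_, contDiffAt_mulChart oneChart_one_mem hc ?_⟩
  · rw [oneChart_symm_one, mul_one]; exact (oneChart F G).map_target hc
  · rw [oneChart_symm_one, one_mul]; exact (oneChart F G).map_target hc

theorem fderiv_mulChart_inr : (fderiv ℝ (mulChart F G) (ptOne F G, ptOne F G)).comp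
    (ContinuousLinearMap.inr ℝ F F) = ContinuousLinearMap.id ℝ F := by
  have h1 : HasFDerivAt (fun v : F => mulChart F G (ptOne F G, v)) _ (ptOne F G) :=
    ((contDiffAt_mulChart_one (F := F) (G := G)).differentiableAt (by simp)).hasFDerivAt.comp _
      (hasFDerivAt_prodMk_right (ptOne F G) (ptOne F G))
  refine h1.unique ((hasFDerivAt_id _).congr_of_eventuallyEq ?_)
  filter_upwards [extChartAt_target_mem_nhds (I := 𝓘(ℝ, F)) (1 : G)] with c hc
  rw [mulChart, oneChart_symm_one, one_mul]
  exact (oneChart F G).right_inv hc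

theorem fderiv_mulChart_inl : (fderiv ℝ (mulChart F G) (ptOne F G, ptOne F G)).comp
    (ContinuousLinearMap.inl ℝ F F) = ContinuousLinearMap.id ℝ F := by
  have h1 : HasFDerivAt (fun v : F => mulChart F G (v, ptOne F G)) _ (ptOne F G) :=
    HasFDerivAt.comp (f := fun v => (v, ptOne F G)) (ptOne F G)
      ((contDiffAt_mulChart_one (F := F) (G := G)).differentiableAt (by simp)).hasFDerivAt
      (hasFDerivAt_prodMk_left (ptOne F G) (ptOne F G))
  refine h1.unique ((hasFDerivAt_id _).congr_of_eventuallyEq ?_)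
  filter_upwards [extChartAt_target_mem_nhds (I := 𝓘(ℝ, F)) (1 : G)] with c hc
  rw [mulChart, oneChart_symm_one, mul_one]
  exact (oneChart F G).right_inv hc

theorem fderiv_mulChart_apply (u v : F) :
    fderiv ℝ (mulChart F G) (ptOne F G, ptOne F G) (u, v) = u + v := by
  have h1 := DFunLike.congr_fun (fderiv_mulChart_inl (F := F) (G := G)) u
  have h2 := DFunLike.congr_fun (fderiv_mulChart_inr (F := F) (G := G)) v
  simp only [ContinuousLinearMap.comp_apply, ContinuousLinearMap.inl_apply,
    ContinuousLinearMap.inr_apply, ContinuousLinearMap.id_apply] at h1 h2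
  conv_rhs => rw [← h1, ← h2]
  rw [← map_add, Prod.mk_add_mk, add_zero, zero_add]

/-- The derivative of a product of functions with value `1`. -/
theorem hasFDerivAt_oneChart_mul {f g : X → G} {y : X} {f' g' : X →L[ℝ] F} (hfc : ContinuousAt f y)
    (hgc : ContinuousAt g y) (hf : f y = 1) (hg : g y = 1)
    (hf' : HasFDerivAt (fun z => oneChart F G (f z)) f' y)
    (hg' : HasFDerivAt (fun z => oneChart F G (g z)) g' y) :
    HasFDerivAt (fun z => oneChart F G (f z * g z)) (f' + g') y := by
  have hm : HasFDerivAt (mulChart F G) (fderiv ℝ (mulChart F G) (ptOne F G, ptOne F G))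
      (oneChart F G (f y), oneChart F G (g y)) := by
    rw [hf, hg]
    exact ((contDiffAt_mulChart_one (F := F) (G := G)).differentiableAt (by simp)).hasFDerivAt
  have h := hm.comp y (hf'.prodMk hg')
  refine (h.congr_fderiv ?_).congr_of_eventuallyEq ?_
  · ext v
    exact fderiv_mulChart_apply (f' v) (g' v)
  · filter_upwards [eventually_mem_source (F := F) hfc (hf ▸ one_mem_source),
      eventually_mem_source (F := F) hgc (hg ▸ one_mem_source)] with z h1 h2
    exact (mulChart_oneChart h1 h2).symm

theorem derivOne_eq_fderiv {c : G → G} (hc : c 1 = 1)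
    (h : MDifferentiableAt 𝓘(ℝ, F) 𝓘(ℝ, F) c 1) :
    derivOne c = fderiv ℝ (fun v => oneChart F G (c ((oneChart F G).symm v))) (ptOne F G) := by
  have h1 := h.mfderiv
  simp only [writtenInExtChartAt, hc, modelWithCornersSelf_coe, Set.range_id,
    fderivWithin_univ] at h1
  exact h1

theorem contMDiff_conj (g : G) : ContMDiff 𝓘(ℝ, F) 𝓘(ℝ, F) ∞ fun y : G => g * y * g⁻¹ :=
  (contMDiff_mul_right (I := 𝓘(ℝ, F)) (n := ∞) (a := g⁻¹)).comp
    (contMDiff_mul_left (I := 𝓘(ℝ, F)) (n := ∞) (a := g))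

variable (F) in
/-- The conjugation with `g` in the chart at the identity. -/
def conjChart (g : G) (v : F) : F :=
  oneChart F G (g * (oneChart F G).symm v * g⁻¹)

theorem conjChart_one (g : G) : conjChart F g (ptOne F G) = ptOne F G := by
  rw [conjChart, oneChart_symm_one, mul_one, mul_inv_cancel]

theorem hasFDerivAt_conjChart (g : G) :
    HasFDerivAt (conjChart F g) (derivOne (F := F) fun y : G => g * y * g⁻¹) (ptOne F G) := by
  rw [derivOne_eq_fderiv (by simp) (mdiff_conj g 1)]
  refine DifferentiableAt.hasFDerivAt (ContDiffAt.differentiableAt (n := ∞) ?_ (by simp))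
  refine contDiffAt_oneChart (f := fun v : F => g * (oneChart F G).symm v * g⁻¹)
    ((contMDiff_conj g).contMDiffAt.comp _ (contMDiffAt_oneChart_symm oneChart_one_mem)) ?_
  rw [oneChart_symm_one, mul_one, mul_inv_cancel]
  exact one_mem_source

/-- The derivative of a conjugate of a function with value `1`. -/
theorem hasFDerivAt_oneChart_conj (g : G) {f : X → G} {y : X} {f' : X →L[ℝ] F}
    (hfc : ContinuousAt f y) (hf : f y = 1)
    (hf' : HasFDerivAt (fun z => oneChart F G (f z)) f' y) :
    HasFDerivAt (fun z => oneChart F G (g * f z * g⁻¹))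
      ((derivOne (F := F) fun y : G => g * y * g⁻¹).comp f') y := by
  have hm : HasFDerivAt (conjChart F g) (derivOne (F := F) fun y : G => g * y * g⁻¹)
      (oneChart F G (f y)) := by
    rw [hf]; exact hasFDerivAt_conjChart g
  refine (hm.comp y hf').congr_of_eventuallyEq ?_
  filter_upwards [eventually_mem_source (F := F) hfc (hf ▸ one_mem_source)] with z h1
  rw [Function.comp_apply, conjChart, (oneChart F G).left_inv h1]

/-! ### Second order terms of the product and the Lie bracket -/

variable (F G) in
/-- The mixed second derivative of the product at the identity. -/
def mulBil (u v : F) : F :=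
  fderiv ℝ (fderiv ℝ (mulChart F G)) (ptOne F G, ptOne F G) (u, 0) (0, v)

theorem hasFDerivAt_fderiv_mulChart : HasFDerivAt (fderiv ℝ (mulChart F G))
    (fderiv ℝ (fderiv ℝ (mulChart F G)) (ptOne F G, ptOne F G)) (ptOne F G, ptOne F G) :=
  (((contDiffAt_mulChart_one (F := F) (G := G)).fderiv_right (m := 1) (by
    rw [show (1 + 1 : ℕ∞ω) = 2 by norm_num]; exact WithTop.coe_le_coe.2 le_top)).differentiableAt
      (by simp)).hasFDerivAt

theorem mulBil_symm (u v : F) :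
    fderiv ℝ (fderiv ℝ (mulChart F G)) (ptOne F G, ptOne F G) (0, v) (u, 0) = mulBil F G u v :=
  ((contDiffAt_mulChart_one (F := F) (G := G)).isSymmSndFDerivAt (by
    rw [minSmoothness_of_isRCLikeNormedField]; exact WithTop.coe_le_coe.2 le_top)) _ _

/-- The derivative of `c ↦ D m (c, 1) (0, w)`. -/
theorem hasFDerivAt_mulChart_left (w : F) :
    HasFDerivAt (fun c => fderiv ℝ (mulChart F G) (c, ptOne F G) (0, w))
      (((ContinuousLinearMap.apply ℝ F ((0, w) : F × F)).comp
        (fderiv ℝ (fderiv ℝ (mulChart F G)) (ptOne F G, ptOne F G))).comp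
          (ContinuousLinearMap.inl ℝ F F)) (ptOne F G) := by
  have h := HasFDerivAt.comp (f := fun v => (v, ptOne F G)) (ptOne F G)
    (hasFDerivAt_fderiv_mulChart (F := F) (G := G))
    (hasFDerivAt_prodMk_left (ptOne F G) (ptOne F G))
  exact (ContinuousLinearMap.apply ℝ F ((0, w) : F × F)).hasFDerivAt.comp _ h

theorem hasFDerivAt_mulChart_right :
    HasFDerivAt (fun c => fderiv ℝ (mulChart F G) (ptOne F G, c))
      ((fderiv ℝ (fderiv ℝ (mulChart F G)) (ptOne F G, ptOne F G)).comp
          (ContinuousLinearMap.inr ℝ F F)) (ptOne F G) :=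
  (hasFDerivAt_fderiv_mulChart (F := F) (G := G)).comp (ptOne F G)
    (hasFDerivAt_prodMk_right (ptOne F G) (ptOne F G))

variable (F) in
/-- The adjoint action of `g`, as a continuous linear map on the model space. -/
abbrev adCLM (g : G) : F →L[ℝ] F := derivOne (F := F) fun y : G => g * y * g⁻¹

theorem adCLM_one : adCLM F (1 : G) = ContinuousLinearMap.id ℝ F := by
  have : (fun y : G => 1 * y * 1⁻¹) = id := by ext; simp
  rw [adCLM, this, derivOne_id]

theorem adCLM_eq_fderiv (g : G) : adCLM F g = fderiv ℝ (conjChart F g) (ptOne F G) :=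
  (hasFDerivAt_conjChart g).fderiv.symm

theorem contDiffAt_adCLM {γ : X → G} {y : X} (hγ : ContMDiffAt 𝓘(ℝ, X) 𝓘(ℝ, F) ∞ γ y) :
    ContDiffAt ℝ ∞ (fun z => adCLM F (γ z)) y := by
  simp only [adCLM_eq_fderiv]
  refine ContDiffAt.fderiv (n := ∞) (f := fun z => conjChart F (γ z)) (g := fun _ => ptOne F G) ?_
    contDiffAt_const (by simp)
  refine contDiffAt_oneChart
    (f := fun p : X × F => γ p.1 * (oneChart F G).symm p.2 * (γ p.1)⁻¹) ?_ ?_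
  · have h1 : ContMDiffAt 𝓘(ℝ, X × F) 𝓘(ℝ, F) ∞ (fun p : X × F => γ p.1) (y, ptOne F G) :=
      ContMDiffAt.comp (y, ptOne F G) hγ contDiff_fst.contDiffAt.contMDiffAt
    have h2 : ContMDiffAt 𝓘(ℝ, X × F) 𝓘(ℝ, F) ∞ (fun p : X × F => (oneChart F G).symm p.2)
        (y, ptOne F G) :=
      ContMDiffAt.comp (y, ptOne F G) (contMDiffAt_oneChart_symm oneChart_one_mem)
        contDiff_snd.contDiffAt.contMDiffAt
    exact (h1.mul h2).mul h1.inv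
  · rw [oneChart_symm_one, mul_one, mul_inv_cancel]
    exact one_mem_source

/-- Differentiation of `c y = (c y c⁻¹) c` in `y`. -/
theorem eventually_fderiv_mulChart_eq : ∀ᶠ c in nhds (ptOne F G), ∀ w : F,
    fderiv ℝ (mulChart F G) (c, ptOne F G) (0, w) =
      fderiv ℝ (mulChart F G) (ptOne F G, c) (adCLM F ((oneChart F G).symm c) w, 0) := by
  filter_upwards [eventually_left (F := F) (G := G)] with c ⟨hc, h1, h2⟩ w
  have hl : HasFDerivAt (fun v : F => mulChart F G (c, v)) _ (ptOne F G) :=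
    (h1.differentiableAt (by simp)).hasFDerivAt.comp _ (hasFDerivAt_prodMk_right c (ptOne F G))
  have h2' : HasFDerivAt (mulChart F G) (fderiv ℝ (mulChart F G) (ptOne F G, c))
      (conjChart F ((oneChart F G).symm c) (ptOne F G), c) := by
    rw [conjChart_one]; exact (h2.differentiableAt (by simp)).hasFDerivAt
  have hr := h2'.comp (ptOne F G)
    ((hasFDerivAt_conjChart ((oneChart F G).symm c)).prodMk (hasFDerivAt_const c (ptOne F G)))
  have hev : (fun v : F => mulChart F G (c, v)) =ᶠ[nhds (ptOne F G)]
      (mulChart F G) ∘ fun v => (conjChart F ((oneChart F G).symm c) v, c) := by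
    have hcont : ContinuousAt (fun v : F => (oneChart F G).symm c * (oneChart F G).symm v *
        ((oneChart F G).symm c)⁻¹) (ptOne F G) :=
      ((contMDiff_conj ((oneChart F G).symm c)).contMDiffAt.comp _
        (contMDiffAt_oneChart_symm oneChart_one_mem)).continuousAt
    filter_upwards [eventually_mem_source (F := F) hcont (by
      rw [oneChart_symm_one, mul_one, mul_inv_cancel]; exact one_mem_source)] with v hv
    rw [Function.comp_apply, mulChart, mulChart, conjChart, (oneChart F G).left_inv hv,
      inv_mul_cancel_right]
  have h := (hl.congr_of_eventuallyEq hev.symm).unique hr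
  exact DFunLike.congr_fun h w

/-- The derivative of the adjoint action at the identity. -/
theorem hasFDerivAt_adCLM {A' : F →L[ℝ] F →L[ℝ] F}
    (h : HasFDerivAt (fun c => adCLM F ((oneChart F G).symm c)) A' (ptOne F G)) (u w : F) :
    A' u w = mulBil F G u w - mulBil F G w u := by
  have h1 := hasFDerivAt_mulChart_left (F := F) (G := G) w
  have hAw : HasFDerivAt (fun c => adCLM F ((oneChart F G).symm c) w)
      ((ContinuousLinearMap.apply ℝ F w).comp A') (ptOne F G) :=
    (ContinuousLinearMap.apply ℝ F w).hasFDerivAt.comp _ h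
  have h2 := (hasFDerivAt_mulChart_right (F := F) (G := G)).clm_apply
    (hAw.prodMk (hasFDerivAt_const (0 : F) (ptOne F G)))
  have h3 := h1.unique (h2.congr_of_eventuallyEq
    (eventually_fderiv_mulChart_eq.mono fun c hc => hc w))
  have h4 := DFunLike.congr_fun h3 u
  simp only [ContinuousLinearMap.add_apply, ContinuousLinearMap.comp_apply,
    ContinuousLinearMap.apply_apply, ContinuousLinearMap.inl_apply, ContinuousLinearMap.flip_apply,
    ContinuousLinearMap.inr_apply, ContinuousLinearMap.prod_apply, oneChart_symm_one,
    adCLM_one, ContinuousLinearMap.id_apply, ContinuousLinearMap.zero_apply,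
    fderiv_mulChart_apply, add_zero, mulBil_symm] at h4
  rw [eq_sub_iff_add_eq]
  exact h4.symm

theorem isInvertible_mfderiv_oneChart_symm {c : F} (hc : c ∈ (oneChart F G).target) :
    (mfderiv 𝓘(ℝ, F) 𝓘(ℝ, F) (oneChart F G).symm c).IsInvertible := by
  have := IsManifold.of_le (I := 𝓘(ℝ, F)) (M := G) (m := 1) (n := ∞)
    (WithTop.coe_le_coe.2 le_top)
  have h := isInvertible_mfderivWithin_extChartAt_symm (I := 𝓘(ℝ, F)) hc
  rwa [modelWithCornersSelf_coe, Set.range_id, mfderivWithin_univ] at h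

/-- Left invariant vector fields in the chart at the identity. -/
theorem mpullback_mulInvariantVectorField_oneChart {c : F} (hc : c ∈ (oneChart F G).target)
    (h1 : ContDiffAt ℝ ∞ (mulChart F G) (c, ptOne F G)) (w : F) :
    VectorField.mpullback 𝓘(ℝ, F) 𝓘(ℝ, F) (oneChart F G).symm
      (mulInvariantVectorField (I := 𝓘(ℝ, F)) (G := G) w) c =
        fderiv ℝ (mulChart F G) (c, ptOne F G) (0, w) := by
  have hcs := (oneChart F G).map_target hc
  have hψc := (contMDiffAt_oneChart_symm hc).mdifferentiableAt (by simp)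
  have hψ1 := (contMDiffAt_oneChart_symm (oneChart_one_mem (F := F) (G := G))).mdifferentiableAt
    (by simp)
  have hm1 : mulChart F G (c, ptOne F G) = c := by
    rw [mulChart, oneChart_symm_one, mul_one]; exact (oneChart F G).right_inv hc
  have hm : DifferentiableAt ℝ (fun v => mulChart F G (c, v)) (ptOne F G) :=
    (HasFDerivAt.comp (g := mulChart F G) (ptOne F G) (h1.differentiableAt (by simp)).hasFDerivAt
      (hasFDerivAt_prodMk_right c (ptOne F G))).differentiableAt
  have hm' : fderiv ℝ (fun v => mulChart F G (c, v)) (ptOne F G) w =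
      fderiv ℝ (mulChart F G) (c, ptOne F G) (0, w) := by
    have := (h1.differentiableAt (by simp)).hasFDerivAt.comp (ptOne F G)
      (hasFDerivAt_prodMk_right c (ptOne F G))
    exact DFunLike.congr_fun this.fderiv w
  have hL : MDifferentiableAt 𝓘(ℝ, F) 𝓘(ℝ, F) (fun b : G => (oneChart F G).symm c * b)
      ((oneChart F G).symm (ptOne F G)) :=
    (contMDiff_mul_left (I := 𝓘(ℝ, F)) (n := ∞) (a := (oneChart F G).symm c)).mdifferentiable
      (by simp) _
  have hψm : MDifferentiableAt 𝓘(ℝ, F) 𝓘(ℝ, F) (oneChart F G).symm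
      ((fun v => mulChart F G (c, v)) (ptOne F G)) := by
    show MDifferentiableAt 𝓘(ℝ, F) 𝓘(ℝ, F) (oneChart F G).symm (mulChart F G (c, ptOne F G))
    rw [hm1]; exact hψc
  have hA := mfderiv_comp (I'' := 𝓘(ℝ, F)) (ptOne F G) hL hψ1
  have hB := mfderiv_comp (I'' := 𝓘(ℝ, F)) (ptOne F G) hψm hm.mdifferentiableAt
  have hev : (oneChart F G).symm ∘ (fun v => mulChart F G (c, v)) =ᶠ[nhds (ptOne F G)]
      (fun b : G => (oneChart F G).symm c * b) ∘ (oneChart F G).symm := by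
    have hcont : ContinuousAt (fun v : F => (oneChart F G).symm c * (oneChart F G).symm v)
        (ptOne F G) := ContinuousAt.comp (g := fun b : G => (oneChart F G).symm c * b)
          hL.continuousAt hψ1.continuousAt
    filter_upwards [eventually_mem_source (F := F) hcont (by
      rw [oneChart_symm_one, mul_one]; exact hcs)] with v hv
    rw [Function.comp_apply, mulChart, (oneChart F G).left_inv hv, Function.comp_apply]
  have hAB : (mfderiv 𝓘(ℝ, F) 𝓘(ℝ, F) ((oneChart F G).symm ∘ (fun v => mulChart F G (c, v)))
      (ptOne F G) : F →L[ℝ] F) = mfderiv 𝓘(ℝ, F) 𝓘(ℝ, F)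
        ((fun b : G => (oneChart F G).symm c * b) ∘ (oneChart F G).symm) (ptOne F G) :=
    hev.mfderiv_eq
  have hk1 : ∀ z : F, z = c → (mfderiv 𝓘(ℝ, F) 𝓘(ℝ, F) (oneChart F G).symm z : F →L[ℝ] F) =
      mfderiv 𝓘(ℝ, F) 𝓘(ℝ, F) (oneChart F G).symm c := by rintro z rfl; rfl
  have hk2 : ∀ z : G, z = 1 → (mfderiv 𝓘(ℝ, F) 𝓘(ℝ, F)
      (fun b : G => (oneChart F G).symm c * b) z : F →L[ℝ] F) =
      mfderiv 𝓘(ℝ, F) 𝓘(ℝ, F) (fun b : G => (oneChart F G).symm c * b) 1 := by rintro z rfl; rfl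
  have hfin : (mfderiv 𝓘(ℝ, F) 𝓘(ℝ, F) (oneChart F G).symm c : F →L[ℝ] F)
      (fderiv ℝ (mulChart F G) (c, ptOne F G) (0, w)) =
      (mfderiv 𝓘(ℝ, F) 𝓘(ℝ, F) (fun b : G => (oneChart F G).symm c * b) 1 : F →L[ℝ] F) w := by
    have e1 : (mfderiv 𝓘(ℝ, F) 𝓘(ℝ, F) ((oneChart F G).symm ∘ (fun v => mulChart F G (c, v)))
        (ptOne F G) : F →L[ℝ] F) w = (mfderiv 𝓘(ℝ, F) 𝓘(ℝ, F) (oneChart F G).symm c : F →L[ℝ] F)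
          (fderiv ℝ (mulChart F G) (c, ptOne F G) (0, w)) := by
      rw [hB, mfderiv_eq_fderiv, ← hm']
      exact congrArg (fun L : F →L[ℝ] F => L _) (hk1 _ hm1)
    have e2 : (mfderiv 𝓘(ℝ, F) 𝓘(ℝ, F)
        ((fun b : G => (oneChart F G).symm c * b) ∘ (oneChart F G).symm) (ptOne F G) : F →L[ℝ] F) w
        = (mfderiv 𝓘(ℝ, F) 𝓘(ℝ, F) (fun b : G => (oneChart F G).symm c * b) 1 : F →L[ℝ] F) w := by
      rw [hA]
      have e3 : (mfderiv 𝓘(ℝ, F) 𝓘(ℝ, F) (oneChart F G).symm (ptOne F G) : F →L[ℝ] F) w = w :=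
        DFunLike.congr_fun (mfderiv_chart_symm_self (1 : G)) w
      refine (congrArg (mfderiv 𝓘(ℝ, F) 𝓘(ℝ, F) (fun b : G => (oneChart F G).symm c * b)
        ((oneChart F G).symm (ptOne F G)) : F →L[ℝ] F) e3).trans ?_
      exact congrArg (fun L : F →L[ℝ] F => L w) (hk2 _ oneChart_symm_one)
    exact e1.symm.trans ((DFunLike.congr_fun hAB w).trans e2)
  rw [VectorField.mpullback_apply]
  have hinv : (mfderiv 𝓘(ℝ, F) 𝓘(ℝ, F) (oneChart F G).symm c).IsInvertible :=
    isInvertible_mfderiv_oneChart_symm hc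
  refine (hinv.inverse_apply_eq).2 ?_
  exact hfin.symm

theorem lie_eq_mulBil (u w : LieAlg F G) : ⁅u, w⁆ = mulBil F G u w - mulBil F G w u := by
  have hn : IsManifold 𝓘(ℝ, F) (minSmoothness ℝ 2) G := IsManifold.of_le (n := ∞) (by
    rw [minSmoothness_of_isRCLikeNormedField]; exact WithTop.coe_le_coe.2 le_top)
  have h := VectorField.mpullback_mlieBracket (I := 𝓘(ℝ, F)) (I' := 𝓘(ℝ, F)) (n := ∞)
    (f := (oneChart F G).symm) (x₀ := ptOne F G)
    (V := mulInvariantVectorField (I := 𝓘(ℝ, F)) (G := G) u)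
    (W := mulInvariantVectorField (I := 𝓘(ℝ, F)) (G := G) w)
    (mdifferentiableAt_mulInvariantVectorField u) (mdifferentiableAt_mulInvariantVectorField w)
    (contMDiffAt_oneChart_symm oneChart_one_mem)
    (by rw [minSmoothness_of_isRCLikeNormedField]; exact WithTop.coe_le_coe.2 le_top)
  have hV (v : F) : VectorField.mpullback 𝓘(ℝ, F) 𝓘(ℝ, F) (oneChart F G).symm
      (mulInvariantVectorField (I := 𝓘(ℝ, F)) (G := G) v) =ᶠ[nhds (ptOne F G)]
        fun c => fderiv ℝ (mulChart F G) (c, ptOne F G) (0, v) :=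
    (eventually_left (F := F) (G := G)).mono fun c hc =>
      mpullback_mulInvariantVectorField_oneChart hc.1 hc.2.1 v
  have hr : VectorField.mlieBracket 𝓘(ℝ, F)
      (VectorField.mpullback 𝓘(ℝ, F) 𝓘(ℝ, F) (oneChart F G).symm
        (mulInvariantVectorField (I := 𝓘(ℝ, F)) (G := G) u))
      (VectorField.mpullback 𝓘(ℝ, F) 𝓘(ℝ, F) (oneChart F G).symm
        (mulInvariantVectorField (I := 𝓘(ℝ, F)) (G := G) w)) (ptOne F G) =
      mulBil F G u w - mulBil F G w u := by
    have key (V W : ∀ x : F, TangentSpace 𝓘(ℝ, F) x) :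
        VectorField.mlieBracket 𝓘(ℝ, F) V W (ptOne F G) =
          VectorField.lieBracket ℝ V W (ptOne F G) := by
      rw [← VectorField.mlieBracketWithin_univ, VectorField.mlieBracketWithin_eq_lieBracketWithin]
      exact congrFun (@VectorField.lieBracketWithin_univ ℝ _ F _ _ V W) _
    have hD (u w : F) : VectorField.lieBracket ℝ
        (fun c => fderiv ℝ (mulChart F G) (c, ptOne F G) (0, u))
        (fun c => fderiv ℝ (mulChart F G) (c, ptOne F G) (0, w)) (ptOne F G) =
          mulBil F G u w - mulBil F G w u := by
      rw [VectorField.lieBracket_eq]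
      simp only [(hasFDerivAt_mulChart_left _).fderiv]
      simp [fderiv_mulChart_apply, mulBil]
    refine (key _ _).trans ?_
    exact (Filter.EventuallyEq.lieBracket_vectorField_eq (hV u) (hV w)).trans (hD u w)
  have hl : VectorField.mpullback 𝓘(ℝ, F) 𝓘(ℝ, F) (oneChart F G).symm
      (VectorField.mlieBracket 𝓘(ℝ, F) (mulInvariantVectorField (I := 𝓘(ℝ, F)) (G := G) u)
        (mulInvariantVectorField (I := 𝓘(ℝ, F)) (G := G) w)) (ptOne F G) = ⁅u, w⁆ := by
    rw [VectorField.mpullback_apply]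
    have hk : ∀ z : G, z = 1 → (VectorField.mlieBracket 𝓘(ℝ, F)
        (mulInvariantVectorField (I := 𝓘(ℝ, F)) (G := G) u)
        (mulInvariantVectorField (I := 𝓘(ℝ, F)) (G := G) w) z : F) = (⁅u, w⁆ : LieAlg F G) := by
      rintro z rfl; rfl
    have hinv : (mfderiv 𝓘(ℝ, F) 𝓘(ℝ, F) (oneChart F G).symm (ptOne F G)).IsInvertible :=
      isInvertible_mfderiv_oneChart_symm oneChart_one_mem
    refine (hinv.inverse_apply_eq).2 ?_
    refine (hk _ oneChart_symm_one).trans ?_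
    exact (DFunLike.congr_fun (mfderiv_chart_symm_self (1 : G)) (⁅u, w⁆ : LieAlg F G)).symm
  exact (hl.symm.trans h).trans hr

end LieGroupChart

/-! ### Logarithmic derivatives and the adjoint action -/
section LogDerivative
variable {X : Type*} [NormedAddCommGroup X] [NormedSpace ℝ X]

variable (F G) in
/-- The Lie bracket of the Lie algebra of `G`, as an operation on the model space. -/
def modelLie (u w : F) : F := Bracket.bracket (L := LieAlg F G) (M := LieAlg F G) u w

theorem modelLie_eq (u w : F) : modelLie F G u w = mulBil F G u w - mulBil F G w u :=
  lie_eq_mulBil u w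

theorem adCLM_mul (g h : G) : adCLM F (g * h) = (adCLM F g).comp (adCLM F h) := by
  have : (fun y : G => g * h * y * (g * h)⁻¹) = (fun y => g * y * g⁻¹) ∘ fun y => h * y * h⁻¹ := by
    ext; simp [mul_assoc]
  rw [adCLM, this, derivOne_comp _ _ (by simp) (mdiff_conj g _) (mdiff_conj h _)]

theorem adCLM_inv_apply (g : G) (w : F) : adCLM F g⁻¹ (adCLM F g w) = w := by
  rw [← ContinuousLinearMap.comp_apply, ← adCLM_mul, inv_mul_cancel, adCLM_one,
    ContinuousLinearMap.id_apply]

theorem adCLM_apply_inv (g : G) (w : F) : adCLM F g (adCLM F g⁻¹ w) = w := by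
  rw [← ContinuousLinearMap.comp_apply, ← adCLM_mul, mul_inv_cancel, adCLM_one,
    ContinuousLinearMap.id_apply]

/-- The derivative of the adjoint action along a function with value `1`. -/
theorem exists_hasFDerivAt_adCLM {f : X → G} {y : X} {f' : X →L[ℝ] F} (hfc : ContinuousAt f y)
    (hf : f y = 1) (hf' : HasFDerivAt (fun z => oneChart F G (f z)) f' y) :
    ∃ D : X →L[ℝ] F →L[ℝ] F, HasFDerivAt (fun z => adCLM F (f z)) D y ∧
      ∀ (v : X) (w : F), D v w = modelLie F G (f' v) w := by
  have h0 : HasFDerivAt (fun c => adCLM F ((oneChart F G).symm c)) _ (ptOne F G) :=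
    ((contDiffAt_adCLM (contMDiffAt_oneChart_symm oneChart_one_mem)).differentiableAt
      (by simp)).hasFDerivAt
  have h0' := h0
  rw [show ptOne F G = oneChart F G (f y) by rw [hf]] at h0'
  refine ⟨_, (h0'.comp y hf').congr_of_eventuallyEq ?_, fun v w => ?_⟩
  · filter_upwards [eventually_mem_source (F := F) hfc (hf ▸ one_mem_source)] with z h1
    rw [Function.comp_apply, (oneChart F G).left_inv h1]
  · rw [modelLie_eq, ContinuousLinearMap.comp_apply]
    rw [← hasFDerivAt_adCLM h0]

theorem hasFDerivAt_oneChart_symm :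
    HasFDerivAt (fun z => oneChart F G ((oneChart F G).symm z)) (ContinuousLinearMap.id ℝ F)
      (ptOne F G) := by
  refine (hasFDerivAt_id _).congr_of_eventuallyEq ?_
  filter_upwards [extChartAt_target_mem_nhds (I := 𝓘(ℝ, F)) (1 : G)] with z hz
  exact (oneChart F G).right_inv hz

/-- The adjoint action respects the Lie bracket. -/
theorem adCLM_modelLie (g : G) (u w : F) :
    adCLM F g (modelLie F G u w) = modelLie F G (adCLM F g u) (adCLM F g w) := by
  have hc : ContinuousAt (oneChart F G).symm (ptOne F G) :=
    (contMDiffAt_oneChart_symm oneChart_one_mem).continuousAt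
  obtain ⟨D, hD, hD'⟩ := exists_hasFDerivAt_adCLM (F := F) (G := G) hc oneChart_symm_one
    hasFDerivAt_oneChart_symm
  obtain ⟨D₂, hD₂, hD₂'⟩ := exists_hasFDerivAt_adCLM (F := F) (G := G)
    (f := fun z => g * (oneChart F G).symm z * g⁻¹) (y := ptOne F G)
    ((contMDiff_conj g).contMDiffAt.comp _
      (contMDiffAt_oneChart_symm oneChart_one_mem)).continuousAt
    (by rw [oneChart_symm_one, mul_one, mul_inv_cancel])
    (hasFDerivAt_oneChart_conj g hc oneChart_symm_one hasFDerivAt_oneChart_symm)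
  have h1 : HasFDerivAt (fun z => adCLM F (g * (oneChart F G).symm z * g⁻¹) (adCLM F g w))
      ((ContinuousLinearMap.apply ℝ F (adCLM F g w)).comp D₂) (ptOne F G) :=
    (ContinuousLinearMap.apply ℝ F (adCLM F g w)).hasFDerivAt.comp _ hD₂
  have h2 : HasFDerivAt (fun z => adCLM F g (adCLM F ((oneChart F G).symm z) w))
      ((adCLM F g).comp ((ContinuousLinearMap.apply ℝ F (w : F)).comp D)) (ptOne F G) :=
    (adCLM F g).hasFDerivAt.comp _ ((ContinuousLinearMap.apply ℝ F (w : F)).hasFDerivAt.comp _ hD)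
  have h3 : (fun z => adCLM F (g * (oneChart F G).symm z * g⁻¹) (adCLM F g w)) =
      fun z => adCLM F g (adCLM F ((oneChart F G).symm z) w) := by
    ext z
    rw [adCLM_mul, adCLM_mul, ContinuousLinearMap.comp_apply, ContinuousLinearMap.comp_apply,
      adCLM_inv_apply]
  rw [h3] at h1
  have h4 := DFunLike.congr_fun (h1.unique h2) u
  simp only [ContinuousLinearMap.comp_apply, ContinuousLinearMap.apply_apply] at h4
  rw [hD₂', hD'] at h4
  exact h4.symm

/-- The left logarithmic derivative `γ⁻¹ dγ`. -/
def leftLog (γ : X → G) (y : X) : X →L[ℝ] F :=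
  fderiv ℝ (fun z => oneChart F G ((γ y)⁻¹ * γ z)) y

/-- The right logarithmic derivative `dγ γ⁻¹`. -/
def rightLog (γ : X → G) (y : X) : X →L[ℝ] F :=
  fderiv ℝ (fun z => oneChart F G (γ z * (γ y)⁻¹)) y

variable {γ δ : X → G} {y : X}

theorem hasFDerivAt_leftLog (hγ : ContMDiffAt 𝓘(ℝ, X) 𝓘(ℝ, F) ∞ γ y) :
    HasFDerivAt (fun z => oneChart F G ((γ y)⁻¹ * γ z)) (leftLog γ y) y := by
  refine DifferentiableAt.hasFDerivAt (ContDiffAt.differentiableAt (n := ∞)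
    (contDiffAt_oneChart (f := fun z => (γ y)⁻¹ * γ z) (contMDiffAt_const.mul hγ) ?_) (by simp))
  rw [inv_mul_cancel]; exact one_mem_source

theorem hasFDerivAt_rightLog (hγ : ContMDiffAt 𝓘(ℝ, X) 𝓘(ℝ, F) ∞ γ y) :
    HasFDerivAt (fun z => oneChart F G (γ z * (γ y)⁻¹)) (rightLog γ y) y := by
  refine DifferentiableAt.hasFDerivAt (ContDiffAt.differentiableAt (n := ∞)
    (contDiffAt_oneChart (f := fun z => γ z * (γ y)⁻¹) (hγ.mul contMDiffAt_const) ?_) (by simp))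
  rw [mul_inv_cancel]; exact one_mem_source

theorem rightLog_eq (hγ : ContMDiffAt 𝓘(ℝ, X) 𝓘(ℝ, F) ∞ γ y) :
    rightLog γ y = (adCLM F (γ y)).comp (leftLog γ y) := by
  have h := hasFDerivAt_oneChart_conj (γ y) (f := fun z => (γ y)⁻¹ * γ z)
    (ContMDiffAt.continuousAt (contMDiffAt_const.mul hγ)) (by simp) (hasFDerivAt_leftLog hγ)
  refine (hasFDerivAt_rightLog hγ).unique (h.congr_of_eventuallyEq (Filter.Eventually.of_forall ?_))
  intro z
  simp only [mul_inv_cancel_left]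

theorem leftLog_mul (hγ : ContMDiffAt 𝓘(ℝ, X) 𝓘(ℝ, F) ∞ γ y)
    (hδ : ContMDiffAt 𝓘(ℝ, X) 𝓘(ℝ, F) ∞ δ y) :
    leftLog (fun z => γ z * δ z) y = (adCLM F (δ y)⁻¹).comp (leftLog γ y) + leftLog δ y := by
  have hc1 : ContMDiffAt 𝓘(ℝ, X) 𝓘(ℝ, F) ∞ (fun z => (γ y)⁻¹ * γ z) y := contMDiffAt_const.mul hγ
  have h1 := hasFDerivAt_oneChart_conj (δ y)⁻¹ (f := fun z => (γ y)⁻¹ * γ z)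
    hc1.continuousAt (by simp) (hasFDerivAt_leftLog hγ)
  have h2 := hasFDerivAt_oneChart_mul
    (f := fun z => (δ y)⁻¹ * ((γ y)⁻¹ * γ z) * (δ y)⁻¹⁻¹) (g := fun z => (δ y)⁻¹ * δ z)
    (ContMDiffAt.continuousAt ((contMDiffAt_const.mul hc1).mul contMDiffAt_const))
    (ContMDiffAt.continuousAt (contMDiffAt_const.mul hδ)) (by simp) (by simp) h1
    (hasFDerivAt_leftLog hδ)
  refine (hasFDerivAt_leftLog (hγ.mul hδ)).unique
    (h2.congr_of_eventuallyEq (Filter.Eventually.of_forall ?_))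
  intro z
  simp [mul_assoc]

theorem contDiffAt_leftLog (hγ : ContMDiffAt 𝓘(ℝ, X) 𝓘(ℝ, F) ∞ γ y) :
    ContDiffAt ℝ ∞ (leftLog (F := F) γ) y := by
  refine ContDiffAt.fderiv (n := ∞) (f := fun y z => oneChart F G ((γ y)⁻¹ * γ z)) (g := id) ?_
    contDiffAt_id (by simp)
  refine contDiffAt_oneChart (f := fun p : X × X => (γ p.1)⁻¹ * γ p.2) ?_ ?_
  · have h1 : ContMDiffAt 𝓘(ℝ, X × X) 𝓘(ℝ, F) ∞ (fun p : X × X => γ p.1) (y, y) :=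
      ContMDiffAt.comp (y, y) hγ contDiff_fst.contDiffAt.contMDiffAt
    have h2 : ContMDiffAt 𝓘(ℝ, X × X) 𝓘(ℝ, F) ∞ (fun p : X × X => γ p.2) (y, y) :=
      ContMDiffAt.comp (y, y) hγ contDiff_snd.contDiffAt.contMDiffAt
    exact h1.inv.mul h2
  · rw [id_eq, inv_mul_cancel]; exact one_mem_source

/-- The Maurer-Cartan equation. -/
theorem leftLog_maurerCartan {s : Set X} (hs : IsOpen s) (hy : y ∈ s)
    (hγ : ContMDiffOn 𝓘(ℝ, X) 𝓘(ℝ, F) ∞ γ s) {Q : X →L[ℝ] X →L[ℝ] F}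
    (hL : HasFDerivAt (leftLog (F := F) γ) Q y) (u v : X) :
    Q u v - Q v u = -modelLie F G (leftLog γ y u) (leftLog γ y v) := by
  have hγ' (z) (hz : z ∈ s) : ContMDiffAt 𝓘(ℝ, X) 𝓘(ℝ, F) ∞ γ z :=
    hγ.contMDiffAt (hs.mem_nhds hz)
  let c : X → F := fun z => oneChart F G ((γ y)⁻¹ * γ z)
  have hc0 : c y = ptOne F G := by simp only [c, inv_mul_cancel]
  have hcs : ContDiffAt ℝ ∞ c y :=
    contDiffAt_oneChart (f := fun z => (γ y)⁻¹ * γ z) (contMDiffAt_const.mul (hγ' y hy))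
      (by rw [inv_mul_cancel]; exact one_mem_source)
  have hc1 : HasFDerivAt c (leftLog γ y) y := hasFDerivAt_leftLog (hγ' y hy)
  -- left translation: `D c = D₂ m (c, 1) ∘ leftLog γ`
  have hDc : ∀ᶠ z in nhds y, fderiv ℝ c z = (fderiv ℝ (mulChart F G) (c z, ptOne F G)).comp
      ((ContinuousLinearMap.inr ℝ F F).comp (leftLog γ z)) := by
    have hcont : ContinuousAt (fun z => (γ y)⁻¹ * γ z) y :=
      ContMDiffAt.continuousAt (I := 𝓘(ℝ, X)) (I' := 𝓘(ℝ, F)) (contMDiffAt_const.mul (hγ' y hy))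
    have hct : ∀ᶠ z in nhds y, ContDiffAt ℝ ∞ (mulChart F G) (c z, ptOne F G) := by
      have := (eventually_left (F := F) (G := G)).mono fun c hc => hc.2.1
      rw [← hc0] at this
      have h2 := hcs.continuousAt.eventually this
      rwa [hc0] at h2
    filter_upwards [hs.mem_nhds hy, hct, eventually_mem_source (F := F) hcont (by
      rw [inv_mul_cancel]; exact one_mem_source)] with z hz h1 h2
    have h3 : HasFDerivAt (mulChart F G) (fderiv ℝ (mulChart F G) (c z, ptOne F G))
        (c z, oneChart F G ((γ z)⁻¹ * γ z)) := by
      rw [inv_mul_cancel]; exact (h1.differentiableAt (by simp)).hasFDerivAt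
    have h4 := h3.comp z ((hasFDerivAt_const (c z) z).prodMk (hasFDerivAt_leftLog (hγ' z hz)))
    have hcont2 : ContinuousAt (fun x => (γ z)⁻¹ * γ x) z :=
      ContMDiffAt.continuousAt (I := 𝓘(ℝ, X)) (I' := 𝓘(ℝ, F)) (contMDiffAt_const.mul (hγ' z hz))
    refine HasFDerivAt.fderiv ((h4.congr_fderiv ?_).congr_of_eventuallyEq ?_)
    · ext v; simp
    · filter_upwards [eventually_mem_source (F := F) hcont2 (by
        rw [inv_mul_cancel]; exact one_mem_source)] with x hx
      rw [Function.comp_apply, mulChart_oneChart h2 hx]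
      simp only [c, mul_assoc, mul_inv_cancel_left]
  have hD2 : HasFDerivAt (fderiv ℝ c) (fderiv ℝ (fderiv ℝ c) y) y :=
    ((hcs.fderiv_right (m := 1) (by
      rw [show (1 + 1 : ℕ∞ω) = 2 by norm_num]; exact WithTop.coe_le_coe.2 le_top)).differentiableAt
      (by simp)).hasFDerivAt
  have hsymm := hcs.isSymmSndFDerivAt (by
    rw [minSmoothness_of_isRCLikeNormedField]; exact WithTop.coe_le_coe.2 le_top)
  have key (u v : X) : fderiv ℝ (fderiv ℝ c) y u v =
      mulBil F G (leftLog γ y u) (leftLog γ y v) + Q u v := by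
    have h1 : HasFDerivAt (fun z => fderiv ℝ c z v)
        ((ContinuousLinearMap.apply ℝ F v).comp (fderiv ℝ (fderiv ℝ c) y)) y :=
      (ContinuousLinearMap.apply ℝ F v).hasFDerivAt.comp _ hD2
    have hM : HasFDerivAt (fun z => fderiv ℝ (mulChart F G) (c z, ptOne F G))
        ((fderiv ℝ (fderiv ℝ (mulChart F G)) (ptOne F G, ptOne F G)).comp
          ((leftLog γ y).prod 0)) y := by
      have h0 := hasFDerivAt_fderiv_mulChart (F := F) (G := G)
      have h0' : HasFDerivAt (fderiv ℝ (mulChart F G))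
          (fderiv ℝ (fderiv ℝ (mulChart F G)) (ptOne F G, ptOne F G)) (c y, ptOne F G) := by
        rw [hc0]; exact h0
      exact h0'.comp (f := fun z => (c z, ptOne F G)) y
        (hc1.prodMk (hasFDerivAt_const (ptOne F G) y))
    have hLv : HasFDerivAt (fun z => leftLog (F := F) γ z v)
        ((ContinuousLinearMap.apply ℝ F v).comp Q) y :=
      (ContinuousLinearMap.apply ℝ F v).hasFDerivAt.comp _ hL
    have h2 := hM.clm_apply ((hasFDerivAt_const (0 : F) y).prodMk hLv)
    have h3 := h1.unique (h2.congr_of_eventuallyEq (hDc.mono fun z hz => by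
      simp only [hz]; simp))
    have h4 := DFunLike.congr_fun h3 u
    simp only [ContinuousLinearMap.add_apply, ContinuousLinearMap.comp_apply,
      ContinuousLinearMap.apply_apply, ContinuousLinearMap.flip_apply, hc0,
      ContinuousLinearMap.prod_apply, ContinuousLinearMap.zero_apply,
      fderiv_mulChart_apply, zero_add] at h4
    rw [h4, add_comm]
    rfl
  have h5 := hsymm u v
  rw [key, key] at h5
  rw [modelLie_eq, neg_sub, sub_eq_sub_iff_add_eq_add, add_comm, h5, add_comm]

end LogDerivative

/-- The adjoint representation, as a linear map. -/
def lieAdLin (L : Type*) [LieRing L] [LieAlgebra ℝ L] : L →ₗ[ℝ] End ℝ L :=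
  LinearMap.mk₂ ℝ (fun x y => ⁅x, y⁆) add_lie smul_lie lie_add fun r x y => lie_smul r x y

theorem lieAdLin_apply {L : Type*} [LieRing L] [LieAlgebra ℝ L] (x y : L) :
    lieAdLin L x y = ⁅x, y⁆ := rfl

/-! ### Maps to the Lie group in the charts of the manifold -/
section MapsInCharts

theorem chartInvDeriv_self (x : M) :
    chartInvDeriv x (extChartAt 𝓘(ℝ, E) x x) = (LinearMap.id : E →ₗ[ℝ] E) :=
  congrArg ContinuousLinearMap.toLinearMap (mfderiv_chart_symm_self x)

theorem contMDiffOn_comp_chart (g : MapGroup E M F G) (x₀ : M) :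
    ContMDiffOn 𝓘(ℝ, E) 𝓘(ℝ, F) ∞ (fun y => g ((extChartAt 𝓘(ℝ, E) x₀).symm y))
      (extChartAt 𝓘(ℝ, E) x₀).target :=
  g.contMDiff.comp_contMDiffOn (contMDiffOn_extChartAt_symm x₀)

theorem contMDiffAt_comp_chart (g : MapGroup E M F G) (x₀ : M) {y : E}
    (hy : y ∈ (extChartAt 𝓘(ℝ, E) x₀).target) :
    ContMDiffAt 𝓘(ℝ, E) 𝓘(ℝ, F) ∞ (fun y => g ((extChartAt 𝓘(ℝ, E) x₀).symm y)) y :=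
  (contMDiffOn_comp_chart g x₀).contMDiffAt ((isOpen_extChartAt_target _).mem_nhds hy)

/-- The manifold derivative of a function on `E` with value `1`. -/
theorem mfderiv_eq_of_eq_one {f : E → G} {y : E} (hf : MDifferentiableAt 𝓘(ℝ, E) 𝓘(ℝ, F) f y)
    (h : f y = 1) : (mfderiv 𝓘(ℝ, E) 𝓘(ℝ, F) f y : E →L[ℝ] F) =
      fderiv ℝ (fun z => oneChart F G (f z)) y := by
  have h1 := hf.mfderiv
  simp only [writtenInExtChartAt, h, modelWithCornersSelf_coe, Set.range_id,
    fderivWithin_univ] at h1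
  exact h1

/-- The derivative of a map `M → G` as a linear map of the model spaces. -/
def mderivLin (f : M → G) (x : M) : E →ₗ[ℝ] F :=
  (mfderiv 𝓘(ℝ, E) 𝓘(ℝ, F) f x : E →L[ℝ] F).toLinearMap

theorem mfderiv_comp_chartInvDeriv {f : M → G} (hf : ContMDiff 𝓘(ℝ, E) 𝓘(ℝ, F) ∞ f) (x₀ : M) {y : E}
    (hy : y ∈ (extChartAt 𝓘(ℝ, E) x₀).target) (h : f ((extChartAt 𝓘(ℝ, E) x₀).symm y) = 1) :
    mderivLin f ((extChartAt 𝓘(ℝ, E) x₀).symm y) ∘ₗ chartInvDeriv x₀ y =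
      (fderiv ℝ (fun z : E => oneChart F G (f ((extChartAt 𝓘(ℝ, E) x₀).symm z))) y :
        E →L[ℝ] F).toLinearMap := by
  have h1 := mfderiv_comp (I'' := 𝓘(ℝ, F)) y (hf.mdifferentiable (by simp) _)
    ((contMDiffAt_chart_symm x₀ hy).mdifferentiableAt (by simp))
  have h2 := mfderiv_eq_of_eq_one (F := F) (f := f ∘ (extChartAt 𝓘(ℝ, E) x₀).symm) (y := y)
    ((hf.contMDiffAt.comp y (contMDiffAt_chart_symm x₀ hy)).mdifferentiableAt (by simp)) h
  have h3 := h1.symm.trans h2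
  exact congrArg ContinuousLinearMap.toLinearMap h3

theorem leftMC_comp_chartInvDeriv (g : MapGroup E M F G) (x₀ : M) {y : E}
    (hy : y ∈ (extChartAt 𝓘(ℝ, E) x₀).target) :
    leftMC g ((extChartAt 𝓘(ℝ, E) x₀).symm y) ∘ₗ chartInvDeriv x₀ y =
      (leftLog (fun z => g ((extChartAt 𝓘(ℝ, E) x₀).symm z)) y : E →L[ℝ] F).toLinearMap :=
  mfderiv_comp_chartInvDeriv (f := fun z => (g ((extChartAt 𝓘(ℝ, E) x₀).symm y))⁻¹ * g z)
    (contMDiff_const.mul g.contMDiff) x₀ hy (inv_mul_cancel _)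

theorem leftMC_eq (g : MapGroup E M F G) (x : M) :
    leftMC g x = (leftLog (fun z => g ((extChartAt 𝓘(ℝ, E) x).symm z)) (extChartAt 𝓘(ℝ, E) x x) :
      E →L[ℝ] F).toLinearMap := by
  have h := leftMC_comp_chartInvDeriv g x (mem_extChartAt_target (I := 𝓘(ℝ, E)) x)
  rw [chartInvDeriv_self, LinearMap.comp_id, extChartAt_to_inv] at h
  exact h

theorem rightMC_eq (g : MapGroup E M F G) (x : M) :
    rightMC g x = (rightLog (fun z => g ((extChartAt 𝓘(ℝ, E) x).symm z)) (extChartAt 𝓘(ℝ, E) x x) :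
      E →L[ℝ] F).toLinearMap := by
  have h := mfderiv_comp_chartInvDeriv (f := fun z => g z * (g x)⁻¹)
    (g.contMDiff.mul contMDiff_const) x (mem_extChartAt_target (I := 𝓘(ℝ, E)) x)
    (by rw [extChartAt_to_inv, mul_inv_cancel])
  rw [chartInvDeriv_self, LinearMap.comp_id, extChartAt_to_inv] at h
  refine h.trans ?_
  rw [rightLog, extChartAt_to_inv]

theorem rightMC_eq_AdLin (g : MapGroup E M F G) (x : M) :
    rightMC g x = AdLin (g x) ∘ₗ leftMC g x := by
  rw [rightMC_eq, leftMC_eq, rightLog_eq (contMDiffAt_comp_chart g x (mem_extChartAt_target x)),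
    extChartAt_to_inv]
  rfl

theorem AdLin_inv_apply (g : G) (w : LieAlg F G) : AdLin (F := F) g⁻¹ (AdLin (F := F) g w) = w :=
  adCLM_inv_apply (F := F) g w

theorem AdLin_apply_inv (g : G) (w : LieAlg F G) : AdLin (F := F) g (AdLin (F := F) g⁻¹ w) = w :=
  adCLM_apply_inv (F := F) g w

theorem AdLin_lie (g : G) (u w : LieAlg F G) :
    AdLin (F := F) g ⁅u, w⁆ = ⁅AdLin (F := F) g u, AdLin (F := F) g w⁆ :=
  adCLM_modelLie (F := F) g u w

theorem leftMC_mul (g h : MapGroup E M F G) (x : M) :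
    leftMC (g * h) x = AdLin (h x)⁻¹ ∘ₗ leftMC g x + leftMC h x := by
  rw [leftMC_eq, leftMC_eq, leftMC_eq]
  have h1 := leftLog_mul (contMDiffAt_comp_chart g x (mem_extChartAt_target x))
    (contMDiffAt_comp_chart h x (mem_extChartAt_target x))
  rw [extChartAt_to_inv] at h1
  exact congrArg ContinuousLinearMap.toLinearMap h1

theorem leftMC_one (x : M) : leftMC (1 : MapGroup E M F G) x = 0 := by
  have h := leftMC_mul (1 : MapGroup E M F G) 1 x
  rw [mul_one, ContMDiffMap.coe_one, Pi.one_apply, inv_one, AdLin_one] at h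
  have h2 : (1 : End ℝ (LieAlg F G)) ∘ₗ leftMC (1 : MapGroup E M F G) x = leftMC 1 x := rfl
  rw [h2] at h
  exact left_eq_add.1 h

theorem rightMC_one (x : M) : rightMC (1 : MapGroup E M F G) x = 0 := by
  rw [rightMC_eq_AdLin, leftMC_one, LinearMap.comp_zero]

theorem rightMC_mul (g h : MapGroup E M F G) (x : M) :
    rightMC (g * h) x = rightMC g x + AdLin (g x) ∘ₗ rightMC h x := by
  rw [rightMC_eq_AdLin, rightMC_eq_AdLin, rightMC_eq_AdLin, leftMC_mul, ContMDiffMap.coe_mul,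
    Pi.mul_apply, AdLin_mul]
  ext v
  simp only [comp_apply, LinearMap.add_apply, map_add, End.mul_apply,
    AdLin_apply_inv]

variable (F G) in
/-- The passage from continuous linear maps of the model space to endomorphisms of `𝔤`. -/
def toLieEnd : (F →L[ℝ] F) →ₗ[ℝ] End ℝ (LieAlg F G) where
  toFun L := L.toLinearMap
  map_add' _ _ := rfl
  map_smul' _ _ := rfl

variable (E F G) in
/-- The passage from continuous linear maps `E → F` to linear maps `E → 𝔤`. -/
def toLieHom : (E →L[ℝ] F) →ₗ[ℝ] (E →ₗ[ℝ] LieAlg F G) where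
  toFun L := L.toLinearMap
  map_add' _ _ := rfl
  map_smul' _ _ := rfl

theorem AdLin_mem_smoothFin {f : E → G} {s : Set E} (hs : IsOpen s)
    (hf : ContMDiffOn 𝓘(ℝ, E) 𝓘(ℝ, F) ∞ f s) :
    (fun y => AdLin (F := F) (f y)) ∈ smoothFin (End ℝ (LieAlg F G)) s := by
  have h : ContDiffOn ℝ ∞ (fun y => adCLM F (f y)) s := fun y hy =>
    (contDiffAt_adCLM (hf.contMDiffAt (hs.mem_nhds hy))).contDiffWithinAt
  exact smoothFin_linear (toLieEnd F G) (mem_smoothFin_of_contDiffOn' h)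

theorem leftLog_mem_smoothFin {f : E → G} {s : Set E} (hs : IsOpen s)
    (hf : ContMDiffOn 𝓘(ℝ, E) 𝓘(ℝ, F) ∞ f s) :
    (fun y => toLieHom E F G (leftLog f y)) ∈ smoothFin (E →ₗ[ℝ] LieAlg F G) s := by
  have h : ContDiffOn ℝ ∞ (fun y => leftLog (F := F) f y) s := fun y hy =>
    (contDiffAt_leftLog (hf.contMDiffAt (hs.mem_nhds hy))).contDiffWithinAt
  exact smoothFin_linear (toLieHom E F G) (mem_smoothFin_of_contDiffOn' h)

/-- The derivative of the adjoint action along a function with value `1`. -/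
theorem hasD_AdLin {f : E → G} {y : E} {f' : E →L[ℝ] F} (hfc : ContinuousAt f y)
    (hf : f y = 1) (hf' : HasFDerivAt (fun z => oneChart F G (f z)) f' y) :
    HasD (fun z => AdLin (F := F) (f z)) y
      (lieAdLin (LieAlg F G) ∘ₗ toLieHom E F G f') := by
  obtain ⟨D, hD, hD'⟩ := exists_hasFDerivAt_adCLM hfc hf hf'
  have h := hD.hasD.linear (toLieEnd F G)
  have h2 : toLieEnd F G ∘ₗ D.toLinearMap =
      lieAdLin (LieAlg F G) ∘ₗ toLieHom E F G f' :=
    LinearMap.ext fun v => LinearMap.ext fun w => hD' v w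
  rw [← h2]
  exact h

theorem hasD_AdLin_right (g : MapGroup E M F G) (x : M) :
    HasD (fun z => AdLin (F := F) (g ((extChartAt 𝓘(ℝ, E) x).symm z) * (g x)⁻¹))
      (extChartAt 𝓘(ℝ, E) x x)
      (lieAdLin (LieAlg F G) ∘ₗ rightMC g x) := by
  have hc := contMDiffAt_comp_chart g x (mem_extChartAt_target (I := 𝓘(ℝ, E)) x)
  have h := hasFDerivAt_rightLog hc
  rw [extChartAt_to_inv] at h
  have h2 := hasD_AdLin (f := fun z => g ((extChartAt 𝓘(ℝ, E) x).symm z) * (g x)⁻¹)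
    (ContMDiffAt.continuousAt (hc.mul contMDiffAt_const))
    (by rw [extChartAt_to_inv, mul_inv_cancel]) h
  rw [rightMC_eq]
  exact h2

end MapsInCharts

/-! ### Sections of the algebra of forms with values in a superalgebra -/
section Sections
variable {M : Type*} [TopologicalSpace M] [ChartedSpace E M]
  {U : Type*} [Ring U] [Algebra ℝ U] [SuperAlgebra U]
  {U' : Type*} [Ring U'] [Algebra ℝ U'] [SuperAlgebra U']

theorem ExteriorAlgebra.parity_map {V W : Type*} [AddCommGroup V] [Module ℝ V] [AddCommGroup W]
    [Module ℝ W] (f : V →ₗ[ℝ] W) (a : ExteriorAlgebra ℝ V) :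
    ExteriorAlgebra.map f (parity a) = parity (ExteriorAlgebra.map f a) := by
  have : (ExteriorAlgebra.map f).comp (parity : ExteriorAlgebra ℝ V →ₐ[ℝ] ExteriorAlgebra ℝ V) =
      (parity : ExteriorAlgebra ℝ W →ₐ[ℝ] ExteriorAlgebra ℝ W).comp (ExteriorAlgebra.map f) := by
    apply ExteriorAlgebra.hom_ext
    ext v
    simp only [comp_apply, AlgHom.toLinearMap_apply, AlgHom.comp_apply,
      map_apply_ι]
    rw [parity_ι, parity_ι, map_neg, map_apply_ι]
  exact DFunLike.congr_fun this a

/-- The pullback of forms at a point by the inverse of a chart. -/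
def chartPull (x₀ : M) (y : E) : ExtCot E →ₐ[ℝ] ExtCot E :=
  ExteriorAlgebra.map (chartInvDeriv x₀ y).dualMap

theorem chartPull_parity (x₀ : M) (y : E) (a : ExtCot E) :
    chartPull x₀ y (parity a) = parity (chartPull x₀ y a) := parity_map _ a

theorem chartPull_self [IsManifold 𝓘(ℝ, E) ∞ M] (x : M) :
    chartPull x (extChartAt 𝓘(ℝ, E) x x) = AlgHom.id ℝ (ExtCot E) := by
  rw [chartPull, chartInvDeriv_self, LinearMap.dualMap_id, ExteriorAlgebra.map_id]

/-- A section with values in `Λ T* M ⊗ U` in the preferred chart at `x₀`. -/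
def chartSec (h : M → ExtCot E ⊗ₛ U) (x₀ : M) (y : E) : ExtCot E ⊗ₛ U :=
  superMapLin (chartPull x₀ y).toLinearMap LinearMap.id (h ((extChartAt 𝓘(ℝ, E) x₀).symm y))

theorem superMapLin_algHom_mul (f : ExtCot E →ₐ[ℝ] ExtCot E)
    (hf : ∀ a, f (parity a) = parity (f a)) (x y : ExtCot E ⊗ₛ U) :
    superMapLin f.toLinearMap (LinearMap.id : U →ₗ[ℝ] U) (x * y) =
      superMapLin f.toLinearMap LinearMap.id x * superMapLin f.toLinearMap LinearMap.id y := by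
  have h := superMap_eq_superMapLin f (AlgHom.id ℝ U) hf (fun _ => rfl)
  have h1 (z : ExtCot E ⊗ₛ U) : superMapLin f.toLinearMap (LinearMap.id : U →ₗ[ℝ] U) z =
      superMap f (AlgHom.id ℝ U) hf (fun _ => rfl) z := (h z).symm
  exact (h1 _).trans ((map_mul _ x y).trans (congrArg₂ (· * ·) (h1 x).symm (h1 y).symm))

theorem chartSec_mul (h k : M → ExtCot E ⊗ₛ U) (x₀ : M) (y : E) :
    chartSec (fun x => h x * k x) x₀ y = chartSec h x₀ y * chartSec k x₀ y :=
  superMapLin_algHom_mul _ (chartPull_parity x₀ y) _ _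

theorem chartSec_self [IsManifold 𝓘(ℝ, E) ∞ M] (h : M → ExtCot E ⊗ₛ U) (x : M) :
    chartSec h x (extChartAt 𝓘(ℝ, E) x x) = h x := by
  rw [chartSec, chartPull_self, extChartAt_to_inv]
  exact superMapLin_id _

theorem chartSec_one (x₀ : M) (y : E) : chartSec (fun _ => (1 : ExtCot E ⊗ₛ U)) x₀ y = 1 := by
  rw [chartSec, one_def, superMapLin_tmul]
  exact congrArg (fun a => (a ᵍ⊗ₜ (1 : U) : ExtCot E ⊗ₛ U)) (map_one (chartPull x₀ y))

/-- Smooth sections which are locally finite sums of products of smooth forms and vectors. -/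
def IsSmoothSec (h : M → ExtCot E ⊗ₛ U) : Prop :=
  ∀ x₀ : M, chartSec h x₀ ∈ smoothFin (ExtCot E ⊗ₛ U) (extChartAt 𝓘(ℝ, E) x₀).target

theorem IsSmoothSec.isSmoothForm {h : M → ExtCot E ⊗ₛ U} (hh : IsSmoothSec h) :
    IsSmoothForm fun x => (GradedTensorProduct.of ℝ (part (ExtCot E)) (part U)).symm (h x) :=
  fun x₀ c => contDiffOn_of_mem_smoothFin (hh x₀)
    (c ∘ₗ (GradedTensorProduct.of ℝ (part (ExtCot E)) (part U)).symm.toLinearMap)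

theorem isSmoothSec_of_isSmoothForm {h : M → ExtCot E ⊗ₛ U} (P : Submodule ℝ (ExtCot E ⊗ₛ U))
    [Module.Finite ℝ P] (hP : ∀ x₀ y, chartSec h x₀ y ∈ P)
    (hh : IsSmoothForm fun x =>
      (GradedTensorProduct.of ℝ (part (ExtCot E)) (part U)).symm (h x)) : IsSmoothSec h :=
  fun x₀ => mem_smoothFin_of_contDiffOn P (fun y _ => hP x₀ y) fun l =>
    hh x₀ (l ∘ₗ (GradedTensorProduct.of ℝ (part (ExtCot E)) (part U)).toLinearMap)

theorem IsSmoothSec.mul {h k : M → ExtCot E ⊗ₛ U} (hh : IsSmoothSec h) (hk : IsSmoothSec k) :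
    IsSmoothSec fun x => h x * k x := fun x₀ =>
  smoothFin_congr (smoothFin_mul (hh x₀) (hk x₀)) fun y _ => chartSec_mul h k x₀ y

theorem isSmoothSec_one : IsSmoothSec fun _ : M => (1 : ExtCot E ⊗ₛ U) := fun x₀ =>
  smoothFin_congr (const_mem_smoothFin 1) fun y _ => chartSec_one x₀ y

/-- The form `∑ᵢ dxⁱ ⊗ f' eᵢ`. -/
def dTens (f' : E →ₗ[ℝ] ExtCot E ⊗ₛ U) : ExtCot E ⊗ₛ U :=
  ∑ i, (ι ℝ ((finBasis ℝ E).coord i) ᵍ⊗ₜ (1 : U) : ExtCot E ⊗ₛ U) *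
    f' (finBasis ℝ E i)

theorem dTens_add (f' g' : E →ₗ[ℝ] ExtCot E ⊗ₛ U) : dTens (f' + g') = dTens f' + dTens g' := by
  simp only [dTens, LinearMap.add_apply, mul_add, sum_add_distrib]

theorem dTens_map (f : U →ₗ[ℝ] U') (f' : E →ₗ[ℝ] ExtCot E ⊗ₛ U) :
    dTens (superMapLin LinearMap.id f ∘ₗ f') = superMapLin LinearMap.id f (dTens f') := by
  rw [dTens, dTens, map_sum]
  refine sum_congr rfl fun i _ => ?_
  rw [comp_apply]
  generalize f' (finBasis ℝ E i) = z
  induction z using SuperTensor.induction with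
  | zero => simp only [map_zero, mul_zero]
  | tmul a u => rw [superMapLin_tmul, tmul_one_mul, tmul_one_mul,
      superMapLin_tmul]; rfl
  | add x y hx hy => simp only [map_add, mul_add, hx, hy]

theorem dTens_mulRight (f' : E →ₗ[ℝ] ExtCot E ⊗ₛ U) (z : ExtCot E ⊗ₛ U) :
    dTens (mulRight ℝ z ∘ₗ f') = dTens f' * z := by
  simp only [dTens, comp_apply, mulRight_apply, sum_mul, mul_assoc]

theorem dTens_mulLeft (f' : E →ₗ[ℝ] ExtCot E ⊗ₛ U) {z : ExtCot E ⊗ₛ U} (hz : parity z = z) :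
    dTens (mulLeft ℝ z ∘ₗ f') = z * dTens f' := by
  simp only [dTens, comp_apply, mulLeft_apply, mul_sum]
  refine sum_congr rfl fun i _ => ?_
  have h := tmul_one_comm (B := U)
    (a := ι ℝ ((finBasis ℝ E).coord i)) (parity_ι _)
    (ι_superComm _) z
  rw [← mul_assoc, h, hz, mul_assoc]

variable [IsManifold 𝓘(ℝ, E) ∞ M]

/-- The exterior derivative of a section in terms of its derivative in the chart. -/
theorem extD_eq_dTens {h : M → ExtCot E ⊗ₛ U} {x : M} {f' : E →ₗ[ℝ] ExtCot E ⊗ₛ U}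
    (hf : HasD (chartSec h x) (extChartAt 𝓘(ℝ, E) x x) f') :
    GradedTensorProduct.of ℝ (part (ExtCot E)) (part U)
      (extD (fun x => (GradedTensorProduct.of ℝ (part (ExtCot E)) (part U)).symm (h x)) x) =
        dTens f' := by
  rw [extD, map_sum, dTens]
  refine sum_congr rfl fun i _ => ?_
  have h1 := HasD.dirDeriv_eq (hf.linear
    (GradedTensorProduct.of ℝ (part (ExtCot E)) (part U)).symm.toLinearMap)
    (finBasis ℝ E i)
  have h2 : dirDeriv (chartForm (fun x =>
      (GradedTensorProduct.of ℝ (part (ExtCot E)) (part U)).symm (h x)) x)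
      (extChartAt 𝓘(ℝ, E) x x) (finBasis ℝ E i) =
      (GradedTensorProduct.of ℝ (part (ExtCot E)) (part U)).symm (f' (finBasis ℝ E i)) := h1
  rw [h2]
  generalize f' (finBasis ℝ E i) = z
  induction z using SuperTensor.induction with
  | zero => simp only [map_zero, mul_zero]
  | tmul a u => rw [tmul_one_mul]; rfl
  | add x y hx hy => simp only [map_add, mul_add, hx, hy]

theorem IsSmoothSec.exists_hasD {h : M → ExtCot E ⊗ₛ U} (hh : IsSmoothSec h) (x : M) :
    ∃ f', HasD (chartSec h x) (extChartAt 𝓘(ℝ, E) x x) f' :=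
  _root_.exists_hasD (isOpen_extChartAt_target x) (mem_extChartAt_target x) (hh x)

theorem hasD_chartSec_mul {h k : M → ExtCot E ⊗ₛ U} (hh : IsSmoothSec h) (hk : IsSmoothSec k)
    {x : M} {f' g' : E →ₗ[ℝ] ExtCot E ⊗ₛ U}
    (hf : HasD (chartSec h x) (extChartAt 𝓘(ℝ, E) x x) f')
    (hg : HasD (chartSec k x) (extChartAt 𝓘(ℝ, E) x x) g') :
    HasD (chartSec (fun x => h x * k x) x) (extChartAt 𝓘(ℝ, E) x x)
      (mulRight ℝ (k x) ∘ₗ f' + mulLeft ℝ (h x) ∘ₗ g') := by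
  have h1 := HasD.mul (isOpen_extChartAt_target x) (mem_extChartAt_target x) (hh x) (hk x) hf hg
  rw [chartSec_self, chartSec_self] at h1
  exact h1.congr (Filter.Eventually.of_forall fun y => chartSec_mul h k x y)

end Sections

/-! ### Group-like elements over an exterior algebra -/
section GroupLikeExterior
variable {V : Type*} [AddCommGroup V] [Module ℝ V]

theorem ExteriorAlgebra.superComm {v w : ExteriorAlgebra ℝ V} {m n : ℕ}
    (hv : parity v = (-1 : ℝ) ^ m • v) (hw : parity w = (-1 : ℝ) ^ n • w) :
    w * v = (-1 : ℝ) ^ (m * n) • (v * w) := by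
  rcases Nat.even_or_odd m with h | h
  · rw [h.neg_one_pow, one_smul] at hv
    rw [(h.mul_right n).neg_one_pow, one_smul, even_central hv]
  rcases Nat.even_or_odd n with h' | h'
  · rw [h'.neg_one_pow, one_smul] at hw
    rw [(h'.mul_left m).neg_one_pow, one_smul, even_central hw]
  · rw [h.neg_one_pow, neg_smul, one_smul] at hv
    rw [h'.neg_one_pow, neg_smul, one_smul] at hw
    rw [(h.mul h').neg_one_pow, neg_smul, one_smul]
    -- odd elements anticommute since multiplication by the generators supercommutes
    have key : ∀ w : ExteriorAlgebra ℝ V, w * v = v * parity w := by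
      intro w
      induction w using ExteriorAlgebra.left_induction with
      | algebraMap r => rw [AlgHom.commutes, Algebra.commutes]
      | add a b ha hb => rw [add_mul, ha, hb, map_add, mul_add]
      | ι_mul a b hb =>
        rw [mul_assoc, hb, map_mul, parity_ι, ← mul_assoc,
          ι_superComm, hv, neg_mul, neg_mul, neg_mul, mul_neg, mul_assoc]
    rw [key, hw, mul_neg]

theorem inFst_inSnd_comm_of_mem {x y : ExteriorAlgebra ℝ V ⊗ₛ UL L}
    (hx : x ∈ degFiltration L V 0) (hy : y ∈ degFiltration L V 0) :
    inFst L _ x * inSnd L _ y = inSnd L _ y * inFst L _ x := by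
  induction hx using Submodule.iSup_induction' with
  | mem m x hx =>
    induction hy using Submodule.iSup_induction' with
    | mem n y hy =>
      exact inFst_inSnd_comm (fun s hs => parity_of_mem hs)
        (fun s hs => parity_of_mem hs)
        (fun s hs t ht => superComm (parity_of_mem hs)
          (parity_of_mem ht)) hx hy
    | zero => rw [map_zero, mul_zero, zero_mul]
    | add y z _ _ hy hz => rw [map_add, mul_add, add_mul, hy, hz]
  | zero => rw [map_zero, mul_zero, zero_mul]
  | add y z _ _ hy hz => rw [map_add, mul_add, add_mul, hy, hz]

/-- The group-like elements of `B ⊗ U(L(S⁺𝔤))` over `B`. -/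
def IsGroupLike {B : Type*} [Ring B] [Algebra ℝ B] [SuperAlgebra B] (z : B ⊗ₛ UL L) : Prop :=
  comulB L B z = inFst L B z * inSnd L B z

theorem mul_mul_mul_comm_of {R : Type*} [Monoid R] {a b c d : R} (h : b * c = c * b) :
    (a * b) * (c * d) = (a * c) * (b * d) := by
  rw [mul_assoc, ← mul_assoc b, h, mul_assoc, mul_assoc]

theorem eq_of_mul_eq_one {R : Type*} [Monoid R] {a b x : R} (h1 : b * a = 1) (h2 : a * x = 1) :
    b = x := by
  rw [← mul_one b, ← h2, ← mul_assoc, h1, one_mul]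

theorem isGroupLike_one {B : Type*} [Ring B] [Algebra ℝ B] [SuperAlgebra B] :
    IsGroupLike (1 : B ⊗ₛ UL L) := by
  rw [IsGroupLike, map_one, map_one, map_one, one_mul]

theorem IsGroupLike.mul {x y : ExteriorAlgebra ℝ V ⊗ₛ UL L} (hx : IsGroupLike x)
    (hy : IsGroupLike y) (hx0 : x ∈ degFiltration L V 0) (hy0 : y ∈ degFiltration L V 0) :
    IsGroupLike (x * y) :=
  (map_mul (comulB L _) x y).trans <| (congrArg₂ (· * ·) hx hy).trans <|
    (mul_mul_mul_comm_of (inFst_inSnd_comm_of_mem hy0 hx0).symm).trans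
      (congrArg₂ (· * ·) (map_mul (inFst L _) x y) (map_mul (inSnd L _) x y)).symm

theorem IsGroupLike.of_mul_eq_one {x y : ExteriorAlgebra ℝ V ⊗ₛ UL L} (hx : IsGroupLike x)
    (hx0 : x ∈ degFiltration L V 0) (hy0 : y ∈ degFiltration L V 0) (h : x * y = 1)
    (h' : y * x = 1) : IsGroupLike y := by
  have h1 : comulB L _ y * comulB L _ x = 1 :=
    (map_mul (comulB L _) y x).symm.trans ((congrArg _ h').trans (map_one _))
  have h2 : comulB L _ x * (inFst L _ y * inSnd L _ y) = 1 := by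
    refine (congrArg (· * (inFst L _ y * inSnd L _ y)) hx).trans ?_
    refine (mul_mul_mul_comm_of (inFst_inSnd_comm_of_mem hy0 hx0).symm).trans ?_
    refine (congrArg₂ (· * ·) (map_mul (inFst L _) x y) (map_mul (inSnd L _) x y)).symm.trans ?_
    rw [h, map_one, map_one, one_mul]
  exact eq_of_mul_eq_one h1 h2

theorem ulComul_ulMap (φ : End ℝ L) (u : UL L) :
    ulComul L (ulMap φ u) =
      superMap (ulMap φ) (ulMap φ) (ulMap_parity φ) (ulMap_parity φ) (ulComul L u) := by
  have : (ulComul L).comp (ulMap φ) =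
      (superMap (ulMap φ) (ulMap φ) (ulMap_parity φ) (ulMap_parity φ)).comp (ulComul L) := by
    apply TensorAlgebra.hom_ext
    refine LinearMap.ext fun u => ?_
    simp only [comp_apply, AlgHom.toLinearMap_apply, AlgHom.comp_apply]
    rw [← genI_coe, ulMap_genI, ulComul_genI, ulComul_genI, map_add, superMap_tmul, superMap_tmul,
      map_one, ulMap_genI]
  exact DFunLike.congr_fun this u

theorem bMap_tmul {B : Type*} [Ring B] [Algebra ℝ B] [SuperAlgebra B] (φ : End ℝ L)
    (b : B) (u : UL L) : bMap B φ (b ᵍ⊗ₜ u : B ⊗ₛ UL L) = (b ᵍ⊗ₜ ulMap φ u : B ⊗ₛ UL L) :=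
  superMap_tmul _ _ _ _ b u

theorem toBUD_tmul {B : Type*} [Ring B] [Algebra ℝ B] [SuperAlgebra B] (b : B) (u : UL L) :
    toBUD L B (b ᵍ⊗ₜ u : B ⊗ₛ UL L) = (b ᵍ⊗ₜ ulToUD L u : B ⊗ₛ UD L) :=
  superMap_tmul _ _ _ _ b u

theorem IsGroupLike.bMap {B : Type*} [Ring B] [Algebra ℝ B] [SuperAlgebra B] {z : B ⊗ₛ UL L}
    (hz : IsGroupLike z) (φ : End ℝ L) : IsGroupLike (bMap B φ z) := by
  let S := superMap (ulMap φ) (ulMap φ) (ulMap_parity φ) (ulMap_parity φ)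
  let T : (B ⊗ₛ (UL L ⊗ₛ UL L)) →ₐ[ℝ] (B ⊗ₛ (UL L ⊗ₛ UL L)) :=
    superMap (AlgHom.id ℝ B) S (fun _ => rfl) (parity_superMap _ _ _ _)
  have hS (u v : UL L) : S (u ᵍ⊗ₜ v : UL L ⊗ₛ UL L) =
      (ulMap φ u ᵍ⊗ₜ ulMap φ v : UL L ⊗ₛ UL L) := superMap_tmul _ _ _ _ u v
  have hT (b : B) (u : UL L ⊗ₛ UL L) : T (b ᵍ⊗ₜ u : B ⊗ₛ (UL L ⊗ₛ UL L)) =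
      (b ᵍ⊗ₜ S u : B ⊗ₛ (UL L ⊗ₛ UL L)) := superMap_tmul _ _ _ _ b u
  have h1 (z) : comulB L B (_root_.bMap B φ z) = T (comulB L B z) := by
    induction z using SuperTensor.induction with
    | zero => simp only [map_zero]
    | add x y hx hy => simp only [map_add, hx, hy]
    | tmul b u =>
      rw [bMap_tmul, comulB_tmul, comulB_tmul, hT, ulComul_ulMap]
  have h2 (z) : inFst L B (_root_.bMap B φ z) = T (inFst L B z) := by
    induction z using SuperTensor.induction with
    | zero => simp only [map_zero]
    | add x y hx hy => simp only [map_add, hx, hy]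
    | tmul b u =>
      rw [bMap_tmul, inFst_tmul, inFst_tmul, hT, hS, map_one]
  have h3 (z) : inSnd L B (_root_.bMap B φ z) = T (inSnd L B z) := by
    induction z using SuperTensor.induction with
    | zero => simp only [map_zero]
    | add x y hx hy => simp only [map_add, hx, hy]
    | tmul b u =>
      rw [bMap_tmul, inSnd_tmul, inSnd_tmul, hT, hS, map_one]
  rw [IsGroupLike, h1, h2, h3, ← map_mul]
  exact congrArg T hz

/-! ### The differential of `D𝔤` with form coefficients -/

variable {B : Type*} [Ring B] [Algebra ℝ B] [SuperAlgebra B]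

variable (L B) in
/-- The differential of `D𝔤`, extended to `B ⊗ U(L(S⁺𝔤))`. -/
def dTensUL : (B ⊗ₛ UL L) →ₗ[ℝ] (B ⊗ₛ UD L) :=
  superMapLin (parity : B →ₐ[ℝ] B).toLinearMap (dUL L)

theorem dTensUL_mul {x : B ⊗ₛ UL L} (hx : parity x = x) (y : B ⊗ₛ UL L) :
    dTensUL L B (x * y) =
      dTensUL L B x * toBUD L B y + toBUD L B x * dTensUL L B y := by
  have h := (dUL_isDerOver (L := L)).superMapLin_parity (A := B) dUL_parity (fun _ => rfl)
    parity_ulToUD x y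
  have h2 : ((superMap (AlgHom.id ℝ B) (ulToUD L) (fun _ => rfl) parity_ulToUD).comp parity) x =
      toBUD L B x := congrArg (toBUD L B) hx
  exact h.trans (congrArg₂ (· + ·) rfl (congrArg (· * dTensUL L B y) h2))

theorem dTensUL_one : dTensUL L B 1 = 0 := by
  have h : dUL L 1 = 0 := by rw [← map_one (algebraMap ℝ (UL L)), dUL_algebraMap]
  rw [dTensUL, one_def, superMapLin_tmul, h, ← zero_smul ℝ (0 : UD L),
    tmul_smul, zero_smul]

variable (B) in
/-- The action on `B ⊗ U(D𝔤)` of an endomorphism of the Lie algebra `𝔤`. -/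
def bMapUD (φ : L →ₗ⁅ℝ⁆ L) : (B ⊗ₛ UD L) →ₐ[ℝ] (B ⊗ₛ UD L) :=
  superMap (AlgHom.id ℝ B) (udMap φ) (fun _ => rfl) (udMap_parity φ)

theorem bMapUD_tmul (φ : L →ₗ⁅ℝ⁆ L) (b : B) (u : UD L) :
    bMapUD B φ (b ᵍ⊗ₜ u : B ⊗ₛ UD L) = (b ᵍ⊗ₜ udMap φ u : B ⊗ₛ UD L) :=
  superMap_tmul _ _ _ _ b u

theorem dTensUL_tmul (b : B) (u : UL L) :
    dTensUL L B (b ᵍ⊗ₜ u : B ⊗ₛ UL L) = (parity b ᵍ⊗ₜ dUL L u : B ⊗ₛ UD L) := rfl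

theorem toBUD_bMap (φ : L →ₗ⁅ℝ⁆ L) (z : B ⊗ₛ UL L) :
    toBUD L B (bMap B (φ : L →ₗ[ℝ] L) z) = bMapUD B φ (toBUD L B z) := by
  induction z using SuperTensor.induction with
  | zero => simp only [map_zero]
  | add x y hx hy => simp only [map_add, hx, hy]
  | tmul b u =>
    rw [bMap_tmul, toBUD_tmul, toBUD_tmul, bMapUD_tmul, udMap_ulToUD]

theorem dTensUL_bMap (φ : L →ₗ⁅ℝ⁆ L) (z : B ⊗ₛ UL L) :
    dTensUL L B (bMap B (φ : L →ₗ[ℝ] L) z) = bMapUD B φ (dTensUL L B z) := by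
  induction z using SuperTensor.induction with
  | zero => simp only [map_zero]
  | add x y hx hy => simp only [map_add, hx, hy]
  | tmul b u =>
    rw [bMap_tmul, dTensUL_tmul, dTensUL_tmul, bMapUD_tmul, dUL_ulMap]

/-! ### Smooth families of endomorphisms -/
section Families
variable {X : Type*} [NormedAddCommGroup X] [NormedSpace ℝ X] [FiniteDimensional ℝ X] {s : Set X}
  {T : X → End ℝ L}

theorem smoothFin_symMap (hT : T ∈ smoothFin (End ℝ L) s) (u : Sym𝔤 L) :
    (fun z => symMap (T z) u) ∈ smoothFin (Sym𝔤 L) s := by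
  induction u using MvPolynomial.induction_on with
  | C r => simpa only [symMap, MvPolynomial.algHom_C] using const_mem_smoothFin _
  | add u v hu hv => simpa only [map_add] using smoothFin_add hu hv
  | mul_X u a hu =>
    simp only [map_mul]
    refine smoothFin_mul hu ?_
    simp only [symMap, MvPolynomial.aeval_X]
    exact smoothFin_linear (symι ∘ₗ LinearMap.applyₗ (lieBasis L a)) hT

theorem smoothFin_ulMap (hT : T ∈ smoothFin (End ℝ L) s) (w : UL L) :
    (fun z => ulMap (T z) w) ∈ smoothFin (UL L) s := by
  induction w using TensorAlgebra.induction with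
  | algebraMap r => simpa only [AlgHom.commutes] using const_mem_smoothFin _
  | ι u =>
    simp only [← genI_coe, ulMap_genI]
    exact smoothFin_linear genI (smoothFin_symMap hT _)
  | mul v w hv hw => simpa only [map_mul] using smoothFin_mul hv hw
  | add v w hv hw => simpa only [map_add] using smoothFin_add hv hw

theorem symMap_one_apply (u : Sym𝔤 L) : symMap (1 : End ℝ L) u = u := by
  have h : symMap (1 : End ℝ L) = AlgHom.id ℝ _ := by
    apply MvPolynomial.algHom_ext; intro a; simp [symMap, symι]
  rw [h, AlgHom.id_apply]

variable {y : X} {r : X →ₗ[ℝ] L} (hs : IsOpen s) (hy : y ∈ s)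
  (hT : T ∈ smoothFin (End ℝ L) s) (h1 : T y = 1) (hT' : HasD T y (lieAdLin L ∘ₗ r))
include hs hy hT h1 hT'

theorem exists_hasD_symMap (u : Sym𝔤 L) :
    ∃ D : X →ₗ[ℝ] Sym𝔤 L, HasD (fun z => symMap (T z) u) y D ∧ ∀ v, D v = symAd (r v) u := by
  induction u using MvPolynomial.induction_on with
  | C c =>
    refine ⟨0, ?_, fun v => ?_⟩
    · simpa only [symMap, MvPolynomial.algHom_C] using hasD_const _
    · rw [MvPolynomial.derivation_C, LinearMap.zero_apply]
  | add u v hu hv =>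
    obtain ⟨D, hD, hD'⟩ := hu
    obtain ⟨D₂, hD₂, hD₂'⟩ := hv
    refine ⟨D + D₂, ?_, fun v => ?_⟩
    · simpa only [map_add] using hD.add hD₂
    · rw [LinearMap.add_apply, hD', hD₂', map_add]
  | mul_X u a hu =>
    obtain ⟨D, hD, hD'⟩ := hu
    have hX : HasD (fun z => symMap (T z) (MvPolynomial.X a)) y
        ((symι ∘ₗ LinearMap.applyₗ (lieBasis L a)) ∘ₗ (lieAdLin L ∘ₗ r)) := by
      have := hT'.linear (symι ∘ₗ LinearMap.applyₗ (lieBasis L a))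
      simp only [symMap, MvPolynomial.aeval_X]
      exact this
    have hM := HasD.mul hs hy (smoothFin_symMap hT u) (smoothFin_symMap hT (MvPolynomial.X a)) hD hX
    simp only [map_mul]
    refine ⟨_, hM, fun v => ?_⟩
    · simp only [LinearMap.add_apply, comp_apply, mulRight_apply,
        mulLeft_apply, hD', h1, symMap_one_apply, Derivation.leibniz, smul_eq_mul]
      rw [add_comm, mul_comm (MvPolynomial.X a)]
      congr 2
      simp only [symAd, mkDerivation_X]
      rfl

theorem exists_hasD_ulMap (w : UL L) : ∃ D : X →ₗ[ℝ] UL L, HasD (fun z => ulMap (T z) w) y D ∧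
    ∀ v, ulToUD L (D v) = udL (r v) * ulToUD L w - ulToUD L w * udL (r v) := by
  induction w using TensorAlgebra.induction with
  | algebraMap c =>
    refine ⟨0, ?_, fun v => ?_⟩
    · simpa only [AlgHom.commutes] using hasD_const _
    · rw [LinearMap.zero_apply, map_zero, AlgHom.commutes, Algebra.commutes, sub_self]
  | ι u =>
    obtain ⟨D, hD, hD'⟩ := exists_hasD_symMap hs hy hT h1 hT' (u : Sym𝔤 L)
    refine ⟨genI ∘ₗ D, ?_, fun v => ?_⟩
    · simp only [← genI_coe, ulMap_genI]
      exact hD.linear genI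
    · rw [← genI_coe, comp_apply, hD', ulToUD_genI, ulToUD_genI, udL_udI]
  | mul v w hv hw =>
    obtain ⟨D, hD, hD'⟩ := hv
    obtain ⟨D₂, hD₂, hD₂'⟩ := hw
    have hM := HasD.mul hs hy (smoothFin_ulMap hT v) (smoothFin_ulMap hT w) hD hD₂
    simp only [map_mul]
    refine ⟨_, hM, fun x => ?_⟩
    · simp only [LinearMap.add_apply, comp_apply, mulRight_apply,
        mulLeft_apply, map_add, map_mul, hD', hD₂', h1, ulMap_one, AlgHom.id_apply]
      rw [sub_mul, mul_sub]
      simp only [mul_assoc]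
      abel
  | add v w hv hw =>
    obtain ⟨D, hD, hD'⟩ := hv
    obtain ⟨D₂, hD₂, hD₂'⟩ := hw
    refine ⟨D + D₂, ?_, fun x => ?_⟩
    · simpa only [map_add] using hD.add hD₂
    · simp only [LinearMap.add_apply, map_add, hD', hD₂']
      noncomm_ring

end Families

end GroupLikeExterior

/-! ### The action of a smooth family of endomorphisms -/
section FamilyAction
variable {B : Type*} [Ring B] [Algebra ℝ B] [SuperAlgebra B]
  {X : Type*} [NormedAddCommGroup X] [NormedSpace ℝ X] [FiniteDimensional ℝ X] {s : Set X}
  {T : X → End ℝ L}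

/-- The linear map `u ↦ b ⊗ u`. -/
def SuperTensor.mkLeft {A U : Type*} [Ring A] [Algebra ℝ A] [SuperAlgebra A]
    [Ring U] [Algebra ℝ U] [SuperAlgebra U] (b : A) : U →ₗ[ℝ] A ⊗ₛ U :=
  (GradedTensorProduct.of ℝ (part A) (part U)).toLinearMap ∘ₗ TensorProduct.mk ℝ A U b

theorem smoothFin_bMap_apply (hT : T ∈ smoothFin (End ℝ L) s) (z : B ⊗ₛ UL L) :
    (fun y => bMap B (T y) z) ∈ smoothFin (B ⊗ₛ UL L) s := by
  induction z using SuperTensor.induction with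
  | zero => simp only [map_zero]; exact const_mem_smoothFin _
  | add x y hx hy => simp only [map_add]; exact smoothFin_add hx hy
  | tmul b u =>
    simp only [bMap_tmul]
    exact smoothFin_linear (mkLeft b) (smoothFin_ulMap hT u)

theorem mem_smoothFin_of_contDiffOn_real {c : X → ℝ} (hc : ContDiffOn ℝ ∞ c s) :
    c ∈ smoothFin ℝ s := mem_smoothFin_of_contDiffOn' hc

theorem smoothFin_bMap (hT : T ∈ smoothFin (End ℝ L) s) {w : X → B ⊗ₛ UL L}
    (hw : w ∈ smoothFin (B ⊗ₛ UL L) s) :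
    (fun y => bMap B (T y) (w y)) ∈ smoothFin (B ⊗ₛ UL L) s := by
  induction hw using span_induction with
  | mem w h =>
    obtain ⟨c, u, hc, h⟩ := h
    refine smoothFin_congr (smoothFin_bilin (LinearMap.lsmul ℝ (B ⊗ₛ UL L))
      (mem_smoothFin_of_contDiffOn_real hc) (smoothFin_bMap_apply hT u)) fun y hy => ?_
    rw [h y hy, map_smul, LinearMap.lsmul_apply]
  | zero => simp only [Pi.zero_apply, map_zero]; exact const_mem_smoothFin _
  | add v w _ _ hv hw => simp only [Pi.add_apply, map_add]; exact smoothFin_add hv hw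
  | smul r w _ hw => simp only [Pi.smul_apply, map_smul]; exact smoothFin_const_smul r hw

/-- The commutator with `1 ⊗ l(x)`. -/
def udComm (x : L) (z : B ⊗ₛ UD L) : B ⊗ₛ UD L :=
  ((1 : B) ᵍ⊗ₜ udL x : B ⊗ₛ UD L) * z - z * ((1 : B) ᵍ⊗ₜ udL x : B ⊗ₛ UD L)

theorem udComm_add (x : L) (z w : B ⊗ₛ UD L) : udComm x (z + w) = udComm x z + udComm x w := by
  rw [udComm, udComm, udComm, mul_add, add_mul, add_sub_add_comm]

theorem udComm_smul (x : L) (r : ℝ) (z : B ⊗ₛ UD L) : udComm x (r • z) = r • udComm x z := by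
  rw [udComm, udComm, mul_smul_comm, smul_mul_assoc, smul_sub]

theorem udComm_tmul (x : L) (b : B) (u : UD L) : udComm x (b ᵍ⊗ₜ u : B ⊗ₛ UD L) =
    (b ᵍ⊗ₜ (udL x * u - u * udL x) : B ⊗ₛ UD L) := by
  rw [udComm, tmul_even_mul (parity_udL x), tmul_mul_one, one_mul]
  exact (map_sub (mkLeft b) _ _).symm

variable {y : X} {r : X →ₗ[ℝ] L}

theorem exists_hasD_bMap_apply (hs : IsOpen s) (hy : y ∈ s)
    (hT : T ∈ smoothFin (End ℝ L) s) (h1 : T y = 1) (hT' : HasD T y (lieAdLin L ∘ₗ r))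
    (w : B ⊗ₛ UL L) :
    ∃ D : X →ₗ[ℝ] B ⊗ₛ UL L, HasD (fun z => bMap B (T z) w) y D ∧
      ∀ v, toBUD L B (D v) = udComm (r v) (toBUD L B w) := by
  induction w using SuperTensor.induction with
  | zero =>
    simp only [map_zero]
    exact ⟨0, hasD_const _, fun v => by rw [udComm, mul_zero, zero_mul, sub_zero]; exact map_zero _⟩
  | add w w' hw hw' =>
    obtain ⟨D, hD, hD'⟩ := hw
    obtain ⟨D₂, hD₂, hD₂'⟩ := hw'
    simp only [map_add]
    exact ⟨D + D₂, hD.add hD₂, fun v => (map_add (toBUD L B) _ _).trans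
      ((congrArg₂ (· + ·) (hD' v) (hD₂' v)).trans (udComm_add _ _ _).symm)⟩
  | tmul b u =>
    obtain ⟨D, hD, hD'⟩ := exists_hasD_ulMap hs hy hT h1 hT' u
    simp only [bMap_tmul]
    refine ⟨mkLeft b ∘ₗ D, hD.linear (mkLeft b), fun v => ?_⟩
    rw [toBUD_tmul, udComm_tmul, ← hD']
    exact toBUD_tmul b (D v)

theorem exists_hasD_bMap (hs : IsOpen s) (hy : y ∈ s)
    (hT : T ∈ smoothFin (End ℝ L) s) (h1 : T y = 1) (hT' : HasD T y (lieAdLin L ∘ₗ r))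
    {w : X → B ⊗ₛ UL L} (hw : w ∈ smoothFin (B ⊗ₛ UL L) s) :
    ∃ w' D : X →ₗ[ℝ] B ⊗ₛ UL L, HasD w y w' ∧ HasD (fun z => bMap B (T z) (w z)) y D ∧
      ∀ v, toBUD L B (D v) = toBUD L B (w' v) + udComm (r v) (toBUD L B (w y)) := by
  induction hw using span_induction with
  | mem w h =>
    obtain ⟨c, u, hc, h⟩ := h
    obtain ⟨D, hD, hD'⟩ := exists_hasD_bMap_apply (B := B) hs hy hT h1 hT' u
    obtain ⟨c', hc'⟩ := exists_hasD hs hy (mem_smoothFin_of_contDiffOn_real hc)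
    have hnear : ∀ᶠ z in nhds y, z ∈ s := hs.mem_nhds hy
    have hb (f : X → B ⊗ₛ UL L) (f') (hf : f ∈ smoothFin _ s) (hf' : HasD f y f') :=
      HasD.bilin (LinearMap.lsmul ℝ (B ⊗ₛ UL L)) hs hy (mem_smoothFin_of_contDiffOn_real hc) hf
        hc' hf'
    refine ⟨_, _, (hb _ _ (const_mem_smoothFin u) (hasD_const u)).congr
      (hnear.mono fun z hz => h z hz), (hb _ _ (smoothFin_bMap_apply hT u) hD).congr
      (hnear.mono fun z hz => ?_), fun v => ?_⟩
    · dsimp only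
      rw [h z hz, map_smul, LinearMap.lsmul_apply]
    · simp only [LinearMap.add_apply, comp_apply, flip_apply,
        LinearMap.lsmul_apply, LinearMap.zero_apply, smul_zero, add_zero, h1, bMap_one,
        AlgHom.id_apply, h y hy]
      refine (map_add (toBUD L B) _ _).trans (congrArg₂ (· + ·) rfl ?_)
      refine (map_smul (toBUD L B) _ _).trans ((congrArg _ (hD' v)).trans ?_)
      exact (udComm_smul _ _ _).symm.trans (congrArg _ (map_smul (toBUD L B) _ _).symm)
  | zero =>
    refine ⟨0, 0, hasD_const _, ?_, fun v => ?_⟩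
    · simp only [Pi.zero_apply, map_zero]; exact hasD_const _
    · rw [LinearMap.zero_apply, Pi.zero_apply, map_zero, udComm, mul_zero, zero_mul, sub_zero,
        add_zero]
  | add v w _ _ hv hw =>
    obtain ⟨v', D, hv', hD, hD'⟩ := hv
    obtain ⟨w', D₂, hw', hD₂, hD₂'⟩ := hw
    refine ⟨v' + w', D + D₂, hv'.add hw', ?_, fun x => ?_⟩
    · simp only [Pi.add_apply, map_add]; exact hD.add hD₂
    · rw [LinearMap.add_apply, LinearMap.add_apply, Pi.add_apply, map_add, map_add, map_add,
        udComm_add, hD', hD₂']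
      abel
  | smul c w _ hw =>
    obtain ⟨w', D₂, hw', hD₂, hD₂'⟩ := hw
    refine ⟨c • w', c • D₂, hw'.const_smul c, ?_, fun x => ?_⟩
    · simp only [Pi.smul_apply, map_smul]; exact hD₂.const_smul c
    · rw [LinearMap.smul_apply, LinearMap.smul_apply, Pi.smul_apply, map_smul, map_smul, map_smul,
        udComm_smul, hD₂', smul_add]

end FamilyAction

/-! ### Algebra of the differential of a section -/
section SectionAlgebra

theorem bMap_eq_superMapLin {L B : Type*} [LieRing L] [LieAlgebra ℝ L] [Module.Finite ℝ L] [Ring B]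
    [Algebra ℝ B] [SuperAlgebra B] (φ : End ℝ L) (z : B ⊗ₛ UL L) :
    bMap B φ z = superMapLin LinearMap.id (ulMap φ).toLinearMap z :=
  superMap_eq_superMapLin _ _ _ _ z

theorem bMap_mem_degFiltration {L V : Type*} [LieRing L] [LieAlgebra ℝ L] [Module.Finite ℝ L]
    [AddCommGroup V] [Module ℝ V] (φ : End ℝ L) {k : ℕ} {x : ExteriorAlgebra ℝ V ⊗ₛ UL L}
    (hx : x ∈ degFiltration L V k) : bMap (ExteriorAlgebra ℝ V) φ x ∈ degFiltration L V k := by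
  have h := superMapLin_mem_degFiltration LinearMap.id (g := (ulMap φ).toLinearMap)
    (ulMap_mem_ULdeg φ) hx
  rw [ExteriorAlgebra.map_id] at h
  exact (bMap_eq_superMapLin φ x).symm ▸ h

/-- The form `∑ᵢ dxⁱ ⊗ l(r eᵢ)`. -/
def udForm (r : E →ₗ[ℝ] L) : ExtCot E ⊗ₛ UD L :=
  GradedTensorProduct.of ℝ (part (ExtCot E)) (part (UD L)) (oneFormElt (udL ∘ₗ r))

theorem udForm_eq (r : E →ₗ[ℝ] L) : udForm r =
    ∑ i, (ι ℝ ((finBasis ℝ E).coord i) ᵍ⊗ₜ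
      udL (r (finBasis ℝ E i)) : ExtCot E ⊗ₛ UD L) := by
  rw [udForm, oneFormElt, map_sum]; rfl

theorem udForm_add (r r' : E →ₗ[ℝ] L) : udForm (r + r') = udForm r + udForm r' := by
  simp only [udForm_eq, LinearMap.add_apply, map_add, tmul_add, sum_add_distrib]

theorem sum_ι_mul_udComm (r : E →ₗ[ℝ] L) {k : ExtCot E ⊗ₛ UD L}
    (hk : parity k = k) :
    ∑ i, (ι ℝ ((finBasis ℝ E).coord i) ᵍ⊗ₜ (1 : UD L) :
      ExtCot E ⊗ₛ UD L) * udComm (r (finBasis ℝ E i)) k =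
        udForm r * k - k * udForm r := by
  rw [udForm_eq, sum_mul, mul_sum, ← sum_sub_distrib]
  refine sum_congr rfl fun i _ => ?_
  have h := tmul_one_comm (B := UD L)
    (a := ι ℝ ((finBasis ℝ E).coord i)) (parity_ι _)
    (ι_superComm _) k
  have h2 : (ι ℝ ((finBasis ℝ E).coord i) ᵍ⊗ₜ (1 : UD L) :
      ExtCot E ⊗ₛ UD L) * ((1 : ExtCot E) ᵍ⊗ₜ udL (r (finBasis ℝ E i)) :
      ExtCot E ⊗ₛ UD L) = (ι ℝ ((finBasis ℝ E).coord i) ᵍ⊗ₜ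
        udL (r (finBasis ℝ E i)) : ExtCot E ⊗ₛ UD L) := by
    rw [tmul_one_mul, mul_one]
  rw [udComm, mul_sub, ← mul_assoc, ← mul_assoc, h, hk, h2, mul_assoc, h2]

theorem toBUD_dTens {L : Type*} [LieRing L] [LieAlgebra ℝ L] [Module.Finite ℝ L]
    (f' : E →ₗ[ℝ] ExtCot E ⊗ₛ UL L) : toBUD L (ExtCot E) (dTens f') =
      dTens ((toBUD L (ExtCot E)).toLinearMap ∘ₗ f') := by
  have h : (toBUD L (ExtCot E)).toLinearMap = superMapLin LinearMap.id (ulToUD L).toLinearMap :=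
    LinearMap.ext toBUD_eq_superMapLin
  rw [h, dTens_map, ← h]; rfl

theorem bMap_dTens {L : Type*} [LieRing L] [LieAlgebra ℝ L] [Module.Finite ℝ L]
    (φ : End ℝ L) (f' : E →ₗ[ℝ] ExtCot E ⊗ₛ UL L) : bMap (ExtCot E) φ (dTens f') =
      dTens ((bMap (ExtCot E) φ).toLinearMap ∘ₗ f') := by
  have h : (bMap (ExtCot E) φ).toLinearMap = superMapLin LinearMap.id (ulMap φ).toLinearMap :=
    LinearMap.ext (bMap_eq_superMapLin φ)
  rw [h, dTens_map, ← h]; rfl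

theorem parity_toBUD {L B : Type*} [LieRing L] [LieAlgebra ℝ L] [Module.Finite ℝ L] [Ring B]
    [Algebra ℝ B] [SuperAlgebra B] {z : B ⊗ₛ UL L} (hz : parity z = z) :
    parity (toBUD L B z) = toBUD L B z :=
  (parity_superMap _ _ _ _ z).symm.trans (congrArg (toBUD L B) hz)

theorem toBUD_dTens_add_dTensUL_mul {a b : ExtCot E ⊗ₛ UL L} (ha : parity a = a)
    (f' g' : E →ₗ[ℝ] ExtCot E ⊗ₛ UL L) :
    toBUD L (ExtCot E) (dTens (mulRight ℝ b ∘ₗ f' + mulLeft ℝ a ∘ₗ g')) +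
        dTensUL L (ExtCot E) (a * b) =
      (toBUD L (ExtCot E) (dTens f') + dTensUL L (ExtCot E) a) * toBUD L (ExtCot E) b +
        toBUD L (ExtCot E) a * (toBUD L (ExtCot E) (dTens g') + dTensUL L (ExtCot E) b) := by
  rw [dTens_add, dTens_mulRight, dTens_mulLeft _ ha, dTensUL_mul ha, map_add, map_mul, map_mul,
    add_mul, mul_add]
  abel

theorem bMapUD_udForm (φ : L →ₗ⁅ℝ⁆ L) (r : E →ₗ[ℝ] L) :
    bMapUD (ExtCot E) φ (udForm r) = udForm ((φ : L →ₗ[ℝ] L) ∘ₗ r) := by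
  rw [udForm_eq, udForm_eq, map_sum]
  refine sum_congr rfl fun i _ => ?_
  rw [bMapUD_tmul, udMap_udL]
  rfl

/-- The derivative of `Ad_g h` at a point where `g = 1`, in a form which also covers the
translates of `g`. -/
theorem toBUD_dTens_bMap {φ : L →ₗ⁅ℝ⁆ L} {r : E →ₗ[ℝ] L} {f' D : E →ₗ[ℝ] ExtCot E ⊗ₛ UL L}
    {a k : ExtCot E ⊗ₛ UL L} (hk : k = bMap (ExtCot E) (φ : L →ₗ[ℝ] L) a)
    (ha : parity k = k)
    (hD : ∀ v, toBUD L (ExtCot E) (D v) =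
      toBUD L (ExtCot E) (bMap (ExtCot E) (φ : L →ₗ[ℝ] L) (f' v)) +
        udComm (r v) (toBUD L (ExtCot E) k)) :
    toBUD L (ExtCot E) (dTens D) + dTensUL L (ExtCot E) k =
      bMapUD (ExtCot E) φ (toBUD L (ExtCot E) (dTens f') + dTensUL L (ExtCot E) a) +
      (udForm r * toBUD L (ExtCot E) k - toBUD L (ExtCot E) k * udForm r) := by
  rw [← sum_ι_mul_udComm _ (parity_toBUD ha), toBUD_dTens, dTens]
  simp only [comp_apply, AlgHom.toLinearMap_apply, hD, mul_add, sum_add_distrib]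
  have h1 : ∑ i, (ι ℝ ((finBasis ℝ E).coord i) ᵍ⊗ₜ (1 : UD L) :
      ExtCot E ⊗ₛ UD L) * toBUD L (ExtCot E) (bMap (ExtCot E) (φ : L →ₗ[ℝ] L)
        (f' (finBasis ℝ E i))) =
      bMapUD (ExtCot E) φ (toBUD L (ExtCot E) (dTens f')) := by
    rw [← toBUD_bMap, bMap_dTens, toBUD_dTens]
    rfl
  rw [h1, map_add, hk, dTensUL_bMap]
  abel

end SectionAlgebra

/-! ### The groups `H(M) ⋊ G(M)` and `DG(M)` -/
section Groups

/-- The automorphism `Ad_g` of the Lie algebra of `G`. -/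
def AdLie (g : G) : LieAlg F G →ₗ⁅ℝ⁆ LieAlg F G :=
  { AdLin (F := F) g with map_lie' := AdLin_lie g _ _ }

theorem fibDegZero_eq : fibDegZero E F G = degFiltration (LieAlg F G) (Dual ℝ E) 0 := by
  simp only [fibDegZero, degFiltration, zero_add]

theorem IsH.mem {h : UnitSections E M F G} (hh : IsH h) (x : M) :
    (h x : Fib E F G) ∈ degFiltration (LieAlg F G) (Dual ℝ E) 0 :=
  fibDegZero_eq (E := E) (F := F) (G := G) ▸ hh.degree_zero x

theorem IsH.parity {h : UnitSections E M F G} (hh : IsH h) (x : M) :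
    SuperAlgebra.parity (h x : Fib E F G) = h x := parity_of_mem_degFiltration (hh.mem x)

theorem chartSec_mem {h : M → Fib E F G}
    (hh : ∀ x, h x ∈ degFiltration (LieAlg F G) (Dual ℝ E) 0) (x₀ : M) (y : E) :
    chartSec h x₀ y ∈ degFiltration (LieAlg F G) (Dual ℝ E) 0 :=
  superMapLin_mem_degFiltration _ (fun _ _ hu => hu) (hh _)

theorem IsH.isSmoothSec {h : UnitSections E M F G} (hh : IsH h) :
    IsSmoothSec fun x => (h x : Fib E F G) :=
  haveI : Module.Finite ℝ (degFiltration (LieAlg F G) (Dual ℝ E) 0) :=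
    Module.Finite.iff_fg.2 fg_degFiltration_zero
  isSmoothSec_of_isSmoothForm (degFiltration (LieAlg F G) (Dual ℝ E) 0)
    (chartSec_mem hh.mem) hh.smooth

theorem isH_of {h : UnitSections E M F G} (h1 : IsSmoothSec fun x => (h x : Fib E F G))
    (h2 : ∀ x, (h x : Fib E F G) ∈ degFiltration (LieAlg F G) (Dual ℝ E) 0)
    (h3 : ∀ x, IsGroupLike (h x : Fib E F G)) : IsH h :=
  ⟨h1.isSmoothForm, fun x => (fibDegZero_eq (E := E) (F := F) (G := G)).symm ▸ h2 x, h3⟩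

theorem isH_one : IsH (1 : UnitSections E M F G) :=
  isH_of isSmoothSec_one (fun _ => one_mem_degFiltration) fun _ => isGroupLike_one

theorem IsH.mul {h k : UnitSections E M F G} (hh : IsH h) (hk : IsH k) : IsH (h * k) :=
  isH_of (hh.isSmoothSec.mul hk.isSmoothSec)
    (fun x => mul_mem_degFiltration (j := 0) (k := 0) (hh.mem x) (hk.mem x))
    fun x => IsGroupLike.mul (hh.groupLike x) (hk.groupLike x) (hh.mem x) (hk.mem x)

theorem isUnit_chartSec (h : UnitSections E M F G) (x₀ : M) (y : E) :
    chartSec (fun x => (h x : Fib E F G)) x₀ y *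
      chartSec (fun x => (((h x)⁻¹ : (Fib E F G)ˣ) : Fib E F G)) x₀ y = 1 ∧
    chartSec (fun x => (((h x)⁻¹ : (Fib E F G)ˣ) : Fib E F G)) x₀ y *
      chartSec (fun x => (h x : Fib E F G)) x₀ y = 1 :=
  ⟨(chartSec_mul _ _ x₀ y).symm.trans ((congrArg (chartSec · x₀ y)
      (funext fun x => (h x).mul_inv)).trans (chartSec_one x₀ y)),
    (chartSec_mul _ _ x₀ y).symm.trans ((congrArg (chartSec · x₀ y)
      (funext fun x => (h x).inv_mul)).trans (chartSec_one x₀ y))⟩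

/-- The inverse is smooth, since it is a finite geometric series. -/
theorem IsH.isSmoothSec_inv {h : UnitSections E M F G} (hh : IsH h) :
    IsSmoothSec fun x => (((h x)⁻¹ : (Fib E F G)ˣ) : Fib E F G) := by
  intro x₀
  set s := (extChartAt 𝓘(ℝ, E) x₀).target
  have hsm := hh.isSmoothSec x₀
  have hunit (y : E) : IsUnit (chartSec (fun x => (h x : Fib E F G)) x₀ y) :=
    ⟨⟨_, _, (isUnit_chartSec h x₀ y).1, (isUnit_chartSec h x₀ y).2⟩, rfl⟩
  have hne (y : E) := augm_ne_zero (chartSec_mem hh.mem x₀ y) (hunit y)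
  have hc : ContDiffOn ℝ ∞ (fun y => (augm (LieAlg F G) (Dual ℝ E)
      (chartSec (fun x => (h x : Fib E F G)) x₀ y))⁻¹) s :=
    (contDiffOn_of_mem_smoothFin hsm _).inv fun y _ => hne y
  have hc' := mem_smoothFin_of_contDiffOn_real hc
  have h1 := smoothFin_sub (const_mem_smoothFin (s := s) (1 : Fib E F G))
    (smoothFin_bilin (LinearMap.lsmul ℝ (Fib E F G)) hc' hsm)
  have h2 := smoothFin_bilin (LinearMap.lsmul ℝ (Fib E F G)) hc' (smoothFin_sum
    (range (finrank ℝ (Dual ℝ E) + 1)) fun k _ => smoothFin_pow h1 k)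
  refine smoothFin_congr h2 fun y _ => ?_
  have h3 := inv_eq_geom_series (hunit y).unit (chartSec_mem hh.mem x₀ y)
  exact (eq_of_mul_eq_one (isUnit_chartSec h x₀ y).2 (hunit y).mul_val_inv).trans h3

theorem IsH.inv {h : UnitSections E M F G} (hh : IsH h) : IsH h⁻¹ :=
  isH_of hh.isSmoothSec_inv (fun x => inv_mem_degFiltration (h x) (hh.mem x)) fun x =>
    IsGroupLike.of_mul_eq_one (hh.groupLike x) (hh.mem x) (inv_mem_degFiltration (h x) (hh.mem x))
      (h x).mul_inv (h x).inv_mul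

theorem chartSec_bMap (g : MapGroup E M F G) (h : M → Fib E F G) (x₀ : M) (y : E) :
    chartSec (fun x => bMap (ExtCot E) (AdLin (F := F) (g x)) (h x)) x₀ y =
      bMap (ExtCot E) (AdLin (F := F) (g ((extChartAt 𝓘(ℝ, E) x₀).symm y))) (chartSec h x₀ y) := by
  rw [chartSec, chartSec, bMap_eq_superMapLin, bMap_eq_superMapLin, superMapLin_comp_apply,
    superMapLin_comp_apply]
  rfl

end Groups

section Groups

theorem isSmoothSec_bMap {h : M → Fib E F G} (hh : IsSmoothSec h) (g : MapGroup E M F G) :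
    IsSmoothSec fun x => bMap (ExtCot E) (AdLin (F := F) (g x)) (h x) := fun x₀ => by
  have h1 := AdLin_mem_smoothFin (F := F) (isOpen_extChartAt_target x₀)
    (contMDiffOn_comp_chart g x₀)
  have h2 := smoothFin_bMap (B := ExtCot E) h1 (hh x₀)
  exact smoothFin_congr h2 fun y _ => chartSec_bMap g h x₀ y

theorem IsH.sectionAd {h : UnitSections E M F G} (hh : IsH h) (g : MapGroup E M F G) :
    IsH (sectionAd g h) := by
  have h1 : IsSmoothSec fun x => (_root_.sectionAd g h x : Fib E F G) :=
    isSmoothSec_bMap hh.isSmoothSec g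
  have h2 (x) : (_root_.sectionAd g h x : Fib E F G) ∈
      degFiltration (LieAlg F G) (Dual ℝ E) 0 :=
    bMap_mem_degFiltration (AdLin (F := F) (g x)) (hh.mem x)
  have h3 (x) : IsGroupLike (_root_.sectionAd g h x : Fib E F G) :=
    IsGroupLike.bMap (hh.groupLike x) (AdLin (F := F) (g x))
  exact isH_of h1 h2 h3

variable (E M F G) in
/-- The group `H(M) ⋊ G(M)`. -/
def SGbarGroup : Subgroup (Ambient E M F G) where
  carrier := SGbar E M F G
  one_mem' := isH_one
  mul_mem' {p q} hp hq := IsH.mul hp (IsH.sectionAd hq p.right)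
  inv_mem' {p} hp := IsH.sectionAd (IsH.inv hp) p.right⁻¹

/-! ### The differential of sections -/

theorem sectionD_eq {h : UnitSections E M F G} {x : M} {f' : E →ₗ[ℝ] Fib E F G}
    (hf : HasD (chartSec (fun x => (h x : Fib E F G)) x) (extChartAt 𝓘(ℝ, E) x x) f') :
    sectionD h x = toBUD (LieAlg F G) (ExtCot E) (dTens f') +
      dTensUL (LieAlg F G) (ExtCot E) (h x) := by
  rw [toBUD_eq_superMapLin]
  exact congrArg (· + dTensUL (LieAlg F G) (ExtCot E) (h x : Fib E F G))
    (congrArg (superMapLin LinearMap.id (ulToUD (LieAlg F G)).toLinearMap) (extD_eq_dTens hf))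

theorem sectionD_mul {h k : UnitSections E M F G} (hh : IsH h) (hk : IsH k) (x : M) :
    sectionD (h * k) x = sectionD h x * toBUD (LieAlg F G) (ExtCot E) (k x) +
      toBUD (LieAlg F G) (ExtCot E) (h x) * sectionD k x := by
  obtain ⟨f', hf⟩ := hh.isSmoothSec.exists_hasD x
  obtain ⟨g', hg⟩ := hk.isSmoothSec.exists_hasD x
  have h1 := sectionD_eq (h := h * k) (hasD_chartSec_mul hh.isSmoothSec hk.isSmoothSec hf hg)
  rw [h1, sectionD_eq hf, sectionD_eq hg]
  exact toBUD_dTens_add_dTensUL_mul (hh.parity x) f' g'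

set_option maxHeartbeats 800000 in
/-- The differential of `Ad_g h`. -/
theorem sectionD_sectionAd {h : UnitSections E M F G} (hh : IsH h) (g : MapGroup E M F G) (x : M) :
    sectionD (sectionAd g h) x = bMapUD (ExtCot E) (AdLie (F := F) (g x)) (sectionD h x) +
      (udForm (rightMC g x) * toBUD (LieAlg F G) (ExtCot E) (sectionAd g h x) -
        toBUD (LieAlg F G) (ExtCot E) (sectionAd g h x) * udForm (rightMC g x)) := by
  set φ := extChartAt 𝓘(ℝ, E) x
  let T (z : E) : End ℝ (LieAlg F G) := AdLin (F := F) (g (φ.symm z) * (g x)⁻¹)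
  have hgx : ContMDiffOn 𝓘(ℝ, E) 𝓘(ℝ, F) ∞ (fun z => g (φ.symm z) * (g x)⁻¹) φ.target :=
    (contMDiffOn_comp_chart g x).mul contMDiffOn_const
  have hT : T ∈ smoothFin _ φ.target := AdLin_mem_smoothFin (F := F) (isOpen_extChartAt_target x) hgx
  have h1 : T (φ x) = 1 := by
    change AdLin (F := F) (g (φ.symm (φ x)) * (g x)⁻¹) = 1
    rw [extChartAt_to_inv, mul_inv_cancel, AdLin_one]
  have hw := smoothFin_linear (bMap (ExtCot E) (AdLin (F := F) (g x))).toLinearMap (hh.isSmoothSec x)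
  obtain ⟨w', D, hw', hD, hD'⟩ := exists_hasD_bMap (isOpen_extChartAt_target x)
    (mem_extChartAt_target x) hT h1 (hasD_AdLin_right g x) hw
  obtain ⟨f', hf⟩ := hh.isSmoothSec.exists_hasD x
  obtain rfl := hw'.unique (hf.linear (bMap (ExtCot E) (AdLin (F := F) (g x))).toLinearMap)
  have hAd : HasD (chartSec (fun x => (sectionAd g h x : Fib E F G)) x) (φ x) D := by
    refine hD.congr (Filter.Eventually.of_forall fun z => ?_)
    refine (chartSec_bMap g (fun x => (h x : Fib E F G)) x z).trans ?_
    have h2 : AdLin (F := F) (g (φ.symm z)) = T z * AdLin (F := F) (g x) := by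
      rw [← AdLin_mul, inv_mul_cancel_right]
    rw [h2, bMap_mul]
    rfl
  have hx : chartSec (fun x => (h x : Fib E F G)) x (φ x) = h x := chartSec_self _ x
  have hk : (sectionAd g h x : Fib E F G) = bMap (ExtCot E) (AdLin (F := F) (g x)) (h x) := rfl
  rw [sectionD_eq hAd, sectionD_eq hf]
  refine toBUD_dTens_bMap (φ := AdLie (F := F) (g x)) hk ((hh.sectionAd g).parity x) fun v => ?_
  refine (hD' v).trans (congrArg₂ (· + ·) rfl ?_)
  rw [hk, ← hx]
  rfl

theorem algHom_add_mul {R : Type*} [Ring R] [Algebra ℝ R] (f : R →ₐ[ℝ] R) {d a r b : R}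
    (h : f a = b) : f (d + a * r) = f d + b * f r := by
  rw [map_add, map_mul, h]

theorem mul_add_mul_algHom_eq_zero {R : Type*} [Ring R] [Algebra ℝ R] (f : R →ₐ[ℝ] R) {a k j b : R}
    (ha : a = 0) (hb : b = 0) : a * k + j * f b = 0 := by
  rw [ha, hb, map_zero, mul_zero, zero_mul, add_zero]

theorem eq_zero_of_mul_add_mul_algHom {R : Type*} [Ring R] [Algebra ℝ R] (f : R →ₐ[ℝ] R)
    {a k j b c : R} (h : a * k + j * f b = 0) (hb : b = 0) (hk : k * c = 1) : a = 0 := by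
  rw [hb, map_zero, mul_zero, add_zero] at h
  rw [← mul_one a, ← hk, ← mul_assoc, h, zero_mul]

theorem mul_defect {R : Type*} [Ring R] {d d₁ d' s j k jk r r' u b : R} (h1 : d = d₁ * k + j * s)
    (h2 : jk = j * k) (h4 : u = r + r') (h5 : b = d' + k * r') (h6 : s = d' + (r * k - k * r)) :
    d + jk * u = (d₁ + j * r) * k + j * b := by
  rw [h1, h2, h4, h5, h6]
  noncomm_ring

/-- The element `dh + h (dg g⁻¹)`, which vanishes if and only if `(h, g)` is closed. -/
def closedDefect (p : Ambient E M F G) (x : M) : ExtCot E ⊗ₛ UD (LieAlg F G) :=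
  sectionD p.left x + toBUD (LieAlg F G) (ExtCot E) (p.left x) * udForm (rightMC p.right x)

theorem unit_inv_mul_add_eq_zero_iff {R : Type*} [Ring R] {a b d r : R} (h : a * b = 1)
    (h' : b * a = 1) : b * d + r = 0 ↔ d + a * r = 0 := by
  constructor
  · intro e
    have := congrArg (a * ·) e
    simpa only [mul_add, ← mul_assoc, h, one_mul, mul_zero] using this
  · intro e
    have := congrArg (b * ·) e
    simpa only [mul_add, ← mul_assoc, h', one_mul, mul_zero] using this

theorem toBUD_mul_inv {L B : Type*} [LieRing L] [LieAlgebra ℝ L] [Module.Finite ℝ L] [Ring B]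
    [Algebra ℝ B] [SuperAlgebra B] {a b : B ⊗ₛ UL L} (h : a * b = 1) :
    toBUD L B a * toBUD L B b = 1 :=
  (map_mul (toBUD L B) a b).symm.trans ((congrArg _ h).trans (map_one _))

theorem mem_DGset_iff {p : Ambient E M F G} :
    p ∈ DGset E M F G ↔ p ∈ SGbar E M F G ∧ ∀ x, closedDefect p x = 0 :=
  and_congr Iff.rfl (forall_congr' fun x => unit_inv_mul_add_eq_zero_iff
    (toBUD_mul_inv (p.left x).mul_inv) (toBUD_mul_inv (p.left x).inv_mul))

theorem closedDefect_mul {p q : Ambient E M F G} (hp : p ∈ SGbar E M F G)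
    (hq : q ∈ SGbar E M F G) (x : M) :
    closedDefect (p * q) x = closedDefect p x *
        toBUD (LieAlg F G) (ExtCot E) (sectionAd p.right q.left x) +
      toBUD (LieAlg F G) (ExtCot E) (p.left x) *
        bMapUD (ExtCot E) (AdLie (F := F) (p.right x)) (closedDefect q x) := by
  have h1 : sectionD (p * q).left x = _ := sectionD_mul hp (IsH.sectionAd hq p.right) x
  have h2 : toBUD (LieAlg F G) (ExtCot E) ((p * q).left x : Fib E F G) =
      toBUD (LieAlg F G) (ExtCot E) (p.left x) *
        toBUD (LieAlg F G) (ExtCot E) (sectionAd p.right q.left x) :=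
    map_mul (toBUD (LieAlg F G) (ExtCot E)) _ _
  have h3 : bMapUD (ExtCot E) (AdLie (F := F) (p.right x)) (toBUD (LieAlg F G) (ExtCot E) (q.left x)) =
      toBUD (LieAlg F G) (ExtCot E) (sectionAd p.right q.left x) := (toBUD_bMap _ _).symm
  have h4 : udForm (rightMC (p * q).right x) = udForm (rightMC p.right x) +
      bMapUD (ExtCot E) (AdLie (F := F) (p.right x)) (udForm (rightMC q.right x)) := by
    rw [bMapUD_udForm, ← udForm_add]
    exact congrArg udForm (rightMC_mul _ _ _)
  have h5 : bMapUD (ExtCot E) (AdLie (F := F) (p.right x)) (closedDefect q x) =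
      bMapUD (ExtCot E) (AdLie (F := F) (p.right x)) (sectionD q.left x) +
      toBUD (LieAlg F G) (ExtCot E) (sectionAd p.right q.left x) *
        bMapUD (ExtCot E) (AdLie (F := F) (p.right x)) (udForm (rightMC q.right x)) :=
    algHom_add_mul _ h3
  have h6 := sectionD_sectionAd hq p.right x
  rw [closedDefect, closedDefect]
  exact mul_defect h1 h2 h4 h5 h6

theorem closedDefect_one (x : M) : closedDefect (1 : Ambient E M F G) x = 0 := by
  have h1 : HasD (chartSec (fun x => ((1 : UnitSections E M F G) x : Fib E F G)) x)
      (extChartAt 𝓘(ℝ, E) x x) 0 :=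
    (hasD_const 1).congr (Filter.Eventually.of_forall fun y => chartSec_one x y)
  have h2 : dTens (0 : E →ₗ[ℝ] Fib E F G) = 0 := by
    simp only [dTens, LinearMap.zero_apply, mul_zero, sum_const_zero]
  have h3 : udForm (0 : E →ₗ[ℝ] LieAlg F G) = 0 := by
    have h := udForm_add (0 : E →ₗ[ℝ] LieAlg F G) 0
    rw [add_zero] at h
    exact left_eq_add.1 h
  have h4 := sectionD_eq (h := (1 : UnitSections E M F G)) h1
  have h5 : dTensUL (LieAlg F G) (ExtCot E) ((1 : UnitSections E M F G) x : Fib E F G) = 0 :=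
    dTensUL_one
  rw [closedDefect, SemidirectProduct.one_left, SemidirectProduct.one_right, h4, rightMC_one, h3,
    h2, h5, map_zero, mul_zero, add_zero, add_zero]

variable (E M F G) in
/-- The group `DG(M)`. -/
def DGGroup : Subgroup (Ambient E M F G) where
  carrier := DGset E M F G
  one_mem' := mem_DGset_iff.2 ⟨isH_one, closedDefect_one⟩
  mul_mem' {p q} hp hq := by
    rw [mem_DGset_iff] at *
    refine ⟨(SGbarGroup E M F G).mul_mem hp.1 hq.1, fun x => ?_⟩
    exact (closedDefect_mul hp.1 hq.1 x).trans
      (mul_add_mul_algHom_eq_zero _ (hp.2 x) (hq.2 x))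
  inv_mem' {p} hp := by
    rw [mem_DGset_iff] at *
    have hp' : p⁻¹ ∈ SGbar E M F G := (SGbarGroup E M F G).inv_mem hp.1
    refine ⟨hp', fun x => ?_⟩
    have h := (closedDefect_mul hp' hp.1 x).symm
    have h1 : closedDefect (p⁻¹ * p) x = 0 := by
      rw [inv_mul_cancel]; exact closedDefect_one x
    exact eq_zero_of_mul_add_mul_algHom _ (h.trans h1) (hp.2 x)
      (toBUD_mul_inv (sectionAd (p⁻¹).right p.left x).mul_inv)

end Groups

/-! ### One-forms and two-forms at a point -/
section PointForms
variable {V : Type*} [AddCommGroup V] [Module ℝ V]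

variable (E) in
/-- The coordinate form `dxⁱ`. -/
def extdx (i : Fin (finrank ℝ E)) : ExtCot E :=
  ι ℝ ((finBasis ℝ E).coord i)

theorem dual_eq_sum (α : Dual ℝ E) :
    α = ∑ j, α (finBasis ℝ E j) • (finBasis ℝ E).coord j :=
  (finBasis ℝ E).ext fun i => by
    simp [Finsupp.single_apply]

theorem ι_eq_sum (α : Dual ℝ E) :
    ι ℝ α = ∑ j, α (finBasis ℝ E j) • extdx E j := by
  conv_lhs => rw [dual_eq_sum α]
  simp only [map_sum, map_smul, extdx]

variable (E V) in
/-- `oneFormElt` as a linear map. -/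
def oneFormLin : (E →ₗ[ℝ] V) →ₗ[ℝ] ExtCot E ⊗[ℝ] V where
  toFun := oneFormElt
  map_add' B C := by
    simp only [oneFormElt, LinearMap.add_apply, TensorProduct.tmul_add, sum_add_distrib]
  map_smul' r B := by
    simp only [oneFormElt, LinearMap.smul_apply, TensorProduct.tmul_smul, smul_sum,
      RingHom.id_apply]

theorem map_oneFormElt (B : E →ₗ[ℝ] V) (f : E →ₗ[ℝ] E) :
    (ExteriorAlgebra.map f.dualMap).toLinearMap.rTensor V (oneFormElt B) =
      oneFormElt (B ∘ₗ f) := by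
  have h (j) : B (f (finBasis ℝ E j)) =
      ∑ i, (finBasis ℝ E).coord i (f (finBasis ℝ E j)) •
        B (finBasis ℝ E i) := by
    conv_lhs => rw [← (finBasis ℝ E).sum_repr (f (finBasis ℝ E j)), map_sum]
    simp only [map_smul, Module.Basis.coord_apply]
  simp only [oneFormElt, map_sum, LinearMap.rTensor_tmul, AlgHom.toLinearMap_apply,
    map_apply_ι, comp_apply, h, TensorProduct.tmul_sum]
  rw [sum_comm]
  refine sum_congr rfl fun i _ => ?_
  rw [ι_eq_sum, TensorProduct.sum_tmul]
  exact sum_congr rfl fun j _ => TensorProduct.smul_tmul _ _ _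

variable (E V) in
/-- The projection to the one-forms with values in `V`. -/
def oneFormInv : ExtCot E ⊗[ℝ] V →ₗ[ℝ] (E →ₗ[ℝ] V) :=
  dualTensorHom ℝ E V ∘ₗ ExteriorAlgebra.ιInv.rTensor V

theorem oneFormInv_oneFormElt (B : E →ₗ[ℝ] V) : oneFormInv E V (oneFormElt B) = B := by
  have h (α : Dual ℝ E) : ExteriorAlgebra.ιInv (ι ℝ α) = α :=
    ExteriorAlgebra.ι_leftInverse α
  refine (finBasis ℝ E).ext fun j => ?_
  simp [oneFormInv, oneFormElt, h, Finsupp.single_apply]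

variable (E) in
/-- The two-form `∑ β(eᵢ, eⱼ) dxⁱ dxʲ`. -/
def twoForm : (E →ₗ[ℝ] E →ₗ[ℝ] ℝ) →ₗ[ℝ] ExtCot E where
  toFun β := ∑ i, ∑ j, β (finBasis ℝ E i) (finBasis ℝ E j) • (extdx E i * extdx E j)
  map_add' β γ := by simp only [LinearMap.add_apply, add_smul, sum_add_distrib]
  map_smul' r β := by
    simp only [LinearMap.smul_apply, smul_assoc, smul_sum, RingHom.id_apply]

theorem twoForm_apply (β : E →ₗ[ℝ] E →ₗ[ℝ] ℝ) : twoForm E β =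
    ∑ i, ∑ j, β (finBasis ℝ E i) (finBasis ℝ E j) • (extdx E i * extdx E j) := rfl

theorem extdx_mul (i j) : extdx E i * extdx E j = -(extdx E j * extdx E i) :=
  eq_neg_of_add_eq_zero_left (ExteriorAlgebra.ι_add_mul_swap _ _)

theorem twoForm_flip (β : E →ₗ[ℝ] E →ₗ[ℝ] ℝ) : twoForm E β.flip = -twoForm E β := by
  rw [twoForm_apply, twoForm_apply, sum_comm, ← sum_neg_distrib]
  refine sum_congr rfl fun i _ => ?_
  rw [← sum_neg_distrib]
  refine sum_congr rfl fun j _ => ?_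
  rw [flip_apply, extdx_mul, smul_neg]

/-- A two-form only depends on the antisymmetric part of the bilinear form. -/
theorem twoForm_congr {β γ : E →ₗ[ℝ] E →ₗ[ℝ] ℝ} (h : ∀ u v, β u v - β v u = γ u v - γ v u) :
    twoForm E β = twoForm E γ := by
  have h1 : β + γ.flip = γ + β.flip := LinearMap.ext₂ fun u v => by
    have := h u v
    simp only [LinearMap.add_apply, flip_apply]
    linarith
  have h2 := congrArg (twoForm E) h1
  rw [map_add, map_add, twoForm_flip, twoForm_flip, ← sub_eq_add_neg, ← sub_eq_add_neg,
    sub_eq_sub_iff_add_eq_add, ← two_smul ℝ, ← two_smul ℝ] at h2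
  exact smul_right_injective _ (two_ne_zero (α := ℝ)) h2

theorem ι_mul_ι_eq_twoForm (α β : Dual ℝ E) : ι ℝ α * ι ℝ β =
    twoForm E ((LinearMap.mul ℝ ℝ).compl₁₂ α β) := by
  rw [ι_eq_sum α, ι_eq_sum β, twoForm_apply, Finset.sum_mul_sum]
  refine sum_congr rfl fun i _ => sum_congr rfl fun j _ => ?_
  rw [smul_mul_smul_comm]
  rfl

theorem map_twoForm (β : E →ₗ[ℝ] E →ₗ[ℝ] ℝ) (f : E →ₗ[ℝ] E) :
    ExteriorAlgebra.map f.dualMap (twoForm E β) = twoForm E (β.compl₁₂ f f) := by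
  have h (u v : E) : β u v = ∑ i, ∑ j, β (finBasis ℝ E i) (finBasis ℝ E j) *
      ((finBasis ℝ E).coord i u * (finBasis ℝ E).coord j v) := by
    conv_lhs => rw [← (finBasis ℝ E).sum_repr u, ← (finBasis ℝ E).sum_repr v]
    simp only [map_sum, map_smul, LinearMap.sum_apply, LinearMap.smul_apply, smul_eq_mul,
      Module.Basis.coord_apply]
    simp only [mul_sum]
    rw [sum_comm]
    refine sum_congr rfl fun i _ => sum_congr rfl fun j _ => ?_
    ring
  have h2 : β.compl₁₂ f f = ∑ i, ∑ j, β (finBasis ℝ E i) (finBasis ℝ E j) •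
      (LinearMap.mul ℝ ℝ).compl₁₂ (f.dualMap ((finBasis ℝ E).coord i))
        (f.dualMap ((finBasis ℝ E).coord j)) := by
    refine LinearMap.ext₂ fun u v => ?_
    rw [compl₁₂_apply, h]
    simp only [LinearMap.sum_apply, LinearMap.smul_apply, compl₁₂_apply, smul_eq_mul]
    rfl
  rw [h2, twoForm_apply]
  simp only [map_sum, map_smul, map_mul, extdx, map_apply_ι,
    ← ι_mul_ι_eq_twoForm]

theorem sum_extdx_mul_ι (γ : E →ₗ[ℝ] Dual ℝ E) :
    ∑ i, extdx E i * ι ℝ (γ (finBasis ℝ E i)) = twoForm E γ := by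
  simp only [ι_eq_sum (γ _), mul_sum, mul_smul_comm]
  rfl

theorem sum_extdx_mul_twoForm {γ : E →ₗ[ℝ] E →ₗ[ℝ] E →ₗ[ℝ] ℝ} (h : ∀ u v, γ u v = γ v u) :
    ∑ k, extdx E k * twoForm E (γ (finBasis ℝ E k)) = 0 := by
  have key : ∑ k, extdx E k * twoForm E (γ (finBasis ℝ E k)) =
      -∑ k, extdx E k * twoForm E (γ (finBasis ℝ E k)) := by
    simp only [twoForm_apply, mul_sum]
    conv_lhs => rw [sum_comm]
    rw [← sum_neg_distrib]
    refine sum_congr rfl fun i _ => ?_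
    rw [← sum_neg_distrib]
    refine sum_congr rfl fun k _ => ?_
    rw [← sum_neg_distrib]
    refine sum_congr rfl fun j _ => ?_
    rw [mul_smul_comm, mul_smul_comm, h, ← mul_assoc, ← mul_assoc, extdx_mul k i, neg_mul, smul_neg]
  have h2 := add_eq_zero_iff_eq_neg.2 key
  rw [← two_smul ℝ] at h2
  exact (smul_eq_zero.1 h2).resolve_left two_ne_zero

theorem twoForm_mem (β : E →ₗ[ℝ] E →ₗ[ℝ] ℝ) : twoForm E β ∈ ⋀[ℝ]^2 (Dual ℝ E) := by
  rw [twoForm_apply, exteriorPower, pow_two]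
  exact Submodule.sum_mem _ fun i _ => Submodule.sum_mem _ fun j _ =>
    smul_mem _ _ (Submodule.mul_mem_mul ⟨_, rfl⟩ ⟨_, rfl⟩)

theorem parity_twoForm (β : E →ₗ[ℝ] E →ₗ[ℝ] ℝ) : parity (twoForm E β) = twoForm E β := by
  have h := parity_of_mem (twoForm_mem β)
  rwa [even_two.neg_one_pow, one_smul] at h

end PointForms

/-! ### First and second derivatives -/
section Derivatives
variable {E E' : Type*} [NormedAddCommGroup E] [NormedSpace ℝ E] [FiniteDimensional ℝ E]
  [NormedAddCommGroup E'] [NormedSpace ℝ E'] [FiniteDimensional ℝ E']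
  {U : Type*} [AddCommGroup U] [Module ℝ U] {s : Set E}

theorem smoothFin_comp {f : E' → U} {t : Set E'} (hf : f ∈ smoothFin U t) {τ : E → E'}
    (hτ : ContDiffOn ℝ ∞ τ s) (hst : Set.MapsTo τ s t) : (fun z => f (τ z)) ∈ smoothFin U s := by
  induction hf using span_induction with
  | mem f h =>
    obtain ⟨c, u, hc, h⟩ := h
    exact subset_span ⟨fun z => c (τ z), u, hc.comp hτ hst, fun z hz => h _ (hst hz)⟩
  | zero => exact const_mem_smoothFin 0
  | add f g _ _ hf hg => exact smoothFin_add hf hg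
  | smul r f _ hf => exact smoothFin_const_smul r hf

theorem HasD.comp {f : E' → U} {τ : E → E'} {y : E} {f' : E' →ₗ[ℝ] U} {τ' : E →L[ℝ] E'}
    (hf : HasD f (τ y) f') (hτ : HasFDerivAt τ τ' y) :
    HasD (fun z => f (τ z)) y (f' ∘ₗ τ'.toLinearMap) := fun l =>
  (HasFDerivAt.comp y (hf l) hτ).congr_fderiv (by ext v; simp)

/-- A smooth function has a smooth derivative, whose derivative is symmetric. -/
theorem exists_smooth_deriv (hs : IsOpen s) {f : E → U} (hf : f ∈ smoothFin U s) :
    ∃ f' ∈ smoothFin (E →ₗ[ℝ] U) s, (∀ y ∈ s, HasD f y (f' y)) ∧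
      ∀ y ∈ s, ∃ f'' : E →ₗ[ℝ] E →ₗ[ℝ] U, HasD f' y f'' ∧ ∀ u v, f'' u v = f'' v u := by
  induction hf using span_induction with
  | mem f h =>
    obtain ⟨c, u, hc, h⟩ := h
    let S : (E →L[ℝ] ℝ) →ₗ[ℝ] (E →ₗ[ℝ] U) :=
      { toFun := fun Q => Q.toLinearMap.smulRight u
        map_add' := fun Q Q' => by ext v; simp [add_smul]
        map_smul' := fun r Q => by ext v; simp [mul_smul] }
    have hd : ContDiffOn ℝ ∞ (fderiv ℝ c) s := hc.fderiv_of_isOpen hs (by simp)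
    refine ⟨fun z => S (fderiv ℝ c z), smoothFin_linear S (mem_smoothFin_of_contDiffOn' hd),
      fun y hy => ?_, fun y hy => ?_⟩
    · have h1 := ((hc.contDiffAt (hs.mem_nhds hy)).differentiableAt (by simp)).hasFDerivAt
      exact (hasD_smul h1 u).congr (Filter.Eventually.mono (hs.mem_nhds hy) h)
    · have h1 := ((hd.contDiffAt (hs.mem_nhds hy)).differentiableAt (by simp)).hasFDerivAt
      refine ⟨_, h1.hasD.linear S, fun v w => ?_⟩
      have h2 : IsSymmSndFDerivAt ℝ c y := (hc.contDiffAt (hs.mem_nhds hy)).isSymmSndFDerivAt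
        (by rw [minSmoothness_of_isRCLikeNormedField]; exact WithTop.coe_le_coe.2 le_top)
      exact congrArg (· • u) (h2 v w)
  | zero =>
    exact ⟨0, const_mem_smoothFin 0, fun y _ => hasD_const 0, fun y _ => ⟨0, hasD_const 0,
      fun _ _ => rfl⟩⟩
  | add f g _ _ hf hg =>
    obtain ⟨f', hf1, hf2, hf3⟩ := hf
    obtain ⟨g', hg1, hg2, hg3⟩ := hg
    refine ⟨f' + g', smoothFin_add hf1 hg1, fun y hy => (hf2 y hy).add (hg2 y hy), fun y hy => ?_⟩
    obtain ⟨f'', h1, h2⟩ := hf3 y hy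
    obtain ⟨g'', h3, h4⟩ := hg3 y hy
    exact ⟨f'' + g'', h1.add h3, fun u v => by simp only [LinearMap.add_apply, h2 u v, h4 u v]⟩
  | smul r f _ hf =>
    obtain ⟨f', hf1, hf2, hf3⟩ := hf
    refine ⟨r • f', smoothFin_const_smul r hf1, fun y hy => (hf2 y hy).const_smul r, fun y hy => ?_⟩
    obtain ⟨f'', h1, h2⟩ := hf3 y hy
    exact ⟨r • f'', h1.const_smul r, fun u v => by simp only [LinearMap.smul_apply, h2 u v]⟩

end Derivatives

/-! ### One-forms and their curvature in charts -/
section ChartForms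
variable {V : Type*} [AddCommGroup V] [Module ℝ V]

/-- A one-form in the preferred chart at `x₀`. -/
def chartOne (A : M → E →ₗ[ℝ] V) (x₀ : M) (y : E) : E →ₗ[ℝ] V :=
  A ((extChartAt 𝓘(ℝ, E) x₀).symm y) ∘ₗ chartInvDeriv x₀ y

theorem chartOne_self (A : M → E →ₗ[ℝ] V) (x : M) :
    chartOne A x (extChartAt 𝓘(ℝ, E) x x) = A x := by
  rw [chartOne, chartInvDeriv_self, extChartAt_to_inv, LinearMap.comp_id]

theorem chartForm_oneFormElt (A : M → E →ₗ[ℝ] V) (x₀ : M) (y : E) :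
    chartForm (fun x => oneFormElt (A x)) x₀ y = oneFormElt (chartOne A x₀ y) :=
  map_oneFormElt _ _

theorem isSmoothForm_oneFormElt_iff [Module.Finite ℝ V] {A : M → E →ₗ[ℝ] V} :
    IsSmoothForm (fun x => oneFormElt (A x)) ↔
      ∀ x₀ : M, chartOne A x₀ ∈ smoothFin (E →ₗ[ℝ] V) (extChartAt 𝓘(ℝ, E) x₀).target := by
  refine ⟨fun h x₀ => mem_smoothFin_of_contDiffOn ⊤ (fun _ _ => trivial) fun l =>
    (h x₀ (l ∘ₗ oneFormInv E V)).congr fun y _ => ?_, fun h x₀ c =>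
    (contDiffOn_of_mem_smoothFin (h x₀) (c ∘ₗ oneFormLin E V)).congr fun y _ => ?_⟩
  · rw [chartForm_oneFormElt, comp_apply, oneFormInv_oneFormElt]
  · rw [chartForm_oneFormElt]; rfl

/-- The derivatives of the inverse charts are related by the transition map. -/
theorem chartInvDeriv_transition (x₀ x : M) {z : E} (hz : z ∈ (extChartAt 𝓘(ℝ, E) x₀).target)
    (hx : (extChartAt 𝓘(ℝ, E) x₀).symm z ∈ (extChartAt 𝓘(ℝ, E) x).source) :
    chartInvDeriv x₀ z =
      chartInvDeriv x (extChartAt 𝓘(ℝ, E) x ((extChartAt 𝓘(ℝ, E) x₀).symm z)) ∘ₗ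
        (fderiv ℝ (fun z => extChartAt 𝓘(ℝ, E) x ((extChartAt 𝓘(ℝ, E) x₀).symm z)) z :
          E →L[ℝ] E).toLinearMap := by
  set τ : E → E := fun z => extChartAt 𝓘(ℝ, E) x ((extChartAt 𝓘(ℝ, E) x₀).symm z)
  have hc := contMDiffAt_chart_symm x₀ hz
  have hτ : ContMDiffAt 𝓘(ℝ, E) 𝓘(ℝ, E) ∞ τ z :=
    ContMDiffAt.comp z (contMDiffAt_extChartAt' (by rwa [extChartAt_source] at hx)) hc
  have h1 := contMDiffAt_chart_symm x ((extChartAt 𝓘(ℝ, E) x).map_source hx)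
  have h2 := mfderiv_comp z (h1.mdifferentiableAt (by simp)) (hτ.mdifferentiableAt (by simp))
  have h3 : (extChartAt 𝓘(ℝ, E) x).symm ∘ τ =ᶠ[nhds z] (extChartAt 𝓘(ℝ, E) x₀).symm := by
    have h4 := hc.continuousAt.eventually ((isOpen_extChartAt_source (I := 𝓘(ℝ, E)) x).mem_nhds hx)
    exact h4.mono fun w hw => (extChartAt 𝓘(ℝ, E) x).left_inv hw
  rw [h3.mfderiv_eq, mfderiv_eq_fderiv] at h2
  exact congrArg ContinuousLinearMap.toLinearMap h2

theorem contDiffOn_transition (x₀ x : M) :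
    ContDiffOn ℝ ∞ (fun z => extChartAt 𝓘(ℝ, E) x ((extChartAt 𝓘(ℝ, E) x₀).symm z))
      ((extChartAt 𝓘(ℝ, E) x₀).target ∩
        (extChartAt 𝓘(ℝ, E) x₀).symm ⁻¹' (extChartAt 𝓘(ℝ, E) x).source) := by
  refine contMDiffOn_iff_contDiffOn.1 fun z hz => ContMDiffAt.contMDiffWithinAt ?_
  exact ContMDiffAt.comp z (contMDiffAt_extChartAt' (by
    have := hz.2; rwa [Set.mem_preimage, extChartAt_source] at this))
    (contMDiffAt_chart_symm x₀ hz.1)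

/-- Change of charts for the derivative of a one-form, up to a symmetric term. -/
theorem hasD_chartOne_transition {A : M → E →ₗ[ℝ] V}
    (hA : ∀ x₀ : M, chartOne A x₀ ∈ smoothFin (E →ₗ[ℝ] V) (extChartAt 𝓘(ℝ, E) x₀).target)
    (x₀ : M) {y : E} (hy : y ∈ (extChartAt 𝓘(ℝ, E) x₀).target) {x : M}
    (hx : (extChartAt 𝓘(ℝ, E) x₀).symm y = x) {B₀ B : E →ₗ[ℝ] E →ₗ[ℝ] V}
    (h₀ : HasD (chartOne A x₀) y B₀)
    (h : HasD (chartOne A x) (extChartAt 𝓘(ℝ, E) x x) B) (u v : E) :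
    B₀ u v - B₀ v u = B (chartInvDeriv x₀ y u) (chartInvDeriv x₀ y v) -
      B (chartInvDeriv x₀ y v) (chartInvDeriv x₀ y u) := by
  set s := (extChartAt 𝓘(ℝ, E) x₀).target ∩
    (extChartAt 𝓘(ℝ, E) x₀).symm ⁻¹' (extChartAt 𝓘(ℝ, E) x).source with hs_def
  set τ : E → E := fun z => extChartAt 𝓘(ℝ, E) x ((extChartAt 𝓘(ℝ, E) x₀).symm z)
  have hτ : ContDiffOn ℝ ∞ τ s := contDiffOn_transition x₀ x
  have hs : IsOpen s := (continuousOn_extChartAt_symm x₀).isOpen_inter_preimage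
    (isOpen_extChartAt_target x₀) (isOpen_extChartAt_source x)
  have hys : y ∈ s := ⟨hy, by rw [Set.mem_preimage, hx]; exact mem_extChartAt_source x⟩
  have hτy : τ y = extChartAt 𝓘(ℝ, E) x x := by simp only [τ, hx]
  have hmaps : Set.MapsTo τ s (extChartAt 𝓘(ℝ, E) x).target := fun z hz =>
    (extChartAt 𝓘(ℝ, E) x).map_source hz.2
  have hd : ContDiffOn ℝ ∞ (fderiv ℝ τ) s := hτ.fderiv_of_isOpen hs (by simp)
  let C : (E →L[ℝ] E) →ₗ[ℝ] (E →ₗ[ℝ] E) :=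
    { toFun := fun Q => Q.toLinearMap, map_add' := fun _ _ => rfl, map_smul' := fun _ _ => rfl }
  have hτ1 := ((hτ.contDiffAt (hs.mem_nhds hys)).differentiableAt (by simp)).hasFDerivAt
  have hτ2 := ((hd.contDiffAt (hs.mem_nhds hys)).differentiableAt (by simp)).hasFDerivAt
  have hsymm : IsSymmSndFDerivAt ℝ τ y := (hτ.contDiffAt (hs.mem_nhds hys)).isSymmSndFDerivAt
    (by rw [minSmoothness_of_isRCLikeNormedField]; exact WithTop.coe_le_coe.2 le_top)
  rw [← hτy] at h
  have h1 := HasD.bilin (llcomp ℝ E E V) hs hys (smoothFin_comp (hA x) hτ hmaps)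
    (smoothFin_linear C (mem_smoothFin_of_contDiffOn' hd)) (h.comp hτ1) (hτ2.hasD.linear C)
  have h2 : chartOne A x₀ =ᶠ[nhds y] fun z =>
      llcomp ℝ E E V (chartOne A x (τ z)) (C (fderiv ℝ τ z)) := by
    filter_upwards [hs.mem_nhds hys] with z hz
    refine LinearMap.ext fun w => ?_
    rw [chartOne, chartInvDeriv_transition x₀ x hz.1 hz.2, LinearMap.llcomp_apply, chartOne,
      (extChartAt 𝓘(ℝ, E) x).left_inv hz.2]
    rfl
  obtain rfl := h₀.unique (h1.congr h2)
  have h3 : chartInvDeriv x₀ y = (fderiv ℝ τ y).toLinearMap :=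
    congrArg ContinuousLinearMap.toLinearMap (mfderiv_chart_symm x₀ hy hx)
  have h4 (u v : E) : C (fderiv ℝ (fderiv ℝ τ) y u) v = fderiv ℝ (fderiv ℝ τ) y u v := rfl
  simp only [LinearMap.add_apply, comp_apply, flip_apply,
    LinearMap.llcomp_apply, h3, ContinuousLinearMap.coe_coe, h4, hsymm u v]
  simp only [C, LinearMap.coe_mk, AddHom.coe_mk, ContinuousLinearMap.coe_coe]
  abel

end ChartForms

/-! ### The curvature of a connection -/
section CurvatureAlgebra

/-- The bilinear form `B' + 1/2 [B, B]`, whose antisymmetrization is the curvature of the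
connection form `B` with derivative `B'`. -/
def curvForm (B' : E →ₗ[ℝ] E →ₗ[ℝ] L) (B : E →ₗ[ℝ] L) : E →ₗ[ℝ] E →ₗ[ℝ] L :=
  B' + (2⁻¹ : ℝ) • (lieAdLin L).compl₁₂ B B

theorem curvForm_sub_swap (B' : E →ₗ[ℝ] E →ₗ[ℝ] L) (B : E →ₗ[ℝ] L) (u v : E) :
    curvForm B' B u v - curvForm B' B v u = B' u v - B' v u + ⁅B u, B v⁆ := by
  simp only [curvForm, LinearMap.add_apply, LinearMap.smul_apply, compl₁₂_apply,
    lieAdLin_apply]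
  rw [← lie_skew (B u) (B v)]
  generalize ⁅B v, B u⁆ = w
  module

/-- The component of index `a` of the two-form with values in `𝔤` given by a bilinear form. -/
def curvElt (γ : E →ₗ[ℝ] E →ₗ[ℝ] L) (a : Idx L) : ExtCot E :=
  twoForm E (γ.compr₂ ((lieBasis L).coord a))

theorem curvElt_congr {γ γ' : E →ₗ[ℝ] E →ₗ[ℝ] L} (h : ∀ u v, γ u v - γ v u = γ' u v - γ' v u)
    (a : Idx L) : curvElt γ a = curvElt γ' a :=
  twoForm_congr fun u v => by
    simp only [compr₂_apply, ← map_sub, h u v]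

theorem coord_lie (a : Idx L) (u v : L) : (lieBasis L).coord a ⁅u, v⁆ =
    ∑ b, ∑ c, structConst L a b c * ((lieBasis L).coord b u * (lieBasis L).coord c v) := by
  conv_lhs => rw [← (lieBasis L).sum_repr u, ← (lieBasis L).sum_repr v, sum_lie]
  simp only [lie_sum, smul_lie, lie_smul, map_sum, map_smul, smul_eq_mul, structConst,
    Module.Basis.coord_apply]
  refine sum_congr rfl fun b _ => sum_congr rfl fun c _ => ?_
  ring

theorem half_sum_ι_mul_ι (B : E →ₗ[ℝ] L) (a : Idx L) :
    ∑ b, ∑ c, structConst L a b c • (ι ℝ ((lieBasis L).coord b ∘ₗ B) *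
      ι ℝ ((lieBasis L).coord c ∘ₗ B)) = curvElt ((lieAdLin L).compl₁₂ B B) a := by
  simp only [ι_mul_ι_eq_twoForm, ← map_smul, ← map_sum]
  refine congrArg _ (LinearMap.ext₂ fun u v => ?_)
  simp only [LinearMap.sum_apply, LinearMap.smul_apply, compl₁₂_apply, smul_eq_mul,
    comp_apply, LinearMap.mul_apply', compr₂_apply, lieAdLin_apply, coord_lie]

theorem curvElt_curvForm (B' : E →ₗ[ℝ] E →ₗ[ℝ] L) (B : E →ₗ[ℝ] L) (a : Idx L) :
    curvElt (curvForm B' B) a = curvElt B' a +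
      (2⁻¹ : ℝ) • ∑ b, ∑ c, structConst L a b c •
        (ι ℝ ((lieBasis L).coord b ∘ₗ B) *
          ι ℝ ((lieBasis L).coord c ∘ₗ B)) := by
  rw [half_sum_ι_mul_ι, curvElt, curvElt, curvElt, ← map_smul, ← map_add]
  refine congrArg _ (LinearMap.ext₂ fun u v => ?_)
  simp only [curvForm, compr₂_apply, LinearMap.add_apply, LinearMap.smul_apply, map_add,
    map_smul]

/-- The behaviour of the curvature under gauge transformations `C = a B + L`, where `L` satisfies
the Maurer-Cartan equation. -/
theorem curvElt_gauge (φ : L →ₗ⁅ℝ⁆ L) {B C Q : E →ₗ[ℝ] L} {B' C' : E →ₗ[ℝ] E →ₗ[ℝ] L}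
    (hC : ∀ u, C u = φ (B u) + Q u)
    (hC' : ∀ u v, C' u v - C' v u = φ (B' u v) - φ (B' v u) - ⁅Q u, φ (B v)⁆ + ⁅Q v, φ (B u)⁆ -
      ⁅Q u, Q v⁆) (a : Idx L) :
    curvElt (curvForm C' C) a = ∑ c, (lieBasis L).coord a (φ (lieBasis L c)) •
      curvElt (curvForm B' B) c := by
  have h1 : curvElt (curvForm C' C) a =
      curvElt ((curvForm B' B).compr₂ (φ : L →ₗ[ℝ] L)) a := by
    refine curvElt_congr (fun u v => ?_) a
    have h2 : φ (curvForm B' B u v) - φ (curvForm B' B v u) =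
        φ (B' u v) - φ (B' v u) + ⁅φ (B u), φ (B v)⁆ := by
      rw [← map_sub, curvForm_sub_swap, map_add, map_sub, LieHom.map_lie]
    rw [curvForm_sub_swap, hC', hC, hC]
    refine Eq.trans ?_ h2.symm
    simp only [add_lie, lie_add]
    rw [← lie_skew (Q v) (φ (B u))]
    abel
  rw [h1]
  simp only [curvElt, ← map_smul, ← map_sum]
  refine congrArg _ (LinearMap.ext₂ fun u v => ?_)
  simp only [compr₂_apply, LinearMap.sum_apply, LinearMap.smul_apply, smul_eq_mul]
  conv_lhs => rw [← (lieBasis L).sum_repr (curvForm B' B u v), map_sum, map_sum]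
  refine sum_congr rfl fun c _ => ?_
  rw [map_smul, map_smul, smul_eq_mul, mul_comm]
  rfl

end CurvatureAlgebra

section CurvatureCharts

theorem extD_oneFormElt {A : M → E →ₗ[ℝ] L} {x : M} {B' : E →ₗ[ℝ] E →ₗ[ℝ] L}
    (h : HasD (chartOne A x) (extChartAt 𝓘(ℝ, E) x x) B') (a : Idx L) :
    TensorProduct.rid ℝ (ExtCot E) (((lieBasis L).coord a).lTensor (ExtCot E)
      (extD (fun y => oneFormElt (A y)) x)) = curvElt B' a := by
  have h1 (v : E) : dirDeriv (chartForm (fun y => oneFormElt (A y)) x) (extChartAt 𝓘(ℝ, E) x x) v =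
      oneFormElt (B' v) :=
    HasD.dirDeriv_eq ((h.linear (oneFormLin E L)).congr
      (Filter.Eventually.of_forall fun y => chartForm_oneFormElt A x y)) v
  simp only [extD, h1]
  simp only [oneFormElt, map_sum, LinearMap.rTensor_tmul, LinearMap.lTensor_tmul,
    TensorProduct.rid_tmul, mulLeft_apply]
  rfl

theorem chartPull_curvElt {A : M → E →ₗ[ℝ] L}
    (hA : ∀ x₀ : M, chartOne A x₀ ∈ smoothFin (E →ₗ[ℝ] L) (extChartAt 𝓘(ℝ, E) x₀).target)
    (x₀ : M) {y : E} (hy : y ∈ (extChartAt 𝓘(ℝ, E) x₀).target) {x : M}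
    (hx : (extChartAt 𝓘(ℝ, E) x₀).symm y = x) {B₀ B : E →ₗ[ℝ] E →ₗ[ℝ] L}
    (h₀ : HasD (chartOne A x₀) y B₀)
    (h : HasD (chartOne A x) (extChartAt 𝓘(ℝ, E) x x) B) (a : Idx L) :
    chartPull x₀ y (curvElt (curvForm B (A x)) a) =
      curvElt (curvForm B₀ (chartOne A x₀ y)) a := by
  refine (map_twoForm _ _).trans (curvElt_congr
    (γ := (curvForm B (A x)).compl₁₂ (chartInvDeriv x₀ y) (chartInvDeriv x₀ y)) (fun u v => ?_) a)
  rw [compl₁₂_apply, compl₁₂_apply, curvForm_sub_swap, curvForm_sub_swap,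
    hasD_chartOne_transition hA x₀ hy hx h₀ h, chartOne, hx]
  rfl

end CurvatureCharts

/-! ### Gauge transformations -/
section Gauge
variable {A : OneForms E M F G}

theorem IsConnection.smoothFin (hA : IsConnection A) (x₀ : M) :
    chartOne A x₀ ∈ _root_.smoothFin (E →ₗ[ℝ] LieAlg F G) (extChartAt 𝓘(ℝ, E) x₀).target :=
  isSmoothForm_oneFormElt_iff.1 hA x₀

theorem isConnection_zero : IsConnection (0 : OneForms E M F G) :=
  isSmoothForm_oneFormElt_iff.2 fun _ =>
    smoothFin_congr (const_mem_smoothFin 0) fun _ _ => LinearMap.zero_comp _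

theorem gaugeTransform_one (A : OneForms E M F G) : gaugeTransform A 1 = A := by
  funext x
  rw [gaugeTransform, leftMC_one, ContMDiffMap.coe_one, Pi.one_apply, inv_one, AdLin_one, add_zero]
  rfl

theorem gaugeTransform_mul (A : OneForms E M F G) (g h : MapGroup E M F G) :
    gaugeTransform A (g * h) = gaugeTransform (gaugeTransform A g) h := by
  funext x
  rw [gaugeTransform, leftMC_mul, ContMDiffMap.coe_mul, Pi.mul_apply, mul_inv_rev, AdLin_mul]
  refine LinearMap.ext fun v => ?_
  have h1 := map_add (AdLin (F := F) (h x)⁻¹) (AdLin (F := F) (g x)⁻¹ (A x v)) (leftMC g x v)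
  exact (add_assoc _ _ _).symm.trans (congrArg (· + leftMC h x v) h1.symm)

theorem chartOne_gaugeTransform (A : OneForms E M F G) (g : MapGroup E M F G) (x₀ : M) {y : E}
    (hy : y ∈ (extChartAt 𝓘(ℝ, E) x₀).target) :
    chartOne (gaugeTransform A g) x₀ y =
      AdLin (F := F) (g⁻¹ ((extChartAt 𝓘(ℝ, E) x₀).symm y)) ∘ₗ chartOne A x₀ y +
        toLieHom E F G (leftLog (fun z => g ((extChartAt 𝓘(ℝ, E) x₀).symm z)) y) := by
  have h := leftMC_comp_chartInvDeriv g x₀ hy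
  exact congrArg (AdLin (F := F) (g ((extChartAt 𝓘(ℝ, E) x₀).symm y))⁻¹ ∘ₗ chartOne A x₀ y + ·) h

theorem IsConnection.gaugeTransform (hA : IsConnection A) (g : MapGroup E M F G) :
    IsConnection (gaugeTransform A g) := by
  refine isSmoothForm_oneFormElt_iff.2 fun x₀ => ?_
  have h1 := AdLin_mem_smoothFin (F := F) (isOpen_extChartAt_target x₀)
    (contMDiffOn_comp_chart g⁻¹ x₀)
  have h2 := smoothFin_bilin (llcomp ℝ E (LieAlg F G) (LieAlg F G)) h1 (hA.smoothFin x₀)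
  have h3 := leftLog_mem_smoothFin (F := F) (isOpen_extChartAt_target x₀)
    (contMDiffOn_comp_chart g x₀)
  exact smoothFin_congr (smoothFin_add h2 h3) fun y hy => chartOne_gaugeTransform A g x₀ hy

theorem rightMC_inv (g : MapGroup E M F G) (x : M) : rightMC g⁻¹ x = -leftMC g x := by
  have h1 := rightMC_mul g⁻¹ g x
  rw [inv_mul_cancel, rightMC_one, rightMC_eq_AdLin g] at h1
  have h2 : AdLin (F := F) (g⁻¹ x) ∘ₗ (AdLin (F := F) (g x) ∘ₗ leftMC g x) = leftMC g x :=
    LinearMap.ext fun v => AdLin_inv_apply (g x) (leftMC g x v)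
  rw [h2] at h1
  exact eq_neg_of_add_eq_zero_left h1.symm

/-- The derivative of the gauge transform in a chart. -/
theorem hasD_gaugeTransform (hA : IsConnection A) (g : MapGroup E M F G) (x : M)
    {B' : E →ₗ[ℝ] E →ₗ[ℝ] LieAlg F G}
    (h : HasD (chartOne A x) (extChartAt 𝓘(ℝ, E) x x) B') :
    ∃ C' : E →ₗ[ℝ] E →ₗ[ℝ] LieAlg F G,
      HasD (chartOne (_root_.gaugeTransform A g) x) (extChartAt 𝓘(ℝ, E) x x) C' ∧
      ∀ u v, C' u v - C' v u = AdLie (F := F) (g x)⁻¹ (B' u v) - AdLie (F := F) (g x)⁻¹ (B' v u) -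
        ⁅leftMC g x u, AdLie (F := F) (g x)⁻¹ (A x v)⁆ +
        ⁅leftMC g x v, AdLie (F := F) (g x)⁻¹ (A x u)⁆ - ⁅leftMC g x u, leftMC g x v⁆ := by
  set φ := extChartAt 𝓘(ℝ, E) x with hφ
  have ho : IsOpen φ.target := isOpen_extChartAt_target x
  have hy : φ x ∈ φ.target := mem_extChartAt_target x
  have hT1 := AdLin_mem_smoothFin (F := F) ho (contMDiffOn_comp_chart g⁻¹ x)
  have hT2 := (hasD_AdLin_right g⁻¹ x).linear
    (mulRight ℝ (AdLin (F := F) (g x)⁻¹ : End ℝ (LieAlg F G)))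
  have hT3 : HasD (fun z => AdLin (F := F) (g⁻¹ (φ.symm z))) (φ x) (mulRight ℝ
      (AdLin (F := F) (g x)⁻¹ : End ℝ (LieAlg F G)) ∘ₗ
        (lieAdLin (LieAlg F G) ∘ₗ rightMC g⁻¹ x)) := by
    refine hT2.congr (Filter.Eventually.of_forall fun z => ?_)
    refine Eq.trans ?_ (AdLin_mul (F := F) (g⁻¹ (φ.symm z) * (g⁻¹ x)⁻¹) (g x)⁻¹)
    have h5 : (g⁻¹ x)⁻¹ * (g x)⁻¹ = 1 := by
      change ((g x)⁻¹)⁻¹ * (g x)⁻¹ = 1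
      rw [inv_inv, mul_inv_cancel]
    rw [mul_assoc, h5, mul_one]
  have h1 := HasD.bilin (llcomp ℝ E (LieAlg F G) (LieAlg F G)) ho hy hT1
    (hA.smoothFin x) hT3 h
  have hγ := contMDiffOn_comp_chart g x
  have hL := ((contDiffAt_leftLog (contMDiffAt_comp_chart g x hy)).differentiableAt
    (by simp)).hasFDerivAt
  refine ⟨_, (h1.add (hL.hasD.linear (toLieHom E F G))).congr
    (Filter.Eventually.mono (ho.mem_nhds hy) fun z hz => chartOne_gaugeTransform A g x hz),
    fun u v => ?_⟩
  have hMC : toLieHom E F G (fderiv ℝ (leftLog (F := F) fun z => g (φ.symm z)) (φ x) u) v -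
      toLieHom E F G (fderiv ℝ (leftLog (F := F) fun z => g (φ.symm z)) (φ x) v) u =
      -⁅leftMC g x u, leftMC g x v⁆ := by
    rw [leftMC_eq]
    exact leftLog_maurerCartan ho hy hγ hL u v
  have hself : chartOne A x (φ x) = A x := chartOne_self A x
  have hg : g⁻¹ ((extChartAt 𝓘(ℝ, E) x).symm (φ x)) = (g x)⁻¹ := by
    rw [hφ, extChartAt_to_inv]; rfl
  have hb (u v : E) : llcomp ℝ E (LieAlg F G) (LieAlg F G)
      ((mulRight ℝ (AdLin (F := F) (g x)⁻¹ : End ℝ (LieAlg F G)))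
        (lieAdLin (LieAlg F G) (rightMC g⁻¹ x u))) (A x) v =
      -⁅leftMC g x u, AdLie (F := F) (g x)⁻¹ (A x v)⁆ := by
    rw [rightMC_inv]
    exact neg_lie (leftMC g x u) (AdLie (F := F) (g x)⁻¹ (A x v))
  simp only [LinearMap.add_apply, comp_apply, flip_apply, hself, hb, hg]
  have hc (u v : E) : llcomp ℝ E (LieAlg F G) (LieAlg F G)
      (AdLin (F := F) (g x)⁻¹) (B' u) v = AdLie (F := F) (g x)⁻¹ (B' u v) := rfl
  rw [hc, hc, add_sub_add_comm]
  refine (congrArg _ hMC).trans ?_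
  abel

theorem curvComp_eq {x : M} {B' : E →ₗ[ℝ] E →ₗ[ℝ] LieAlg F G}
    (h : HasD (chartOne A x) (extChartAt 𝓘(ℝ, E) x x) B') (a : Idx (LieAlg F G)) :
    curvComp A x a = curvElt (curvForm B' (A x)) a := by
  rw [curvElt_curvForm, ← extD_oneFormElt h]
  rfl

/-- The curvature of the gauge transform. -/
theorem curvComp_gaugeTransform (hA : IsConnection A) (g : MapGroup E M F G) (x : M)
    (a : Idx (LieAlg F G)) :
    curvComp (gaugeTransform A g) x a = ∑ c, (lieBasis (LieAlg F G)).coord a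
      (AdLie (F := F) (g x)⁻¹ (lieBasis (LieAlg F G) c)) • curvComp A x c := by
  obtain ⟨B', hB⟩ := exists_hasD (isOpen_extChartAt_target x) (mem_extChartAt_target x)
    (hA.smoothFin x)
  obtain ⟨C', hC, hC'⟩ := hasD_gaugeTransform hA g x hB
  rw [curvComp_eq hC, curvElt_gauge (AdLie (F := F) (g x)⁻¹) (fun _ => rfl) hC']
  exact sum_congr rfl fun c _ => by rw [curvComp_eq hB]

end Gauge

/-! ### The Weil homomorphism -/
section WeilEvaluation

theorem ExteriorAlgebra.map_mem_exteriorPower {V W : Type*} [AddCommGroup V] [Module ℝ V]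
    [AddCommGroup W] [Module ℝ W] (f : V →ₗ[ℝ] W) {n : ℕ} {w : ExteriorAlgebra ℝ V}
    (hw : w ∈ ⋀[ℝ]^n V) : ExteriorAlgebra.map f w ∈ ⋀[ℝ]^n W := by
  rw [exteriorPower] at hw ⊢
  have := Submodule.mem_map_of_mem (f := (ExteriorAlgebra.map f).toLinearMap) hw
  rw [Submodule.map_pow] at this
  refine pow_le_pow_left' (?_ : _ ≤ LinearMap.range (ι ℝ)) _ this
  rintro _ ⟨_, ⟨v, rfl⟩, rfl⟩
  exact ⟨f v, (map_apply_ι f v).symm⟩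

/-- The linear map on the Weil algebra given by `θ^a ↦ α^a`, `t^a ↦ f a`. It is an algebra
homomorphism if the elements `f a` are even. -/
def weilEval (α : E →ₗ[ℝ] L) (f : Idx L → ExtCot E) : Weil L →ₗ[ℝ] ExtCot E :=
  LinearMap.mul' ℝ (ExtCot E) ∘ₗ TensorProduct.map
    ((basisMonomials (Idx L) ℝ).constr ℝ fun m =>
      (List.ofFn fun a => f a ^ m a).prod)
    (ExteriorAlgebra.map α.dualMap).toLinearMap

theorem weilEval_tmul (α : E →ₗ[ℝ] L) (f : Idx L → ExtCot E) (p : SymDual L)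
    (w : ExteriorAlgebra ℝ (Dual ℝ L)) : weilEval α f (p ⊗ₜ[ℝ] w) =
      (basisMonomials (Idx L) ℝ).constr ℝ (fun m =>
        (List.ofFn fun a => f a ^ m a).prod) p * ExteriorAlgebra.map α.dualMap w := rfl

section
variable (α : E →ₗ[ℝ] L) {f : Idx L → ExtCot E} (hf : ∀ a, parity (f a) = f a)

/-- The homomorphism on `S𝔤*` given by `t^a ↦ f a`; the values are central. -/
def symEvalHom : SymDual L →ₐ[ℝ] ExtCot E :=
  (Subalgebra.center ℝ (ExtCot E)).val.comp (aeval fun a =>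
    (⟨f a, Subalgebra.mem_center_iff.2 fun z =>
      (even_central (hf a) z).symm⟩ : Subalgebra.center ℝ (ExtCot E)))

theorem symEvalHom_X (a : Idx L) : symEvalHom hf (MvPolynomial.X a) = f a := by
  rw [symEvalHom, AlgHom.comp_apply, MvPolynomial.aeval_X]; rfl

theorem constr_eq_symEvalHom (p : SymDual L) : (basisMonomials (Idx L) ℝ).constr ℝ
    (fun m => (List.ofFn fun a => f a ^ m a).prod) p = symEvalHom hf p := by
  refine DFunLike.congr_fun (g := (symEvalHom hf).toLinearMap)
    ((basisMonomials (Idx L) ℝ).ext fun m => ?_) p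
  rw [Module.Basis.constr_basis, MvPolynomial.coe_basisMonomials, AlgHom.toLinearMap_apply,
    symEvalHom, AlgHom.comp_apply, MvPolynomial.aeval_monomial, map_one, one_mul,
    Finsupp.prod_fintype _ _ (fun _ => pow_zero _), ← List.prod_ofFn, map_list_prod,
    List.map_ofFn]
  congr 2

/-- The homomorphism on the Weil algebra given by `θ^a ↦ α^a`, `t^a ↦ f a`. -/
def weilEvalHom : Weil L →ₐ[ℝ] ExtCot E :=
  Algebra.TensorProduct.lift (symEvalHom hf) (ExteriorAlgebra.map α.dualMap) fun p w =>
    (Subalgebra.mem_center_iff.1 (Subtype.prop (p := (· ∈ Subalgebra.center ℝ (ExtCot E)))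
      (aeval _ p)) _).symm

theorem weilEval_eq (z : Weil L) : weilEval α f z = weilEvalHom α hf z := by
  refine DFunLike.congr_fun (g := (weilEvalHom α hf).toLinearMap)
    (TensorProduct.ext' fun p w => ?_) z
  rw [weilEval_tmul, constr_eq_symEvalHom hf, AlgHom.toLinearMap_apply, weilEvalHom]
  exact (Algebra.TensorProduct.lift_tmul _ _ _ p w).symm

include hf in
theorem weilEval_mul (x y : Weil L) : weilEval α f (x * y) = weilEval α f x * weilEval α f y := by
  simp only [weilEval_eq α hf, map_mul]

include hf in
theorem weilEval_one : weilEval α f 1 = 1 := by rw [weilEval_eq α hf, map_one]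

include hf in
theorem weilEval_weilt (a : Idx L) : weilEval α f (weilt a) = f a := by
  rw [weilt, weilEval_tmul, constr_eq_symEvalHom hf, symEvalHom_X, map_one, mul_one]

include hf in
theorem weilEval_weilθ (a : Idx L) :
    weilEval α f (weilθ a) = ι ℝ ((lieBasis L).coord a ∘ₗ α) := by
  rw [weilθ, weilEval_tmul, constr_eq_symEvalHom hf, map_one, one_mul, extθ,
    map_apply_ι]
  rfl

include hf in
theorem weilEval_weilQ (a : Idx L) : weilEval α f (weilQ a) =
    ∑ b, ∑ c, structConst L a b c • (ι ℝ ((lieBasis L).coord b ∘ₗ α) *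
      ι ℝ ((lieBasis L).coord c ∘ₗ α)) := by
  simp only [weilQ, map_sum, map_smul, weilEval_mul α hf, weilEval_weilθ α hf]

include hf in
theorem weilEval_parity (z : Weil L) : weilEval α f (parity z) = parity (weilEval α f z) := by
  induction z using Weil.induction with
  | one => rw [map_one, weilEval_one α hf, map_one]
  | add x y hx hy => simp only [map_add, hx, hy]
  | smul r x hx => simp only [map_smul, hx]
  | mul_t a x hx => simp only [map_mul, weilEval_mul α hf, hx, parity_weilt, weilEval_weilt α hf, hf]
  | mul_θ a x hx =>
    simp only [map_mul, weilEval_mul α hf, hx, parity_weilθ, weilEval_weilθ α hf, map_neg,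
      parity_ι]

include hf in
/-- An algebra homomorphism commuting with the generators commutes with the Weil homomorphism. -/
theorem map_weilEval {f' : Idx L → ExtCot E} (hf' : ∀ a, parity (f' a) = f' a)
    (Q : E →ₗ[ℝ] E) (h : ∀ a, ExteriorAlgebra.map Q.dualMap (f a) = f' a) (z : Weil L) :
    ExteriorAlgebra.map Q.dualMap (weilEval α f z) = weilEval (α ∘ₗ Q) f' z := by
  induction z using Weil.induction with
  | one => rw [weilEval_one _ hf, weilEval_one _ hf', map_one]
  | add x y hx hy => simp only [map_add, hx, hy]
  | smul r x hx => simp only [map_smul, hx]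
  | mul_t a x hx =>
    rw [weilEval_mul _ hf, weilEval_mul _ hf', map_mul, hx, weilEval_weilt _ hf,
      weilEval_weilt _ hf', h]
  | mul_θ a x hx =>
    rw [weilEval_mul _ hf, weilEval_mul _ hf', map_mul, hx, weilEval_weilθ _ hf,
      weilEval_weilθ _ hf', map_apply_ι]
    rfl
end

/-- The Weil homomorphism preserves degrees if the elements `f a` have degree two. -/
theorem weilEval_mem (α : E →ₗ[ℝ] L) {f : Idx L → ExtCot E}
    (hf : ∀ a, f a ∈ ⋀[ℝ]^2 (Dual ℝ E)) {n : ℕ} {z : Weil L} (hz : z ∈ weilDeg L n) :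
    weilEval α f z ∈ ⋀[ℝ]^n (Dual ℝ E) := by
  rw [weilDeg] at hz
  induction hz using span_induction with
  | zero => rw [map_zero]; exact zero_mem _
  | add x y _ _ hx hy => rw [map_add]; exact add_mem hx hy
  | smul r x _ hx => rw [map_smul]; exact smul_mem _ _ hx
  | mem z hz =>
    obtain ⟨i, j, p, w, rfl, hp, hw, rfl⟩ := hz
    rw [weilEval_tmul]
    refine SetLike.GradedMul.mul_mem ?_ (map_mem_exteriorPower _ hw)
    rw [p.as_sum, map_sum]
    refine Submodule.sum_mem _ fun m hm => ?_
    have h1 := hp (MvPolynomial.mem_support_iff.1 hm)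
    have h2 : monomial m (MvPolynomial.coeff m p) =
        MvPolynomial.coeff m p • (basisMonomials (Idx L) ℝ) m := by
      rw [MvPolynomial.coe_basisMonomials, MvPolynomial.smul_monomial, smul_eq_mul, mul_one]
    rw [h2, map_smul, Module.Basis.constr_basis]
    refine smul_mem _ _ ?_
    have h3 := SetLike.list_prod_ofFn_mem_graded (A := fun n : ℕ => ⋀[ℝ]^n (Dual ℝ E))
      (fun a => m a • 2) (fun a => f a ^ m a) fun a => SetLike.pow_mem_graded (m a) (hf a)
    convert h3 using 2
    rw [List.sum_ofFn, ← h1, Finsupp.weight_apply, Finsupp.sum_fintype _ _ (by simp),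
      mul_sum]
    exact sum_congr rfl fun a _ => by simp [mul_comm]

/-- The exterior derivative of a form in a chart in terms of its derivative. -/
def formD (f' : E →ₗ[ℝ] ExtCot E) : ExtCot E :=
  ∑ i, extdx E i * f' (finBasis ℝ E i)

theorem formD_add (f' g' : E →ₗ[ℝ] ExtCot E) : formD (f' + g') = formD f' + formD g' := by
  simp only [formD, LinearMap.add_apply, mul_add, sum_add_distrib]

theorem formD_smul (r : ℝ) (f' : E →ₗ[ℝ] ExtCot E) : formD (r • f') = r • formD f' := by
  simp only [formD, LinearMap.smul_apply, mul_smul_comm, smul_sum]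

theorem formD_zero : formD (0 : E →ₗ[ℝ] ExtCot E) = 0 := by
  simp only [formD, LinearMap.zero_apply, mul_zero, sum_const_zero]

theorem formD_leibniz (f' g' : E →ₗ[ℝ] ExtCot E) (a b : ExtCot E) :
    formD (mulRight ℝ b ∘ₗ f' + mulLeft ℝ a ∘ₗ g') =
      formD f' * b + parity a * formD g' := by
  rw [formD_add]
  simp only [formD, comp_apply, mulRight_apply, mulLeft_apply,
    sum_mul, mul_sum, mul_assoc]
  refine congrArg _ (sum_congr rfl fun i _ => ?_)
  have h := ι_superComm ((finBasis ℝ E).coord i) a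
  rw [← mul_assoc, ← mul_assoc]
  exact congrArg (· * _) h

section
variable {s : Set E} (hs : IsOpen s) {B : E → E →ₗ[ℝ] L} {B' : E → E →ₗ[ℝ] E →ₗ[ℝ] L}

/-- The Weil homomorphism of a connection form `B` with derivative `B'` on an open subset of a
vector space. -/
def localEval (B : E → E →ₗ[ℝ] L) (B' : E → E →ₗ[ℝ] E →ₗ[ℝ] L) (y : E) :
    Weil L →ₗ[ℝ] ExtCot E :=
  weilEval (B y) fun a => curvElt (curvForm (B' y) (B y)) a

theorem parity_curvElt (γ : E →ₗ[ℝ] E →ₗ[ℝ] L) (a : Idx L) :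
    parity (curvElt γ a) = curvElt γ a := parity_twoForm _

/-- The function `y ↦ localEval B B' y z` is smooth on `s`, with exterior derivative
`localEval B B' y (weilD z)`. -/
def EvalCommutes (s : Set E) (B : E → E →ₗ[ℝ] L) (B' : E → E →ₗ[ℝ] E →ₗ[ℝ] L) (z : Weil L) :
    Prop :=
  (fun y => localEval B B' y z) ∈ smoothFin (ExtCot E) s ∧
    ∀ y ∈ s, ∃ f', HasD (fun y => localEval B B' y z) y f' ∧
      formD f' = localEval B B' y (weilD L z)

theorem EvalCommutes.add {x y : Weil L} (hx : EvalCommutes s B B' x) (hy : EvalCommutes s B B' y) :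
    EvalCommutes s B B' (x + y) := by
  refine ⟨?_, fun p hp => ?_⟩
  · simp only [map_add]; exact smoothFin_add hx.1 hy.1
  · obtain ⟨f', hf, hf'⟩ := hx.2 p hp
    obtain ⟨g', hg, hg'⟩ := hy.2 p hp
    refine ⟨f' + g', ?_, ?_⟩
    · simp only [map_add]; exact hf.add hg
    · rw [formD_add, hf', hg', map_add, map_add]

theorem EvalCommutes.smul (r : ℝ) {x : Weil L} (hx : EvalCommutes s B B' x) :
    EvalCommutes s B B' (r • x) := by
  refine ⟨?_, fun p hp => ?_⟩
  · simp only [map_smul]; exact smoothFin_const_smul r hx.1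
  · obtain ⟨f', hf, hf'⟩ := hx.2 p hp
    refine ⟨r • f', ?_, ?_⟩
    · simp only [map_smul]; exact hf.const_smul r
    · rw [formD_smul, hf', map_smul, map_smul]

theorem evalCommutes_one : EvalCommutes s B B' 1 := by
  have h (y : E) : localEval B B' y 1 = 1 := weilEval_one _ (parity_curvElt _)
  refine ⟨?_, fun p hp => ⟨0, ?_, ?_⟩⟩
  · simp only [h]; exact const_mem_smoothFin _
  · simp only [h]; exact hasD_const _
  · rw [formD_zero, weilD_isOddDer.map_one, map_zero]

include hs in
theorem EvalCommutes.mul {x y : Weil L} (hx : EvalCommutes s B B' x) (hy : EvalCommutes s B B' y) :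
    EvalCommutes s B B' (x * y) := by
  have h (p : E) (x y : Weil L) : localEval B B' p (x * y) =
      localEval B B' p x * localEval B B' p y := weilEval_mul _ (parity_curvElt _) x y
  refine ⟨?_, fun p hp => ?_⟩
  · simp only [h]; exact smoothFin_mul hx.1 hy.1
  · obtain ⟨f', hf, hf'⟩ := hx.2 p hp
    obtain ⟨g', hg, hg'⟩ := hy.2 p hp
    refine ⟨mulRight ℝ (localEval B B' p y) ∘ₗ f' +
      mulLeft ℝ (localEval B B' p x) ∘ₗ g', ?_, ?_⟩
    · simp only [h]; exact HasD.mul hs hp hx.1 hy.1 hf hg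
    · rw [formD_leibniz, hf', hg', weilD_isOddDer x y, map_add, h, h]
      exact congrArg (fun w => _ + w * _) (weilEval_parity _ (parity_curvElt _) x).symm

theorem EvalCommutes.sum {ι : Type*} (t : Finset ι) {x : ι → Weil L}
    (h : ∀ i, EvalCommutes s B B' (x i)) : EvalCommutes s B B' (∑ i ∈ t, x i) := by
  classical
  induction t using Finset.induction_on with
  | empty =>
    have := (evalCommutes_one (s := s) (B := B) (B' := B')).smul 0
    rwa [zero_smul] at this
  | insert i t hi ih => rw [Finset.sum_insert hi]; exact (h i).add ih

variable (hB : B ∈ smoothFin (E →ₗ[ℝ] L) s) (hB' : B' ∈ smoothFin (E →ₗ[ℝ] E →ₗ[ℝ] L) s)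
  (hD : ∀ y ∈ s, HasD B y (B' y))
  (hD' : ∀ y ∈ s, ∃ B'', HasD B' y B'' ∧ ∀ u v, B'' u v = B'' v u)

theorem localEval_weilθ (y : E) (a : Idx L) : localEval B B' y (weilθ a) =
    ι ℝ ((lieBasis L).coord a ∘ₗ B y) := weilEval_weilθ _ (parity_curvElt _) a

/-- The linear map `B ↦ B^a`. -/
def connCompLin (a : Idx L) : (E →ₗ[ℝ] L) →ₗ[ℝ] ExtCot E :=
  ι ℝ ∘ₗ llcomp ℝ E L ℝ ((lieBasis L).coord a)

/-- The linear map `γ ↦ γ^a`. -/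
def curvEltLin (a : Idx L) : (E →ₗ[ℝ] E →ₗ[ℝ] L) →ₗ[ℝ] ExtCot E :=
  twoForm E ∘ₗ llcomp ℝ E (E →ₗ[ℝ] L) (E →ₗ[ℝ] ℝ)
    (llcomp ℝ E L ℝ ((lieBasis L).coord a))

include hB hD in
theorem evalCommutes_weilθ (a : Idx L) : EvalCommutes s B B' (weilθ a) := by
  have h (y : E) : localEval B B' y (weilθ a) = connCompLin a (B y) := localEval_weilθ y a
  refine ⟨?_, fun y hy => ⟨connCompLin a ∘ₗ B' y, ?_, ?_⟩⟩
  · simp only [h]; exact smoothFin_linear _ hB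
  · simp only [h]; exact (hD y hy).linear _
  · refine (sum_extdx_mul_ι ((B' y).compr₂ ((lieBasis L).coord a))).trans ?_
    rw [weilD_weilθ, map_sub, map_smul, localEval, weilEval_weilt _ (parity_curvElt _),
      weilEval_weilQ _ (parity_curvElt _), curvElt_curvForm, add_sub_cancel_right]
    rfl

include hs hB hD in
theorem evalCommutes_weilQ (a : Idx L) : EvalCommutes s B B' (weilQ a) :=
  EvalCommutes.sum _ fun b => EvalCommutes.sum _ fun c =>
    ((evalCommutes_weilθ hB hD b).mul hs (evalCommutes_weilθ hB hD c)).smul _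

include hB' hD' in
theorem evalCommutes_weilD_weilθ (a : Idx L) : EvalCommutes s B B' (weilD L (weilθ a)) := by
  have h (y : E) : localEval B B' y (weilD L (weilθ a)) = curvEltLin a (B' y) := by
    rw [weilD_weilθ, map_sub, map_smul, localEval, weilEval_weilt _ (parity_curvElt _),
      weilEval_weilQ _ (parity_curvElt _), curvElt_curvForm, add_sub_cancel_right]
    rfl
  refine ⟨?_, fun y hy => ?_⟩
  · simp only [h]; exact smoothFin_linear _ hB'
  · obtain ⟨B'', h1, h2⟩ := hD' y hy
    refine ⟨curvEltLin a ∘ₗ B'', ?_, ?_⟩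
    · simp only [h]; exact h1.linear _
    · rw [weilD_weilD, map_zero]
      refine (sum_extdx_mul_twoForm (γ := llcomp ℝ E (E →ₗ[ℝ] L) (E →ₗ[ℝ] ℝ)
        (llcomp ℝ E L ℝ ((lieBasis L).coord a)) ∘ₗ B'') fun u v => ?_)
      exact congrArg (fun w => (lieBasis L).coord a ∘ₗ w) (h2 u v)

include hs hB hB' hD hD' in
/-- The Weil homomorphism of a connection is a homomorphism of differential algebras. -/
theorem evalCommutes (z : Weil L) : EvalCommutes s B B' z := by
  induction z using Weil.induction with
  | one => exact evalCommutes_one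
  | add x y hx hy => exact hx.add hy
  | smul r x hx => exact hx.smul r
  | mul_t a x hx =>
    refine EvalCommutes.mul hs ?_ hx
    have h : weilt a = weilD L (weilθ a) + (2⁻¹ : ℝ) • weilQ a := by
      rw [weilD_weilθ, sub_add_cancel]
    rw [h]
    exact (evalCommutes_weilD_weilθ hB' hD' a).add ((evalCommutes_weilQ hs hB hD a).smul _)
  | mul_θ a x hx => exact (evalCommutes_weilθ hB hD a).mul hs hx

/-- The linear map `b ↦ b ⊗ u`. -/
def SuperTensor.mkRight {A U : Type*} [Ring A] [Algebra ℝ A] [SuperAlgebra A]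
    [Ring U] [Algebra ℝ U] [SuperAlgebra U] (u : U) : A →ₗ[ℝ] A ⊗ₛ U :=
  (GradedTensorProduct.of ℝ (part A) (part U)).toLinearMap ∘ₗ (TensorProduct.mk ℝ A U).flip u

theorem dTens_mkRight {U : Type*} [Ring U] [Algebra ℝ U] [SuperAlgebra U] (f' : E →ₗ[ℝ] ExtCot E)
    (u : U) : dTens (mkRight u ∘ₗ f') = (formD f' ᵍ⊗ₜ u : ExtCot E ⊗ₛ U) := by
  rw [dTens, formD]
  refine Eq.trans ?_ (map_sum (mkRight (A := ExtCot E) u) _ _).symm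
  exact sum_congr rfl fun i _ => tmul_one_mul _ _ _

include hs hB hB' hD hD' in
theorem hasD_superMapLin_localEval {U : Type*} [Ring U] [Algebra ℝ U] [SuperAlgebra U]
    (Z : Weil L ⊗ₛ U) :
    (fun y => superMapLin (localEval B B' y) (LinearMap.id : U →ₗ[ℝ] U) Z) ∈
        smoothFin (ExtCot E ⊗ₛ U) s ∧
      ∀ y ∈ s, ∃ f', HasD (fun y => superMapLin (localEval B B' y) .id Z) y f' ∧
        dTens f' = superMapLin (localEval B B' y ∘ₗ weilD L) .id Z := by
  induction Z using SuperTensor.induction with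
  | zero =>
    simp only [map_zero]
    refine ⟨const_mem_smoothFin _, fun y _ => ⟨0, hasD_const _, ?_⟩⟩
    simp only [dTens, LinearMap.zero_apply, mul_zero, sum_const_zero]
  | add x z hx hz =>
    simp only [map_add]
    refine ⟨smoothFin_add hx.1 hz.1, fun y hy => ?_⟩
    obtain ⟨f', hf, hf'⟩ := hx.2 y hy
    obtain ⟨g', hg, hg'⟩ := hz.2 y hy
    exact ⟨f' + g', hf.add hg, by rw [dTens_add, hf', hg']⟩
  | tmul z u =>
    obtain ⟨h1, h2⟩ := evalCommutes hs hB hB' hD hD' z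
    refine ⟨smoothFin_linear (mkRight u) h1, fun y hy => ?_⟩
    obtain ⟨f', hf, hf'⟩ := h2 y hy
    refine ⟨mkRight u ∘ₗ f', hf.linear (mkRight u), ?_⟩
    rw [dTens_mkRight, hf']
    rfl
end

end WeilEvaluation

/-! ### Evaluation of power series over the Weil algebra -/
section WeilSeries
variable {U U' : Type*} [Ring U] [Algebra ℝ U] [SuperAlgebra U] [Ring U'] [Algebra ℝ U'] [SuperAlgebra U']

/-- If the coefficients of two power series vanish beyond the index `N`, then the sum of the
coefficients is multiplicative. -/
theorem sum_coeff_mul {R : Type*} [Ring R] {P Q : PowerSeries R} {N : ℕ}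
    (hP : ∀ n, N < n → coeff n P = 0) (hQ : ∀ n, N < n → coeff n Q = 0) :
    ∑ n ∈ range (2 * N + 1), coeff n (P * Q) =
      (∑ n ∈ range (N + 1), coeff n P) *
        ∑ n ∈ range (N + 1), coeff n Q := by
  rw [Finset.sum_mul_sum, ← Finset.sum_product',
    ← Finset.sum_fiberwise_of_maps_to (t := range (2 * N + 1)) (g := fun p : ℕ × ℕ => p.1 + p.2)
      (by intro p hp; simp only [mem_product, mem_range] at hp ⊢; omega)]
  refine sum_congr rfl fun n _ => ?_
  rw [coeff_mul]
  refine (Finset.sum_subset (fun p hp => ?_) fun p hp hp' => ?_).symm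
  · exact HasAntidiagonal.mem_antidiagonal.2 (Finset.mem_filter.1 hp).2
  · by_cases h1 : N < p.1
    · rw [hP _ h1, zero_mul]
    by_cases h2 : N < p.2
    · rw [hQ _ h2, mul_zero]
    refine (hp' (Finset.mem_filter.2
      ⟨?_, HasAntidiagonal.mem_antidiagonal.1 hp⟩)).elim
    simp only [mem_product, mem_range]
    omega

theorem exteriorPower_dual_eq_bot {n : ℕ} (h : finrank ℝ E < n) :
    ⋀[ℝ]^n (Dual ℝ E) = ⊥ :=
  exteriorPower_eq_bot (by rwa [Subspace.dual_finrank_eq])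

section
variable {α : E →ₗ[ℝ] L} {f : Idx L → ExtCot E} (hf : ∀ a, f a ∈ ⋀[ℝ]^2 (Dual ℝ E))

include hf in
theorem parity_of_mem_two (a : Idx L) : parity (f a) = f a := by
  rw [parity_of_mem (hf a)]; norm_num

include hf in
theorem superMapLin_weilEval_mul (x y : Weil L ⊗ₛ U) :
    superMapLin (weilEval α f) (.id : U →ₗ[ℝ] U) (x * y) =
      superMapLin (weilEval α f) .id x * superMapLin (weilEval α f) .id y := by
  have h (z : Weil L) := weilEval_eq α (parity_of_mem_two hf) z
  have h1 : weilEval α f = (weilEvalHom α (parity_of_mem_two hf)).toLinearMap := LinearMap.ext h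
  have h2 (z : Weil L ⊗ₛ U) := superMap_eq_superMapLin (weilEvalHom α (parity_of_mem_two hf))
    (AlgHom.id ℝ U) (fun a => by
      rw [← h, ← h, weilEval_parity α (parity_of_mem_two hf)]) (fun _ => rfl) z
  rw [h1]
  exact (h2 _).symm.trans ((map_mul _ x y).trans (congrArg₂ (· * ·) (h2 x) (h2 y)))

include hf in
theorem superMapLin_weilEval_one :
    superMapLin (weilEval α f) (.id : U →ₗ[ℝ] U) 1 = 1 := by
  rw [one_def, superMapLin_tmul, weilEval_one α (parity_of_mem_two hf)]
  rfl

theorem superMap_superMapLin (e : Weil L →ₗ[ℝ] ExtCot E) (g : U →ₐ[ℝ] U')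
    (hg : ∀ b, g (parity b) = parity (g b)) (z : Weil L ⊗ₛ U) :
    superMap (AlgHom.id ℝ (ExtCot E)) g (fun _ => rfl) hg (superMapLin e .id z) =
      superMapLin e .id (superMap (AlgHom.id ℝ (Weil L)) g (fun _ => rfl) hg z) := by
  have h1 := superMap_eq_superMapLin (AlgHom.id ℝ (ExtCot E)) g (fun _ => rfl) hg
    (superMapLin e .id z)
  have h2 := superMap_eq_superMapLin (AlgHom.id ℝ (Weil L)) g (fun _ => rfl) hg z
  have h3 := superMapLin_comp_apply (LinearMap.id : ExtCot E →ₗ[ℝ] ExtCot E) g.toLinearMap e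
    (LinearMap.id : U →ₗ[ℝ] U) z
  have h4 := superMapLin_comp_apply e (LinearMap.id : U' →ₗ[ℝ] U')
    (LinearMap.id : Weil L →ₗ[ℝ] Weil L) g.toLinearMap z
  exact h1.trans (h3.trans (h4.symm.trans (congrArg (superMapLin e .id) h2.symm)))

include hf in
theorem superMapLin_weilEval_mem {n : ℕ} {z : Weil L ⊗ₛ UL L}
    (hz : z ∈ bidegree (weilDeg L n) n) :
    superMapLin (weilEval α f) .id z ∈ bidegree (⋀[ℝ]^n (Dual ℝ E)) n := by
  rw [bidegree] at hz
  induction hz using span_induction with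
  | zero => rw [map_zero]; exact zero_mem _
  | add x y _ _ hx hy => rw [map_add]; exact add_mem hx hy
  | smul r x _ hx => rw [map_smul]; exact smul_mem _ _ hx
  | mem z hz =>
    obtain ⟨b, hb, u, hu, rfl⟩ := hz
    exact tmul_mem_bidegree (weilEval_mem α hf hb) hu

include hf in
theorem superMapLin_weilEval_eq_zero {n : ℕ} (hn : finrank ℝ E < n) {z : Weil L ⊗ₛ UL L}
    (hz : z ∈ bidegree (weilDeg L n) n) :
    superMapLin (weilEval α f) .id z = (0 : ExtCot E ⊗ₛ UL L) := by
  have h := superMapLin_weilEval_mem (α := α) hf hz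
  rw [exteriorPower_dual_eq_bot hn, bidegree_bot] at h
  exact h

/-- The sum of the values of the coefficients of index at most `dim E`. -/
def evSum (α : E →ₗ[ℝ] L) (f : Idx L → ExtCot E) (Z : PowerSeries (Weil L ⊗ₛ U)) :
    ExtCot E ⊗ₛ U :=
  ∑ n ∈ range (finrank ℝ E + 1),
    superMapLin (weilEval α f) .id (coeff n Z)

theorem evSum_eq {Z : PowerSeries (Weil L ⊗ₛ U)}
    (hZ : ∀ n, finrank ℝ E < n →
      superMapLin (weilEval α f) (.id : U →ₗ[ℝ] U) (coeff n Z) = 0)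
    {K : ℕ} (hK : finrank ℝ E < K) :
    ∑ n ∈ range K, superMapLin (weilEval α f) .id (coeff n Z) =
      evSum α f Z :=
  Finset.eventually_constant_sum (fun n hn => hZ n hn) hK

include hf in
theorem evSum_mul {P Q : PowerSeries (Weil L ⊗ₛ U)}
    (hP : ∀ n, finrank ℝ E < n →
      superMapLin (weilEval α f) (.id : U →ₗ[ℝ] U) (coeff n P) = 0)
    (hQ : ∀ n, finrank ℝ E < n →
      superMapLin (weilEval α f) (.id : U →ₗ[ℝ] U) (coeff n Q) = 0) :
    ∑ n ∈ range (2 * finrank ℝ E + 1),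
      superMapLin (weilEval α f) .id (coeff n (P * Q)) =
        evSum α f P * evSum α f Q := by
  let S (Z : PowerSeries (Weil L ⊗ₛ U)) : PowerSeries (ExtCot E ⊗ₛ U) := PowerSeries.mk fun n =>
    superMapLin (weilEval α f) .id (coeff n Z)
  have hS (Z : PowerSeries (Weil L ⊗ₛ U)) (n : ℕ) : coeff n (S Z) =
      superMapLin (weilEval α f) .id (coeff n Z) := coeff_mk _ _
  have h := sum_coeff_mul (P := S P) (Q := S Q) (N := finrank ℝ E)
    (fun n hn => (hS P n).trans (hP n hn)) (fun n hn => (hS Q n).trans (hQ n hn))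
  simp only [hS] at h
  refine Eq.trans (sum_congr rfl fun n _ => ?_) h
  rw [coeff_mul, coeff_mul, map_sum]
  refine sum_congr rfl fun p _ => ?_
  rw [hS, hS, superMapLin_weilEval_mul hf]

theorem superMap_evSum (g : U →ₐ[ℝ] U') (hg : ∀ b, g (parity b) = parity (g b))
    (Z : PowerSeries (Weil L ⊗ₛ U)) :
    evSum α f (PowerSeries.map
      (superMap (AlgHom.id ℝ (Weil L)) g (fun _ => rfl) hg).toRingHom Z) =
      superMap (AlgHom.id ℝ (ExtCot E)) g (fun _ => rfl) hg (evSum α f Z) := by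
  rw [evSum, evSum, map_sum]
  refine sum_congr rfl fun n _ => ?_
  rw [superMap_superMapLin, coeff_map]
  rfl

theorem superMapLin_coeff_map_eq_zero (g : U →ₐ[ℝ] U') (hg : ∀ b, g (parity b) = parity (g b))
    {Z : PowerSeries (Weil L ⊗ₛ U)} {n : ℕ}
    (hZ : superMapLin (weilEval α f) (.id : U →ₗ[ℝ] U) (coeff n Z) = 0) :
    superMapLin (weilEval α f) (.id : U' →ₗ[ℝ] U') (coeff n (PowerSeries.map
      (superMap (AlgHom.id ℝ (Weil L)) g (fun _ => rfl) hg).toRingHom Z)) = 0 := by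
  rw [coeff_map]
  refine (superMap_superMapLin (weilEval α f) g hg _).symm.trans ?_
  rw [hZ, map_zero]

variable {Φ : PowerSeries (Weil L ⊗ₛ UL L)} (hΦ : IsKalkman Φ)

include hf hΦ in
theorem IsKalkman.eval_eq_zero {n : ℕ} (hn : finrank ℝ E < n) :
    superMapLin (weilEval α f) (.id : UL L →ₗ[ℝ] UL L) (coeff n Φ) = 0 :=
  superMapLin_weilEval_eq_zero hf hn (hΦ.degree_zero n)

include hf hΦ in
theorem IsKalkman.evSum_mem : evSum α f Φ ∈ degFiltration L (Dual ℝ E) 0 :=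
  Submodule.sum_mem _ fun n _ => bidegree_le_degFiltration (Nat.zero_le n)
    (superMapLin_weilEval_mem hf (hΦ.degree_zero n))

include hf hΦ in
/-- The value of `Φ` is the sum of `1` and of a nilpotent element. -/
theorem IsKalkman.isUnit_evSum : IsUnit (evSum α f Φ) := by
  rw [evSum, Finset.sum_range_succ', hΦ.counit, superMapLin_weilEval_one hf, add_comm]
  refine IsNilpotent.isUnit_one_add ⟨_, pow_eq_zero_of_mem_degFiltration (L := L)
    (V := Dual ℝ E) ?_⟩
  exact Submodule.sum_mem _ fun n _ => bidegree_le_degFiltration (Nat.le_add_left 1 n)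
    (superMapLin_weilEval_mem hf (hΦ.degree_zero (n + 1)))

include hf hΦ in
theorem IsKalkman.isGroupLike_evSum : IsGroupLike (evSum α f Φ) := by
  have h0 (n) (hn : finrank ℝ E < n) := hΦ.eval_eq_zero (α := α) hf hn
  have k0 (n) (hn : finrank ℝ E < n) : superMapLin (weilEval α f) .id
      (coeff n (PowerSeries.map (comulB L (Weil L)).toRingHom Φ)) = 0 :=
    superMapLin_coeff_map_eq_zero _ parity_ulComul (h0 n hn)
  have k1 (n) (hn : finrank ℝ E < n) : superMapLin (weilEval α f) .id
      (coeff n (PowerSeries.map (inFst L (Weil L)).toRingHom Φ)) = 0 :=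
    superMapLin_coeff_map_eq_zero _ parity_includeLeft (h0 n hn)
  have k2 (n) (hn : finrank ℝ E < n) : superMapLin (weilEval α f) .id
      (coeff n (PowerSeries.map (inSnd L (Weil L)).toRingHom Φ)) = 0 :=
    superMapLin_coeff_map_eq_zero _ parity_includeRight (h0 n hn)
  have e0 : evSum α f (PowerSeries.map (comulB L (Weil L)).toRingHom Φ) =
    comulB L (ExtCot E) (evSum α f Φ) := superMap_evSum _ parity_ulComul Φ
  have e1 : evSum α f (PowerSeries.map (inFst L (Weil L)).toRingHom Φ) =
    inFst L (ExtCot E) (evSum α f Φ) := superMap_evSum _ parity_includeLeft Φ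
  have e2 : evSum α f (PowerSeries.map (inSnd L (Weil L)).toRingHom Φ) =
    inSnd L (ExtCot E) (evSum α f Φ) := superMap_evSum _ parity_includeRight Φ
  have h1 := evSum_mul hf k1 k2
  rw [← hΦ.comul, evSum_eq k0 (by omega), e0, e1, e2] at h1
  exact h1

include hf in
theorem eval_connElt_eq_zero {n : ℕ} (hn : finrank ℝ E < n) :
    superMapLin (weilEval α f) (.id : UD L →ₗ[ℝ] UD L)
      (coeff n (connElt L)) = 0 := by
  rw [connElt, coeff_mk, if_neg (by omega)]
  split_ifs with h
  · rw [map_neg, map_sum, neg_eq_zero]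
    refine sum_eq_zero fun a _ => ?_
    rw [superMapLin_tmul]
    have h1 : ((∏ i, (MvPolynomial.X (a i) : SymDual L)) ⊗ₜ[ℝ] 1 : Weil L) ∈
        weilDeg L (n + 1) := by
      refine subset_span ⟨(n + 1) / 2, 0, _, 1, ?_, ?_, ?_, rfl⟩
      · obtain ⟨k, rfl⟩ := h; omega
      · have := MvPolynomial.IsHomogeneous.prod univ
          (fun i => (MvPolynomial.X (a i) : SymDual L)) (fun _ => 1)
          (fun i _ => isHomogeneous_X ℝ (a i))
        simpa using this
      · exact SetLike.one_mem_graded (fun n : ℕ => ⋀[ℝ]^n (Dual ℝ L))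
    have h2 := weilEval_mem α hf h1
    rw [exteriorPower_dual_eq_bot (Nat.lt_succ_of_lt hn)] at h2
    rw [(Submodule.mem_bot ℝ).1 h2]
    exact (mkRight (A := ExtCot E) _).map_zero
  · exact map_zero _

theorem superMapLin_weilD_ulToUD (z : Weil L ⊗ₛ UL L) :
    superMapLin (weilEval α f) (.id : UD L →ₗ[ℝ] UD L)
      (superMapLin (weilD L) (ulToUD L).toLinearMap z) =
      toBUD L (ExtCot E) (superMapLin (weilEval α f ∘ₗ weilD L) .id z) := by
  refine Eq.trans ?_ (toBUD_eq_superMapLin _).symm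
  have h1 := superMapLin_comp_apply (weilEval α f) (LinearMap.id : UD L →ₗ[ℝ] UD L) (weilD L)
    (ulToUD L).toLinearMap z
  have h2 := superMapLin_comp_apply (LinearMap.id : ExtCot E →ₗ[ℝ] ExtCot E)
    (ulToUD L).toLinearMap (weilEval α f ∘ₗ weilD L) LinearMap.id z
  exact h1.trans h2.symm

include hf in
theorem superMapLin_parity_dUL (z : Weil L ⊗ₛ UL L) :
    superMapLin (weilEval α f) (.id : UD L →ₗ[ℝ] UD L)
      (superMapLin (parity : Weil L →ₐ[ℝ] Weil L).toLinearMap (dUL L) z) =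
      dTensUL L (ExtCot E) (superMapLin (weilEval α f) .id z) := by
  refine (superMapLin_comp_apply _ _ _ _ _).trans
    (Eq.trans ?_ (superMapLin_comp_apply _ _ _ _ _).symm)
  exact congrArg (fun g => superMapLin g (dUL L) z)
    (LinearMap.ext fun z => weilEval_parity α (parity_of_mem_two hf) z)

include hf hΦ in
theorem IsKalkman.dTensUL_evSum : dTensUL L (ExtCot E) (evSum α f Φ) =
    ∑ n ∈ range (2 * finrank ℝ E + 1), dTensUL L (ExtCot E)
      (superMapLin (weilEval α f) .id (coeff (n + 1) Φ)) := by
  rw [← evSum_eq (fun n hn => hΦ.eval_eq_zero hf hn)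
    (K := 2 * finrank ℝ E + 1 + 1) (by omega), Finset.sum_range_succ', map_add, map_sum,
    hΦ.counit, superMapLin_weilEval_one hf, dTensUL_one, add_zero]

include hf hΦ in
/-- The equation `dΦ = Φ (-i(t) + l(θ))` after evaluation. -/
theorem IsKalkman.evSum_dlog :
    toBUD L (ExtCot E) (∑ n ∈ range (2 * finrank ℝ E + 1),
        superMapLin (weilEval α f ∘ₗ weilD L) .id (coeff n Φ)) +
      dTensUL L (ExtCot E) (evSum α f Φ) =
        toBUD L (ExtCot E) (evSum α f Φ) * evSum α f (connElt L) := by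
  have k1 (n) (hn : finrank ℝ E < n) : superMapLin (weilEval α f) .id
      (coeff n (PowerSeries.map (toBUD L (Weil L)).toRingHom Φ)) = 0 :=
    superMapLin_coeff_map_eq_zero _ parity_ulToUD (hΦ.eval_eq_zero hf hn)
  have h1 := evSum_mul hf k1 (fun n hn => eval_connElt_eq_zero hf hn)
  have h2 : evSum α f (PowerSeries.map (toBUD L (Weil L)).toRingHom Φ) =
    toBUD L (ExtCot E) (evSum α f Φ) := superMap_evSum _ parity_ulToUD Φ
  rw [← hΦ.dlog, h2] at h1
  rw [← h1, hΦ.dTensUL_evSum hf, map_sum, ← sum_add_distrib]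
  refine sum_congr rfl fun n _ => ?_
  rw [totalD, coeff_mk, map_add, superMapLin_weilD_ulToUD, superMapLin_parity_dUL hf]
end

/-! ### Equivariance of the connection element -/
section
variable {α : E →ₗ[ℝ] L} {f : Idx L → ExtCot E}

theorem sum_ι_tmul_udL (hf : ∀ a, parity (f a) = f a) :
    superMapLin (weilEval α f) (.id : UD L →ₗ[ℝ] UD L) (lθ L) = udForm α := by
  rw [lθ, map_sum, udForm_eq]
  have h (i) : udL (α (finBasis ℝ E i)) =
      ∑ a, (lieBasis L).coord a (α (finBasis ℝ E i)) • udL (lieBasis L a) := by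
    conv_lhs => rw [← (lieBasis L).sum_repr (α (finBasis ℝ E i))]
    rw [map_sum]
    exact sum_congr rfl fun a _ => map_smul _ _ _
  simp only [h]
  have h2 (b : ExtCot E) (c : Idx L → UD L) : (b ᵍ⊗ₜ (∑ a, c a) : ExtCot E ⊗ₛ UD L) =
    ∑ a, (b ᵍ⊗ₜ c a : ExtCot E ⊗ₛ UD L) := map_sum (mkLeft b) _ _
  simp only [h2]
  rw [sum_comm]
  refine sum_congr rfl fun a _ => ?_
  rw [superMapLin_tmul, weilEval_weilθ α hf, ι_eq_sum]
  refine (map_sum (mkRight (A := ExtCot E) (udL (lieBasis L a))) _ _).trans ?_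
  refine sum_congr rfl fun i _ => ?_
  refine (map_smul (mkRight (A := ExtCot E) (udL (lieBasis L a))) _ _).trans ?_
  exact (map_smul (mkLeft (U := UD L) (extdx E i)) _ _).symm

/-- The linear map `b ⊗ u ↦ b ⊗ I(u)`. -/
def tensI : ExtCot E ⊗[ℝ] Sym𝔤 L →ₗ[ℝ] ExtCot E ⊗ₛ UD L :=
  (GradedTensorProduct.of ℝ (part (ExtCot E)) (part (UD L))).toLinearMap ∘ₗ
    TensorProduct.map LinearMap.id udI

theorem tensI_tmul (b : ExtCot E) (u : Sym𝔤 L) :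
    tensI (b ⊗ₜ[ℝ] u) = (b ᵍ⊗ₜ udI u : ExtCot E ⊗ₛ UD L) := rfl

theorem superMapLin_weilEval_polyTens (hf : ∀ a, parity (f a) = f a)
    (z : SymDual L ⊗[ℝ] Sym𝔤 L) :
    superMapLin (weilEval α f) (.id : UD L →ₗ[ℝ] UD L) (polyTens udI z) =
      tensI (Algebra.TensorProduct.map (symEvalHom hf) (AlgHom.id ℝ (Sym𝔤 L)) z) := by
  induction z using TensorProduct.induction_on with
  | zero => simp only [map_zero]
  | add x y hx hy => simp only [map_add, hx, hy]
  | tmul p u =>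
    rw [polyTens_tmul, superMapLin_tmul, weilEval_tmul, constr_eq_symEvalHom hf, map_one, mul_one,
      Algebra.TensorProduct.map_tmul, tensI_tmul]
    rfl

theorem bMapUD_tensI (φ : L →ₗ⁅ℝ⁆ L) (z : ExtCot E ⊗[ℝ] Sym𝔤 L) :
    bMapUD (ExtCot E) φ (tensI z) = tensI (Algebra.TensorProduct.map (AlgHom.id ℝ (ExtCot E))
      (symMap (φ : L →ₗ[ℝ] L)) z) := by
  induction z using TensorProduct.induction_on with
  | zero => simp only [map_zero]
  | add x y hx hy => simp only [map_add, hx, hy]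
  | tmul b u =>
    rw [tensI_tmul, bMapUD_tmul, udMap_udI, Algebra.TensorProduct.map_tmul, tensI_tmul]
    rfl

theorem symι_lieBasis (a : Idx L) : symι (lieBasis L a) = MvPolynomial.X a := by
  rw [symι, Module.Basis.constr_basis]

/-- The element `∑ f^a ⊗ e_a` is invariant. -/
theorem map_canonElt {f' : Idx L → ExtCot E} (hf : ∀ a, parity (f a) = f a)
    (hf' : ∀ a, parity (f' a) = f' a) (φ ψ : L →ₗ⁅ℝ⁆ L) (hφψ : ∀ x, φ (ψ x) = x)
    (h : ∀ a, f' a = ∑ c, (lieBasis L).coord a (ψ (lieBasis L c)) • f c) :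
    Algebra.TensorProduct.map (AlgHom.id ℝ (ExtCot E)) (symMap (φ : L →ₗ[ℝ] L))
        (Algebra.TensorProduct.map (symEvalHom hf') (AlgHom.id ℝ (Sym𝔤 L)) (canonElt L)) =
      Algebra.TensorProduct.map (symEvalHom hf) (AlgHom.id ℝ (Sym𝔤 L)) (canonElt L) := by
  simp only [canonElt, map_sum, Algebra.TensorProduct.map_tmul, symEvalHom_X, AlgHom.id_apply, h]
  simp only [TensorProduct.sum_tmul]
  rw [sum_comm]
  refine sum_congr rfl fun c _ => ?_
  simp only [TensorProduct.smul_tmul, ← TensorProduct.tmul_sum]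
  congr 1
  conv_rhs => rw [← symι_lieBasis, ← hφψ (lieBasis L c), ← (lieBasis L).sum_repr (ψ (lieBasis L c))]
  rw [map_sum, map_sum]
  refine sum_congr rfl fun a _ => ?_
  rw [map_smul, map_smul, ← symι_lieBasis, symMap_symι]
  rfl

theorem eval_coeff_connElt (hf : ∀ a, parity (f a) = f a) (n : ℕ) :
    superMapLin (weilEval α f) (.id : UD L →ₗ[ℝ] UD L)
      (coeff n (connElt L)) = (if n = 0 then udForm α else 0) -
        if Odd n then superMapLin (weilEval α f) .id
          (polyTens udI (canonElt L ^ ((n + 1) / 2))) else 0 := by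
  rw [connElt_eq]
  refine (congrArg _ (map_sub (coeff n) _ _)).trans ((map_sub (superMapLin
    (weilEval α f) (LinearMap.id : UD L →ₗ[ℝ] UD L)) _ _).trans (congrArg₂ (· - ·) ?_ ?_))
  · rw [coeff_C]
    split_ifs
    · exact sum_ι_tmul_udL hf
    · exact map_zero _
  · rw [iSeries, coeff_oddSeries]
    split_ifs
    · rfl
    · exact map_zero _

/-- The behaviour of `-i(t) + l(θ)` under gauge transformations. -/
theorem bMapUD_evSum_connElt {α' lam : E →ₗ[ℝ] L} {f' : Idx L → ExtCot E}
    (hf : ∀ a, parity (f a) = f a) (hf' : ∀ a, parity (f' a) = f' a) (φ ψ : L →ₗ⁅ℝ⁆ L)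
    (hφψ : ∀ x, φ (ψ x) = x) (hα : (φ : L →ₗ[ℝ] L) ∘ₗ α' = α + lam)
    (h : ∀ a, f' a = ∑ c, (lieBasis L).coord a (ψ (lieBasis L c)) • f c) :
    bMapUD (ExtCot E) φ (evSum α' f' (connElt L)) = evSum α f (connElt L) + udForm lam := by
  have h1 (k : ℕ) : bMapUD (ExtCot E) φ (superMapLin (weilEval α' f')
      (LinearMap.id : UD L →ₗ[ℝ] UD L) (polyTens udI (canonElt L ^ k))) =
      superMapLin (weilEval α f) .id (polyTens udI (canonElt L ^ k)) := by
    rw [superMapLin_weilEval_polyTens hf', superMapLin_weilEval_polyTens hf, bMapUD_tensI,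
      map_pow (Algebra.TensorProduct.map (symEvalHom hf') (AlgHom.id ℝ (Sym𝔤 L))),
      map_pow (Algebra.TensorProduct.map (symEvalHom hf) (AlgHom.id ℝ (Sym𝔤 L))),
      map_pow (Algebra.TensorProduct.map (AlgHom.id ℝ (ExtCot E)) (symMap (φ : L →ₗ[ℝ] L))),
      map_canonElt hf hf' φ ψ hφψ h]
  have h2 (n : ℕ) : bMapUD (ExtCot E) φ (superMapLin (weilEval α' f')
      (LinearMap.id : UD L →ₗ[ℝ] UD L) (coeff n (connElt L))) =
      superMapLin (weilEval α f) .id (coeff n (connElt L)) +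
        if n = 0 then udForm lam else 0 := by
    rw [eval_coeff_connElt hf, eval_coeff_connElt hf']
    refine (map_sub (bMapUD (ExtCot E) φ) _ _).trans ?_
    rw [sub_add_eq_add_sub]
    refine congrArg₂ (· - ·) ?_ ?_
    · split_ifs
      · rw [bMapUD_udForm, hα, udForm_add]
      · rw [add_zero]; exact map_zero _
    · split_ifs
      · exact h1 _
      · exact map_zero _
  rw [evSum, evSum, map_sum, sum_congr rfl fun n _ => h2 n, sum_add_distrib,
    Finset.sum_ite_eq' (range _) 0 fun _ => udForm lam]
  rw [if_pos (mem_range.2 (Nat.succ_pos _))]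
end

end WeilSeries

/-! ### The values of `Φ` at connections -/
section Values
variable {A : OneForms E M F G}

theorem curvComp_mem (hA : IsConnection A) (x : M) (a : Idx (LieAlg F G)) :
    curvComp A x a ∈ ⋀[ℝ]^2 (Dual ℝ E) := by
  obtain ⟨B', hB⟩ := exists_hasD (isOpen_extChartAt_target x) (mem_extChartAt_target x)
    (hA.smoothFin x)
  rw [curvComp_eq hB]
  exact twoForm_mem _

theorem parity_curvComp (hA : IsConnection A) (x : M) (a : Idx (LieAlg F G)) :
    parity (curvComp A x a) = curvComp A x a := parity_of_mem_two (curvComp_mem hA x) a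

theorem chartPull_evWeil (hA : IsConnection A) (x₀ : M) {y : E}
    (hy : y ∈ (extChartAt 𝓘(ℝ, E) x₀).target) {B' : E → E →ₗ[ℝ] E →ₗ[ℝ] LieAlg F G}
    (hB : HasD (chartOne A x₀) y (B' y)) (z : Weil (LieAlg F G)) :
    chartPull x₀ y (evWeil A ((extChartAt 𝓘(ℝ, E) x₀).symm y) z) =
      localEval (chartOne A x₀) B' y z := by
  set x := (extChartAt 𝓘(ℝ, E) x₀).symm y with hx
  obtain ⟨B₁, hB₁⟩ := exists_hasD (isOpen_extChartAt_target x) (mem_extChartAt_target x)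
    (hA.smoothFin x)
  refine map_weilEval (A x) (parity_curvComp hA x) (fun a => parity_curvElt _ a)
    (chartInvDeriv x₀ y) (fun a => ?_) z
  rw [curvComp_eq hB₁]
  exact chartPull_curvElt hA.smoothFin x₀ hy hx.symm hB hB₁ a

variable {U : Type*} [Ring U] [Algebra ℝ U] [SuperAlgebra U]

theorem chartSec_evWeil (hA : IsConnection A) (Z : Weil (LieAlg F G) ⊗ₛ U) (x₀ : M) {y : E}
    (hy : y ∈ (extChartAt 𝓘(ℝ, E) x₀).target) {B' : E → E →ₗ[ℝ] E →ₗ[ℝ] LieAlg F G}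
    (hB : HasD (chartOne A x₀) y (B' y)) :
    chartSec (fun x => superMapLin (evWeil A x) (LinearMap.id : U →ₗ[ℝ] U) Z) x₀ y =
      superMapLin (localEval (chartOne A x₀) B' y) LinearMap.id Z := by
  refine (superMapLin_comp_apply _ _ _ _ _).trans ?_
  exact congrArg (fun g => superMapLin g (LinearMap.id : U →ₗ[ℝ] U) Z)
    (LinearMap.ext fun z => chartPull_evWeil hA x₀ hy hB z)

theorem isSmoothSec_evWeil (hA : IsConnection A) (Z : Weil (LieAlg F G) ⊗ₛ U) :
    IsSmoothSec fun x : M => superMapLin (evWeil A x) (LinearMap.id : U →ₗ[ℝ] U) Z := fun x₀ => by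
  have ho := isOpen_extChartAt_target (I := 𝓘(ℝ, E)) x₀
  obtain ⟨B', h1, h2, h3⟩ := exists_smooth_deriv ho (hA.smoothFin x₀)
  exact smoothFin_congr (hasD_superMapLin_localEval ho (hA.smoothFin x₀) h1 h2 h3 Z).1
    fun y hy => chartSec_evWeil hA Z x₀ hy (h2 y hy)

theorem exists_hasD_evWeil (hA : IsConnection A) (Z : Weil (LieAlg F G) ⊗ₛ U) (x : M) :
    ∃ f', HasD (chartSec (fun x => superMapLin (evWeil A x) (LinearMap.id : U →ₗ[ℝ] U) Z) x)
        (extChartAt 𝓘(ℝ, E) x x) f' ∧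
      dTens f' = superMapLin (evWeil A x ∘ₗ weilD (LieAlg F G)) LinearMap.id Z := by
  have ho := isOpen_extChartAt_target (I := 𝓘(ℝ, E)) x
  have hy := mem_extChartAt_target (I := 𝓘(ℝ, E)) x
  obtain ⟨B', h1, h2, h3⟩ := exists_smooth_deriv ho (hA.smoothFin x)
  obtain ⟨f', h4, h5⟩ := (hasD_superMapLin_localEval ho (hA.smoothFin x) h1 h2 h3 Z).2 _ hy
  refine ⟨f', h4.congr (Filter.Eventually.mono (ho.mem_nhds hy) fun z hz =>
    chartSec_evWeil hA Z x hz (h2 z hz)), h5.trans ?_⟩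
  refine congrArg (fun g => superMapLin g (LinearMap.id : U →ₗ[ℝ] U) Z)
    (LinearMap.ext fun z => (chartPull_evWeil hA x hy (h2 _ hy) _).symm.trans ?_)
  rw [chartPull_self, extChartAt_to_inv]
  rfl

variable {Φ : PowerSeries (Weil (LieAlg F G) ⊗ₛ UL (LieAlg F G))}

theorem isUnit_evPhi (hΦ : IsKalkman Φ) (hA : IsConnection A) (x : M) : IsUnit (evPhi Φ A x) :=
  hΦ.isUnit_evSum (α := A x) (curvComp_mem hA x)

theorem coe_phiSection (hΦ : IsKalkman Φ) (hA : IsConnection A) (x : M) :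
    (phiSection Φ A x : Fib E F G) = evPhi Φ A x := by
  rw [phiSection, dif_pos (isUnit_evPhi hΦ hA x)]
  rfl

/-- As the components of large index have the value zero, more of them can be included. -/
theorem evPhi_eq (hΦ : IsKalkman Φ) (hA : IsConnection A) (x : M) :
    evPhi Φ A x = ∑ n ∈ range (2 * finrank ℝ E + 1),
      superMapLin (evWeil A x) .id (coeff n Φ) :=
  (evSum_eq (α := A x) (f := curvComp A x)
    (fun n hn => hΦ.eval_eq_zero (curvComp_mem hA x) hn) (by omega)).symm

theorem chartSec_sum {ι : Type*} (t : Finset ι) (h : ι → M → ExtCot E ⊗ₛ U) (x₀ : M) (y : E) :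
    chartSec (fun x => ∑ i ∈ t, h i x) x₀ y = ∑ i ∈ t, chartSec (h i) x₀ y :=
  map_sum _ _ _

theorem isH_phiSection (hΦ : IsKalkman Φ) (hA : IsConnection A) : IsH (phiSection Φ A) := by
  have h (x : M) := coe_phiSection hΦ hA x
  refine isH_of ?_ (fun x => ?_) fun x => ?_
  · simp only [h]
    intro x₀
    exact smoothFin_congr (smoothFin_sum _ fun n _ => isSmoothSec_evWeil hA _ x₀)
      fun y _ => chartSec_sum _ _ x₀ y
  · rw [h]
    exact hΦ.evSum_mem (α := A x) (curvComp_mem hA x)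
  · rw [h]
    exact hΦ.isGroupLike_evSum (α := A x) (curvComp_mem hA x)

/-- The value at a connection of the element `-i(t) + l(θ)`. -/
def connValue (A : OneForms E M F G) (x : M) : ExtCot E ⊗ₛ UD (LieAlg F G) :=
  evSum (A x) (curvComp A x) (connElt (LieAlg F G))

theorem sectionD_phiSection (hΦ : IsKalkman Φ) (hA : IsConnection A) (x : M) :
    sectionD (phiSection Φ A) x =
      toBUD (LieAlg F G) (ExtCot E) (phiSection Φ A x) * connValue A x := by
  choose f' h1 h2 using fun n => exists_hasD_evWeil hA (coeff n Φ) x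
  have h3 : HasD (chartSec (fun x => (phiSection Φ A x : Fib E F G)) x)
      (extChartAt 𝓘(ℝ, E) x x) (∑ n ∈ range (2 * finrank ℝ E + 1), f' n) := by
    have h4 : (fun x => (phiSection Φ A x : Fib E F G)) = fun x =>
        ∑ n ∈ range (2 * finrank ℝ E + 1),
          superMapLin (evWeil A x) .id (coeff n Φ) :=
      funext fun x => (coe_phiSection hΦ hA x).trans (evPhi_eq hΦ hA x)
    rw [h4]
    exact (HasD.sum _ fun n _ => h1 n).congr
      (Filter.Eventually.of_forall fun y => chartSec_sum _ _ x y)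
  have h5 : dTens (∑ n ∈ range (2 * finrank ℝ E + 1), f' n) =
      ∑ n ∈ range (2 * finrank ℝ E + 1),
        superMapLin (evWeil A x ∘ₗ weilD (LieAlg F G)) LinearMap.id (coeff n Φ) := by
    simp only [← h2, dTens, LinearMap.sum_apply, mul_sum]
    exact sum_comm
  rw [sectionD_eq h3, h5, coe_phiSection hΦ hA]
  exact hΦ.evSum_dlog (α := A x) (curvComp_mem hA x)

theorem bMapUD_connValue (hA : IsConnection A) (g : MapGroup E M F G) (x : M) :
    bMapUD (ExtCot E) (AdLie (F := F) (g x)) (connValue (gaugeTransform A g) x) =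
      connValue A x + udForm (rightMC g x) := by
  refine bMapUD_evSum_connElt (α := A x) (parity_curvComp hA x)
    (parity_curvComp (hA.gaugeTransform g) x) (AdLie (F := F) (g x)) (AdLie (F := F) (g x)⁻¹)
    (fun v => ?_) (LinearMap.ext fun v => ?_) (fun a => curvComp_gaugeTransform hA g x a)
  · have h := AdLin_inv_apply (F := F) (g x)⁻¹ v
    rwa [inv_inv] at h
  · rw [rightMC_eq_AdLin]
    have h := AdLin_inv_apply (F := F) (g x)⁻¹ (A x v)
    rw [inv_inv] at h
    exact (map_add (AdLin (F := F) (g x)) (AdLin (F := F) (g x)⁻¹ (A x v)) (leftMC g x v)).trans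
      (congrArg (· + AdLin (F := F) (g x) (leftMC g x v)) h)

/-! ### The morphism `μ` -/

theorem mu_mul_inl (Φ : PowerSeries (Weil (LieAlg F G) ⊗ₛ UL (LieAlg F G)))
    (g : MapGroup E M F G) (A : OneForms E M F G) :
    mu Φ g A * SemidirectProduct.inl (phiSection Φ (gaugeTransform A g)) =
      SemidirectProduct.inl (phiSection Φ A) * SemidirectProduct.inr g := by
  rw [mu, inv_mul_cancel_right]

theorem mu_right (Φ : PowerSeries (Weil (LieAlg F G) ⊗ₛ UL (LieAlg F G)))
    (g : MapGroup E M F G) (A : OneForms E M F G) :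
    SemidirectProduct.rightHom (mu Φ g A) = g := by
  rw [mu, map_mul, map_mul, map_inv, SemidirectProduct.rightHom_inl,
    SemidirectProduct.rightHom_inl, SemidirectProduct.rightHom_inr, inv_one, mul_one, one_mul]

theorem mu_one (Φ : PowerSeries (Weil (LieAlg F G) ⊗ₛ UL (LieAlg F G))) (A : OneForms E M F G) :
    mu Φ (1 : MapGroup E M F G) A = 1 := by
  rw [mu, gaugeTransform_one, map_one, mul_one, mul_inv_cancel]

theorem mu_mul (Φ : PowerSeries (Weil (LieAlg F G) ⊗ₛ UL (LieAlg F G)))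
    (g h : MapGroup E M F G) (A : OneForms E M F G) :
    mu Φ (g * h) A = mu Φ g A * mu Φ h (gaugeTransform A g) := by
  simp only [mu, gaugeTransform_mul, map_mul, mul_assoc, inv_mul_cancel_left]

theorem inl_mem_SGbar {h : UnitSections E M F G} (hh : IsH h) :
    (SemidirectProduct.inl h : Ambient E M F G) ∈ SGbarGroup E M F G := hh

theorem inr_mem_SGbar (g : MapGroup E M F G) :
    (SemidirectProduct.inr g : Ambient E M F G) ∈ SGbarGroup E M F G := isH_one

theorem mu_mem_SGbar (hΦ : IsKalkman Φ) (hA : IsConnection A) (g : MapGroup E M F G) :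
    mu Φ g A ∈ SGbarGroup E M F G :=
  mul_mem (mul_mem (inl_mem_SGbar (isH_phiSection hΦ hA)) (inr_mem_SGbar g))
    (inv_mem (inl_mem_SGbar (isH_phiSection hΦ (hA.gaugeTransform g))))

theorem closedDefect_inl_mul_inr (hΦ : IsKalkman Φ) (hA : IsConnection A) (g : MapGroup E M F G)
    (x : M) : closedDefect (SemidirectProduct.inl (phiSection Φ A) * SemidirectProduct.inr g) x =
      toBUD (LieAlg F G) (ExtCot E) (phiSection Φ A x) *
        (connValue A x + udForm (rightMC g x)) := by
  have h1 : (SemidirectProduct.inl (phiSection Φ A) * SemidirectProduct.inr g :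
      Ambient E M F G) = ⟨phiSection Φ A, g⟩ := (SemidirectProduct.mk_eq_inl_mul_inr _ _).symm
  rw [h1, closedDefect, mul_add, sectionD_phiSection hΦ hA]

theorem closedDefect_inl (hΦ : IsKalkman Φ) (hA : IsConnection A) (x : M) :
    closedDefect (SemidirectProduct.inl (phiSection Φ A)) x =
      toBUD (LieAlg F G) (ExtCot E) (phiSection Φ A x) * connValue A x := by
  have h3 : udForm (0 : E →ₗ[ℝ] LieAlg F G) = 0 := by
    have h := udForm_add (0 : E →ₗ[ℝ] LieAlg F G) 0
    rw [add_zero] at h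
    exact left_eq_add.1 h
  have h1 := closedDefect_inl_mul_inr hΦ hA 1 x
  rw [map_one, mul_one, rightMC_one] at h1
  exact h1.trans (congrArg _ ((congrArg _ h3).trans (add_zero _)))

theorem eq_zero_of_mul_defect {R : Type*} [Ring R] {t a s m b w j c : R} (h1 : t = a * s + m * b)
    (h2 : b = s * w) (h3 : j = m * s) (h4 : t = j * w) (h5 : s * c = 1) : a = 0 := by
  have h : a * s = 0 := by
    rw [h2, ← mul_assoc, ← h3, ← h4] at h1
    exact right_eq_add.1 h1
  rw [← mul_one a, ← h5, ← mul_assoc, h, zero_mul]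

/-- The elements `Φ(A, F_A) g` and `Φ(A^g, F_{A^g})` are not closed, but both have the same
logarithmic derivative, so that their quotient is closed. -/
theorem mu_mem_DGGroup (hΦ : IsKalkman Φ) (hA : IsConnection A) (g : MapGroup E M F G) :
    mu Φ g A ∈ DGGroup E M F G := by
  have hB := hA.gaugeTransform g
  refine mem_DGset_iff.2 ⟨mu_mem_SGbar hΦ hA g, fun x => ?_⟩
  have h1 := closedDefect_mul (mu_mem_SGbar hΦ hA g) (inl_mem_SGbar (isH_phiSection hΦ hB)) x
  have hr : (mu Φ g A).right = g := mu_right Φ g A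
  have hl : (mu Φ g A * SemidirectProduct.inl (phiSection Φ (gaugeTransform A g))).left =
      phiSection Φ A := by
    rw [mu_mul_inl, ← SemidirectProduct.mk_eq_inl_mul_inr]
  have h2 : toBUD (LieAlg F G) (ExtCot E) (phiSection Φ A x) =
      toBUD (LieAlg F G) (ExtCot E) ((mu Φ g A).left x) * toBUD (LieAlg F G) (ExtCot E)
        (sectionAd (mu Φ g A).right (phiSection Φ (gaugeTransform A g)) x) := by
    rw [← hl]
    exact map_mul (toBUD (LieAlg F G) (ExtCot E)) _ _
  have h3 : bMapUD (ExtCot E) (AdLie (F := F) ((mu Φ g A).right x))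
      (closedDefect (SemidirectProduct.inl (phiSection Φ (gaugeTransform A g))) x) =
      toBUD (LieAlg F G) (ExtCot E)
        (sectionAd (mu Φ g A).right (phiSection Φ (gaugeTransform A g)) x) *
        (connValue A x + udForm (rightMC g x)) := by
    rw [closedDefect_inl hΦ hB, hr]
    exact (map_mul (bMapUD (ExtCot E) (AdLie (F := F) (g x))) _ _).trans
      (congrArg₂ (· * ·) (toBUD_bMap _ _).symm (bMapUD_connValue hA g x))
  have h4 : closedDefect (mu Φ g A * SemidirectProduct.inl (phiSection Φ (gaugeTransform A g))) x =
      toBUD (LieAlg F G) (ExtCot E) (phiSection Φ A x) *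
        (connValue A x + udForm (rightMC g x)) := by
    rw [mu_mul_inl]
    exact closedDefect_inl_mul_inr hΦ hA g x
  exact eq_zero_of_mul_defect h1 h3 h2 h4 (toBUD_mul_inv
    (sectionAd (mu Φ g A).right (phiSection Φ (gaugeTransform A g)) x).mul_inv)

end Values

end

theorem theorem6p4
    {E : Type*} [NormedAddCommGroup E] [NormedSpace ℝ E] [FiniteDimensional ℝ E]
    {M : Type*} [TopologicalSpace M] [ChartedSpace E M] [IsManifold 𝓘(ℝ, E) ∞ M]
    {F : Type*} [NormedAddCommGroup F] [NormedSpace ℝ F] [FiniteDimensional ℝ F] [CompleteSpace F]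
    {G : Type*} [TopologicalSpace G] [ChartedSpace F G] [Group G] [LieGroup 𝓘(ℝ, F) ∞ G]
    [ConnectedSpace G] :
    -- the element `Φ` exists
    (∃ Φ : PowerSeries (Weil (LieAlg F G) ⊗ₛ UL (LieAlg F G)), IsKalkman Φ) ∧
    -- the gauge action is a right action of `G(M)` on the set of connections
    (∀ A : OneForms E M F G, IsConnection A →
      gaugeTransform A 1 = A ∧
      ∀ g : MapGroup E M F G, IsConnection (gaugeTransform A g) ∧
        ∀ h : MapGroup E M F G,
          gaugeTransform A (g * h) = gaugeTransform (gaugeTransform A g) h) ∧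
    -- `H(M) ⋊ G(M)` and `DG(M)` are groups
    ∃ SG DG : Subgroup (Ambient E M F G),
      (SG : Set (Ambient E M F G)) = SGbar E M F G ∧
      (DG : Set (Ambient E M F G)) = DGset E M F G ∧
      -- the projection `DG(M) → G(M)` is surjective
      Function.Surjective (SemidirectProduct.rightHom.comp DG.subtype) ∧
      ∀ Φ : PowerSeries (Weil (LieAlg F G) ⊗ₛ UL (LieAlg F G)), IsKalkman Φ →
        -- the evaluations of `Φ` at connections are elements of `H(M)`
        (∀ A : OneForms E M F G, IsConnection A →
          (∀ x, IsUnit (evPhi Φ A x)) ∧ IsH (phiSection Φ A)) ∧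
        -- `μ` is a morphism of groupoids to `H(M) ⋊ G(M)`
        (∀ A : OneForms E M F G, IsConnection A →
          (∀ g, mu Φ g A ∈ SG) ∧ mu Φ 1 A = 1 ∧
          ∀ g h, mu Φ (g * h) A = mu Φ g A * mu Φ h (gaugeTransform A g)) ∧
        -- `μ` takes values in `DG(M)` and lifts the forgetful map
        (∀ A : OneForms E M F G, IsConnection A →
          ∀ g, mu Φ g A ∈ DG ∧ SemidirectProduct.rightHom (mu Φ g A) = g) ∧
        -- the zero connection gives a section of `DG(M) → G(M)`
        IsConnection (0 : OneForms E M F G) ∧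
        ∃ s : MapGroup E M F G → DG,
          (∀ g, (s g : Ambient E M F G) = mu Φ g 0) ∧
          Function.RightInverse s (SemidirectProduct.rightHom.comp DG.subtype) := by
  have hsec (Φ : PowerSeries (Weil (LieAlg F G) ⊗ₛ UL (LieAlg F G))) (hΦ : IsKalkman Φ)
      (g : MapGroup E M F G) : mu Φ g 0 ∈ DGGroup E M F G := mu_mem_DGGroup hΦ isConnection_zero g
  obtain ⟨Φ₀, hΦ₀⟩ := exists_isKalkman (L := LieAlg F G)
  refine ⟨⟨Φ₀, hΦ₀⟩, fun A hA => ⟨gaugeTransform_one A, fun g =>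
    ⟨hA.gaugeTransform g, fun h => gaugeTransform_mul A g h⟩⟩,
    SGbarGroup E M F G, DGGroup E M F G, rfl, rfl,
    fun g => ⟨⟨mu Φ₀ g 0, hsec Φ₀ hΦ₀ g⟩, mu_right Φ₀ g 0⟩, fun Φ hΦ => ⟨?_, ?_, ?_,
    isConnection_zero, fun g => ⟨mu Φ g 0, hsec Φ hΦ g⟩, fun _ => rfl, fun g => mu_right Φ g 0⟩⟩
  · exact fun A hA => ⟨isUnit_evPhi hΦ hA, isH_phiSection hΦ hA⟩
  · exact fun A hA => ⟨mu_mem_SGbar hΦ hA, mu_one Φ A, fun g h => mu_mul Φ g h A⟩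
  · exact fun A hA g => ⟨mu_mem_DGGroup hΦ hA g, mu_right Φ g A⟩
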